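/- Let $2\le k\le n$ and let $\Omega\subset\mathbb{R}^n$ be a bounded domain whose boundary $\partial\Omega$ is of class $C^{3,1}$ and strictly $(k-1)$-convex, i.e. for some $\delta>0$ the principal curvatures $\kappa=(\kappa_1,\dots,\kappa_{n-1})$ of $\partial\Omega$ (with respect to the interior normal) satisfy $\sigma_j(\kappa)\ge\delta$ on $\partial\Omega$ for $j=1,\dots,k-1$, where $\sigma_j$ is the $j$-th elementary symmetric polynomial. For a symmetric matrix $A$ let $\lambda(A)$ be the tuple of its eigenvalues and $\sigma_k[A]=\sigma_k(\lambda(A))$; let $\Gamma_k=\{\lambda\in\mathbb{R}^n:\sigma_j(\lambda)>0,\ j=1,\dots,k\}$. For every $\varepsilon>0$, $d_0>0$, $M_\varphi\ge 0$ and $M_f\ge 0$ there is a constant $C_\varepsilon>0$, depending only on $n,k,\Omega,\varepsilon,d_0,M_\varphi,M_f$, such that the following holds. Let $\Omega_0\Supset\Omega$ be open with $\operatorname{dist}(\Omega,\partial\Omega_0)\ge d_0$, let $\inf_{\Omega_0}f>0$, and assume that either (a) $f^{1/(k-1)}\in C^{1,1}(\overline{\Omega_0})$ with $\|f^{1/(k-1)}\|_{C^{1,1}(\overline{\Omega_0})}\le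 M_f$, or (b) $k\ge5$ and $f^{3/(2k-2)}\in C^{2,1}(\overline{\Omega_0})$ with $\|f^{3/(2k-2)}\|_{C^{2,1}(\overline{\Omega_0})}\le M_f$. Let $\varphi\in C^{3,1}(\partial\Omega)$ with $\|\varphi\|_{C^3(\partial\Omega)}\le M_\varphi$, and let $u\in C^{3,1}(\overline\Omega)$ be $k$-admissible, i.e. $\lambda(D^2u(x))\in\Gamma_k$ for all $x\in\Omega$, with $$\sigma_k[D^2u]=f\ \text{ in }\Omega,\qquad u=\varphi\ \text{ on }\partial\Omega.$$ Then $$|D^2u(x)|\le\frac{1}{\operatorname{dist}(x,\partial\Omega)}\Big(\varepsilon\sup_{\partial\Omega}|D^2u|+C_\varepsilon\Big)\qquad\text{for all }x\in\Omega.$$ In particular $C_\varepsilon$ does not depend on $\inf_{\Omega_0}f$. -/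

import Mathlib

open Set Filter Topology
open scoped NNReal ENNReal

namespace KHessian

noncomputable section

/-- The ambient space `ℝⁿ` with its Euclidean norm. -/
abbrev E (n : ℕ) : Type := EuclideanSpace ℝ (Fin n)

/-! ### The operators `σ_k`, the Gårding cone, admissible functions -/

/-- The eigenvalues of a real matrix, with multiplicity (there are `n` of them when the
`n × n` matrix is symmetric). -/
def eigenvalues {n : ℕ} (A : Matrix (Fin n) (Fin n) ℝ) : Multiset ℝ :=
  A.charpoly.roots

/-- `σ_k[A]`: the `k`-th elementary symmetric polynomial of the eigenvalues of `A`. -/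
def sigma {n : ℕ} (k : ℕ) (A : Matrix (Fin n) (Fin n) ℝ) : ℝ :=
  (eigenvalues A).esymm k

/-- The Gårding cone `Γ_k`, as a set of (unordered) tuples of real numbers. -/
def gardingCone (k : ℕ) : Set (Multiset ℝ) :=
  {s | ∀ j : ℕ, 1 ≤ j → j ≤ k → 0 < s.esymm j}

/-- The Hessian matrix `D²u(x) = (∂ᵢⱼ u(x))`. -/
def hessian {n : ℕ} (u : E n → ℝ) (x : E n) : Matrix (Fin n) (Fin n) ℝ :=
  Matrix.of fun i j =>
    iteratedFDeriv ℝ 2 u x ![EuclideanSpace.single i 1, EuclideanSpace.single j 1]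

/-- `u ∈ C²(Ω) ∩ C⁰(closure Ω)` is `k`-admissible: `λ(D²u(x)) ∈ Γ_k` for all `x ∈ Ω`. -/
structure IsAdmissible {n : ℕ} (k : ℕ) (Ω : Set (E n)) (u : E n → ℝ) : Prop where
  contDiffOn : ContDiffOn ℝ 2 u Ω
  continuousOn : ContinuousOn u (closure Ω)
  mem_cone : ∀ x ∈ Ω, eigenvalues (hessian u x) ∈ gardingCone k

/-- `u` solves the Dirichlet problem `σ_k[D²u] = f` in `Ω`, `u = φ` on `∂Ω`. -/
structure SolvesDirichlet {n : ℕ} (k : ℕ) (Ω : Set (E n)) (f φ u : E n → ℝ) : Prop where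
  equation : ∀ x ∈ Ω, sigma k (hessian u x) = f x
  boundary : ∀ x ∈ frontier Ω, u x = φ x

/-! ### The spaces `C^m` and `C^{m,1}` on the closure of an open set -/

/-- `g ∈ C^m(closure U)`, `U` open: `g` is `C^m` in `U`, continuous on the closure, and all
derivatives of order at most `m` extend continuously from `U` to the closure. -/
structure IsCBar {n : ℕ} (m : ℕ) (U : Set (E n)) (g : E n → ℝ) : Prop where
  contDiffOn : ContDiffOn ℝ m g U
  continuousOn : ContinuousOn g (closure U)
  extends_deriv : ∀ j ≤ m, ∃ G : E n → ContinuousMultilinearMap ℝ (fun _ : Fin j => E n) ℝ,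
    ContinuousOn G (closure U) ∧ EqOn G (iteratedFDeriv ℝ j g) U

/-- `g ∈ C^{m,1}(closure U)`: moreover the `m`-th derivative is Lipschitz in `U`. -/
structure IsCLipBar {n : ℕ} (m : ℕ) (U : Set (E n)) (g : E n → ℝ) : Prop
    extends IsCBar m U g where
  lipschitz : ∃ K : ℝ≥0, LipschitzOnWith K (iteratedFDeriv ℝ m g) U

/-- `‖g‖_{C^m(closure U)}`, the sum over `j ≤ m` of `sup_U |D^j g|` (possibly `∞`). -/
def cNorm {n : ℕ} (m : ℕ) (U : Set (E n)) (g : E n → ℝ) : ℝ≥0∞ :=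
  ∑ j ∈ Finset.range (m + 1), ⨆ x ∈ U, ‖iteratedFDeriv ℝ j g x‖ₑ

/-- `‖g‖_{C^{m,1}(closure U)}`: the `C^m` norm plus the Lipschitz seminorm of `D^m g` in `U`
(the terms with `x = y` are `0 / 0 = 0`). -/
def cLipNorm {n : ℕ} (m : ℕ) (U : Set (E n)) (g : E n → ℝ) : ℝ≥0∞ :=
  cNorm m U g +
    ⨆ x ∈ U, ⨆ y ∈ U, edist (iteratedFDeriv ℝ m g x) (iteratedFDeriv ℝ m g y) / edist x y

/-- `φ ∈ C^{m,1}(∂Ω)`: `φ` is the trace of a function in `C^{m,1}(closure Ω)`. -/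
def IsCLipBoundary {n : ℕ} (m : ℕ) (Ω : Set (E n)) (φ : E n → ℝ) : Prop :=
  ∃ Φ : E n → ℝ, IsCLipBar m Ω Φ ∧ EqOn Φ φ (frontier Ω)

/-- `‖φ‖_{C^m(∂Ω)}`: the infimum of `‖Φ‖_{C^m(closure Ω)}` over all `C^m(closure Ω)`
extensions `Φ` of `φ`. -/
def boundaryCNorm {n : ℕ} (m : ℕ) (Ω : Set (E n)) (φ : E n → ℝ) : ℝ≥0∞ :=
  ⨅ Φ ∈ {Φ : E n → ℝ | IsCBar m Ω Φ ∧ EqOn Φ φ (frontier Ω)}, cNorm m Ω Φ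

/-! ### Regularity and curvature of the boundary -/

/-- `r` is a `C^m` defining function of `Ω` in the open set `V`:
`∇r ≠ 0` in `V` and `Ω ∩ V = {x ∈ V : r(x) > 0}` (so that `∂Ω ∩ V = {x ∈ V : r(x) = 0}`). -/
structure IsDefiningFunction {n : ℕ} (m : ℕ) (Ω V : Set (E n)) (r : E n → ℝ) : Prop where
  isOpen : IsOpen V
  contDiffOn : ContDiffOn ℝ m r V
  gradient_ne : ∀ x ∈ V, gradient r x ≠ 0
  mem_iff : ∀ x ∈ V, x ∈ Ω ↔ 0 < r x

/-- `∂Ω ∈ C^{m,1}`: near each boundary point there is a `C^{m,1}` defining function. -/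
def HasCLipBoundary {n : ℕ} (m : ℕ) (Ω : Set (E n)) : Prop :=
  ∀ y ∈ frontier Ω, ∃ (V : Set (E n)) (r : E n → ℝ), y ∈ V ∧ IsDefiningFunction m Ω V r ∧
    ∃ K : ℝ≥0, LipschitzOnWith K (iteratedFDeriv ℝ m r) V

/-- The tangent space at `y` of the level set of `r` through `y`. -/
abbrev tangentSpace {n : ℕ} (r : E n → ℝ) (y : E n) : Submodule ℝ (E n) :=
  (Submodule.span ℝ {gradient r y})ᗮ

/-- The shape operator at `y` of the level set of `r` through `y`, with respect to the unit
normal `ν = ∇r / |∇r|`. It is the map `τ ↦ -dν(τ)`, which on tangent vectors equals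
`-|∇r|⁻¹` times the tangential part of `D²r τ`. -/
def shapeOperator {n : ℕ} (r : E n → ℝ) (y : E n) :
    tangentSpace r y →L[ℝ] tangentSpace r y :=
  (-‖gradient r y‖⁻¹) •
    ((tangentSpace r y).orthogonalProjectionOnto ∘L fderiv ℝ (gradient r) y ∘L
      (tangentSpace r y).subtypeL)

/-- The `n - 1` principal curvatures at `y` of the level set of `r` through `y`. When `r` is a
defining function of `Ω` these are the principal curvatures of `∂Ω` with respect to the
interior normal (all equal to `1 / R` for a ball of radius `R`); they do not depend on `r`. -/
def principalCurvatures {n : ℕ} (r : E n → ℝ) (y : E n) : Multiset ℝ :=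
  (shapeOperator r y : tangentSpace r y →ₗ[ℝ] tangentSpace r y).charpoly.roots

/-- `∂Ω` is strictly `m`-convex: for some `δ > 0`, the principal curvatures `κ` satisfy
`σ_j(κ) ≥ δ` on `∂Ω` for `j = 1, …, m`. -/
def IsStrictlyConvexBoundary {n : ℕ} (m : ℕ) (Ω : Set (E n)) : Prop :=
  ∃ δ : ℝ, 0 < δ ∧ ∀ y ∈ frontier Ω, ∃ (V : Set (E n)) (r : E n → ℝ),
    y ∈ V ∧ IsDefiningFunction 2 Ω V r ∧
      ∀ j : ℕ, 1 ≤ j → j ≤ m → δ ≤ (principalCurvatures r y).esymm j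

/-- `sup_{∂Ω} |D²u|`, where `D²u` on `∂Ω` is the continuous extension of `D²u` from `Ω`. -/
def supBoundaryHessian {n : ℕ} (Ω : Set (E n)) (u : E n → ℝ) : ℝ :=
  sSup ((fun y => ‖extendFrom Ω (iteratedFDeriv ℝ 2 u) y‖) '' frontier Ω)

end

end KHessian

/-! Write the equation as F(D²u) = h with F = σ_k^{1/k} and h = f^{1/k}. Let w_i > 0 be the
derivatives of F in an eigenframe of D²u, and let T = Σ w_i.

Why inf f does not enter. Concavity of F, in Gårding's form, says that Σ w_i D(e_i,e_i) ≥ F(D) for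
every form D in the cone and every orthonormal frame e (`garding_form`). Hence T ≥ 1. A Maclaurin
type inequality gives in addition k T ≥ f^{-1/(k(k-1))} wherever some pure second derivative is at
least 1 (`IsEigenframe.sigma_rpow_le`). Under either regularity assumption h is semiconvex with a
constant of exactly that order (`exists_rhsBounds`), so the error from the second derivatives of h
is at most C T, and terms of size T can be beaten with a barrier.

Maximum principle. A bound for D²u(ξ,ξ) with a direction ξ(y) = ξ₀ + A(y - x₀), A a multiple of the
identity plus a skew map, is tested by composing u with the similarities generated by ξ. These
respect F up to a factor. Since u need not have fourth derivatives, second difference quotients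
along the motion replace derivatives, and their limit is taken only at the end (`viscosity_test`).

Barrier. Strict (k-1)-convexity of the boundary allows a defining function to be bent by an
exponential so that its negative Hessian lies in Γ_k near the boundary. This yields ρ, bounded below
by a multiple of the distance, with Σ w_i ρ_ii ≤ -c₀ T (`exists_isBarrier`). Comparing u with ±Kρ
gives bounds for Du and for the tangential second derivatives on the boundary
(`IsBarrier.exists_boundary_constants`).

Strip estimate. In {ρ ≤ ρ₀} the comparison is D²u(ξ,ξ) + a|Du|²|ξ|² ≤ N(α(ρ)(∂_ξρ)² + b(ρ)|ξ|²),
with α(t) = 1/(1/Λ + θ log((ε+t)/ε)) and b(t) = ε + t - Kt². An interior contact point is impossible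
(`not_isMax_strip`): the field ξ is chosen so that α(ρ)∂_ξρ is stationary at the point. On the
boundary, Λ of order 1/(ε₁²ε) pays for the mixed and normal derivatives, which are at most M =
sup|D²u| there, as soon as N ≥ ε₁M plus a constant. But tα(t) is bounded independently of Λ. So ε₁
can be made small without spoiling the estimate of distance times D²u, and this gives the factor ε
in front of the boundary supremum.

Closing. On {ρ = ρ₀} the comparison needs N to dominate the interior maximum m. If N is governed by
m, the strip estimate on {ρ = ρ₀/4} gives only 3m/4, and the interior maximum principle then bounds
m (`exists_strip_constant`). Positivity of the trace finally turns upper bounds for pure second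
derivatives into bounds for the whole Hessian. -/

namespace KHessian

set_option linter.unusedSectionVars false

/-! ### Elementary symmetric functions and Newton's inequality. -/

section ElementarySymmetric

variable {ι : Type*}

/-- The elementary symmetric function of degree `j` of the numbers `f i`, `i ∈ s`. -/
def es (s : Finset ι) (f : ι → ℝ) (j : ℕ) : ℝ := ∑ t ∈ s.powersetCard j, ∏ i ∈ t, f i

lemma esymm_map_val_eq_es (s : Finset ι) (f : ι → ℝ) (j : ℕ) :
    (s.val.map f).esymm j = es s f j := Finset.esymm_map_val f s j

@[simp] lemma es_zero (s : Finset ι) (f : ι → ℝ) : es s f 0 = 1 := by simp [es]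

lemma es_one (s : Finset ι) (f : ι → ℝ) : es s f 1 = ∑ i ∈ s, f i := by
  simp [es, Finset.powersetCard_one]

lemma es_empty_succ (f : ι → ℝ) (j : ℕ) : es ∅ f (j + 1) = 0 := by
  unfold es; rw [Finset.powersetCard_eq_empty.2 (by simp)]; simp

variable [DecidableEq ι]

lemma es_insert {s : Finset ι} {a : ι} (ha : a ∉ s) (f : ι → ℝ) (j : ℕ) :
    es (insert a s) f (j + 1) = es s f (j + 1) + f a * es s f j := by
  unfold es
  rw [Finset.powersetCard_succ_insert ha, Finset.sum_union, Finset.sum_image]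
  · congr 1
    rw [Finset.mul_sum]
    refine Finset.sum_congr rfl fun t ht => ?_
    rw [Finset.prod_insert]
    exact fun h => ha ((Finset.mem_powersetCard.1 ht).1 h)
  · intro t ht t' ht' h
    have h1 : a ∉ t := fun h => ha ((Finset.mem_powersetCard.1 ht).1 h)
    have h2 : a ∉ t' := fun h => ha ((Finset.mem_powersetCard.1 ht').1 h)
    rw [← Finset.erase_insert h1, ← Finset.erase_insert h2, h]
  · rw [Finset.disjoint_left]
    intro t ht ht'
    obtain ⟨t', -, rfl⟩ := Finset.mem_image.1 ht'
    exact ha ((Finset.mem_powersetCard.1 ht).1 (Finset.mem_insert_self a t'))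

lemma es_erase {s : Finset ι} {a : ι} (ha : a ∈ s) (f : ι → ℝ) (j : ℕ) :
    es s f (j + 1) = es (s.erase a) f (j + 1) + f a * es (s.erase a) f j := by
  conv_lhs => rw [← Finset.insert_erase ha]
  exact es_insert (Finset.notMem_erase a s) f j

lemma es_smul (s : Finset ι) (c : ℝ) (f : ι → ℝ) (j : ℕ) :
    es s (fun i => c * f i) j = c ^ j * es s f j := by
  unfold es
  rw [Finset.mul_sum]
  refine Finset.sum_congr rfl fun t ht => ?_
  rw [Finset.prod_mul_distrib, Finset.prod_const, (Finset.mem_powersetCard.1 ht).2]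

/-- Euler's identity for elementary symmetric functions. -/
lemma succ_mul_es (s : Finset ι) (f : ι → ℝ) (j : ℕ) :
    ((j : ℝ) + 1) * es s f (j + 1) = ∑ i ∈ s, f i * es (s.erase i) f j := by
  induction s using Finset.induction_on generalizing j with
  | empty => simp [es_empty_succ]
  | insert a s ha ih =>
    rw [es_insert ha, Finset.sum_insert ha, Finset.erase_insert ha]
    have h1 : ∀ i ∈ s, (insert a s).erase i = insert a (s.erase i) := fun i hi =>
      Finset.erase_insert_of_ne (fun h => ha (h ▸ hi))
    have h2 : ∀ i ∈ s, a ∉ s.erase i := fun i _ h => ha (Finset.mem_of_mem_erase h)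
    cases j with
    | zero =>
      have := ih 0
      simp only [es_zero, mul_one] at this ⊢
      rw [← this]; push_cast; ring
    | succ j =>
      have e : ∑ i ∈ s, f i * es ((insert a s).erase i) f (j + 1)
          = ∑ i ∈ s, f i * es (s.erase i) f (j + 1)
            + f a * ∑ i ∈ s, f i * es (s.erase i) f j := by
        rw [Finset.mul_sum, ← Finset.sum_add_distrib]
        refine Finset.sum_congr rfl fun i hi => ?_
        rw [h1 i hi, es_insert (h2 i hi)]; ring
      rw [e, ← ih (j + 1), ← ih j]; push_cast; ring

/-- `∑ᵢ σ_{j}(f | i) = (n - j) σ_j(f)`. -/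
lemma sum_es_erase (s : Finset ι) (f : ι → ℝ) (j : ℕ) :
    ∑ i ∈ s, es (s.erase i) f j = ((s.card : ℝ) - j) * es s f j := by
  cases j with
  | zero => simp
  | succ j =>
    have h : ∀ i ∈ s, es (s.erase i) f (j + 1)
        = es s f (j + 1) - f i * es (s.erase i) f j := fun i hi => by
      rw [es_erase hi f j]; ring
    rw [Finset.sum_congr rfl h, Finset.sum_sub_distrib, ← succ_mul_es]
    simp; ring

/-! #### Newton's inequality -/

open Polynomial in
-- Rolle's theorem: passing to the derivative loses at most one root, counted with multiplicity,
-- which is exactly the loss of degree.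
lemma splits_derivative_of_splits {p : ℝ[X]} (hp : p.Splits) : (derivative p).Splits := by
  rw [splits_iff_card_roots] at hp ⊢
  refine le_antisymm (card_roots' _) ?_
  have h1 := card_roots_le_derivative p
  have h2 := natDegree_derivative_le p
  omega

open Polynomial in
-- Multiplying r by X - a changes c₁² - 2c₀c₂ into r₀² + a²(r₁² - 2r₀r₂), so nonnegativity
-- propagates over the linear factors.
lemma two_mul_coeff_le_of_splits {p : ℝ[X]} (hp : p.Splits) :
    2 * (p.coeff 0 * p.coeff 2) ≤ p.coeff 1 ^ 2 := by
  obtain ⟨m, hm⟩ := splits_iff_exists_multiset.1 hp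
  have key : ∀ m : Multiset ℝ, 2 * ((m.map fun a => X - C a).prod.coeff 0 *
      (m.map fun a => X - C a).prod.coeff 2) ≤ (m.map fun a => X - C a).prod.coeff 1 ^ 2 := by
    intro m
    induction m using Multiset.induction_on with
    | empty => simp [coeff_one]
    | cons a m ih =>
      rw [Multiset.map_cons, Multiset.prod_cons]
      set r := (m.map fun a => X - C a).prod
      have e0 : ((X - C a) * r).coeff 0 = - a * r.coeff 0 := by simp [sub_mul]
      have e1 : ((X - C a) * r).coeff 1 = r.coeff 0 - a * r.coeff 1 := by
        rw [sub_mul, coeff_sub, coeff_C_mul, coeff_X_mul r 0]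
      have e2 : ((X - C a) * r).coeff 2 = r.coeff 1 - a * r.coeff 2 := by
        rw [sub_mul, coeff_sub, coeff_C_mul, coeff_X_mul r 1]
      rw [e0, e1, e2]
      nlinarith [sq_nonneg (r.coeff 0), sq_nonneg a]
  rw [hm]
  simp only [coeff_C_mul]
  nlinarith [key m, sq_nonneg p.leadingCoeff]

open Polynomial in
-- Differentiation shifts the coefficients down by one and preserves splitting, which reduces the
-- inequality to the lowest three coefficients.
lemma succ_mul_coeff_mul_coeff_le_of_splits {p : ℝ[X]} (hp : p.Splits) (m : ℕ) :
    ((m : ℝ) + 2) * (p.coeff m * p.coeff (m + 2)) ≤ ((m : ℝ) + 1) * p.coeff (m + 1) ^ 2 := by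
  induction m generalizing p with
  | zero => simpa using two_mul_coeff_le_of_splits hp
  | succ m ih =>
    have h := ih (splits_derivative_of_splits hp)
    simp only [coeff_derivative] at h
    push_cast at h ⊢
    have h0 : (0:ℝ) < ((m:ℝ) + 1) * (m + 2) := by positivity
    refine le_of_mul_le_mul_left ?_ h0
    calc _ = ((m:ℝ) + 2) * (p.coeff (m + 1) * (↑m + 1) * (p.coeff (m + 2 + 1) * (↑m + 2 + 1))) := by
          rw [show m + 1 + 2 = m + 2 + 1 from rfl]; ring
      _ ≤ _ := h
      _ = _ := by ring

open Polynomial in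
lemma coeff_mul_coeff_le_of_splits {p : ℝ[X]} (hp : p.Splits) (m : ℕ) :
    p.coeff m * p.coeff (m + 2) ≤ p.coeff (m + 1) ^ 2 := by
  have h := succ_mul_coeff_mul_coeff_le_of_splits hp m
  have h0 : (0:ℝ) ≤ m := by positivity
  by_contra! hc
  nlinarith [sq_nonneg (p.coeff (m + 1))]

open Polynomial in
-- The numbers σ_j are the coefficients of the split polynomial ∏(X + f_i). The non-sharp constant 1
-- is enough for everything below.
lemma es_mul_es_le (s : Finset ι) (f : ι → ℝ) (j : ℕ) :
    es s f j * es s f (j + 2) ≤ es s f (j + 1) ^ 2 := by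
  by_cases hj : j + 2 ≤ s.card
  · have hs : (∏ i ∈ s, (X + C (f i))).Splits :=
      Splits.prod fun i _ => Splits.X_add_C (f i)
    have hc : ∀ m ≤ s.card, (∏ i ∈ s, (X + C (f i))).coeff m = es s f (s.card - m) := by
      intro m hm
      rw [Finset.prod_X_add_C_coeff s f hm]; rfl
    have := coeff_mul_coeff_le_of_splits hs (s.card - (j + 2))
    rw [hc _ (by omega), hc _ (by omega), hc _ (by omega)] at this
    rw [show s.card - (s.card - (j + 2)) = j + 2 by omega,
      show s.card - (s.card - (j + 2) + 2) = j by omega,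
      show s.card - (s.card - (j + 2) + 1) = j + 1 by omega] at this
    linarith
  · have : es s f (j + 2) = 0 := by
      unfold es; rw [Finset.powersetCard_eq_empty.2 (by omega)]; simp
    rw [this, mul_zero]; positivity

end ElementarySymmetric

/-! ### The cone Γ_k and superadditivity of the quotients σ_{j+1}/σ_j. -/

section Garding

variable {ι : Type*} [DecidableEq ι]

/-- The numbers `f i`, `i ∈ s`, form a tuple in the cone `Γ_k`. -/
def InCone (s : Finset ι) (f : ι → ℝ) (k : ℕ) : Prop := ∀ j ≤ k, 0 < es s f j

lemma InCone.mono {s : Finset ι} {f : ι → ℝ} {k l : ℕ} (h : InCone s f k) (hl : l ≤ k) :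
    InCone s f l := fun j hj => h j (hj.trans hl)

/-- Let x, y, z be three consecutive symmetric functions of the remaining variables, with x > 0 by
induction. If y ≤ 0, then Newton's xz ≤ y² gives 0 < x(z + f_a y) ≤ y(y + f_a x) ≤ 0, since both z +
f_a y and y + f_a x are positive. This is a contradiction. -/
lemma InCone.erase {s : Finset ι} {f : ι → ℝ} {k : ℕ} {a : ι} (ha : a ∈ s)
    (h : InCone s f (k + 1)) : InCone (s.erase a) f k := by
  induction k with
  | zero => intro j hj; obtain rfl : j = 0 := by omega
            simp
  | succ k ih =>
    have ih' := ih (h.mono (by omega))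
    intro j hj
    rcases Nat.lt_or_ge j (k + 1) with h1 | h1
    · exact ih' j (by omega)
    obtain rfl : j = k + 1 := by omega
    by_contra! hc
    have a1 := h (k + 1) (by omega)
    have a2 := h (k + 2) (by omega)
    rw [es_erase ha] at a1 a2
    have N := es_mul_es_le (s.erase a) f k
    have p := ih' k le_rfl
    set x := es (s.erase a) f k
    set y := es (s.erase a) f (k + 1)
    set z := es (s.erase a) f (k + 2)
    have a3 : 0 < z + f a * y := a2
    nlinarith [mul_pos p a3, mul_nonneg (neg_nonneg.2 hc) a1.le]

lemma InCone.smul {s : Finset ι} {f : ι → ℝ} {k : ℕ} (h : InCone s f k) {c : ℝ} (hc : 0 < c) :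
    InCone s (fun i => c * f i) k := fun j hj => by
  rw [es_smul]; exact mul_pos (pow_pos hc j) (h j hj)

/-- The quotient `σ_{j+1} / σ_j`. -/
noncomputable def esq (s : Finset ι) (f : ι → ℝ) (j : ℕ) : ℝ := es s f (j + 1) / es s f j

/-- The parallel sum xq/(x+q) equals x - x²/(x+q). It is superadditive because x²/s is convex and
homogeneous of degree one, and it increases with q, which accommodates the inequality `hr`. -/
lemma mul_div_add_superadd {x q x' q' r : ℝ} (h : 0 < x + q) (h' : 0 < x' + q')
    (hr : q + q' ≤ r) :
    x * q / (x + q) + x' * q' / (x' + q') ≤ (x + x') * r / (x + x' + r) := by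
  have h3 : 0 < x + x' + r := by linarith
  have e : ∀ {u v : ℝ}, 0 < u + v → u * v / (u + v) = u - u ^ 2 / (u + v) := by
    intro u v huv; field_simp; ring
  rw [e h, e h', e h3]
  have h4 : (x + x') ^ 2 / (x + x' + r) ≤ (x + x') ^ 2 / ((x + q) + (x' + q')) :=
    div_le_div_of_nonneg_left (sq_nonneg _) (by linarith) (by linarith)
  have h5 : (x + x') ^ 2 / ((x + q) + (x' + q')) ≤ x ^ 2 / (x + q) + x' ^ 2 / (x' + q') := by
    rw [div_add_div _ _ h.ne' h'.ne', div_le_div_iff₀ (by linarith) (mul_pos h h')]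
    nlinarith [sq_nonneg (x * (x' + q') - x' * (x + q))]
  linarith

/-- Euler's identity divided by σ_{j+1}: a quotient becomes a sum of parallel sums of f_i with
quotients of lower degree in one variable fewer. This is the recursion that drives the induction on
the degree. -/
lemma succ_mul_esq {s : Finset ι} {f : ι → ℝ} {j : ℕ} (h : InCone s f (j + 2)) :
    ((j : ℝ) + 2) * esq s f (j + 1)
      = ∑ i ∈ s, f i * esq (s.erase i) f j / (f i + esq (s.erase i) f j) := by
  have h1 := succ_mul_es s f (j + 1)
  unfold esq
  have hp := h (j + 1) (by omega)
  push_cast at h1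
  rw [mul_div_assoc', show ((j:ℝ) + 2) = j + 1 + 1 by ring, h1, Finset.sum_div]
  refine Finset.sum_congr rfl fun i hi => ?_
  have hq := (h.erase (k := j + 1) hi) j (by omega)
  rw [es_erase hi] at hp ⊢
  have : f i + es (s.erase i) f (j + 1) / es (s.erase i) f j ≠ 0 := by
    have : f i + es (s.erase i) f (j + 1) / es (s.erase i) f j
      = (es (s.erase i) f (j + 1) + f i * es (s.erase i) f j) / es (s.erase i) f j := by
        field_simp; ring
    rw [this]; positivity
  rw [div_eq_div_iff hp.ne' this]
  field_simp
  ring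

/-- Superadditivity of `σ_{j+1} / σ_j` on `Γ_{j+1}`, which is closed under addition. -/
theorem esq_add_le (j : ℕ) : ∀ (s : Finset ι) (f g : ι → ℝ), InCone s f (j + 1) →
    InCone s g (j + 1) → InCone s (fun i => f i + g i) (j + 1) ∧
      esq s f j + esq s g j ≤ esq s (fun i => f i + g i) j := by
  induction j with
  | zero =>
    intro s f g hf hg
    have h1 := hf 1 le_rfl
    have h2 := hg 1 le_rfl
    have e : es s (fun i => f i + g i) 1 = es s f 1 + es s g 1 := by
      simp [es_one, Finset.sum_add_distrib]
    constructor
    · intro j hj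
      interval_cases j
      · simp
      · rw [e]; linarith
    · simp [esq, e]
  | succ j ih =>
    intro s f g hf hg
    have h1 := (ih s f g (hf.mono (by omega)) (hg.mono (by omega))).1
    have pos : ∀ {f : ι → ℝ}, InCone s f (j + 1) → ∀ {i : ι}, i ∈ s →
        0 < es (s.erase i) f j → 0 < f i + esq (s.erase i) f j := by
      intro f hf i hi hq
      have hp := hf (j + 1) (by omega)
      rw [es_erase hi] at hp
      have : f i + esq (s.erase i) f j
        = (es (s.erase i) f (j + 1) + f i * es (s.erase i) f j) / es (s.erase i) f j := by
          unfold esq; field_simp; ring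
      rw [this]; positivity
    -- `succ_mul_esq` is not available for f + g, whose membership in Γ_{j+2} is still to be shown.
    -- Positivity of the denominators comes from the induction hypothesis on the set with i removed.
    have hE : ((j : ℝ) + 2) * esq s (fun i => f i + g i) (j + 1)
      = ∑ i ∈ s, (f i + g i) * esq (s.erase i) (fun i => f i + g i) j /
          (f i + g i + esq (s.erase i) (fun i => f i + g i) j) := by
      have e1 := succ_mul_es s (fun i => f i + g i) (j + 1)
      have hp := h1 (j + 1) le_rfl
      push_cast at e1
      rw [esq, mul_div_assoc', show ((j:ℝ) + 2) = j + 1 + 1 by ring, e1, Finset.sum_div]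
      refine Finset.sum_congr rfl fun i hi => ?_
      have hi2 := ih (s.erase i) f g (hf.erase hi) (hg.erase hi)
      have hq := hi2.1 j (by omega)
      have hne := (pos h1 hi hq).ne'
      rw [div_eq_div_iff hp.ne' hne, es_erase hi]
      unfold esq
      field_simp
      ring
    have key : esq s f (j + 1) + esq s g (j + 1) ≤ esq s (fun i => f i + g i) (j + 1) := by
      have hj : (0:ℝ) < j + 2 := by positivity
      rw [← mul_le_mul_iff_right₀ hj, mul_add, hE, succ_mul_esq hf, succ_mul_esq hg,
        ← Finset.sum_add_distrib]
      refine Finset.sum_le_sum fun i hi => ?_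
      have hi2 := ih (s.erase i) f g (hf.erase hi) (hg.erase hi)
      exact mul_div_add_superadd
        (pos (hf.mono (by omega)) hi ((hf.erase (k := j + 1) hi) j (by omega)))
        (pos (hg.mono (by omega)) hi ((hg.erase (k := j + 1) hi) j (by omega))) hi2.2
    refine ⟨?_, key⟩
    intro l hl
    rcases Nat.lt_or_ge l (j + 2) with h | h
    · exact h1 l (by omega)
    obtain rfl : l = j + 2 := by omega
    have a := h1 (j + 1) le_rfl
    have b : 0 < esq s (fun i => f i + g i) (j + 1) := by
      refine lt_of_lt_of_le ?_ key
      exact add_pos (div_pos (hf _ le_rfl) (hf _ (by omega)))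
        (div_pos (hg _ le_rfl) (hg _ (by omega)))
    exact (div_pos_iff_of_pos_right a).1 b

end Garding
end KHessian

namespace KHessian

set_option linter.unusedSectionVars false

/-! ### Gårding's inequality and the trace of the linearised operator. -/

section GardingWeights

variable {ι : Type*} [DecidableEq ι]

/-- The derivative of `σ_k^{1/k}` in the `i`-th variable. -/
noncomputable def wt (s : Finset ι) (k : ℕ) (f : ι → ℝ) (i : ι) : ℝ :=
  1 / (k : ℝ) * es s f k ^ (1 / (k : ℝ) - 1) * es (s.erase i) f (k - 1)

lemma prod_esq {s : Finset ι} {f : ι → ℝ} {k : ℕ} (h : InCone s f k) :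
    ∏ j ∈ Finset.range k, esq s f j = es s f k := by
  induction k with
  | zero => simp
  | succ k ih =>
    rw [Finset.prod_range_succ, ih (h.mono (by omega)), esq, mul_div_cancel₀]
    exact (h k (by omega)).ne'

lemma esq_pos {s : Finset ι} {f : ι → ℝ} {k j : ℕ} (h : InCone s f k) (hj : j < k) :
    0 < esq s f j := div_pos (h _ (by omega)) (h _ (by omega))

lemma esq_succ_le {s : Finset ι} {f : ι → ℝ} {k j : ℕ} (h : InCone s f k) (hj : j + 1 < k) :
    esq s f (j + 1) ≤ esq s f j := by
  unfold esq
  rw [div_le_div_iff₀ (h _ (by omega)) (h _ (by omega))]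
  have := es_mul_es_le s f j
  nlinarith

lemma esq_antitone {s : Finset ι} {f : ι → ℝ} {k i j : ℕ} (h : InCone s f k) (hij : i ≤ j)
    (hj : j < k) : esq s f j ≤ esq s f i := by
  induction j, hij using Nat.le_induction with
  | base => exact le_rfl
  | succ j _ ih => exact (esq_succ_le h hj).trans (ih (by omega))

/-- Maclaurin type inequality `σ_1 σ_k^{k-2} ≤ σ_{k-1}^{k-1}`, with `k = m + 2`. -/
lemma es_one_mul_pow_le {s : Finset ι} {f : ι → ℝ} {m : ℕ} (h : InCone s f (m + 2)) :
    es s f 1 * es s f (m + 2) ^ m ≤ es s f (m + 1) ^ (m + 1) := by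
  have e1 : es s f (m + 2) = es s f (m + 1) * esq s f (m + 1) := by
    rw [esq, mul_div_cancel₀]; exact (h _ (by omega)).ne'
  have e2 : es s f (m + 1) = es s f 1 * ∏ j ∈ Finset.range m, esq s f (j + 1) := by
    rw [← prod_esq (h.mono (by omega : m + 1 ≤ m + 2)), Finset.prod_range_succ']
    simp [esq, mul_comm]
  have h3 : esq s f (m + 1) ^ m ≤ ∏ j ∈ Finset.range m, esq s f (j + 1) := by
    rw [← Finset.card_range m, ← Finset.prod_const, Finset.card_range]
    refine Finset.prod_le_prod (fun _ _ => (esq_pos h (by omega)).le) fun j hj => ?_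
    rw [Finset.mem_range] at hj
    exact esq_antitone h (by omega) (by omega)
  have p1 := h 1 (by omega)
  have p2 := h (m + 1) (by omega)
  calc es s f 1 * es s f (m + 2) ^ m
      = es s f (m + 1) ^ m * (es s f 1 * esq s f (m + 1) ^ m) := by rw [e1, mul_pow]; ring
    _ ≤ es s f (m + 1) ^ m * es s f (m + 1) := by
        refine mul_le_mul_of_nonneg_left ?_ (by positivity)
        rw [e2]; exact mul_le_mul_of_nonneg_left h3 p1.le
    _ = _ := by ring

lemma InCone.add_smul {s : Finset ι} {f g : ι → ℝ} {k : ℕ} (hf : InCone s f (k + 1))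
    (hg : InCone s g (k + 1)) {t : ℝ} (ht : 0 ≤ t) :
    InCone s (fun i => f i + t * g i) (k + 1) := by
  rcases ht.eq_or_lt with rfl | ht
  · simpa using hf
  · exact (esq_add_le k s f _ hf (hg.smul ht)).1

lemma esq_smul (s : Finset ι) (f : ι → ℝ) (j : ℕ) {c : ℝ} (hc : c ≠ 0) :
    esq s (fun i => c * f i) j = c * esq s f j := by
  unfold esq
  rw [es_smul, es_smul, pow_succ, mul_assoc, mul_div_mul_left _ _ (pow_ne_zero _ hc), mul_div_assoc]

lemma esq_add_smul_le {s : Finset ι} {f g : ι → ℝ} {j : ℕ} (hf : InCone s f (j + 1))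
    (hg : InCone s g (j + 1)) {t : ℝ} (ht : 0 ≤ t) :
    esq s f j + t * esq s g j ≤ esq s (fun i => f i + t * g i) j := by
  rcases ht.eq_or_lt with rfl | ht
  · simp
  · rw [← esq_smul s g j ht.ne']
    exact (esq_add_le j s f _ hf (hg.smul ht)).2

lemma hasDerivAt_es (s : Finset ι) (f g : ι → ℝ) (k : ℕ) :
    HasDerivAt (fun t : ℝ => es s (fun i => f i + t * g i) (k + 1))
      (∑ i ∈ s, g i * es (s.erase i) f k) 0 := by
  induction s using Finset.induction_on generalizing k with
  | empty => simpa [es_empty_succ] using hasDerivAt_const (0:ℝ) (0:ℝ)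
  | insert a s ha ih =>
    simp only [es_insert ha]
    rw [Finset.sum_insert ha, Finset.erase_insert ha]
    have h1 : ∀ i ∈ s, (insert a s).erase i = insert a (s.erase i) := fun i hi =>
      Finset.erase_insert_of_ne (fun h => ha (h ▸ hi))
    have h2 : ∀ i ∈ s, a ∉ s.erase i := fun i _ h => ha (Finset.mem_of_mem_erase h)
    have hlin : HasDerivAt (fun t : ℝ => f a + t * g a) (g a) 0 := by
      simpa using ((hasDerivAt_id (0:ℝ)).mul_const (g a)).const_add (f a)
    cases k with
    | zero =>
      have := (ih 0).fun_add hlin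
      simp only [es_zero, mul_one] at this ⊢
      exact this.congr_deriv (add_comm _ _)
    | succ k =>
      have := (ih (k + 1)).add (hlin.mul (ih k))
      refine this.congr_deriv ?_
      have e : ∑ i ∈ s, g i * es ((insert a s).erase i) f (k + 1)
          = ∑ i ∈ s, g i * es (s.erase i) f (k + 1)
            + f a * ∑ i ∈ s, g i * es (s.erase i) f k := by
        rw [Finset.mul_sum, ← Finset.sum_add_distrib]
        refine Finset.sum_congr rfl fun i hi => ?_
        rw [h1 i hi, es_insert (h2 i hi)]; ring
      rw [e]; simp; ring

lemma mul_rpow_prod_le_sum_div {k : ℕ} (hk : 0 < k) {a b : ℕ → ℝ}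
    (ha : ∀ j < k, 0 < a j) (hb : ∀ j < k, 0 < b j) :
    (k : ℝ) * ((∏ j ∈ Finset.range k, b j) / ∏ j ∈ Finset.range k, a j) ^ (1 / (k : ℝ))
      ≤ ∑ j ∈ Finset.range k, b j / a j := by
  have hk' : (0:ℝ) < k := by exact_mod_cast hk
  have := Real.geom_mean_le_arith_mean_weighted (Finset.range k) (fun _ => 1 / (k:ℝ))
    (fun j => b j / a j) (fun _ _ => by positivity) (by simp; field_simp)
    (fun j hj => (div_pos (hb j (Finset.mem_range.1 hj)) (ha j (Finset.mem_range.1 hj))).le)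
  rw [Real.finsetProd_rpow _ _ (fun j hj =>
    (div_pos (hb j (Finset.mem_range.1 hj)) (ha j (Finset.mem_range.1 hj))).le),
    Finset.prod_div_distrib, ← Finset.mul_sum] at this
  calc _ ≤ (k:ℝ) * (1 / k * ∑ j ∈ Finset.range k, b j / a j) :=
        mul_le_mul_of_nonneg_left this hk'.le
    _ = _ := by field_simp

/-- Gårding's inequality, linearised form. -/
theorem garding {s : Finset ι} {f g : ι → ℝ} {k : ℕ} (hk : 0 < k) (hf : InCone s f k)
    (hg : InCone s g k) : es s g k ^ (1 / (k : ℝ)) ≤ ∑ i ∈ s, wt s k f i * g i := by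
  obtain ⟨m, rfl⟩ : ∃ m, k = m + 1 := ⟨k - 1, by omega⟩
  have hk' : (0:ℝ) < ((m + 1 : ℕ) : ℝ) := by positivity
  have d1 := hasDerivAt_es s f g m
  have d2 : HasDerivAt (fun t : ℝ => ∏ j ∈ Finset.range (m + 1), (esq s f j + t * esq s g j))
      (∑ j ∈ Finset.range (m + 1),
        (∏ l ∈ (Finset.range (m + 1)).erase j, esq s f l) * esq s g j) 0 := by
    have := HasDerivAt.fun_finsetProd (u := Finset.range (m + 1)) (x := (0:ℝ))
      (f := fun j (t : ℝ) => esq s f j + t * esq s g j) (f' := fun j => esq s g j)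
      (fun j _ => by simpa using ((hasDerivAt_id (0:ℝ)).mul_const (esq s g j)).const_add (esq s f j))
    simpa using this
  have e0 : es s f (m + 1) = ∏ j ∈ Finset.range (m + 1), esq s f j := (prod_esq hf).symm
  -- The function σ_k(f + tg) - ∏(q_j(f) + t q_j(g)), where q_j = σ_{j+1}/σ_j, vanishes at t = 0. It
  -- is nonnegative for t > 0 by superadditivity of each quotient, so its right derivative at 0 is
  -- nonnegative.
  have hle : ∑ j ∈ Finset.range (m + 1),
        (∏ l ∈ (Finset.range (m + 1)).erase j, esq s f l) * esq s g j
      ≤ ∑ i ∈ s, g i * es (s.erase i) f m := by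
    have d := (d1.sub d2).hasDerivWithinAt (s := Ici 0)
    have hslope := (hasDerivWithinAt_iff_tendsto_slope.1 d)
    rw [← sub_nonneg]
    have : NeBot (𝓝[Ici (0:ℝ) \ {0}] 0) := by
      rw [Ici_sdiff_left]; infer_instance
    refine ge_of_tendsto hslope ?_
    filter_upwards [self_mem_nhdsWithin] with t ht
    have ht0 : 0 < t := lt_of_le_of_ne ht.1 (fun h => ht.2 h.symm)
    rw [slope_def_field]
    refine div_nonneg ?_ (by linarith)
    simp only [Pi.sub_apply, zero_mul, add_zero]
    rw [← e0, sub_self, sub_zero, sub_nonneg, ← prod_esq (hf.add_smul hg ht0.le)]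
    refine Finset.prod_le_prod (fun j hj => ?_) fun j hj => ?_
    · rw [Finset.mem_range] at hj
      exact (add_pos (esq_pos hf hj) (mul_pos ht0 (esq_pos hg hj))).le
    · rw [Finset.mem_range] at hj
      exact esq_add_smul_le (hf.mono (by omega)) (hg.mono (by omega)) ht0.le
  have hpf := hf (m + 1) le_rfl
  have hpg := hg (m + 1) le_rfl
  have e1 : ∑ j ∈ Finset.range (m + 1),
        (∏ l ∈ (Finset.range (m + 1)).erase j, esq s f l) * esq s g j
      = es s f (m + 1) * ∑ j ∈ Finset.range (m + 1), esq s g j / esq s f j := by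
    rw [Finset.mul_sum]
    refine Finset.sum_congr rfl fun j hj => ?_
    have := (esq_pos hf (Finset.mem_range.1 hj)).ne'
    rw [e0, ← Finset.mul_prod_erase _ _ hj]; field_simp
  -- The products of the quotients telescope to σ_k(f) and σ_k(g), so the arithmetic-geometric mean
  -- inequality produces the k-th root.
  have hamgm := mul_rpow_prod_le_sum_div (Nat.succ_pos m) (fun j hj => esq_pos hf hj)
    (fun j hj => esq_pos hg hj)
  rw [prod_esq hf, prod_esq hg, Real.div_rpow hpg.le hpf.le] at hamgm
  have hsum : ∑ i ∈ s, wt s (m + 1) f i * g i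
      = 1 / ((m + 1 : ℕ) : ℝ) * es s f (m + 1) ^ (1 / ((m + 1 : ℕ) : ℝ) - 1) *
        ∑ i ∈ s, g i * es (s.erase i) f m := by
    rw [Finset.mul_sum]
    refine Finset.sum_congr rfl fun i _ => ?_
    simp [wt]; ring
  rw [hsum, Real.rpow_sub_one hpf.ne']
  set G := es s g (m + 1) ^ (1 / ((m + 1 : ℕ) : ℝ)) with hG
  set H := es s f (m + 1) ^ (1 / ((m + 1 : ℕ) : ℝ)) with hH
  have hHp : 0 < H := Real.rpow_pos_of_pos hpf _
  rw [e1] at hle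
  calc G = 1 / ((m + 1 : ℕ) : ℝ) * (H / es s f (m + 1)) *
        (es s f (m + 1) * (((m + 1 : ℕ) : ℝ) * (G / H))) := by field_simp
    _ ≤ 1 / ((m + 1 : ℕ) : ℝ) * (H / es s f (m + 1)) *
        (es s f (m + 1) * ∑ j ∈ Finset.range (m + 1), esq s g j / esq s f j) := by gcongr
    _ ≤ _ := by gcongr

lemma wt_pos {s : Finset ι} {f : ι → ℝ} {k : ℕ} (hk : 0 < k) (hf : InCone s f k) {i : ι}
    (hi : i ∈ s) : 0 < wt s k f i := by
  obtain ⟨m, rfl⟩ : ∃ m, k = m + 1 := ⟨k - 1, by omega⟩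
  exact mul_pos (mul_pos (by positivity) (Real.rpow_pos_of_pos (hf _ le_rfl) _))
    (hf.erase hi m le_rfl)

lemma sum_wt_mul_self {s : Finset ι} {f : ι → ℝ} {k : ℕ} (hk : 0 < k) (hf : InCone s f k) :
    ∑ i ∈ s, wt s k f i * f i = es s f k ^ (1 / (k : ℝ)) := by
  obtain ⟨m, rfl⟩ : ∃ m, k = m + 1 := ⟨k - 1, by omega⟩
  have hp := hf (m + 1) le_rfl
  have hsum : ∑ i ∈ s, wt s (m + 1) f i * f i
      = 1 / ((m + 1 : ℕ) : ℝ) * es s f (m + 1) ^ (1 / ((m + 1 : ℕ) : ℝ) - 1) *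
        ∑ i ∈ s, f i * es (s.erase i) f m := by
    rw [Finset.mul_sum]
    refine Finset.sum_congr rfl fun i _ => ?_
    simp [wt]; ring
  rw [hsum, ← succ_mul_es, Real.rpow_sub_one hp.ne']
  push_cast
  field_simp

lemma sum_wt {s : Finset ι} {f : ι → ℝ} {k : ℕ} :
    ∑ i ∈ s, wt s k f i = 1 / (k : ℝ) * es s f k ^ (1 / (k : ℝ) - 1) *
      (((s.card : ℝ) - (k - 1 : ℕ)) * es s f (k - 1)) := by
  simp only [wt]
  rw [← Finset.mul_sum, sum_es_erase]

lemma es_const_one (s : Finset ι) (j : ℕ) : es s (fun _ => (1:ℝ)) j = s.card.choose j := by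
  simp [es, Finset.card_powersetCard]

/-- Gårding's inequality tested on (1,…,1), whose σ_k is a binomial coefficient and hence at least
1. -/
lemma one_le_sum_wt {s : Finset ι} {f : ι → ℝ} {k : ℕ} (hk : 0 < k) (hks : k ≤ s.card)
    (hf : InCone s f k) : 1 ≤ ∑ i ∈ s, wt s k f i := by
  have h1 : InCone s (fun _ => (1:ℝ)) k := fun j hj => by
    rw [es_const_one]; exact_mod_cast Nat.choose_pos (hj.trans hks)
  have := garding hk hf h1
  simp only [mul_one] at this
  refine le_trans (Real.one_le_rpow ?_ (by positivity)) this
  rw [es_const_one]; exact_mod_cast Nat.choose_pos hks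

/-- Lower bound for the trace of the linearised operator in terms of `σ_1` and `σ_k`. -/
lemma rpow_le_mul_sum_wt {s : Finset ι} {f : ι → ℝ} {k : ℕ} (hk : 2 ≤ k) (hks : k ≤ s.card)
    (hf : InCone s f k) (h1 : 1 ≤ es s f 1) :
    es s f k ^ (-(1 / ((k : ℝ) * (k - 1)))) ≤ k * ∑ i ∈ s, wt s k f i := by
  obtain ⟨m, rfl⟩ : ∃ m, k = m + 2 := ⟨k - 2, by omega⟩
  have hp := hf (m + 2) le_rfl
  have hq := hf (m + 1) (by omega)
  have hm : (0:ℝ) < (m:ℝ) + 1 := by positivity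
  have hM := es_one_mul_pow_le hf
  -- With σ₁ ≥ 1 the Maclaurin inequality gives σ_{k-1} ≥ σ_k^{(k-2)/(k-1)}, where m = k - 2. Since
  -- 1/k - 1 + (k-2)/(k-1) = -1/(k(k-1)), this is the exponent in the conclusion.
  have hM' : es s f (m + 2) ^ ((m:ℝ) / (m + 1)) ≤ es s f (m + 1) := by
    have : es s f (m + 2) ^ m ≤ es s f (m + 1) ^ (m + 1) :=
      le_trans (le_mul_of_one_le_left (by positivity) h1) hM
    have h2 := Real.rpow_le_rpow (by positivity) this (z := 1 / ((m:ℝ) + 1)) (by positivity)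
    rw [← Real.rpow_natCast, ← Real.rpow_natCast, ← Real.rpow_mul hp.le, ← Real.rpow_mul hq.le] at h2
    push_cast at h2
    rw [mul_one_div, mul_one_div, div_self hm.ne', Real.rpow_one] at h2
    exact h2
  rw [sum_wt]
  have hc : (1:ℝ) ≤ (s.card : ℝ) - ((m + 2 - 1 : ℕ) : ℝ) := by
    have : ((m + 2 : ℕ) : ℝ) ≤ s.card := by exact_mod_cast hks
    rw [show m + 2 - 1 = m + 1 by omega]
    push_cast at this ⊢; linarith
  have hk0 : (0:ℝ) < ((m + 2 : ℕ) : ℝ) := by positivity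
  calc es s f (m + 2) ^ (-(1 / (((m + 2 : ℕ) : ℝ) * (((m + 2 : ℕ) : ℝ) - 1))))
      = es s f (m + 2) ^ (1 / ((m + 2 : ℕ) : ℝ) - 1) * es s f (m + 2) ^ ((m:ℝ) / (m + 1)) := by
        rw [← Real.rpow_add hp]; congr 1; push_cast
        rw [show (m:ℝ) + 2 - 1 = m + 1 by ring]; field_simp; ring
    _ ≤ es s f (m + 2) ^ (1 / ((m + 2 : ℕ) : ℝ) - 1) *
          (((s.card : ℝ) - ((m + 2 - 1 : ℕ) : ℝ)) * es s f (m + 1)) := by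
        gcongr
        exact hM'.trans (le_mul_of_one_le_left hq.le hc)
    _ = _ := by
        rw [show m + 2 - 1 = m + 1 by omega]; field_simp

lemma le_es_one {s : Finset ι} {f : ι → ℝ} {k : ℕ} (hk : 2 ≤ k) (hf : InCone s f k) {i : ι}
    (hi : i ∈ s) : f i ≤ es s f 1 := by
  have := (hf.mono hk).erase hi 1 le_rfl
  rw [es_erase hi f 0]; simp; linarith

end GardingWeights

/-! ### Gårding's inequality under doubly stochastic averaging. -/

section Frames

variable {n : ℕ}

lemma es_comp_perm (σ : Equiv.Perm (Fin n)) (f : Fin n → ℝ) (j : ℕ) :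
    es Finset.univ (fun i => f (σ i)) j = es Finset.univ f j := by
  rw [← esymm_map_val_eq_es, ← esymm_map_val_eq_es]
  congr 1
  have := Finset.map_univ_equiv σ
  conv_rhs => rw [← this, Finset.map_val, Multiset.map_map]
  rfl

/-- By Birkhoff's theorem Q is a convex combination of permutations. Gårding's inequality holds for
each permuted g with the same left side, because σ_k is symmetric. -/
lemma garding_doublyStochastic {f g : Fin n → ℝ} {k : ℕ} (hk : 0 < k)
    (hf : InCone Finset.univ f k) (hg : InCone Finset.univ g k) {Q : Matrix (Fin n) (Fin n) ℝ}
    (hQ : Q ∈ doublyStochastic ℝ (Fin n)) :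
    es Finset.univ g k ^ (1 / (k : ℝ)) ≤ ∑ i, wt Finset.univ k f i * ∑ j, Q i j * g j := by
  obtain ⟨w, hw0, hw1, rfl⟩ := exists_eq_sum_perm_of_mem_doublyStochastic hQ
  have e : ∑ i, wt Finset.univ k f i * ∑ j,
        (∑ σ : Equiv.Perm (Fin n), w σ • σ.permMatrix ℝ) i j * g j
      = ∑ σ : Equiv.Perm (Fin n), w σ * ∑ i, wt Finset.univ k f i * g (σ i) := by
    have h1 : ∀ i, ∑ j, (∑ σ : Equiv.Perm (Fin n), w σ • σ.permMatrix ℝ) i j * g j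
        = ∑ σ : Equiv.Perm (Fin n), w σ * g (σ i) := by
      intro i
      simp only [Matrix.sum_apply, Matrix.smul_apply, smul_eq_mul, Finset.sum_mul]
      rw [Finset.sum_comm]
      refine Finset.sum_congr rfl fun σ _ => ?_
      simp [PEquiv.toMatrix_apply, eq_comm]
    simp only [h1, Finset.mul_sum]
    rw [Finset.sum_comm]
    exact Finset.sum_congr rfl fun σ _ => Finset.sum_congr rfl fun i _ => by ring
  rw [e]
  calc _ = ∑ σ : Equiv.Perm (Fin n), w σ * es Finset.univ g k ^ (1 / (k : ℝ)) := by
        rw [← Finset.sum_mul, hw1, one_mul]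
    _ ≤ _ := by
        refine Finset.sum_le_sum fun σ _ => mul_le_mul_of_nonneg_left ?_ (hw0 σ)
        have hgσ : InCone Finset.univ (fun i => g (σ i)) k := fun j hj => by
          rw [es_comp_perm]; exact hg j hj
        have := garding hk hf hgσ
        rwa [es_comp_perm] at this

end Frames
end KHessian

namespace KHessian

/-! ### Symmetric bilinear forms and their eigenframes. -/

section Forms

variable {n : ℕ}

/-- Bilinear forms on `ℝⁿ`. -/
abbrev Form (n : ℕ) : Type := E n →L[ℝ] E n →L[ℝ] ℝ

/-- The Gram matrix of a bilinear form in the standard basis. -/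
noncomputable def formMatrix (A : Form n) : Matrix (Fin n) (Fin n) ℝ :=
  Matrix.of fun i j => A (EuclideanSpace.single i 1) (EuclideanSpace.single j 1)

lemma hessian_eq_formMatrix (u : E n → ℝ) (x : E n) :
    hessian u x = formMatrix (fderiv ℝ (fderiv ℝ u) x) := by
  ext i j
  simp [hessian, formMatrix, iteratedFDeriv_two_apply]

/-- Symmetric bilinear forms. -/
def IsSymmForm (A : Form n) : Prop := ∀ v w, A v w = A w v

/-- `v` is an orthonormal frame diagonalising `A`, with eigenvalues `l`. -/
structure IsEigenframe (A : Form n) (v : Fin n → E n) (l : Fin n → ℝ) : Prop where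
  orthonormal : Orthonormal ℝ v
  apply_eq : ∀ i w, A (v i) w = l i * inner ℝ (v i) w

lemma exists_orthonormalBasis_eq {v : Fin n → E n} (hv : Orthonormal ℝ v) :
    ∃ b : OrthonormalBasis (Fin n) ℝ (E n), ⇑b = v := by
  have hc : Module.finrank ℝ (E n) = Fintype.card (Fin n) := by simp
  obtain ⟨b, hb⟩ := Orthonormal.exists_orthonormalBasis_extension_of_card_eq hc
    (s := Set.univ) (v := v) (hv.comp _ Subtype.val_injective)
  exact ⟨b, funext fun i => hb i (Set.mem_univ i)⟩

lemma sum_inner_sq {v : Fin n → E n} (hv : Orthonormal ℝ v) (w : E n) :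
    ∑ i, inner ℝ (v i) w ^ 2 = ‖w‖ ^ 2 := by
  obtain ⟨b, rfl⟩ := exists_orthonormalBasis_eq hv
  have := b.sum_sq_norm_inner_right w
  rw [← this]
  exact Finset.sum_congr rfl fun i _ => by simp

lemma sum_inner_smul {v : Fin n → E n} (hv : Orthonormal ℝ v) (w : E n) :
    ∑ i, inner ℝ (v i) w • v i = w := by
  obtain ⟨b, rfl⟩ := exists_orthonormalBasis_eq hv
  have := b.sum_repr' w
  simpa using this

lemma formMatrix_apply_single (A : Form n) (i : Fin n) (w : E n) :
    A (EuclideanSpace.single i 1) w = (formMatrix A).mulVec w i := by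
  have h : w = ∑ j, w j • EuclideanSpace.single j (1:ℝ) := by
    have := (EuclideanSpace.basisFun (Fin n) ℝ).sum_repr w
    simpa using this.symm
  conv_lhs => rw [h]
  simp [formMatrix, Matrix.mulVec, dotProduct, mul_comm]

lemma IsSymmForm.isHermitian {A : Form n} (hA : IsSymmForm A) : (formMatrix A).IsHermitian := by
  ext i j
  simp [formMatrix, hA (EuclideanSpace.single j 1)]

lemma form_ext_single {a b : E n →L[ℝ] ℝ}
    (h : ∀ i, a (EuclideanSpace.single i 1) = b (EuclideanSpace.single i 1)) : a = b := by
  ext w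
  have h' : w = ∑ j, w j • EuclideanSpace.single j (1:ℝ) := by
    have := (EuclideanSpace.basisFun (Fin n) ℝ).sum_repr w
    simpa using this.symm
  rw [h']; simp [h]

lemma IsSymmForm.exists_eigenframe {A : Form n} (hA : IsSymmForm A) :
    ∃ v l, IsEigenframe A v l := by
  refine ⟨hA.isHermitian.eigenvectorBasis, hA.isHermitian.eigenvalues,
    hA.isHermitian.eigenvectorBasis.orthonormal, fun i w => ?_⟩
  have : A (hA.isHermitian.eigenvectorBasis i) =
      hA.isHermitian.eigenvalues i • innerSL ℝ (hA.isHermitian.eigenvectorBasis i) := by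
    apply form_ext_single
    intro j
    rw [hA, formMatrix_apply_single, hA.isHermitian.mulVec_eigenvectorBasis]
    simp [EuclideanSpace.inner_single_right]
  rw [this]; simp

lemma IsEigenframe.charpoly {A : Form n} (hA : IsSymmForm A) {v : Fin n → E n} {l : Fin n → ℝ}
    (h : IsEigenframe A v l) :
    (formMatrix A).charpoly = ∏ i, (Polynomial.X - Polynomial.C (l i)) := by
  obtain ⟨b', hb'⟩ := exists_orthonormalBasis_eq h.orthonormal
  let b := b'.toBasis
  have hb : ∀ i, b i = v i := fun i => by simp [b, hb']
  let T : E n →ₗ[ℝ] E n := Matrix.toEuclideanLin (formMatrix A)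
  have hT : ∀ i, T (b i) = l i • b i := by
    intro i
    ext j
    have : (T (b i)) j = (formMatrix A).mulVec (b i) j := by
      simp [T, Matrix.toLpLin_apply]
    rw [this, ← formMatrix_apply_single, hA]
    simp [hb, h.apply_eq, EuclideanSpace.inner_single_right]
  have h1 : LinearMap.toMatrix b b T = Matrix.diagonal l := by
    ext i j
    rw [LinearMap.toMatrix_apply, hT]
    simp [Matrix.diagonal_apply, Finsupp.single_apply, eq_comm]
    split_ifs with hij
    · rw [hij]
    · rfl
  have h2 : LinearMap.toMatrix (EuclideanSpace.basisFun (Fin n) ℝ).toBasis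
      (EuclideanSpace.basisFun (Fin n) ℝ).toBasis T = formMatrix A := by
    ext i j
    rw [LinearMap.toMatrix_apply]
    simp [T, Matrix.toLpLin_apply]
  rw [← h2, LinearMap.charpoly_toMatrix, ← LinearMap.charpoly_toMatrix T b, h1,
    Matrix.charpoly_diagonal]

lemma IsEigenframe.eigenvalues_eq {A : Form n} (hA : IsSymmForm A) {v : Fin n → E n}
    {l : Fin n → ℝ} (h : IsEigenframe A v l) :
    eigenvalues (formMatrix A) = Finset.univ.val.map l := by
  unfold eigenvalues
  rw [h.charpoly hA]
  have := Polynomial.roots_multiset_prod_X_sub_C (Finset.univ.val.map l)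
  rw [Multiset.map_map] at this
  exact this

lemma IsEigenframe.sigma_eq {A : Form n} (hA : IsSymmForm A) {v : Fin n → E n}
    {l : Fin n → ℝ} (h : IsEigenframe A v l) (k : ℕ) :
    sigma k (formMatrix A) = es Finset.univ l k := by
  unfold sigma
  rw [h.eigenvalues_eq hA, esymm_map_val_eq_es]

/-- `λ(A) ∈ Γ_k`, `A` symmetric. -/
structure IsConeForm (k : ℕ) (A : Form n) : Prop where
  symm : IsSymmForm A
  pos : ∀ j ≤ k, 0 < sigma j (formMatrix A)

lemma isConeForm_of_mem {k : ℕ} {A : Form n} (hA : IsSymmForm A)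
    (h : eigenvalues (formMatrix A) ∈ gardingCone k) : IsConeForm k A := by
  refine ⟨hA, fun j hj => ?_⟩
  rcases Nat.eq_zero_or_pos j with rfl | h0
  · simp [sigma, Multiset.esymm]
  · exact h j h0 hj

lemma IsEigenframe.inCone {k : ℕ} {A : Form n} (hA : IsConeForm k A) {v : Fin n → E n}
    {l : Fin n → ℝ} (h : IsEigenframe A v l) : InCone Finset.univ l k := fun j hj => by
  rw [← h.sigma_eq hA.symm]; exact hA.pos j hj

lemma IsEigenframe.apply_self {A : Form n} {v : Fin n → E n}
    {l : Fin n → ℝ} (h : IsEigenframe A v l) (w : E n) :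
    A w w = ∑ i, l i * inner ℝ (v i) w ^ 2 := by
  conv_lhs => enter [1, 2]; rw [← sum_inner_smul h.orthonormal w]
  simp only [map_sum, map_smul, FunLike.coe_sum, Finset.sum_apply]
  refine Finset.sum_congr rfl fun i _ => ?_
  simp [h.apply_eq]; ring

/-- The coefficients of the linearisation of `σ_k^{1/k}` in a diagonalising frame. -/
noncomputable abbrev gw (k : ℕ) (l : Fin n → ℝ) (i : Fin n) : ℝ := wt Finset.univ k l i

/-- Gårding's inequality for symmetric forms: the linearisation of `σ_k^{1/k}` at `A` applied to
`D`, computed in an arbitrarily rotated frame. -/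
theorem garding_form {k : ℕ} (hk : 0 < k) {A D : Form n} (hA : IsConeForm k A)
    (hD : IsConeForm k D) {v w : Fin n → E n} {l : Fin n → ℝ} (h : IsEigenframe A v l)
    (hw : Orthonormal ℝ w) :
    sigma k (formMatrix D) ^ (1 / (k : ℝ)) ≤ ∑ i, gw k l i * D (w i) (w i) := by
  obtain ⟨e, m, he⟩ := hD.symm.exists_eigenframe
  rw [he.sigma_eq hD.symm]
  -- The squared inner products of two orthonormal frames have all row and column sums equal to 1,
  -- by Parseval. They express the diagonal entries of D in the frame w through its eigenvalues.
  have hQ : (Matrix.of fun i j => inner ℝ (w i) (e j) ^ 2) ∈ doublyStochastic ℝ (Fin n) := by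
    rw [mem_doublyStochastic_iff_sum]
    refine ⟨fun i j => sq_nonneg _, fun i => ?_, fun j => ?_⟩
    · have := sum_inner_sq he.orthonormal (w i)
      rw [hw.1 i, one_pow] at this
      rw [← this]
      exact Finset.sum_congr rfl fun j _ => by simp [real_inner_comm]
    · have := sum_inner_sq hw (e j)
      rw [he.orthonormal.1 j, one_pow] at this
      rw [← this]
      exact Finset.sum_congr rfl fun j _ => by simp
  refine (garding_doublyStochastic hk (h.inCone hA) (he.inCone hD) hQ).trans_eq ?_
  refine Finset.sum_congr rfl fun i _ => ?_
  rw [he.apply_self]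
  congr 1
  refine Finset.sum_congr rfl fun j _ => ?_
  simp [real_inner_comm, mul_comm]

lemma IsEigenframe.sum_gw_mul {k : ℕ} (hk : 0 < k) {A : Form n} (hA : IsConeForm k A)
    {v : Fin n → E n} {l : Fin n → ℝ} (h : IsEigenframe A v l) :
    ∑ i, gw k l i * l i = sigma k (formMatrix A) ^ (1 / (k : ℝ)) := by
  rw [h.sigma_eq hA.symm]; exact sum_wt_mul_self hk (h.inCone hA)

lemma IsEigenframe.gw_pos {k : ℕ} (hk : 0 < k) {A : Form n} (hA : IsConeForm k A)
    {v : Fin n → E n} {l : Fin n → ℝ} (h : IsEigenframe A v l) (i : Fin n) : 0 < gw k l i :=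
  wt_pos hk (h.inCone hA) (Finset.mem_univ i)

lemma IsEigenframe.one_le_sum_gw {k : ℕ} (hk : 0 < k) (hkn : k ≤ n) {A : Form n}
    (hA : IsConeForm k A) {v : Fin n → E n} {l : Fin n → ℝ} (h : IsEigenframe A v l) :
    1 ≤ ∑ i, gw k l i := one_le_sum_wt hk (by simpa using hkn) (h.inCone hA)

lemma IsEigenframe.le_trace {k : ℕ} (hk : 2 ≤ k) {A : Form n}
    (hA : IsConeForm k A) {v : Fin n → E n} {l : Fin n → ℝ} (h : IsEigenframe A v l) (i : Fin n) :
    l i ≤ es Finset.univ l 1 := le_es_one hk (h.inCone hA) (Finset.mem_univ i)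

lemma IsEigenframe.sigma_rpow_le {k : ℕ} (hk : 2 ≤ k) (hkn : k ≤ n) {A : Form n}
    (hA : IsConeForm k A) {v : Fin n → E n} {l : Fin n → ℝ} (h : IsEigenframe A v l)
    {w : E n} (hw : ‖w‖ = 1) (h1 : 1 ≤ A w w) :
    sigma k (formMatrix A) ^ (-(1 / ((k : ℝ) * (k - 1)))) ≤ k * ∑ i, gw k l i := by
  rw [h.sigma_eq hA.symm]
  refine rpow_le_mul_sum_wt hk (by simpa using hkn) (h.inCone hA) (h1.trans ?_)
  rw [h.apply_self]
  calc _ ≤ ∑ i, es Finset.univ l 1 * inner ℝ (v i) w ^ 2 :=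
        Finset.sum_le_sum fun i _ => mul_le_mul_of_nonneg_right (h.le_trace hk hA i) (sq_nonneg _)
    _ = es Finset.univ l 1 := by
        rw [← Finset.mul_sum, sum_inner_sq h.orthonormal, hw]; simp

/-- In `Γ_2` the largest eigenvalue controls all of them. -/
lemma IsConeForm.abs_apply_le {k : ℕ} (hk : 2 ≤ k) {A : Form n} (hA : IsConeForm k A) {c : ℝ}
    (hc : 0 ≤ c) (h : ∀ w : E n, ‖w‖ = 1 → A w w ≤ c) (w z : E n) :
    |A w z| ≤ n * c * ‖w‖ * ‖z‖ := by
  obtain ⟨v, l, hv⟩ := hA.symm.exists_eigenframe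
  have hl : ∀ i, l i ≤ c := fun i => by
    have := h (v i) (hv.orthonormal.1 i)
    rw [hv.apply_eq, real_inner_self_eq_norm_sq, hv.orthonormal.1 i] at this; linarith
  have hs : 0 < ∑ i, l i := by
    have := hv.inCone hA 1 (by omega)
    rwa [es_one] at this
  -- The trace is positive, so a single eigenvalue cannot fall below minus the sum of the others,
  -- each of which is at most c.
  have habs : ∀ i, |l i| ≤ n * c := fun i => by
    have hn : (1:ℝ) ≤ n := by exact_mod_cast i.pos
    rw [abs_le]
    constructor
    · have h1 : ∑ j ∈ Finset.univ.erase i, l j ≤ ∑ j ∈ Finset.univ.erase i, c :=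
        Finset.sum_le_sum fun j _ => hl j
      have h2 : ∑ j ∈ Finset.univ.erase i, c ≤ ∑ j : Fin n, c :=
        Finset.sum_le_sum_of_subset_of_nonneg (Finset.erase_subset _ _) fun _ _ _ => hc
      rw [← Finset.add_sum_erase _ _ (Finset.mem_univ i)] at hs
      have h3 : ∑ _j : Fin n, c = n * c := by simp
      linarith
    · nlinarith [hl i]
  have e : A w z = ∑ i, l i * (inner ℝ (v i) w * inner ℝ (v i) z) := by
    conv_lhs => enter [1, 2]; rw [← sum_inner_smul hv.orthonormal w]
    simp only [map_sum, map_smul, FunLike.coe_sum, Finset.sum_apply]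
    exact Finset.sum_congr rfl fun i _ => by simp [hv.apply_eq]; ring
  have hcs : ∑ i, |inner ℝ (v i) w| * |inner ℝ (v i) z| ≤ ‖w‖ * ‖z‖ := by
    have := Finset.sum_mul_sq_le_sq_mul_sq Finset.univ (fun i => |inner ℝ (v i) w|)
      (fun i => |inner ℝ (v i) z|)
    simp only [sq_abs] at this
    rw [sum_inner_sq hv.orthonormal, sum_inner_sq hv.orthonormal, ← mul_pow] at this
    exact abs_le_of_sq_le_sq' this (by positivity) |>.2
  rw [e]
  calc _ ≤ ∑ i, |l i * (inner ℝ (v i) w * inner ℝ (v i) z)| := Finset.abs_sum_le_sum_abs _ _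
    _ ≤ ∑ i, n * c * (|inner ℝ (v i) w| * |inner ℝ (v i) z|) := by
        refine Finset.sum_le_sum fun i _ => ?_
        rw [abs_mul, abs_mul]
        exact mul_le_mul_of_nonneg_right (habs i) (by positivity)
    _ ≤ n * c * (‖w‖ * ‖z‖) := by
        rw [← Finset.mul_sum]; exact mul_le_mul_of_nonneg_left hcs (by positivity)
    _ = _ := by ring

end Forms
end KHessian

namespace KHessian

/-! ### Second derivatives along lines and second difference quotients. -/

section SecondDerivative

variable {n : ℕ}

/-- The second derivative of `w` at `x`. -/
noncomputable abbrev D2 (w : E n → ℝ) (x : E n) : Form n := fderiv ℝ (fderiv ℝ w) x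

lemma differentiableAt_fderiv {w : E n → ℝ} {x : E n} (hw : ContDiffAt ℝ 2 w x) :
    DifferentiableAt ℝ (fderiv ℝ w) x :=
  (hw.fderiv_right (m := 1) (by norm_num)).differentiableAt (by norm_num)

lemma isSymmForm_D2 {w : E n → ℝ} {x : E n} (hw : ContDiffAt ℝ 2 w x) : IsSymmForm (D2 w x) :=
  fun v z => (hw.isSymmSndFDerivAt (by simp)) v z

lemma hasDerivAt_line {w : E n → ℝ} {x v : E n} {s : ℝ}
    (hw : DifferentiableAt ℝ w (x + s • v)) :
    HasDerivAt (fun s : ℝ => w (x + s • v)) (fderiv ℝ w (x + s • v) v) s := by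
  have h1 : HasDerivAt (fun s : ℝ => x + s • v) v s := by
    simpa using ((hasDerivAt_id s).smul_const v).const_add x
  exact hw.hasFDerivAt.comp_hasDerivAt s h1

lemma hasDerivAt_fderiv_line {w : E n → ℝ} {x v z : E n} {s : ℝ}
    (hw : DifferentiableAt ℝ (fderiv ℝ w) (x + s • v)) :
    HasDerivAt (fun s : ℝ => fderiv ℝ w (x + s • v) z) (D2 w (x + s • v) v z) s := by
  have h1 : HasDerivAt (fun s : ℝ => x + s • v) v s := by
    simpa using ((hasDerivAt_id s).smul_const v).const_add x
  have h2 : HasDerivAt (fun s : ℝ => fderiv ℝ w (x + s • v)) (D2 w (x + s • v) v) s :=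
    hw.hasFDerivAt.comp_hasDerivAt s h1
  have h3 := h2.clm_apply (hasDerivAt_const s z)
  simpa using h3

lemma tendsto_line (x v : E n) : Tendsto (fun s : ℝ => x + s • v) (𝓝 0) (𝓝 x) := by
  have : Continuous fun s : ℝ => x + s • v := by fun_prop
  simpa using this.tendsto 0

lemma eventually_deriv_line {w : E n → ℝ} {x v : E n} (hw : ContDiffAt ℝ 2 w x) :
    deriv (fun s : ℝ => w (x + s • v)) =ᶠ[𝓝 0] fun s => fderiv ℝ w (x + s • v) v := by
  have h1 : ∀ᶠ y in 𝓝 x, ContDiffAt ℝ 2 w y := hw.eventually (by simp)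
  filter_upwards [(tendsto_line x v).eventually h1] with s hs
  exact (hasDerivAt_line (hs.differentiableAt (by norm_num))).deriv

lemma deriv_deriv_line {w : E n → ℝ} {x v : E n} (hw : ContDiffAt ℝ 2 w x) :
    deriv (deriv fun s : ℝ => w (x + s • v)) 0 = D2 w x v v := by
  rw [(eventually_deriv_line hw).deriv_eq]
  have := hasDerivAt_fderiv_line (w := w) (x := x) (v := v) (z := v) (s := 0)
    (by simpa using differentiableAt_fderiv hw)
  simpa using this.deriv

/-- Second order necessary condition at a local maximum. -/
lemma D2_nonpos_of_isLocalMax {w : E n → ℝ} {x : E n} (hw : ContDiffAt ℝ 2 w x)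
    (hmax : IsLocalMax w x) (v : E n) : D2 w x v v ≤ 0 := by
  by_contra! hc
  rw [← deriv_deriv_line hw] at hc
  have hmax' : IsLocalMax (fun s : ℝ => w (x + s • v)) 0 := by
    have := (tendsto_line x v).eventually hmax
    filter_upwards [this] with s hs
    simpa using hs
  have hcont : ContinuousAt (fun s : ℝ => w (x + s • v)) 0 := by
    have h0 : ContinuousAt w (x + (0:ℝ) • v) := by simpa using hw.continuousAt
    exact (hasDerivAt_line (w := w) (s := 0)
      (by simpa using hw.differentiableAt (by norm_num))).continuousAt
  -- A positive second derivative makes the point a local minimum along the line as well. The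
  -- function is then locally constant there, which forces the second derivative to vanish.
  have hmin := isLocalMin_of_deriv_deriv_pos hc hmax'.deriv_eq_zero hcont
  have heq : (fun s : ℝ => w (x + s • v)) =ᶠ[𝓝 0] fun _ => w (x + (0:ℝ) • v) := by
    filter_upwards [hmax', hmin] with s h1 h2
    exact le_antisymm h1 h2
  have : deriv (deriv fun s : ℝ => w (x + s • v)) 0 = 0 := by
    rw [heq.deriv.deriv_eq]; simp
  linarith

lemma eventually_contDiffAt_fderiv_add {f g : E n → ℝ} {x : E n} (hf : ContDiffAt ℝ 2 f x)
    (hg : ContDiffAt ℝ 2 g x) :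
    fderiv ℝ (fun y => f y + g y) =ᶠ[𝓝 x] fun y => fderiv ℝ f y + fderiv ℝ g y := by
  filter_upwards [hf.eventually (by simp), hg.eventually (by simp)] with y h1 h2
  exact fderiv_fun_add (h1.differentiableAt (by norm_num)) (h2.differentiableAt (by norm_num))

lemma D2_add {f g : E n → ℝ} {x : E n} (hf : ContDiffAt ℝ 2 f x) (hg : ContDiffAt ℝ 2 g x) :
    D2 (fun y => f y + g y) x = D2 f x + D2 g x := by
  unfold D2
  rw [(eventually_contDiffAt_fderiv_add hf hg).fderiv_eq]
  exact fderiv_fun_add (differentiableAt_fderiv hf) (differentiableAt_fderiv hg)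

lemma D2_const_mul {f : E n → ℝ} {x : E n} (hf : ContDiffAt ℝ 2 f x) (c : ℝ) :
    D2 (fun y => c * f y) x = c • D2 f x := by
  unfold D2
  have : fderiv ℝ (fun y => c * f y) =ᶠ[𝓝 x] fun y => c • fderiv ℝ f y := by
    filter_upwards [hf.eventually (by simp)] with y h1
    exact fderiv_const_mul (h1.differentiableAt (by norm_num)) c
  rw [this.fderiv_eq]
  exact fderiv_fun_const_smul (differentiableAt_fderiv hf) c

lemma D2_sub {f g : E n → ℝ} {x : E n} (hf : ContDiffAt ℝ 2 f x) (hg : ContDiffAt ℝ 2 g x) :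
    D2 (fun y => f y - g y) x = D2 f x - D2 g x := by
  have e : fderiv ℝ (fun y => f y - g y) =ᶠ[𝓝 x] fun y => fderiv ℝ f y - fderiv ℝ g y := by
    filter_upwards [hf.eventually (by simp), hg.eventually (by simp)] with y h1 h2
    exact fderiv_fun_sub (h1.differentiableAt (by norm_num)) (h2.differentiableAt (by norm_num))
  unfold D2
  rw [e.fderiv_eq]
  exact fderiv_fun_sub (differentiableAt_fderiv hf) (differentiableAt_fderiv hg)

lemma D2_congr {f g : E n → ℝ} {x : E n} (h : f =ᶠ[𝓝 x] g) : D2 f x = D2 g x :=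
  h.fderiv.fderiv_eq

lemma D2_comp_affine {f : E n → ℝ} (a : E n) (R : E n →L[ℝ] E n) {x : E n}
    (hf : ContDiffAt ℝ 2 f (a + R x)) (v w : E n) :
    D2 (fun y => f (a + R y)) x v w = D2 f (a + R x) (R v) (R w) := by
  have hR : ∀ y, HasFDerivAt (fun y => a + R y) R y := fun y => R.hasFDerivAt.const_add a
  have hc : Tendsto (fun y => a + R y) (𝓝 x) (𝓝 (a + R x)) := (hR x).continuousAt
  have e : fderiv ℝ (fun y => f (a + R y)) =ᶠ[𝓝 x] fun y => (fderiv ℝ f (a + R y)).comp R := by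
    filter_upwards [hc.eventually (hf.eventually (by simp))] with y hy
    exact ((hy.differentiableAt (by norm_num)).hasFDerivAt.comp y (hR y)).fderiv
  unfold D2
  rw [e.fderiv_eq]
  have h1 : HasFDerivAt (fun y => fderiv ℝ f (a + R y)) ((D2 f (a + R x)).comp R) x :=
    HasFDerivAt.comp x (f := fun y => a + R y) (differentiableAt_fderiv hf).hasFDerivAt (hR x)
  have h2 := h1.clm_comp (hasFDerivAt_const R x)
  rw [h2.fderiv]
  simp

/-- Quantitative convergence of symmetric second difference quotients. -/
lemma abs_second_difference_sub_le {g g' g'' : ℝ → ℝ} {t ε m : ℝ} (ht : 0 < t)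
    (h1 : ∀ s, |s| ≤ t → HasDerivAt g (g' s) s) (h2 : ∀ s, |s| ≤ t → HasDerivAt g' (g'' s) s)
    (h3 : ∀ s, |s| ≤ t → |g'' s - m| ≤ ε) :
    |(g t + g (-t) - 2 * g 0) / t ^ 2 - m| ≤ ε := by
  have key : ∀ {a b : ℝ → ℝ}, (∀ s ∈ Icc 0 t, HasDerivAt a (b s) s) → (∀ s ∈ Icc 0 t, 0 ≤ b s) →
      ∀ s ∈ Icc 0 t, a 0 ≤ a s := by
    intro a b ha hb s hs
    have hm : MonotoneOn a (Icc 0 t) := by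
      refine monotoneOn_of_deriv_nonneg (convex_Icc 0 t)
        (fun s hs => (ha s hs).continuousAt.continuousWithinAt)
        (fun s hs => (ha s (interior_subset hs)).differentiableAt.differentiableWithinAt)
        fun s hs => ?_
      rw [(ha s (interior_subset hs)).deriv]; exact hb s (interior_subset hs)
    exact hm ⟨le_rfl, ht.le⟩ hs hs.1
  have hI : ∀ s ∈ Icc 0 t, |s| ≤ t ∧ |-s| ≤ t := fun s hs => by
    rw [abs_neg, abs_of_nonneg hs.1]; exact ⟨hs.2, hs.2⟩
  have hneg : ∀ s ∈ Icc 0 t, HasDerivAt (fun s => g (-s)) (-g' (-s)) s := fun s hs => by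
    exact ((h1 (-s) (hI s hs).2).comp s (hasDerivAt_neg s)).congr_deriv (by ring)
  have hneg' : ∀ s ∈ Icc 0 t, HasDerivAt (fun s => g' (-s)) (-g'' (-s)) s := fun s hs => by
    exact ((h2 (-s) (hI s hs).2).comp s (hasDerivAt_neg s)).congr_deriv (by ring)
  have hb : ∀ s ∈ Icc 0 t, |g' s - g' (-s) - 2 * m * s| ≤ 2 * ε * s := by
    intro s hs
    have hlin : ∀ (c : ℝ), HasDerivAt (fun s : ℝ => 2 * c * s) (2 * c) s := fun c => by
      simpa using (hasDerivAt_id s).const_mul (2 * c)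
    have u := key (a := fun s => 2 * (m + ε) * s - (g' s - g' (-s)))
      (b := fun s => 2 * (m + ε) - (g'' s - -g'' (-s)))
      (fun s hs => by
        have := (hasDerivAt_id s).const_mul (2 * (m + ε))
        simp only [id, mul_one] at this
        exact this.sub ((h2 s (hI s hs).1).sub (hneg' s hs)))
      (fun s hs => by
        have a1 := (abs_le.1 (h3 s (hI s hs).1)).2
        have a2 := (abs_le.1 (h3 (-s) (hI s hs).2)).2
        linarith) s hs
    have l := key (a := fun s => (g' s - g' (-s)) - 2 * (m - ε) * s)
      (b := fun s => (g'' s - -g'' (-s)) - 2 * (m - ε))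
      (fun s hs => by
        have := (hasDerivAt_id s).const_mul (2 * (m - ε))
        simp only [id, mul_one] at this
        exact ((h2 s (hI s hs).1).sub (hneg' s hs)).sub this)
      (fun s hs => by
        have a1 := (abs_le.1 (h3 s (hI s hs).1)).1
        have a2 := (abs_le.1 (h3 (-s) (hI s hs).2)).1
        linarith) s hs
    simp only [neg_zero, sub_self, mul_zero] at u l
    rw [abs_le]; constructor <;> linarith
  have u := key (a := fun s => (m + ε) * s ^ 2 - (g s + g (-s)))
    (b := fun s => (m + ε) * (2 * s) - (g' s + -g' (-s)))
    (fun s hs => by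
      have := ((hasDerivAt_id s).pow 2).const_mul (m + ε)
      simp only [id] at this
      exact (this.congr_deriv (by simp)).sub ((h1 s (hI s hs).1).add (hneg s hs)))
    (fun s hs => by have := (abs_le.1 (hb s hs)).2; linarith) t ⟨ht.le, le_rfl⟩
  have l := key (a := fun s => (g s + g (-s)) - (m - ε) * s ^ 2)
    (b := fun s => (g' s + -g' (-s)) - (m - ε) * (2 * s))
    (fun s hs => by
      have := ((hasDerivAt_id s).pow 2).const_mul (m - ε)
      simp only [id] at this
      exact ((h1 s (hI s hs).1).add (hneg s hs)).sub (this.congr_deriv (by simp)))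
    (fun s hs => by have := (abs_le.1 (hb s hs)).1; linarith) t ⟨ht.le, le_rfl⟩
  simp only [neg_zero, ne_eq, OfNat.ofNat_ne_zero, not_false_eq_true, zero_pow, mul_zero] at u l
  have ht2 : 0 < t ^ 2 := by positivity
  rw [abs_le, le_sub_iff_add_le, sub_le_iff_le_add, le_div_iff₀ ht2, div_le_iff₀ ht2]
  constructor <;> nlinarith

end SecondDerivative

/-! ### One-parameter groups of similarities. -/

section ConformalFlow

variable {n : ℕ}

/-- The one-parameter group generated by `A`. -/
noncomputable def flow (A : E n →L[ℝ] E n) (t : ℝ) : E n →L[ℝ] E n := NormedSpace.exp (t • A)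

@[simp] lemma flow_zero (A : E n →L[ℝ] E n) : flow A 0 = 1 := by
  have e : (0 : ℝ) • A = 0 := zero_smul ℝ A
  rw [flow, e, NormedSpace.exp_zero]

lemma hasDerivAt_flow (A : E n →L[ℝ] E n) (t : ℝ) :
    HasDerivAt (flow A) (flow A t * A) t := hasDerivAt_exp_smul_const A t

lemma hasDerivAt_flow' (A : E n →L[ℝ] E n) (t : ℝ) :
    HasDerivAt (flow A) (A * flow A t) t := hasDerivAt_exp_smul_const' A t

lemma continuous_flow (A : E n →L[ℝ] E n) : Continuous (flow A) :=
  continuous_iff_continuousAt.2 fun t => (hasDerivAt_flow A t).continuousAt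

/-- The hypothesis says that the symmetric part of A is c times the identity, so e^{-2ct}⟨e^{tA}v,
e^{tA}w⟩ has zero derivative in t. -/
lemma inner_flow {A : E n →L[ℝ] E n} {c : ℝ}
    (hA : ∀ v w, inner ℝ (A v) w + inner ℝ v (A w) = 2 * c * inner ℝ v w) (t : ℝ) (v w : E n) :
    inner ℝ (flow A t v) (flow A t w) = Real.exp (2 * c * t) * inner ℝ v w := by
  have hd : ∀ (t : ℝ) (v : E n), HasDerivAt (fun t => flow A t v) (A (flow A t v)) t := fun t v => by
    simpa using (hasDerivAt_flow' A t).clm_apply (hasDerivAt_const t v)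
  have h1 : ∀ t : ℝ, HasDerivAt (fun t => Real.exp (-(2 * c * t)) *
      inner ℝ (flow A t v) (flow A t w)) 0 t := by
    intro t
    have e : HasDerivAt (fun t => Real.exp (-(2 * c * t))) (Real.exp (-(2 * c * t)) * -(2 * c)) t := by
      have := ((hasDerivAt_id t).const_mul (2 * c)).neg.exp
      simpa using this
    refine (e.mul ((hd t v).inner ℝ (hd t w))).congr_deriv ?_
    have := hA (flow A t v) (flow A t w)
    have e2 : inner ℝ (flow A t v) (A (flow A t w)) =
      2 * c * inner ℝ (flow A t v) (flow A t w) - inner ℝ (A (flow A t v)) (flow A t w) := by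
      linarith
    rw [e2]; ring
  have h2 := is_const_of_deriv_eq_zero (fun t => (h1 t).differentiableAt) (fun t => (h1 t).deriv) t 0
  simp only [mul_zero, neg_zero, Real.exp_zero, flow_zero, one_mul,
    one_apply_eq_self] at h2
  rw [← h2, ← mul_assoc, ← Real.exp_add]; simp

lemma orthonormal_flow {A : E n →L[ℝ] E n} {c : ℝ}
    (hA : ∀ v w, inner ℝ (A v) w + inner ℝ v (A w) = 2 * c * inner ℝ v w) (t : ℝ)
    {v : Fin n → E n} (hv : Orthonormal ℝ v) :
    Orthonormal ℝ fun i => Real.exp (-(c * t)) • flow A t (v i) := by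
  rw [orthonormal_iff_ite] at hv ⊢
  intro i j
  rw [inner_smul_left, inner_smul_right, inner_flow hA, hv]
  have : Real.exp (-(c * t)) * (Real.exp (-(c * t)) * (Real.exp (2 * c * t) * 1)) = 1 := by
    rw [mul_one, ← Real.exp_add, ← Real.exp_add]; simp; ring
  split_ifs
  · simpa using this
  · simp

/-- The first bound keeps the moved points inside the domain. The second shows that the symmetric
second difference of the group is of order t², as needed when the quotients are passed to the limit.
-/
lemma exists_norm_flow_bounds (A : E n →L[ℝ] E n) : ∃ C : ℝ, 0 ≤ C ∧ ∀ t : ℝ, |t| ≤ 1 →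
    ‖flow A t - 1‖ ≤ C * |t| ∧ ‖flow A t + flow A (-t) - 2‖ ≤ C * t ^ 2 := by
  obtain ⟨M, hM⟩ := isCompact_Icc.exists_bound_of_continuousOn
    (s := Icc (-1:ℝ) 1) (continuous_flow A).continuousOn
  have hM0 : 0 ≤ M := (norm_nonneg _).trans (hM 0 (by simp))
  have hseg : ∀ {t s : ℝ}, s ∈ uIcc 0 t → |s| ≤ |t| := by
    intro t s hs
    simpa using abs_sub_left_of_mem_uIcc hs
  have a1 : ∀ t : ℝ, |t| ≤ 1 → ‖flow A t - 1‖ ≤ M * ‖A‖ * |t| := by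
    intro t ht
    have := (convex_uIcc (0:ℝ) t).norm_image_sub_le_of_norm_hasDerivWithin_le
      (f := flow A) (f' := fun s => flow A s * A) (C := M * ‖A‖)
      (fun s _ => (hasDerivAt_flow A s).hasDerivWithinAt)
      (fun s hs => (norm_mul_le _ _).trans (mul_le_mul_of_nonneg_right
        (hM s (abs_le.1 ((hseg hs).trans ht))) (norm_nonneg _))) left_mem_uIcc right_mem_uIcc
    simpa using this
  have a2 : ∀ t : ℝ, |t| ≤ 1 → ‖flow A t + flow A (-t) - 2‖ ≤ 2 * M * ‖A‖ * ‖A‖ * t ^ 2 := by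
    intro t ht
    have hd : ∀ s : ℝ, HasDerivAt (fun s => flow A s + flow A (-s))
        ((flow A s - flow A (-s)) * A) s := fun s => by
      have h2 : HasDerivAt (fun s => flow A (-s)) (-(flow A (-s) * A)) s := by
        have := (hasDerivAt_flow A (-s)).scomp s (hasDerivAt_neg s)
        exact this.congr_deriv (by simp)
      exact ((hasDerivAt_flow A s).add h2).congr_deriv (by rw [sub_mul]; abel)
    have := (convex_uIcc (0:ℝ) t).norm_image_sub_le_of_norm_hasDerivWithin_le
      (f := fun s => flow A s + flow A (-s)) (f' := fun s => (flow A s - flow A (-s)) * A)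
      (C := 2 * M * ‖A‖ * |t| * ‖A‖)
      (fun s _ => (hd s).hasDerivWithinAt)
      (fun s hs => (norm_mul_le _ _).trans (mul_le_mul_of_nonneg_right (by
        have hs' := hseg hs
        have b1 := a1 s (hs'.trans ht)
        have b2 := a1 (-s) (by rw [abs_neg]; exact hs'.trans ht)
        rw [abs_neg] at b2
        have b3 : M * ‖A‖ * |s| ≤ M * ‖A‖ * |t| := by gcongr
        calc ‖flow A s - flow A (-s)‖ = ‖(flow A s - 1) - (flow A (-s) - 1)‖ := by congr 1; abel
          _ ≤ ‖flow A s - 1‖ + ‖flow A (-s) - 1‖ := norm_sub_le _ _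
          _ ≤ _ := by linarith) (norm_nonneg _))) left_mem_uIcc right_mem_uIcc
    simp only [flow_zero, neg_zero, sub_zero, Real.norm_eq_abs] at this
    rw [show (1 : E n →L[ℝ] E n) + 1 = 2 by norm_num] at this
    refine this.trans_eq ?_
    rw [← sq_abs t]; ring
  refine ⟨M * ‖A‖ + 2 * M * ‖A‖ * ‖A‖, by positivity, fun t ht => ⟨(a1 t ht).trans ?_,
    (a2 t ht).trans ?_⟩⟩
  · exact mul_le_mul_of_nonneg_right (le_add_of_nonneg_right (by positivity)) (abs_nonneg _)
  · exact mul_le_mul_of_nonneg_right (le_add_of_nonneg_left (by positivity)) (sq_nonneg _)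

end ConformalFlow
end KHessian

namespace KHessian

/-! ### Maximum principle for second derivatives along conformal motions. -/

section Viscosity

variable {n : ℕ}

/-- The conformal motion `y ↦ x₀ + t ξ₀ + e^{tA} (y - x₀)`. -/
noncomputable def motion (A : E n →L[ℝ] E n) (x₀ ξ₀ : E n) (t : ℝ) (y : E n) : E n :=
  x₀ + t • ξ₀ + flow A t (y - x₀)

lemma continuous_motion (A : E n →L[ℝ] E n) (x₀ ξ₀ : E n) :
    Continuous fun p : ℝ × E n => motion A x₀ ξ₀ p.1 p.2 := by
  unfold motion
  have := (continuous_flow A).comp (continuous_fst (X := ℝ) (Y := E n))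
  exact (by fun_prop : Continuous fun p : ℝ × E n => x₀ + p.1 • ξ₀).add
    (this.clm_apply (continuous_snd.sub continuous_const))

@[simp] lemma motion_zero (A : E n →L[ℝ] E n) (x₀ ξ₀ y : E n) : motion A x₀ ξ₀ 0 y = y := by
  simp [motion]

lemma hasDerivAt_flow_apply (A : E n →L[ℝ] E n) (z : E n) (t : ℝ) :
    HasDerivAt (fun t => flow A t z) (flow A t (A z)) t := by
  simpa using (hasDerivAt_flow A t).clm_apply (hasDerivAt_const t z)

lemma hasDerivAt_motion (A : E n →L[ℝ] E n) (x₀ ξ₀ y : E n) (t : ℝ) :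
    HasDerivAt (fun t => motion A x₀ ξ₀ t y) (ξ₀ + flow A t (A (y - x₀))) t := by
  have h1 : HasDerivAt (fun t : ℝ => x₀ + t • ξ₀) ξ₀ t := by
    simpa using ((hasDerivAt_id t).smul_const ξ₀).const_add x₀
  exact h1.add (hasDerivAt_flow_apply A (y - x₀) t)

/-- The second `t`-derivative of `u (motion t y)`. -/
noncomputable def motionSecond (u : E n → ℝ) (A : E n →L[ℝ] E n) (x₀ ξ₀ : E n) (t : ℝ) (y : E n) :
    ℝ :=
  D2 u (motion A x₀ ξ₀ t y) (ξ₀ + flow A t (A (y - x₀))) (ξ₀ + flow A t (A (y - x₀))) +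
    fderiv ℝ u (motion A x₀ ξ₀ t y) (flow A t (A (A (y - x₀))))

/-- At t = 0 the second derivative is D²u(ξ,ξ) + Du(A²(y - x₀)) with ξ = ξ₀ + A(y - x₀). It depends
continuously on (t, y), so uniform continuity on a compact set makes the convergence uniform in y.
This uniformity locates the maximum in the perturbation argument. -/
lemma motion_second_difference {u : E n → ℝ} {U : Set (E n)} (hU : IsOpen U)
    (hu : ContDiffOn ℝ 2 u U) (A : E n →L[ℝ] E n) (x₀ ξ₀ : E n) {r t₁ : ℝ} (ht₁ : 0 < t₁)
    (hmem : ∀ t, |t| ≤ t₁ → ∀ y ∈ Metric.closedBall x₀ r, motion A x₀ ξ₀ t y ∈ U)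
    {ε : ℝ} (hε : 0 < ε) :
    ∃ t₂ > 0, t₂ ≤ t₁ ∧ ∀ t, 0 < t → t ≤ t₂ → ∀ y ∈ Metric.closedBall x₀ r,
      |(u (motion A x₀ ξ₀ t y) + u (motion A x₀ ξ₀ (-t) y) - 2 * u y) / t ^ 2 -
        motionSecond u A x₀ ξ₀ 0 y| ≤ ε := by
  have hcd : ∀ x ∈ U, ContDiffAt ℝ 2 u x := fun x hx => hu.contDiffAt (hU.mem_nhds hx)
  set K : Set (ℝ × E n) := Icc (-t₁) t₁ ×ˢ Metric.closedBall x₀ r with hK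
  have hKc : IsCompact K := isCompact_Icc.prod (isCompact_closedBall _ _)
  have hmaps : MapsTo (fun p : ℝ × E n => motion A x₀ ξ₀ p.1 p.2) K U := fun p hp =>
    hmem p.1 (abs_le.2 hp.1) p.2 hp.2
  have hm := (continuous_motion A x₀ ξ₀).continuousOn (s := K)
  have hf1 : ContinuousOn (fderiv ℝ u) U := hu.continuousOn_fderiv_of_isOpen hU (by norm_num)
  have hf2 : ContinuousOn (D2 u) U :=
    (hu.fderiv_of_isOpen hU (m := 1) (by norm_num)).continuousOn_fderiv_of_isOpen hU (by norm_num)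
  have hfl : ∀ B : E n →L[ℝ] E n,
      ContinuousOn (fun p : ℝ × E n => flow A p.1 (B (p.2 - x₀))) K := fun B =>
    (((continuous_flow A).comp continuous_fst).clm_apply
      (B.continuous.comp (continuous_snd.sub continuous_const))).continuousOn
  have hcont : ContinuousOn (fun p : ℝ × E n => motionSecond u A x₀ ξ₀ p.1 p.2) K := by
    have a1 := (continuousOn_const (c := ξ₀)).add (hfl A)
    exact (((hf2.comp hm hmaps).clm_apply a1).clm_apply a1).add
      ((hf1.comp hm hmaps).clm_apply (hfl (A * A)))
  have huc := hKc.uniformContinuousOn_of_continuous hcont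
  rw [Metric.uniformContinuousOn_iff] at huc
  obtain ⟨δ, hδ, hδ'⟩ := huc ε hε
  refine ⟨min t₁ (δ / 2), by positivity, min_le_left _ _, fun t ht htle y hy => ?_⟩
  have hts : ∀ s, |s| ≤ t → |s| ≤ t₁ := fun s hs => hs.trans (htle.trans (min_le_left _ _))
  have := abs_second_difference_sub_le (g := fun s => u (motion A x₀ ξ₀ s y))
    (g' := fun s => fderiv ℝ u (motion A x₀ ξ₀ s y) (ξ₀ + flow A s (A (y - x₀))))
    (g'' := fun s => motionSecond u A x₀ ξ₀ s y) (m := motionSecond u A x₀ ξ₀ 0 y) (ε := ε) ht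
    (fun s hs => (hcd _ (hmem s (hts s hs) y hy)).differentiableAt (by norm_num)
      |>.hasFDerivAt.comp_hasDerivAt s (hasDerivAt_motion A x₀ ξ₀ y s))
    (fun s hs => by
      have h1 := (differentiableAt_fderiv (hcd _ (hmem s (hts s hs) y hy))).hasFDerivAt.comp_hasDerivAt
        s (hasDerivAt_motion A x₀ ξ₀ y s)
      exact h1.clm_apply ((hasDerivAt_flow_apply A (A (y - x₀)) s).const_add ξ₀))
    (fun s hs => by
      have := hδ' (s, y) ⟨abs_le.1 (hts s hs), hy⟩ (0, y) ⟨by simp [ht₁.le], hy⟩ (by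
        have h1 : |s| ≤ δ / 2 := hs.trans (htle.trans (min_le_right _ _))
        rw [Prod.dist_eq]
        simp only [dist_self, Real.dist_eq, sub_zero]
        rw [max_lt_iff]; exact ⟨by linarith, hδ⟩)
      exact this.le)
  simpa using this

/-- Adding the quartic makes a touching point strict without changing the second order data at x₀.
-/
lemma D2_norm_pow_four (x₀ v : E n) : D2 (fun y => ‖y - x₀‖ ^ 4) x₀ v v = 0 := by
  have hc : ContDiffAt ℝ 2 (fun y : E n => ‖y - x₀‖ ^ 4) x₀ := by
    have : (fun y : E n => ‖y - x₀‖ ^ 4) = fun y => (‖y - x₀‖ ^ 2) ^ 2 := by ext; ring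
    rw [this]
    exact (((contDiff_id.sub contDiff_const).norm_sq ℝ).pow 2).contDiffAt
  rw [← deriv_deriv_line hc]
  have e : (fun s : ℝ => ‖x₀ + s • v - x₀‖ ^ 4) = fun s => ‖v‖ ^ 4 * s ^ 4 := by
    ext s
    rw [add_sub_cancel_left, norm_smul, mul_pow, Real.norm_eq_abs]
    have : |s| ^ 4 = s ^ 4 := by
      rw [show (4:ℕ) = 2 * 2 by norm_num, pow_mul, pow_mul, sq_abs]
    rw [this]; ring
  rw [e]
  have e1 : deriv (fun s : ℝ => ‖v‖ ^ 4 * s ^ 4) = fun s => ‖v‖ ^ 4 * (4 * s ^ 3) := by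
    ext s
    exact (((hasDerivAt_pow 4 s).const_mul (‖v‖ ^ 4)).congr_deriv (by norm_num)).deriv
  rw [e1]
  have := (((hasDerivAt_pow 3 (0:ℝ)).const_mul 4).const_mul (‖v‖ ^ 4)).deriv
  rw [this]; simp

lemma contDiffAt_norm_pow_four (x₀ y : E n) : ContDiffAt ℝ 2 (fun y : E n => ‖y - x₀‖ ^ 4) y := by
  have : (fun y : E n => ‖y - x₀‖ ^ 4) = fun y => (‖y - x₀‖ ^ 2) ^ 2 := by ext; ring
  rw [this]
  exact (((contDiff_id.sub contDiff_const).norm_sq ℝ).pow 2).contDiffAt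

lemma contDiffAt_fderiv_apply {u : E n → ℝ} {x₀ y : E n} (hu : ContDiffAt ℝ 3 u y)
    (B : E n →L[ℝ] E n) : ContDiffAt ℝ 2 (fun y => fderiv ℝ u y (B (y - x₀))) y :=
  (hu.fderiv_right (m := 2) (by norm_num)).clm_apply
    (B.contDiff.comp (contDiff_id.sub contDiff_const)).contDiffAt

/-- On the line x₀ + sv the function is s · Du(x₀ + sv)(Bv). The prefactor s vanishes at 0, so only
a second derivative of u survives, although Du is differentiated twice. -/
lemma D2_fderiv_apply {u : E n → ℝ} {x₀ : E n} (hu : ContDiffAt ℝ 3 u x₀) (B : E n →L[ℝ] E n)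
    (v : E n) : D2 (fun y => fderiv ℝ u y (B (y - x₀))) x₀ v v = 2 * D2 u x₀ v (B v) := by
  have h2 : ContDiffAt ℝ 2 u x₀ := hu.of_le (by norm_num)
  rw [← deriv_deriv_line (contDiffAt_fderiv_apply hu B)]
  have e : (fun s : ℝ => fderiv ℝ u (x₀ + s • v) (B (x₀ + s • v - x₀)))
      = fun s => s * fderiv ℝ u (x₀ + s • v) (B v) := by
    ext s; simp
  rw [e]
  set g : E n → ℝ := fun y => fderiv ℝ u y (B v) with hg
  have hg2 : ContDiffAt ℝ 2 g x₀ :=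
    (hu.fderiv_right (m := 2) (by norm_num)).clm_apply contDiffAt_const
  have hgv : fderiv ℝ g x₀ v = D2 u x₀ v (B v) := by
    have := hasDerivAt_fderiv_line (v := v) (z := B v) (s := 0) (w := u) (x := x₀)
      (by simpa using differentiableAt_fderiv h2)
    have h' := hasDerivAt_line (v := v) (s := 0) (w := g) (x := x₀)
      (by simpa using hg2.differentiableAt (by norm_num))
    simpa using h'.unique this
  have hev : ∀ᶠ s in 𝓝 (0:ℝ), ContDiffAt ℝ 2 g (x₀ + s • v) :=
    (tendsto_line x₀ v).eventually (hg2.eventually (by simp))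
  have e1 : deriv (fun s : ℝ => s * g (x₀ + s • v)) =ᶠ[𝓝 0]
      fun s => g (x₀ + s • v) + s * fderiv ℝ g (x₀ + s • v) v := by
    filter_upwards [hev] with s hs
    have := (hasDerivAt_id s).mul (hasDerivAt_line (v := v) (hs.differentiableAt (by norm_num)))
    have := this.deriv
    simp only [id, one_mul] at this
    exact this
  rw [e1.deriv_eq]
  have h0 : DifferentiableAt ℝ g (x₀ + (0:ℝ) • v) := by
    simpa using hg2.differentiableAt (by norm_num)
  have hd2 := hasDerivAt_fderiv_line (w := g) (x := x₀) (v := v) (z := v) (s := 0)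
    (by simpa using differentiableAt_fderiv hg2)
  have := (hasDerivAt_line h0).add ((hasDerivAt_id (0:ℝ)).mul hd2)
  have := this.deriv
  simp only [id, one_mul, zero_mul, add_zero, zero_smul] at this
  exact this.trans (by rw [hgv]; ring)

lemma gw_tendsto {k : ℕ} {l : ℕ → Fin n → ℝ} {m : Fin n → ℝ} (hl : Tendsto l atTop (𝓝 m))
    (hm : 0 < es Finset.univ m k) (i : Fin n) :
    Tendsto (fun j => gw k (l j) i) atTop (𝓝 (gw k m i)) := by
  have hes : ∀ (s : Finset (Fin n)) (j : ℕ), Continuous fun f : Fin n → ℝ => es s f j := by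
    intro s j; unfold es; fun_prop
  have h1 := (((hes Finset.univ k).tendsto m).comp hl).rpow_const (p := 1 / (k:ℝ) - 1)
    (Or.inl hm.ne')
  have h2 := ((hes (Finset.univ.erase i) (k - 1)).tendsto m).comp hl
  exact (h1.const_mul _).mul h2

/-- A sequence of eigenframes along `y j → x₀` has a subsequence converging to an eigenframe. -/
lemma exists_eigenframe_subseq {k : ℕ} {F : E n → Form n} {x₀ : E n} (hF : ContinuousAt F x₀)
    (hcone : IsConeForm k (F x₀)) {y : ℕ → E n} (hy : Tendsto y atTop (𝓝 x₀))
    {v : ℕ → Fin n → E n} {l : ℕ → Fin n → ℝ} (hf : ∀ j, IsEigenframe (F (y j)) (v j) (l j)) :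
    ∃ (v₀ : Fin n → E n) (l₀ : Fin n → ℝ) (s : ℕ → ℕ), StrictMono s ∧
      IsEigenframe (F x₀) v₀ l₀ ∧ Tendsto (fun j => v (s j)) atTop (𝓝 v₀) ∧
      Tendsto (fun j => l (s j)) atTop (𝓝 l₀) ∧
      ∀ i, Tendsto (fun j => gw k (l (s j)) i) atTop (𝓝 (gw k l₀ i)) := by
  have hFy : Tendsto (fun j => F (y j)) atTop (𝓝 (F x₀)) := hF.tendsto.comp hy
  obtain ⟨C, hC⟩ := (Metric.isBounded_range_of_tendsto (α := Form n) (fun j => F (y j)) (x := F x₀) hFy).exists_norm_le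
  have hC' : ∀ j, ‖F (y j)‖ ≤ C := fun j => hC _ (mem_range_self j)
  have hC0 : 0 ≤ C := (norm_nonneg (F (y 0))).trans (hC' 0)
  have hvb : ∀ j, (v j, l j) ∈ Metric.closedBall (0 : (Fin n → E n) × (Fin n → ℝ)) (max 1 C) := by
    intro j
    rw [mem_closedBall_zero_iff, Prod.norm_def]
    refine max_le_max ?_ ?_
    · rw [pi_norm_le_iff_of_nonneg zero_le_one]
      exact fun i => ((hf j).orthonormal.1 i).le
    · rw [pi_norm_le_iff_of_nonneg hC0]
      intro i
      have h1 := (hf j).apply_eq i (v j i)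
      rw [real_inner_self_eq_norm_sq, (hf j).orthonormal.1 i] at h1
      have h2 := (F (y j)).le_opNorm₂ (v j i) (v j i)
      rw [h1, (hf j).orthonormal.1 i] at h2
      simp only [one_pow, mul_one] at h2
      exact h2.trans (hC' j)
  obtain ⟨⟨v₀, l₀⟩, -, s, hs, hlim⟩ := (isCompact_closedBall _ _).tendsto_subseq hvb
  have hv : Tendsto (fun j => v (s j)) atTop (𝓝 v₀) := (continuous_fst.tendsto _).comp hlim
  have hl : Tendsto (fun j => l (s j)) atTop (𝓝 l₀) := (continuous_snd.tendsto _).comp hlim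
  have hvi : ∀ i, Tendsto (fun j => v (s j) i) atTop (𝓝 (v₀ i)) := fun i =>
    (continuous_apply i).continuousAt.tendsto.comp hv
  have hli : ∀ i, Tendsto (fun j => l (s j) i) atTop (𝓝 (l₀ i)) := fun i =>
    (continuous_apply i).continuousAt.tendsto.comp hl
  have hframe : IsEigenframe (F x₀) v₀ l₀ := by
    constructor
    · rw [orthonormal_iff_ite]
      intro i j
      refine tendsto_nhds_unique ((hvi i).inner (hvi j)) ?_
      refine tendsto_const_nhds.congr fun m => ?_
      exact ((orthonormal_iff_ite.1 (hf (s m)).orthonormal) i j).symm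
    · intro i w
      have hc3 : Continuous fun p : Form n × E n × E n => p.1 p.2.1 p.2.2 :=
        (continuous_fst.clm_apply (continuous_fst.comp continuous_snd)).clm_apply
          (continuous_snd.comp continuous_snd)
      have h1 : Tendsto (fun j => F (y (s j)) (v (s j) i) w) atTop (𝓝 (F x₀ (v₀ i) w)) :=
        (((hc3.tendsto (F x₀, v₀ i, w)).comp ((hFy.comp hs.tendsto_atTop).prodMk_nhds
          ((hvi i).prodMk_nhds tendsto_const_nhds))))
      have h2 : Tendsto (fun j => l (s j) i * inner ℝ (v (s j) i) w) atTop
          (𝓝 (l₀ i * inner ℝ (v₀ i) w)) := (hli i).mul ((hvi i).inner tendsto_const_nhds)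
      exact tendsto_nhds_unique h1 (h2.congr fun j => ((hf (s j)).apply_eq i w).symm)
  exact ⟨v₀, l₀, s, hs, hframe, hv, hl, fun i =>
    gw_tendsto hl (hframe.inCone hcone k le_rfl) i⟩

end Viscosity
end KHessian

namespace KHessian

section Viscosity

variable {n : ℕ}

/-- The perturbed test function. -/
noncomputable def testFunction (u ψ : E n → ℝ) (A : E n →L[ℝ] E n) (x₀ y : E n) : ℝ :=
  ψ y + (fderiv ℝ u y ((A * A) (y - x₀)) + ‖y - x₀‖ ^ 4)

lemma contDiffAt_testFunction {u ψ : E n → ℝ} (A : E n →L[ℝ] E n) {x₀ y : E n}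
    (hu : ContDiffAt ℝ 3 u y) (hψ : ContDiffAt ℝ 2 ψ y) :
    ContDiffAt ℝ 2 (testFunction u ψ A x₀) y :=
  hψ.add ((contDiffAt_fderiv_apply hu (A * A)).add (contDiffAt_norm_pow_four x₀ y))

lemma D2_testFunction {u ψ : E n → ℝ} (A : E n →L[ℝ] E n) {x₀ : E n}
    (hu : ContDiffAt ℝ 3 u x₀) (hψ : ContDiffAt ℝ 2 ψ x₀) (v : E n) :
    D2 (testFunction u ψ A x₀) x₀ v v = D2 ψ x₀ v v + 2 * D2 u x₀ v (A (A v)) := by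
  have h1 := contDiffAt_fderiv_apply (x₀ := x₀) hu (A * A)
  have h2 := contDiffAt_norm_pow_four x₀ x₀
  unfold testFunction
  rw [D2_add hψ (h1.add h2), D2_add h1 h2]
  have e1 := D2_fderiv_apply hu (A * A) v
  have e2 := D2_norm_pow_four x₀ v
  change D2 ψ x₀ v v + (D2 (fun y => fderiv ℝ u y ((A * A) (y - x₀))) x₀ v v +
    D2 (fun y => ‖y - x₀‖ ^ 4) x₀ v v) = _
  rw [e1, e2]; simp

lemma motion_eq_affine (A : E n →L[ℝ] E n) (x₀ ξ₀ : E n) (t : ℝ) (y : E n) :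
    motion A x₀ ξ₀ t y = (x₀ + t • ξ₀ - flow A t x₀) + flow A t y := by
  unfold motion; rw [map_sub]; abel

lemma contDiffAt_comp_motion {u : E n → ℝ} (A : E n →L[ℝ] E n) (x₀ ξ₀ : E n) {t : ℝ} {y : E n}
    (hu : ContDiffAt ℝ 2 u (motion A x₀ ξ₀ t y)) :
    ContDiffAt ℝ 2 (fun y => u (motion A x₀ ξ₀ t y)) y := by
  have h : ContDiffAt ℝ 2 (fun y => motion A x₀ ξ₀ t y) y := by
    unfold motion
    exact (contDiff_const.add
      ((flow A t).contDiff.comp (contDiff_id.sub contDiff_const))).contDiffAt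
  exact ContDiffAt.comp y hu h

lemma D2_comp_motion {u : E n → ℝ} (A : E n →L[ℝ] E n) (x₀ ξ₀ : E n) {t : ℝ} {y : E n}
    (hu : ContDiffAt ℝ 2 u (motion A x₀ ξ₀ t y)) (v : E n) :
    D2 (fun y => u (motion A x₀ ξ₀ t y)) y v v =
      D2 u (motion A x₀ ξ₀ t y) (flow A t v) (flow A t v) := by
  simp only [motion_eq_affine] at hu ⊢
  exact D2_comp_affine _ _ hu v v

/-- The image of the eigenframe under the flow is orthonormal up to the factor e^{ct}, so Gårding's
inequality in a rotated frame applies to the moved Hessian. The square of that factor appears on the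
left. -/
lemma exp_mul_le_sum_gw {k : ℕ} (hk : 0 < k) {B D : Form n} (hB : IsConeForm k B)
    (hD : IsConeForm k D) {v : Fin n → E n} {l : Fin n → ℝ} (h : IsEigenframe B v l)
    {A : E n →L[ℝ] E n} {c : ℝ}
    (hA : ∀ v w, inner ℝ (A v) w + inner ℝ v (A w) = 2 * c * inner ℝ v w) (t : ℝ) :
    Real.exp (2 * c * t) * sigma k (formMatrix D) ^ (1 / (k : ℝ)) ≤
      ∑ i, gw k l i * D (flow A t (v i)) (flow A t (v i)) := by
  have := garding_form hk hB hD h (orthonormal_flow hA t h.orthonormal)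
  calc _ ≤ Real.exp (2 * c * t) * _ := mul_le_mul_of_nonneg_left this (Real.exp_pos _).le
    _ = _ := by
      rw [Finset.mul_sum]
      refine Finset.sum_congr rfl fun i _ => ?_
      simp only [map_smul, FunLike.coe_smul, Pi.smul_apply, smul_eq_mul]
      have : Real.exp (2 * c * t) * (Real.exp (-(c * t)) * Real.exp (-(c * t))) = 1 := by
        rw [← Real.exp_add, ← Real.exp_add]; simp; ring
      linear_combination gw k l i * D (flow A t (v i)) (flow A t (v i)) * this

/-- D²u(ξ,ξ) itself need not be twice differentiable, so it is replaced by the second difference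
quotient of u along the motion. The quotient minus the test function has an interior maximum near
x₀. Its Hessian is nonpositive there, and weighting it with the linearised coefficients at that
point turns each moved copy of u into a value of h by Gårding's inequality. -/
lemma exists_approximate_test {k : ℕ} (hk : 0 < k) {U : Set (E n)} (hU : IsOpen U)
    {u h : E n → ℝ} (hu : ContDiffOn ℝ 3 u U) (hcone : ∀ x ∈ U, IsConeForm k (D2 u x))
    (heq : ∀ x ∈ U, sigma k (formMatrix (D2 u x)) ^ (1 / (k : ℝ)) = h x)
    {x₀ : E n} (hx₀ : x₀ ∈ U) {ξ₀ : E n} {A : E n →L[ℝ] E n} {c : ℝ}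
    (hA : ∀ v w, inner ℝ (A v) w + inner ℝ v (A w) = 2 * c * inner ℝ v w)
    {ψ : E n → ℝ} (hψ : ContDiffAt ℝ 2 ψ x₀)
    (hle : ∀ᶠ y in 𝓝 x₀, D2 u y (ξ₀ + A (y - x₀)) (ξ₀ + A (y - x₀)) ≤ ψ y)
    (heq0 : D2 u x₀ ξ₀ ξ₀ = ψ x₀) {δ : ℝ} (hδ : 0 < δ) :
    ∃ (t : ℝ) (y : E n) (v : Fin n → E n) (l : Fin n → ℝ), 0 < t ∧ t < δ ∧ dist y x₀ < δ ∧
      y ∈ U ∧ IsEigenframe (D2 u y) v l ∧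
      (Real.exp (2 * c * t) * h (motion A x₀ ξ₀ t y) +
        Real.exp (2 * c * (-t)) * h (motion A x₀ ξ₀ (-t) y) - 2 * h y) / t ^ 2 ≤
      ∑ i, gw k l i * D2 (testFunction u ψ A x₀) y (v i) (v i) := by
  have hcd : ∀ x ∈ U, ContDiffAt ℝ 3 u x := fun x hx => hu.contDiffAt (hU.mem_nhds hx)
  have hcd2 : ∀ x ∈ U, ContDiffAt ℝ 2 u x := fun x hx => (hcd x hx).of_le (by norm_num)
  obtain ⟨r₀, hr₀, hball⟩ := Metric.eventually_nhds_iff_ball.1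
    ((hU.eventually_mem hx₀).and (hle.and (hψ.eventually (by simp))))
  obtain ⟨C, hC0, hC⟩ := exists_norm_flow_bounds A
  set r : ℝ := min (r₀ / 3) (δ / 2) with hr
  have hrpos : 0 < r := by positivity
  have hrr : r ≤ r₀ / 3 := min_le_left _ _
  -- A point of the closed r-ball is displaced by at most |t|(‖ξ₀‖ + Cr) < r, so it stays within 2r
  -- < r₀ of x₀.
  set t₁ : ℝ := min (min 1 (δ / 2)) (r / (‖ξ₀‖ + C * r + 1)) with ht₁
  have hden : 0 < ‖ξ₀‖ + C * r + 1 := by positivity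
  have ht₁pos : 0 < t₁ := by positivity
  have hmem : ∀ t, |t| ≤ t₁ → ∀ y ∈ Metric.closedBall x₀ r, motion A x₀ ξ₀ t y ∈ U := by
    intro t ht y hy
    refine (hball _ ?_).1
    have ht1 : |t| ≤ 1 := ht.trans ((min_le_left _ _).trans (min_le_left _ _))
    have ht2 : |t| * (‖ξ₀‖ + C * r + 1) ≤ r := by
      rw [← le_div_iff₀ hden]; exact ht.trans (min_le_right _ _)
    have hy' : ‖y - x₀‖ ≤ r := by simpa [dist_eq_norm] using hy
    have e : motion A x₀ ξ₀ t y - x₀ = t • ξ₀ + ((flow A t - 1) (y - x₀) + (y - x₀)) := by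
      unfold motion; simp; abel
    rw [Metric.mem_ball, dist_eq_norm, e]
    have h1 : ‖(flow A t - 1) (y - x₀)‖ ≤ C * |t| * r :=
      ((flow A t - 1).le_opNorm _).trans
        (mul_le_mul (hC t ht1).1 hy' (norm_nonneg _) (by positivity))
    have h2 : ‖t • ξ₀‖ = |t| * ‖ξ₀‖ := by rw [norm_smul, Real.norm_eq_abs]
    have h3 := norm_add_le (t • ξ₀) ((flow A t - 1) (y - x₀) + (y - x₀))
    have h4 := norm_add_le ((flow A t - 1) (y - x₀)) (y - x₀)
    have h5 := abs_nonneg t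
    nlinarith
  -- An error of r⁴/4 at each of the two points compared is less than the drop r⁴ that the quartic
  -- causes on the sphere, so the maximum lies inside the ball.
  obtain ⟨t, ht, htle, hest⟩ := motion_second_difference hU (hu.of_le (by norm_num)) A x₀ ξ₀ ht₁pos
    hmem (ε := r ^ 4 / 4) (by positivity)
  specialize hest t ht le_rfl
  have htt : |t| ≤ t₁ := by rwa [abs_of_pos ht]
  have htt' : |-t| ≤ t₁ := by rwa [abs_neg]
  set Q := testFunction u ψ A x₀ with hQ
  have hinU : ∀ y ∈ Metric.closedBall x₀ r, y ∈ U := fun y hy => by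
    have := hmem 0 (by simpa using ht₁pos.le) y hy
    simpa using this
  have hinball : ∀ y ∈ Metric.closedBall x₀ r, y ∈ Metric.ball x₀ r₀ := fun y hy => by
    rw [Metric.mem_closedBall] at hy; rw [Metric.mem_ball]; linarith
  have hQc : ∀ y ∈ Metric.closedBall x₀ r, ContDiffAt ℝ 2 Q y := fun y hy =>
    contDiffAt_testFunction A (hcd y (hinU y hy)) (hball y (hinball y hy)).2.2
  set w : E n → ℝ := fun y => (1 / t ^ 2) * (u (motion A x₀ ξ₀ t y) +
    (u (motion A x₀ ξ₀ (-t) y) + (-2) * u y)) - Q y with hw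
  have c1 : ∀ y ∈ Metric.closedBall x₀ r, ContDiffAt ℝ 2 (fun y => u (motion A x₀ ξ₀ t y)) y :=
    fun y hy => contDiffAt_comp_motion A x₀ ξ₀ (hcd2 _ (hmem t htt y hy))
  have c2 : ∀ y ∈ Metric.closedBall x₀ r, ContDiffAt ℝ 2 (fun y => u (motion A x₀ ξ₀ (-t) y)) y :=
    fun y hy => contDiffAt_comp_motion A x₀ ξ₀ (hcd2 _ (hmem (-t) htt' y hy))
  have c3 : ∀ y ∈ Metric.closedBall x₀ r, ContDiffAt ℝ 2 (fun y => (-2) * u y) y :=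
    fun y hy => contDiffAt_const.mul (hcd2 y (hinU y hy))
  have hwc : ∀ y ∈ Metric.closedBall x₀ r, ContDiffAt ℝ 2 w y := fun y hy =>
    (contDiffAt_const.mul ((c1 y hy).add ((c2 y hy).add (c3 y hy)))).sub (hQc y hy)
  obtain ⟨y, hyb, hymax⟩ := (isCompact_closedBall x₀ r).exists_isMaxOn
    ⟨x₀, Metric.mem_closedBall_self hrpos.le⟩
    (fun y hy => (hwc y hy).continuousAt.continuousWithinAt)
  have hwval : ∀ y ∈ Metric.closedBall x₀ r,
      |w y + ‖y - x₀‖ ^ 4 + ψ y - D2 u y (ξ₀ + A (y - x₀)) (ξ₀ + A (y - x₀))| ≤ r ^ 4 / 4 := by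
    intro y hy
    convert hest y hy using 2
    simp only [hw, hQ, testFunction, motionSecond, motion_zero, flow_zero,
      one_apply_eq_self, mul_apply_eq_comp]
    ring
  have hx₀w := abs_le.1 (hwval x₀ (Metric.mem_closedBall_self hrpos.le))
  simp only [sub_self, map_zero, add_zero, heq0, norm_zero] at hx₀w
  have hyw := abs_le.1 (hwval y hyb)
  have hyle := (hball y (hinball y hyb)).2.1
  have hmx : w x₀ ≤ w y := hymax (Metric.mem_closedBall_self hrpos.le)
  have hylt : ‖y - x₀‖ < r := by
    by_contra! hc
    have : r ^ 4 ≤ ‖y - x₀‖ ^ 4 := pow_le_pow_left₀ hrpos.le hc 4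
    have : 0 < r ^ 4 := by positivity
    norm_num at hx₀w
    linarith [hx₀w.1, hyw.2]
  have hloc : IsLocalMax w y := hymax.isLocalMax
    (Filter.mem_of_superset (Metric.isOpen_ball.mem_nhds
      (by rwa [Metric.mem_ball, dist_eq_norm])) Metric.ball_subset_closedBall)
  obtain ⟨v, l, hvl⟩ := (hcone y (hinU y hyb)).symm.exists_eigenframe
  have hgp := fun i => hvl.gw_pos hk (hcone y (hinU y hyb)) i
  refine ⟨t, y, v, l, ht, ?_, ?_, hinU y hyb, hvl, ?_⟩
  · have : t₁ ≤ δ / 2 := (min_le_left _ _).trans (min_le_right _ _)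
    linarith
  · rw [dist_eq_norm]
    have : r ≤ δ / 2 := min_le_right _ _
    linarith
  · have hD : ∀ i, D2 w y (v i) (v i) = (1 / t ^ 2) *
        (D2 u (motion A x₀ ξ₀ t y) (flow A t (v i)) (flow A t (v i)) +
        (D2 u (motion A x₀ ξ₀ (-t) y) (flow A (-t) (v i)) (flow A (-t) (v i)) +
          (-2) * D2 u y (v i) (v i))) - D2 Q y (v i) (v i) := by
      intro i
      rw [← D2_comp_motion A x₀ ξ₀ (hcd2 _ (hmem t htt y hyb)),
        ← D2_comp_motion A x₀ ξ₀ (hcd2 _ (hmem (-t) htt' y hyb))]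
      rw [hw, D2_sub (contDiffAt_const.mul ((c1 y hyb).add ((c2 y hyb).add (c3 y hyb))))
        (hQc y hyb), D2_const_mul ((c1 y hyb).add ((c2 y hyb).add (c3 y hyb))),
        D2_add (c1 y hyb) ((c2 y hyb).add (c3 y hyb)), D2_add (c2 y hyb) (c3 y hyb),
        D2_const_mul (hcd2 y (hinU y hyb))]
      rfl
    have hmax := fun i => D2_nonpos_of_isLocalMax (hwc y hyb) hloc (v i)
    have g1 := exp_mul_le_sum_gw hk (hcone y (hinU y hyb)) (hcone _ (hmem t htt y hyb)) hvl hA t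
    have g2 := exp_mul_le_sum_gw hk (hcone y (hinU y hyb)) (hcone _ (hmem (-t) htt' y hyb)) hvl hA
      (-t)
    have g3 := hvl.sum_gw_mul hk (hcone y (hinU y hyb))
    rw [heq _ (hmem t htt y hyb)] at g1
    rw [heq _ (hmem (-t) htt' y hyb)] at g2
    rw [heq _ (hinU y hyb)] at g3
    have g4 : ∑ i, gw k l i * D2 u y (v i) (v i) = h y := by
      rw [← g3]
      refine Finset.sum_congr rfl fun i _ => ?_
      rw [hvl.apply_eq, real_inner_self_eq_norm_sq, hvl.orthonormal.1 i]; ring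
    have hsum : ∑ i, gw k l i * D2 w y (v i) (v i) ≤ 0 :=
      Finset.sum_nonpos fun i _ => mul_nonpos_of_nonneg_of_nonpos (hgp i).le (hmax i)
    have hsplit : ∑ i, gw k l i * D2 w y (v i) (v i) = (1 / t ^ 2) *
        (∑ i, gw k l i * D2 u (motion A x₀ ξ₀ t y) (flow A t (v i)) (flow A t (v i)) +
         ∑ i, gw k l i * D2 u (motion A x₀ ξ₀ (-t) y) (flow A (-t) (v i)) (flow A (-t) (v i))
          - 2 * ∑ i, gw k l i * D2 u y (v i) (v i)) - ∑ i, gw k l i * D2 Q y (v i) (v i) := by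
      simp only [hD, Finset.mul_sum, ← Finset.sum_add_distrib, ← Finset.sum_sub_distrib]
      exact Finset.sum_congr rfl fun i _ => by ring
    rw [hsplit, g4] at hsum
    have ht2 : 0 ≤ 1 / t ^ 2 := by positivity
    have := mul_le_mul_of_nonneg_left (add_le_add g1 g2) ht2
    rw [div_eq_mul_one_div]
    nlinarith

lemma tendsto_exp_sub_one_div (a : ℝ) :
    Tendsto (fun t : ℝ => (Real.exp (a * t) - 1) / t) (𝓝[>] 0) (𝓝 a) := by
  have h : HasDerivAt (fun t : ℝ => Real.exp (a * t)) a 0 := by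
    simpa using ((hasDerivAt_id (0:ℝ)).const_mul a).exp
  have := h.tendsto_slope_zero_right
  refine this.congr fun t => ?_
  simp; field_simp

end Viscosity
end KHessian

namespace KHessian

section Viscosity

variable {n : ℕ}

lemma motion_sub (A : E n →L[ℝ] E n) (x₀ ξ₀ : E n) (t : ℝ) (y : E n) :
    motion A x₀ ξ₀ t y - y = t • ξ₀ + (flow A t - 1) (y - x₀) := by
  unfold motion; simp; abel

/-- The operator quotients stay bounded, and they are applied to y_j - x₀, which tends to 0. -/
lemma tendsto_flow_sub_one_div (A : E n →L[ℝ] E n) {x₀ : E n} {t : ℕ → ℝ} {y : ℕ → E n}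
    (ht : Tendsto t atTop (𝓝 0)) (hy : Tendsto y atTop (𝓝 x₀)) :
    Tendsto (fun j => (t j)⁻¹ • (flow A (t j) - 1) (y j - x₀)) atTop (𝓝 0) ∧
    Tendsto (fun j => (t j ^ 2)⁻¹ • (flow A (t j) + flow A (-t j) - 2) (y j - x₀)) atTop (𝓝 0) := by
  obtain ⟨C, hC0, hC⟩ := exists_norm_flow_bounds A
  have h1 : ∀ᶠ j in atTop, |t j| ≤ 1 := by
    have := ht.abs
    rw [abs_zero] at this
    exact (this.eventually_lt_const one_pos).mono fun _ h => h.le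
  have h2 : Tendsto (fun j => C * ‖y j - x₀‖) atTop (𝓝 0) := by
    have := (hy.sub_const x₀).norm.const_mul C
    simpa using this
  constructor
  · refine squeeze_zero_norm' ?_ h2
    filter_upwards [h1] with j hj
    rcases eq_or_ne (t j) 0 with h0 | h0
    · simp [h0]; positivity
    rw [norm_smul, norm_inv, Real.norm_eq_abs]
    have hp : 0 < |t j| := abs_pos.2 h0
    rw [inv_mul_le_iff₀ hp]
    refine ((flow A (t j) - 1).le_opNorm _).trans ?_
    have := mul_le_mul_of_nonneg_right (hC _ hj).1 (norm_nonneg (y j - x₀))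
    linarith
  · refine squeeze_zero_norm' ?_ h2
    filter_upwards [h1] with j hj
    rcases eq_or_ne (t j) 0 with h0 | h0
    · simp [h0]; positivity
    have hp : 0 < t j ^ 2 := by positivity
    rw [norm_smul, norm_inv, Real.norm_eq_abs, abs_of_pos hp]
    rw [inv_mul_le_iff₀ hp]
    refine ((flow A (t j) + flow A (-t j) - 2).le_opNorm _).trans ?_
    have := mul_le_mul_of_nonneg_right (hC _ hj).2 (norm_nonneg (y j - x₀))
    linarith

set_option maxHeartbeats 1000000 in
/-- Maximum principle for the second derivative of `u` along an infinitesimal conformal motion. -/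
theorem viscosity_test {k : ℕ} (hk : 0 < k) {U : Set (E n)} (hU : IsOpen U)
    {u h : E n → ℝ} (hu : ContDiffOn ℝ 3 u U) (hcone : ∀ x ∈ U, IsConeForm k (D2 u x))
    (heq : ∀ x ∈ U, sigma k (formMatrix (D2 u x)) ^ (1 / (k : ℝ)) = h x)
    {x₀ : E n} (hx₀ : x₀ ∈ U) {ξ₀ : E n} {A : E n →L[ℝ] E n} {c : ℝ}
    (hA : ∀ v w, inner ℝ (A v) w + inner ℝ v (A w) = 2 * c * inner ℝ v w)
    {ψ : E n → ℝ} (hψ : ContDiffAt ℝ 2 ψ x₀)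
    (hle : ∀ᶠ y in 𝓝 x₀, D2 u y (ξ₀ + A (y - x₀)) (ξ₀ + A (y - x₀)) ≤ ψ y)
    (heq0 : D2 u x₀ ξ₀ ξ₀ = ψ x₀) {p' : E n → E n →L[ℝ] ℝ} {κ : ℝ} (hp' : ContinuousAt p' x₀)
    (hsemi : ∀ᶠ p in 𝓝 (x₀, x₀), h p.1 + p' p.1 (p.2 - p.1) - κ / 2 * ‖p.2 - p.1‖ ^ 2 ≤ h p.2) :
    ∃ v l, IsEigenframe (D2 u x₀) v l ∧
      -κ * ‖ξ₀‖ ^ 2 + 4 * c * p' x₀ ξ₀ ≤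
        ∑ i, gw k l i * (D2 ψ x₀ (v i) (v i) + 2 * l i * inner ℝ (v i) (A (A (v i)))) := by
  have hu3 : ContDiffAt ℝ 3 u x₀ := hu.contDiffAt (hU.mem_nhds hx₀)
  have hQ2 : ContDiffAt ℝ 2 (testFunction u ψ A x₀) x₀ := contDiffAt_testFunction A hu3 hψ
  -- The approximate inequality is taken at scales 1/(j+1). Eigenframes along the sequence need not
  -- converge, so a subsequence is extracted below.
  choose t y v l ht htd hyd hyU hvl hineq using fun j : ℕ =>
    exists_approximate_test hk hU hu hcone heq hx₀ hA hψ hle heq0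
      (δ := 1 / ((j : ℝ) + 1)) (by positivity)
  have ht0 : Tendsto t atTop (𝓝 0) :=
    squeeze_zero (fun j => (ht j).le) (fun j => (htd j).le) tendsto_one_div_add_atTop_nhds_zero_nat
  have hy0 : Tendsto y atTop (𝓝 x₀) := by
    rw [tendsto_iff_dist_tendsto_zero]
    exact squeeze_zero (fun j => dist_nonneg) (fun j => (hyd j).le)
      tendsto_one_div_add_atTop_nhds_zero_nat
  have hcD : ∀ {w : E n → ℝ}, ContDiffAt ℝ 2 w x₀ → ContinuousAt (D2 w) x₀ := fun hw =>
    ((hw.fderiv_right (m := 1) (by norm_num)).fderiv_right (m := 0) (by norm_num)).continuousAt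
  obtain ⟨v₀, l₀, s, hs, hvl₀, hv, hl, hg⟩ := exists_eigenframe_subseq
    (hcD (hu3.of_le (by norm_num))) (hcone x₀ hx₀) hy0 hvl
  refine ⟨v₀, l₀, hvl₀, ?_⟩
  have hst := hs.tendsto_atTop
  have hRHS : Tendsto (fun j => ∑ i, gw k (l (s j)) i *
      D2 (testFunction u ψ A x₀) (y (s j)) (v (s j) i) (v (s j) i)) atTop
      (𝓝 (∑ i, gw k l₀ i * D2 (testFunction u ψ A x₀) x₀ (v₀ i) (v₀ i))) := by
    refine tendsto_finsetSum _ fun i _ => (hg i).mul ?_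
    have hc3 : Continuous fun p : Form n × E n => p.1 p.2 p.2 :=
      (continuous_fst.clm_apply continuous_snd).clm_apply continuous_snd
    have hvi : Tendsto (fun j => v (s j) i) atTop (𝓝 (v₀ i)) :=
      (continuous_apply i).continuousAt.tendsto.comp hv
    exact (hc3.tendsto (D2 (testFunction u ψ A x₀) x₀, v₀ i)).comp
      (((hcD hQ2).tendsto.comp (hy0.comp hst)).prodMk_nhds hvi)
  have hRHS' : ∑ i, gw k l₀ i * D2 (testFunction u ψ A x₀) x₀ (v₀ i) (v₀ i) =
      ∑ i, gw k l₀ i * (D2 ψ x₀ (v₀ i) (v₀ i) + 2 * l₀ i * inner ℝ (v₀ i) (A (A (v₀ i)))) := by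
    refine Finset.sum_congr rfl fun i _ => ?_
    rw [D2_testFunction A hu3 hψ, hvl₀.apply_eq]; ring
  rw [← hRHS']
  set P : ℕ → E n := fun j => motion A x₀ ξ₀ (t j) (y j) - y j with hP
  set P' : ℕ → E n := fun j => motion A x₀ ξ₀ (-t j) (y j) - y j with hP'
  have htne : ∀ j, t j ≠ 0 := fun j => (ht j).ne'
  have hp : Tendsto (fun j => (t j)⁻¹ • P j) atTop (𝓝 ξ₀) := by
    have := (tendsto_flow_sub_one_div A ht0 hy0).1.const_add ξ₀
    rw [add_zero] at this
    refine this.congr fun j => ?_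
    rw [hP]; simp only [motion_sub]
    rw [smul_add, smul_smul, inv_mul_cancel₀ (htne j), one_smul]
  have hp2 : Tendsto (fun j => (t j)⁻¹ • P' j) atTop (𝓝 (-ξ₀)) := by
    have := ((tendsto_flow_sub_one_div A (t := fun j => - t j) (by simpa using ht0.neg) hy0).1.const_add
      ξ₀).neg
    rw [add_zero] at this
    refine this.congr fun j => ?_
    rw [hP']; simp only [motion_sub]
    rw [smul_add, smul_smul, inv_neg, neg_smul, mul_neg, inv_mul_cancel₀ (htne j), neg_smul, one_smul,
      neg_add, neg_neg]
  have hss : Tendsto (fun j => (t j ^ 2)⁻¹ • (P j + P' j)) atTop (𝓝 0) := by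
    refine (tendsto_flow_sub_one_div A ht0 hy0).2.congr fun j => ?_
    have e : flow A (t j) + flow A (-t j) - 2 = (flow A (t j) - 1) + (flow A (-t j) - 1) := by
      rw [show (2 : E n →L[ℝ] E n) = 1 + 1 by norm_num]; abel
    have e2 : (flow A (t j) + flow A (-t j) - 2) (y j - x₀) =
        (flow A (t j) - 1) (y j - x₀) + (flow A (-t j) - 1) (y j - x₀) :=
      congrArg (fun F : E n →L[ℝ] E n => F (y j - x₀)) e
    rw [e2, hP, hP']; simp only [motion_sub]
    rw [neg_smul]; congr 1; abel
  have htr : Tendsto t atTop (𝓝[>] 0) :=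
    tendsto_nhdsWithin_iff.2 ⟨ht0, Eventually.of_forall ht⟩
  have hep := (tendsto_exp_sub_one_div (2 * c)).comp htr
  have hem := (tendsto_exp_sub_one_div (-(2 * c))).comp htr
  -- Z is the sum of e^{2ct}P and e^{-2ct}P' divided by t², rearranged so that each piece converges.
  -- The limits are 2cξ₀, then (-2c)(-ξ₀), then 0, and together they give the factor 4c in the
  -- conclusion.
  set Z : ℕ → E n := fun j => ((Real.exp (2 * c * t j) - 1) / t j) • ((t j)⁻¹ • P j) +
    ((Real.exp (-(2 * c) * t j) - 1) / t j) • ((t j)⁻¹ • P' j) + (t j ^ 2)⁻¹ • (P j + P' j) with hZ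
  have hZlim : Tendsto Z atTop (𝓝 ((4 * c) • ξ₀)) := by
    have := ((hep.smul hp).add (hem.smul hp2)).add hss
    have e : (2 * c) • ξ₀ + (-(2 * c)) • -ξ₀ + 0 = (4 * c) • ξ₀ := by
      rw [add_zero, smul_neg, neg_smul, neg_neg, ← add_smul]; congr 1; ring
    rw [e] at this
    exact this
  have hexp : ∀ a : ℝ, Tendsto (fun j => Real.exp (a * t j)) atTop (𝓝 1) := fun a => by
    have := (Real.continuous_exp.tendsto _).comp (ht0.const_mul a)
    rw [mul_zero, Real.exp_zero] at this
    exact this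
  have hNlim : Tendsto (fun j => Real.exp (2 * c * t j) * ‖(t j)⁻¹ • P j‖ ^ 2 +
      Real.exp (-(2 * c) * t j) * ‖(t j)⁻¹ • P' j‖ ^ 2) atTop (𝓝 (2 * ‖ξ₀‖ ^ 2)) := by
    have := ((hexp (2 * c)).mul (hp.norm.pow 2)).add ((hexp (-(2 * c))).mul (hp2.norm.pow 2))
    rw [norm_neg, one_mul, ← two_mul] at this
    exact this
  have hpZ : Tendsto (fun j => p' (y j) (Z j)) atTop (𝓝 (p' x₀ ((4 * c) • ξ₀))) :=
    ((isBoundedBilinearMap_apply (𝕜 := ℝ) (E := E n) (F := ℝ)).continuous.tendsto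
      (p' x₀, (4 * c) • ξ₀)).comp ((hp'.tendsto.comp hy0).prodMk_nhds hZlim)
  have hlow := hpZ.sub (hNlim.const_mul (κ / 2))
  have hmot : ∀ a : ℝ, Tendsto (fun j => motion A x₀ ξ₀ (a * t j) (y j)) atTop (𝓝 x₀) := fun a => by
    have h1 := (continuous_motion A x₀ ξ₀).tendsto (0, x₀)
    have h2 : Tendsto (fun j => a * t j) atTop (𝓝 0) := by simpa using ht0.const_mul a
    have := h1.comp (h2.prodMk_nhds hy0)
    simp only [motion_zero] at this
    exact this
  have hm1 := (hy0.prodMk_nhds (hmot 1)).eventually hsemi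
  have hm2 := (hy0.prodMk_nhds (hmot (-1))).eventually hsemi
  have hev : ∀ᶠ j in atTop, p' (y j) (Z j) - κ / 2 * (Real.exp (2 * c * t j) * ‖(t j)⁻¹ • P j‖ ^ 2 +
      Real.exp (-(2 * c) * t j) * ‖(t j)⁻¹ • P' j‖ ^ 2) ≤
      ∑ i, gw k (l j) i * D2 (testFunction u ψ A x₀) (y j) (v j i) (v j i) := by
    filter_upwards [hm1, hm2] with j h1 h2
    refine le_trans ?_ (hineq j)
    simp only [one_mul, neg_one_mul] at h1 h2
    have hpos : 0 < t j ^ 2 := pow_pos (ht j) 2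
    have hh : 0 ≤ h (y j) := by
      rw [← heq _ (hyU j)]
      exact Real.rpow_nonneg ((hcone _ (hyU j)).pos k le_rfl).le _
    have hinv : (t j)⁻¹ * (t j)⁻¹ = (t j ^ 2)⁻¹ := by rw [← mul_inv, sq]
    have hZ' : p' (y j) (Z j) = (Real.exp (2 * c * t j) * p' (y j) (P j) +
        Real.exp (-(2 * c) * t j) * p' (y j) (P' j)) / t j ^ 2 := by
      rw [hZ]
      simp only [map_add, map_smul, smul_eq_mul]
      have := htne j
      field_simp
      ring
    have hN' : Real.exp (2 * c * t j) * ‖(t j)⁻¹ • P j‖ ^ 2 +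
      Real.exp (-(2 * c) * t j) * ‖(t j)⁻¹ • P' j‖ ^ 2 = (Real.exp (2 * c * t j) * ‖P j‖ ^ 2 +
        Real.exp (-(2 * c) * t j) * ‖P' j‖ ^ 2) / t j ^ 2 := by
      rw [norm_smul, norm_smul, mul_pow, mul_pow, norm_inv, inv_pow, Real.norm_eq_abs, sq_abs]
      ring
    -- The zeroth order contribution (e^{2ct} + e^{-2ct} - 2)h(y) is nonnegative and can be dropped.
    have hamgm : 2 ≤ Real.exp (2 * c * t j) + Real.exp (-(2 * c) * t j) := by
      have e : Real.exp (2 * c * t j) * Real.exp (-(2 * c) * t j) = 1 := by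
        rw [← Real.exp_add]; simp
      nlinarith [Real.exp_pos (2 * c * t j), Real.exp_pos (-(2 * c) * t j),
        sq_nonneg (Real.exp (2 * c * t j) - Real.exp (-(2 * c) * t j))]
    rw [hZ', hN', mul_div_assoc', ← sub_div]
    refine div_le_div_of_nonneg_right ?_ hpos.le
    rw [show 2 * c * -t j = -(2 * c) * t j by ring]
    have a1 := mul_le_mul_of_nonneg_left h1 (Real.exp_pos (2 * c * t j)).le
    have a2 := mul_le_mul_of_nonneg_left h2 (Real.exp_pos (-(2 * c) * t j)).le
    have a3 := mul_le_mul_of_nonneg_right hamgm hh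
    change Real.exp (2 * c * t j) * (h (y j) + p' (y j) (P j) - κ / 2 * ‖P j‖ ^ 2) ≤ _ at a1
    change Real.exp (-(2 * c) * t j) * (h (y j) + p' (y j) (P' j) - κ / 2 * ‖P' j‖ ^ 2) ≤ _ at a2
    linarith
  have := le_of_tendsto_of_tendsto (hlow.comp hst) hRHS (hst.eventually hev)
  rw [map_smul, smul_eq_mul] at this
  linarith

end Viscosity
end KHessian

namespace KHessian

/-! ### Chain rules and the linearised equation. -/

section SecondDerivativeCalculus

variable {n : ℕ}

lemma hasFDerivAt_fderiv_apply {w : E n → ℝ} {x : E n} (hw : ContDiffAt ℝ 2 w x) (v z : E n) :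
    DifferentiableAt ℝ (fun y => fderiv ℝ w y v) x ∧
      fderiv ℝ (fun y => fderiv ℝ w y v) x z = D2 w x z v := by
  have h1 : HasFDerivAt (fderiv ℝ w) (D2 w x) x := (differentiableAt_fderiv hw).hasFDerivAt
  have h2 := h1.clm_apply (hasFDerivAt_const v x)
  refine ⟨h2.differentiableAt, ?_⟩
  rw [h2.fderiv]; simp

lemma D2_mul {f g : E n → ℝ} {x : E n} (hf : ContDiffAt ℝ 2 f x) (hg : ContDiffAt ℝ 2 g x)
    (v : E n) : D2 (fun y => f y * g y) x v v =
      f x * D2 g x v v + 2 * fderiv ℝ f x v * fderiv ℝ g x v + g x * D2 f x v v := by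
  rw [← (hasFDerivAt_fderiv_apply (hf.mul hg) v v).2]
  have e : (fun y => fderiv ℝ (fun y => f y * g y) y v) =ᶠ[𝓝 x]
      fun y => f y * fderiv ℝ g y v + g y * fderiv ℝ f y v := by
    filter_upwards [hf.eventually (by simp), hg.eventually (by simp)] with y h1 h2
    rw [fderiv_fun_mul (h1.differentiableAt (by norm_num)) (h2.differentiableAt (by norm_num))]
    simp
  have hf' := hf.differentiableAt (by norm_num)
  have hg' := hg.differentiableAt (by norm_num)
  have hf2 := hasFDerivAt_fderiv_apply hf v v
  have hg2 := hasFDerivAt_fderiv_apply hg v v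
  change fderiv ℝ (fun y => fderiv ℝ (fun y => f y * g y) y v) x v = _
  have h5 := ((hf'.hasFDerivAt.fun_mul hg2.1.hasFDerivAt).fun_add
    (hg'.hasFDerivAt.fun_mul hf2.1.hasFDerivAt)).fderiv
  rw [e.fderiv_eq, h5]
  simp only [add_apply, smul_apply, smul_eq_mul, hf2.2, hg2.2]
  ring

lemma D2_comp_real {F F' : ℝ → ℝ} {F'' : ℝ} {ρ : E n → ℝ} {x : E n} (hρ : ContDiffAt ℝ 2 ρ x)
    (hFc : ContDiffAt ℝ 2 F (ρ x))
    (hF : ∀ᶠ t in 𝓝 (ρ x), HasDerivAt F (F' t) t) (hF' : HasDerivAt F' F'' (ρ x)) (v : E n) :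
    D2 (fun y => F (ρ y)) x v v = F'' * fderiv ℝ ρ x v ^ 2 + F' (ρ x) * D2 ρ x v v := by
  have hc : ContDiffAt ℝ 2 (fun y => F (ρ y)) x := hFc.comp x hρ
  rw [← (hasFDerivAt_fderiv_apply hc v v).2]
  have e : (fun y => fderiv ℝ (fun y => F (ρ y)) y v) =ᶠ[𝓝 x]
      fun y => F' (ρ y) * fderiv ℝ ρ y v := by
    filter_upwards [hρ.continuousAt.eventually hF, hρ.eventually (by simp)] with y h1 h2
    have := (h1.comp_hasFDerivAt y (h2.differentiableAt (by norm_num)).hasFDerivAt).fderiv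
    change fderiv ℝ (F ∘ ρ) y v = _
    rw [this]; simp
  rw [e.fderiv_eq]
  have h2 := hasFDerivAt_fderiv_apply hρ v v
  have h3 := hF'.comp_hasFDerivAt x (hρ.differentiableAt (by norm_num)).hasFDerivAt
  have h4 := (h3.mul h2.1.hasFDerivAt).fderiv
  change fderiv ℝ ((F' ∘ ρ) * fun y => fderiv ℝ ρ y v) x v = _
  rw [h4]
  simp only [add_apply, smul_apply, smul_eq_mul, h2.2, Function.comp]
  ring

lemma D2_norm_sq_affine (ξ₀ x₀ : E n) (A : E n →L[ℝ] E n) (v : E n) :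
    ContDiffAt ℝ 2 (fun y => ‖ξ₀ + A (y - x₀)‖ ^ 2) x₀ ∧
    fderiv ℝ (fun y => ‖ξ₀ + A (y - x₀)‖ ^ 2) x₀ v = 2 * inner ℝ ξ₀ (A v) ∧
    D2 (fun y => ‖ξ₀ + A (y - x₀)‖ ^ 2) x₀ v v = 2 * ‖A v‖ ^ 2 := by
  have hc : ContDiff ℝ 2 (fun y => ‖ξ₀ + A (y - x₀)‖ ^ 2) :=
    (contDiff_const.add (A.contDiff.comp (contDiff_id.sub contDiff_const))).norm_sq ℝ
  have hl : ∀ y, HasFDerivAt (fun y => ξ₀ + A (y - x₀)) A y := fun y => by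
    have := (A.hasFDerivAt.comp y ((hasFDerivAt_id y).sub_const x₀)).const_add ξ₀
    simpa using this
  have hf : ∀ y, fderiv ℝ (fun y => ‖ξ₀ + A (y - x₀)‖ ^ 2) y v =
      2 * inner ℝ (ξ₀ + A (y - x₀)) (A v) := fun y => by
    rw [(hl y).norm_sq.fderiv]; simp [inner_add_left, inner_sub_left]; ring
  refine ⟨hc.contDiffAt, by rw [hf]; simp, ?_⟩
  rw [← (hasFDerivAt_fderiv_apply hc.contDiffAt v v).2]
  have e : (fun y => fderiv ℝ (fun y => ‖ξ₀ + A (y - x₀)‖ ^ 2) y v) =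
      fun y => 2 * inner ℝ (ξ₀ + A (y - x₀)) (A v) := funext hf
  rw [e]
  have := (((hl x₀).inner ℝ (hasFDerivAt_const (A v) x₀)).const_mul 2).fderiv
  rw [this]
  simp

lemma fderiv_directional {ρ : E n → ℝ} {x₀ : E n} (hρ : ContDiffAt ℝ 3 ρ x₀) (ξ₀ : E n)
    (A : E n →L[ℝ] E n) (v : E n) :
    ContDiffAt ℝ 2 (fun y => fderiv ℝ ρ y (ξ₀ + A (y - x₀))) x₀ ∧
    fderiv ℝ (fun y => fderiv ℝ ρ y (ξ₀ + A (y - x₀))) x₀ v =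
      D2 ρ x₀ v ξ₀ + fderiv ℝ ρ x₀ (A v) ∧
    D2 (fun y => fderiv ℝ ρ y (ξ₀ + A (y - x₀))) x₀ v v =
      D2 (fun y => fderiv ℝ ρ y ξ₀) x₀ v v + 2 * D2 ρ x₀ v (A v) := by
  have h2 : ContDiffAt ℝ 2 ρ x₀ := hρ.of_le (by norm_num)
  have e : (fun y => fderiv ℝ ρ y (ξ₀ + A (y - x₀))) =
      fun y => fderiv ℝ ρ y ξ₀ + fderiv ℝ ρ y (A (y - x₀)) := by ext y; rw [map_add]
  have c1 : ContDiffAt ℝ 2 (fun y => fderiv ℝ ρ y ξ₀) x₀ :=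
    (hρ.fderiv_right (m := 2) (by norm_num)).clm_apply contDiffAt_const
  have c2 := contDiffAt_fderiv_apply (x₀ := x₀) hρ A
  rw [e]
  refine ⟨c1.add c2, ?_, ?_⟩
  · rw [fderiv_fun_add (c1.differentiableAt (by norm_num)) (c2.differentiableAt (by norm_num))]
    have h1 : HasFDerivAt (fderiv ℝ ρ) (D2 ρ x₀) x₀ := (differentiableAt_fderiv h2).hasFDerivAt
    have h3 := h1.clm_apply (A.hasFDerivAt.comp x₀ ((hasFDerivAt_id x₀).sub_const x₀))
    have h4 : fderiv ℝ (fun y => fderiv ℝ ρ y (A (y - x₀))) x₀ = _ := h3.fderiv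
    rw [add_apply, (hasFDerivAt_fderiv_apply h2 ξ₀ v).2, h4]
    simp
  · rw [D2_add c1 c2]
    change D2 (fun y => fderiv ℝ ρ y ξ₀) x₀ v v + D2 (fun y => fderiv ℝ ρ y (A (y - x₀))) x₀ v v = _
    rw [D2_fderiv_apply hρ]

/-- The linearised equation for directional derivatives of `u`. -/
lemma sum_gw_D2_fderiv {k : ℕ} (hk : 0 < k) {u h : E n → ℝ} {x₀ : E n}
    (hu : ContDiffAt ℝ 3 u x₀) (hcone : ∀ᶠ x in 𝓝 x₀, IsConeForm k (D2 u x))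
    (heq : ∀ᶠ x in 𝓝 x₀, sigma k (formMatrix (D2 u x)) ^ (1 / (k : ℝ)) = h x)
    {p : E n →L[ℝ] ℝ} {κ : ℝ}
    (hsemi : ∀ᶠ z in 𝓝 x₀, h x₀ + p (z - x₀) - κ / 2 * ‖z - x₀‖ ^ 2 ≤ h z)
    {v : Fin n → E n} {l : Fin n → ℝ} (hv : IsEigenframe (D2 u x₀) v l) (e : E n) :
    ∑ i, gw k l i * D2 (fun y => fderiv ℝ u y e) x₀ (v i) (v i) = p e := by
  have hline := tendsto_line x₀ e
  -- With the weights frozen at x₀, Gårding's inequality gives g(s) ≥ h(x₀ + se), and semiconvexity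
  -- bounds this below by a parabola of slope p(e). Equality at s = 0 forces g'(0) = p(e), so the
  -- equation itself is never differentiated.
  set g : ℝ → ℝ := fun s => ∑ i, gw k l i * D2 u (x₀ + s • e) (v i) (v i) with hg
  have hge : ∀ᶠ s in 𝓝 (0:ℝ), p e * s - κ / 2 * ‖e‖ ^ 2 * s ^ 2 + h x₀ ≤ g s := by
    filter_upwards [hline.eventually hcone, hline.eventually heq, hline.eventually hsemi]
      with s h1 h2 h3
    have := garding_form hk hcone.self_of_nhds h1 hv hv.orthonormal
    rw [h2] at this
    refine le_trans ?_ this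
    refine le_trans (le_of_eq ?_) h3
    simp only [add_sub_cancel_left, map_smul, smul_eq_mul, norm_smul, mul_pow, Real.norm_eq_abs,
      sq_abs]
    ring
  have hg0 : g 0 = h x₀ := by
    rw [← heq.self_of_nhds, ← hv.sum_gw_mul hk hcone.self_of_nhds, hg]
    simp only [zero_smul, add_zero]
    refine Finset.sum_congr rfl fun i _ => ?_
    rw [hv.apply_eq, real_inner_self_eq_norm_sq, hv.orthonormal.1 i]; ring
  have hd : ∀ i, HasDerivAt (fun s : ℝ => D2 u (x₀ + s • e) (v i) (v i))
      (D2 (fun y => fderiv ℝ u y e) x₀ (v i) (v i)) 0 := by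
    intro i
    set gv : E n → ℝ := fun y => fderiv ℝ u y (v i) with hgv
    have hc : ∀ z : E n, ContDiffAt ℝ 2 (fun y => fderiv ℝ u y z) x₀ := fun z =>
      (hu.fderiv_right (m := 2) (by norm_num)).clm_apply contDiffAt_const
    have hu2 : ∀ᶠ y in 𝓝 x₀, ContDiffAt ℝ 2 u y :=
      (hu.of_le (by norm_num)).eventually (by simp)
    have h1 : D2 (fun y => fderiv ℝ u y e) x₀ (v i) (v i) = D2 gv x₀ e (v i) := by
      rw [isSymmForm_D2 (hc (v i)) e (v i), ← (hasFDerivAt_fderiv_apply (hc e) (v i) (v i)).2,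
        ← (hasFDerivAt_fderiv_apply (hc (v i)) e (v i)).2]
      have : (fun y => fderiv ℝ (fun y => fderiv ℝ u y e) y (v i)) =ᶠ[𝓝 x₀]
          fun y => fderiv ℝ gv y e := by
        filter_upwards [hu2] with y hy
        rw [(hasFDerivAt_fderiv_apply hy e (v i)).2, (hasFDerivAt_fderiv_apply hy (v i) e).2]
        exact isSymmForm_D2 hy _ _
      rw [this.fderiv_eq]
    rw [h1]
    have h0 : DifferentiableAt ℝ (fderiv ℝ gv) (x₀ + (0:ℝ) • e) := by
      simpa using differentiableAt_fderiv (hc (v i))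
    have h2 := hasDerivAt_fderiv_line (z := v i) h0
    simp only [zero_smul, add_zero] at h2
    refine h2.congr_of_eventuallyEq ?_
    filter_upwards [hline.eventually hu2] with s hs
    exact (hasFDerivAt_fderiv_apply hs (v i) (v i)).2.symm
  have hgd : HasDerivAt g (∑ i, gw k l i * D2 (fun y => fderiv ℝ u y e) x₀ (v i) (v i)) 0 := by
    have := HasDerivAt.fun_sum (u := Finset.univ) fun i _ => (hd i).const_mul (gw k l i)
    exact this
  have hmin : IsLocalMin (fun s => g s - (p e * s - κ / 2 * ‖e‖ ^ 2 * s ^ 2 + h x₀)) 0 := by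
    filter_upwards [hge] with s hs
    simp [hg0]; linarith
  have hq : HasDerivAt (fun s => p e * s - κ / 2 * ‖e‖ ^ 2 * s ^ 2 + h x₀) (p e) 0 := by
    have := ((((hasDerivAt_id (0:ℝ)).const_mul (p e)).sub
      (((hasDerivAt_pow 2 (0:ℝ))).const_mul (κ / 2 * ‖e‖ ^ 2)))).add_const (h x₀)
    simpa using this
  have := hmin.hasDerivAt_eq_zero (hgd.sub hq)
  linarith

end SecondDerivativeCalculus
end KHessian

/-! ### The comparison argument inside the boundary strip. -/

namespace KHessian

lemma two_mul_le_sq_add_sq_div {δ : ℝ} (hδ : 0 < δ) (x y : ℝ) :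
    2 * x * y ≤ δ * x ^ 2 + y ^ 2 / δ := by
  have : 0 ≤ (δ * x - y) ^ 2 / δ := by positivity
  have e : (δ * x - y) ^ 2 / δ = δ * x ^ 2 + y ^ 2 / δ - 2 * x * y := by field_simp; ring
  linarith

set_option maxHeartbeats 1000000 in
/-- The pointwise inequality behind the estimate in the boundary strip. -/
lemma strip_pointwise {N M w p d x y sv lam g e b b' bt c a s θ ε C c₀ γ Q G : ℝ}
    (hε : 0 < ε) (hεs : ε ≤ s) (hγ : γ * s = θ) (hθ : 128 * θ = c₀) (hc₀ : 0 < c₀) (hC : 1 ≤ C)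
    (hc : c = γ * w - e) (he : |e| ≤ C) (hy : |y| ≤ C) (hsv0 : 0 ≤ sv) (hsv : sv ≤ C ^ 2)
    (hx : |x| ≤ 1) (hg : |g| ≤ C) (hb'0 : 0 ≤ b') (hb' : b' ≤ 1) (_ : 0 ≤ b) (hb : b ≤ s)
    (hbt : |bt| ≤ s) (hG : 0 ≤ G) (hd : |d| ≤ C) (hlam : lam * x = N * (w * p + bt * x))
    (hM : 0 < M) (hMN : M ≤ N) (ha : a * M = Q) (hQ : Q * (16 * ε ^ 2) = c₀)
    (hs1 : s * (64 * C ^ 2) ≤ c₀ ^ 2 * θ) (hs2 : s * (96 * C ^ 2) ≤ c₀)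
    (hε1 : 512 * C ^ 4 * ε ^ 2 ≤ c₀ ^ 2) (hM1 : 256 * Q * C ^ 2 * θ ≤ c₀ * ε * M ^ 2)
    (hM2 : 4096 * Q * C ^ 4 ≤ c₀ * M ^ 2) :
    N * (2 * w * d + θ / s ^ 2 * w ^ 2 * p ^ 2 - 2 * (128 * C ^ 2 / c₀) * p ^ 2 +
        4 * b' * p * (c * x + y) + 2 * b * (c ^ 2 + sv)) -
      a * (2 * lam ^ 2 + 8 * lam * g * (c * x + y) + 2 * G * (c ^ 2 + sv)) - 2 * lam * sv ≤
      N * c₀ * (γ * w ^ 2 + 1 / 2) := by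
  have hs : 0 < s := hε.trans_le hεs
  have hθ0 : 0 < θ := by linarith
  have hγ0 : 0 < γ := pos_of_mul_pos_left (hγ ▸ hθ0) hs.le
  have hN : 0 < N := hM.trans_le hMN
  have hQ0 : 0 < Q := pos_of_mul_pos_left (hQ ▸ hc₀) (by positivity)
  have ha0 : 0 < a := pos_of_mul_pos_left (ha ▸ hQ0) hM.le
  have hC0 : 0 < C := by linarith
  have e2 : e ^ 2 ≤ C ^ 2 := sq_le_sq' (abs_le.1 he).1 (abs_le.1 he).2
  have y2 : y ^ 2 ≤ C ^ 2 := sq_le_sq' (abs_le.1 hy).1 (abs_le.1 hy).2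
  have x2 : x ^ 2 ≤ 1 := (sq_le_one_iff_abs_le_one x).2 hx
  have g2 : g ^ 2 ≤ C ^ 2 := sq_le_sq' (abs_le.1 hg).1 (abs_le.1 hg).2
  have d2 : d ^ 2 ≤ C ^ 2 := sq_le_sq' (abs_le.1 hd).1 (abs_le.1 hd).2
  have bt2 : bt ^ 2 ≤ s ^ 2 := sq_le_sq' (abs_le.1 hbt).1 (abs_le.1 hbt).2
  have hc2 : c ^ 2 ≤ 2 * (γ * w) ^ 2 + 2 * C ^ 2 := by
    rw [hc]; linarith [sq_nonneg (γ * w + e)]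
  -- first order terms in `w`
  have t1 : 2 * w * d ≤ c₀ / 4 * γ * w ^ 2 + c₀ / 16 := by
    have h := two_mul_le_sq_add_sq_div (δ := c₀ / 4 * γ) (by positivity) w d
    have : d ^ 2 / (c₀ / 4 * γ) ≤ c₀ / 16 := by
      rw [div_le_iff₀ (by positivity)]
      have h2 : s * (64 * C ^ 2) ≤ s * (c₀ ^ 2 * γ) := by
        rw [← hγ] at hs1; linarith
      have h3 := le_of_mul_le_mul_left h2 hs
      linarith
    linarith
  -- the gradient of `b`
  have hK : 0 < 128 * C ^ 2 / c₀ := by positivity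
  have t3 : 4 * b' * p * (c * x + y) ≤
      c₀ / 8 + θ / 2 / s ^ 2 * w ^ 2 * p ^ 2 + 2 * (128 * C ^ 2 / c₀) * p ^ 2 := by
    have h1 : |c * x + y| ≤ γ * |w| + 2 * C := by
      have a1 : |c * x| ≤ |c| := by
        rw [abs_mul]; exact mul_le_of_le_one_right (abs_nonneg _) hx
      have a2 : |c| ≤ γ * |w| + C := by
        rw [hc]
        have := abs_sub (γ * w) e
        rw [abs_mul, abs_of_pos hγ0] at this; linarith
      have := abs_add_le (c * x) y
      linarith
    have h2 : 4 * b' * p * (c * x + y) ≤ 4 * |p| * (γ * |w| + 2 * C) := by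
      refine (le_abs_self _).trans ?_
      rw [abs_mul, abs_mul, abs_mul, abs_of_nonneg hb'0, abs_of_pos (by norm_num : (0:ℝ) < 4)]
      refine mul_le_mul ?_ h1 (abs_nonneg _) (by positivity)
      have := mul_le_mul_of_nonneg_right hb' (abs_nonneg p)
      linarith
    have h3 := two_mul_le_sq_add_sq_div (δ := c₀ / 16) (by positivity) 1 (2 * |p| * (γ * |w|))
    have h4 := two_mul_le_sq_add_sq_div (δ := c₀ / 16) (by positivity) 1 (4 * C * |p|)
    have e3 : (2 * |p| * (γ * |w|)) ^ 2 / (c₀ / 16) = θ / 2 / s ^ 2 * w ^ 2 * p ^ 2 := by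
      rw [mul_pow, mul_pow, mul_pow, sq_abs, sq_abs, ← hθ]
      have : γ = θ / s := by rw [← hγ]; field_simp
      rw [this]; field_simp; ring
    have e4 : (4 * C * |p|) ^ 2 / (c₀ / 16) = 2 * (128 * C ^ 2 / c₀) * p ^ 2 := by
      rw [mul_pow, sq_abs]; field_simp; ring
    rw [e3] at h3; rw [e4] at h4
    linarith
  -- the term with `b`
  have t4 : 2 * b * (c ^ 2 + sv) ≤ c₀ / 32 * γ * w ^ 2 + c₀ / 16 := by
    have h1 : 2 * b * (c ^ 2 + sv) ≤ 2 * s * (2 * (γ * w) ^ 2 + 3 * C ^ 2) := by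
      refine mul_le_mul (by linarith) (by linarith) (by positivity) (by positivity)
    have h2 : 2 * s * (2 * (γ * w) ^ 2) = c₀ / 32 * γ * w ^ 2 := by
      rw [← hθ, ← hγ]; ring
    linarith
  have hcxy : (c * x + y) ^ 2 ≤ 4 * (γ * w) ^ 2 + 6 * C ^ 2 := by
    have h1 : (c * x + y) ^ 2 ≤ 2 * (c * x) ^ 2 + 2 * y ^ 2 := by linarith [sq_nonneg (c * x - y)]
    have h2 : (c * x) ^ 2 ≤ c ^ 2 := by
      have := mul_le_mul_of_nonneg_left x2 (sq_nonneg c)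
      rw [mul_pow]; linarith
    linarith
  have haN : a ≤ N * (Q / M ^ 2) := by
    have : a = M * (Q / M ^ 2) := by rw [← ha]; field_simp
    rw [this]; gcongr
  -- The good term -2aλ² is divided: aλ²/2 goes to the cross term here, aλ²/2 to -2λ·sv in `t6`, and
  -- aλ² is kept for `t7`.
  have t5 : -(a * (8 * lam * g * (c * x + y))) ≤
      a * lam ^ 2 / 2 + N * (c₀ / 2 * γ * w ^ 2 + c₀ / 16) := by
    have h1 := two_mul_le_sq_add_sq_div (δ := 1 / 2) (by norm_num) (-lam) (4 * g * (c * x + y))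
    have h2 : (4 * g * (c * x + y)) ^ 2 / (1 / 2) ≤ 32 * C ^ 2 * (4 * (γ * w) ^ 2 + 6 * C ^ 2) := by
      have : (4 * g * (c * x + y)) ^ 2 / (1 / 2) = 32 * (g ^ 2 * (c * x + y) ^ 2) := by ring
      rw [this, mul_assoc]
      exact mul_le_mul_of_nonneg_left (mul_le_mul g2 hcxy (sq_nonneg _) (sq_nonneg _)) (by norm_num)
    have h3 : a * (32 * C ^ 2 * (4 * (γ * w) ^ 2 + 6 * C ^ 2)) ≤
        N * (c₀ / 2 * γ * w ^ 2 + c₀ / 16) := by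
      refine (mul_le_mul_of_nonneg_right haN (by positivity)).trans ?_
      rw [mul_assoc]
      refine mul_le_mul_of_nonneg_left ?_ hN.le
      rw [div_mul_eq_mul_div, div_le_iff₀ (by positivity)]
      have k1 : Q * (128 * C ^ 2) * γ ≤ c₀ / 2 * M ^ 2 := by
        have : Q * (128 * C ^ 2) * γ * s ≤ c₀ / 2 * M ^ 2 * s := by
          have : c₀ * ε * M ^ 2 ≤ c₀ * s * M ^ 2 := by gcongr
          calc Q * (128 * C ^ 2) * γ * s = Q * (128 * C ^ 2) * θ := by rw [← hγ]; ring
            _ ≤ _ := by linarith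
        exact le_of_mul_le_mul_right this hs
      have k2 := mul_le_mul_of_nonneg_right k1 (by positivity : 0 ≤ γ * w ^ 2)
      have k3 : 0 ≤ Q * C ^ 4 := by positivity
      linarith
    have h4 := mul_le_mul_of_nonneg_left (h1.trans (add_le_add le_rfl h2)) ha0.le
    linarith
  have t6 : -(2 * lam * sv) ≤ a * lam ^ 2 / 2 + N * (c₀ / 16) := by
    have h1 := two_mul_le_sq_add_sq_div (δ := a / 2) (by positivity) (-lam) sv
    have h2 : sv ^ 2 / (a / 2) ≤ N * (c₀ / 16) := by
      rw [div_le_iff₀ (by positivity)]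
      have k1 : sv ^ 2 ≤ C ^ 4 := by
        calc sv ^ 2 ≤ (C ^ 2) ^ 2 := pow_le_pow_left₀ hsv0 hsv 2
          _ = C ^ 4 := by ring
      have k2 : Q ≤ N * a := by rw [← ha, mul_comm]; gcongr
      have k4 := mul_le_mul_of_nonneg_right k2 hc₀.le
      have k3 : C ^ 4 * 32 ≤ Q * c₀ := by
        have : C ^ 4 * 32 * (16 * ε ^ 2) ≤ Q * c₀ * (16 * ε ^ 2) := by
          calc C ^ 4 * 32 * (16 * ε ^ 2) ≤ c₀ ^ 2 := by linarith
            _ = Q * c₀ * (16 * ε ^ 2) := by linear_combination (-c₀) * hQ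
        exact le_of_mul_le_mul_right this (by positivity)
      linarith
    linarith [h1, h2]
  -- The first order condition `hlam` gives λ² ≥ N²(w²p²/2 - s²), and aM = c₀/(16ε²) with ε ≤ s, M ≤
  -- N gives a ≥ c₀/(16 s² N). Since c₀ = 128θ, the product is 4θw²p²/s², which exceeds the two
  -- positive terms of that type.
  have t7 : -(a * lam ^ 2) ≤ N * (-(4 * θ / s ^ 2 * w ^ 2 * p ^ 2) + c₀ / 16) := by
    have k1 : N ^ 2 * (w ^ 2 * p ^ 2 / 2 - s ^ 2) ≤ lam ^ 2 := by
      have h1 : (lam * x) ^ 2 ≤ lam ^ 2 := by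
        have := mul_le_mul_of_nonneg_left x2 (sq_nonneg lam)
        rw [mul_pow]; linarith
      have h2 : w ^ 2 * p ^ 2 / 2 - (bt * x) ^ 2 ≤ (w * p + bt * x) ^ 2 := by
        linarith [sq_nonneg (w * p + 2 * (bt * x))]
      have h3 : (bt * x) ^ 2 ≤ s ^ 2 := by
        have := mul_le_mul_of_nonneg_left x2 (sq_nonneg bt)
        rw [mul_pow]; linarith
      rw [hlam, mul_pow] at h1
      have h4 := mul_le_mul_of_nonneg_left (h2.trans' (by linarith : w ^ 2 * p ^ 2 / 2 - s ^ 2 ≤ _))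
        (sq_nonneg N)
      linarith
    have k2 : c₀ / (16 * s ^ 2) / N ≤ a := by
      rw [div_le_iff₀ hN]
      calc c₀ / (16 * s ^ 2) ≤ c₀ / (16 * ε ^ 2) := by gcongr
        _ = a * M := by rw [ha, ← hQ]; field_simp
        _ ≤ a * N := by gcongr
    have k3 : c₀ / (16 * s ^ 2) / N * lam ^ 2 ≤ a * lam ^ 2 := by gcongr
    have k4 : c₀ / (16 * s ^ 2) / N * (N ^ 2 * (w ^ 2 * p ^ 2 / 2 - s ^ 2)) ≤
        c₀ / (16 * s ^ 2) / N * lam ^ 2 := by gcongr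
    have k5 : c₀ / (16 * s ^ 2) / N * (N ^ 2 * (w ^ 2 * p ^ 2 / 2 - s ^ 2)) =
        -(N * (-(4 * θ / s ^ 2 * w ^ 2 * p ^ 2) + c₀ / 16)) := by
      rw [← hθ]; field_simp; ring
    linarith
  have t8 : 0 ≤ a * (2 * G * (c ^ 2 + sv)) := by positivity
  have t2 : θ / s ^ 2 * w ^ 2 * p ^ 2 + θ / 2 / s ^ 2 * w ^ 2 * p ^ 2 ≤
      4 * θ / s ^ 2 * w ^ 2 * p ^ 2 := by
    have : 0 ≤ θ / s ^ 2 * w ^ 2 * p ^ 2 := by positivity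
    have e1 : θ / 2 / s ^ 2 * w ^ 2 * p ^ 2 = (θ / s ^ 2 * w ^ 2 * p ^ 2) / 2 := by ring
    have e2 : 4 * θ / s ^ 2 * w ^ 2 * p ^ 2 = 4 * (θ / s ^ 2 * w ^ 2 * p ^ 2) := by ring
    rw [e1, e2]; linarith
  have hw0 : 0 ≤ c₀ * γ * w ^ 2 := by positivity
  have hmain : 2 * w * d + θ / s ^ 2 * w ^ 2 * p ^ 2 - 2 * (128 * C ^ 2 / c₀) * p ^ 2 +
        4 * b' * p * (c * x + y) + 2 * b * (c ^ 2 + sv) + (c₀ / 2 * γ * w ^ 2 + c₀ / 16) + c₀ / 16 +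
        (-(4 * θ / s ^ 2 * w ^ 2 * p ^ 2) + c₀ / 16) ≤ c₀ * (γ * w ^ 2 + 1 / 2) := by
    linarith
  have := mul_le_mul_of_nonneg_left hmain hN.le
  linarith

end KHessian

namespace KHessian

variable {n : ℕ}

lemma exists_inner_eq (L : E n →L[ℝ] ℝ) : ∃ ν : E n, (∀ v, inner ℝ ν v = L v) ∧ ‖ν‖ = ‖L‖ := by
  refine ⟨(InnerProductSpace.toDual ℝ (E n)).symm L, fun v => ?_, ?_⟩
  · rw [InnerProductSpace.toDual_symm_apply]
  · exact LinearIsometryEquiv.norm_map _ L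

/-- The infinitesimal rotation that turns the derivative of a direction into a multiple of the
conormal. -/
lemma exists_rotation {L H : E n →L[ℝ] ℝ} {C : ℝ} (hC : 0 ≤ C) (h1 : 1 ≤ C * ‖L‖)
    (hH : ‖H‖ ≤ C) : ∃ (e : ℝ) (S : E n →L[ℝ] E n), |e| ≤ C ^ 2 ∧
      (∀ v w, inner ℝ (S v) w = -inner ℝ v (S w)) ∧ (∀ v, H v + L (S v) = e * L v) ∧
      ∀ v, ‖S v‖ ≤ 2 * C ^ 2 * ‖v‖ := by
  obtain ⟨ν, hν, hνn⟩ := exists_inner_eq L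
  obtain ⟨q, hq, hqn⟩ := exists_inner_eq H
  have hν0 : 0 < ‖ν‖ := by
    rw [hνn]; by_contra! h
    have := norm_nonneg L
    nlinarith
  set e := inner ℝ ν q / ‖ν‖ ^ 2 with he
  set z := q - e • ν with hz
  have hzν : inner ℝ ν z = 0 := by
    rw [hz, inner_sub_right, inner_smul_right, real_inner_self_eq_norm_sq, he]; field_simp; ring
  have hq2 : ‖q‖ ^ 2 = ‖z‖ ^ 2 + e ^ 2 * ‖ν‖ ^ 2 := by
    have : q = z + e • ν := by rw [hz]; abel
    conv_lhs => rw [this]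
    rw [norm_add_sq_real, inner_smul_right, real_inner_comm, hzν, norm_smul, mul_pow,
      Real.norm_eq_abs, sq_abs]; ring
  have hzC : ‖z‖ ≤ C := by
    have : ‖z‖ ^ 2 ≤ ‖q‖ ^ 2 := by rw [hq2]; nlinarith [sq_nonneg (e * ‖ν‖)]
    exact (pow_le_pow_iff_left₀ (norm_nonneg _) (norm_nonneg _) two_ne_zero).1 this |>.trans
      (hqn ▸ hH)
  have hinv : ‖ν‖⁻¹ ≤ C := by
    rw [inv_le_iff_one_le_mul₀ hν0, hνn]; exact h1
  -- S rotates in the plane of ν and z. Because z ⟂ ν, ⟨ν, Sv⟩ = -⟨z, v⟩, which cancels the part of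
  -- H not proportional to L.
  set S : E n →L[ℝ] E n := (‖ν‖ ^ 2)⁻¹ • ((innerSL ℝ ν).smulRight z - (innerSL ℝ z).smulRight ν)
    with hS
  have hSv : ∀ v, S v = (‖ν‖ ^ 2)⁻¹ • ((inner ℝ ν v) • z - (inner ℝ z v) • ν) := fun v => by
    simp [hS]
  refine ⟨e, S, ?_, fun v w => ?_, fun v => ?_, fun v => ?_⟩
  · rw [he, abs_div, abs_of_nonneg (sq_nonneg ‖ν‖), div_le_iff₀ (by positivity)]
    have a1 := abs_real_inner_le_norm ν q
    have a2 : ‖q‖ ≤ C := hqn ▸ hH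
    have a3 : 1 ≤ C * ‖ν‖ := hνn ▸ h1
    calc _ ≤ ‖ν‖ * C := a1.trans (by gcongr)
      _ ≤ ‖ν‖ * C * (C * ‖ν‖) := le_mul_of_one_le_right (by positivity) a3
      _ = _ := by ring
  · rw [hSv, hSv, inner_smul_left, inner_smul_right, inner_sub_left, inner_sub_right,
      inner_smul_left, inner_smul_left, inner_smul_right, inner_smul_right]
    simp only [conj_trivial]
    rw [real_inner_comm ν v, real_inner_comm z v]; ring
  · rw [← hν, ← hν, ← hq, hSv, inner_smul_right, inner_sub_right, inner_smul_right, inner_smul_right,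
      hzν, real_inner_self_eq_norm_sq]
    have : q = z + e • ν := by rw [hz]; abel
    rw [this, inner_add_left, inner_smul_left]
    simp only [conj_trivial]
    field_simp; ring
  · rw [hSv, norm_smul, norm_inv, norm_pow, norm_norm]
    have b1 := norm_sub_le ((inner ℝ ν v : ℝ) • z) ((inner ℝ z v : ℝ) • ν)
    rw [norm_smul, norm_smul, Real.norm_eq_abs, Real.norm_eq_abs] at b1
    have b2 := abs_real_inner_le_norm ν v
    have b3 := abs_real_inner_le_norm z v
    have b4 : ‖(inner ℝ ν v : ℝ) • z - (inner ℝ z v : ℝ) • ν‖ ≤ 2 * (‖ν‖ * ‖z‖ * ‖v‖) := by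
      have := mul_le_mul_of_nonneg_right b2 (norm_nonneg z)
      have := mul_le_mul_of_nonneg_right b3 (norm_nonneg ν)
      linarith
    calc _ ≤ (‖ν‖ ^ 2)⁻¹ * (2 * (‖ν‖ * ‖z‖ * ‖v‖)) := by gcongr
      _ = 2 * (‖ν‖⁻¹ * ‖z‖) * ‖v‖ := by field_simp
      _ ≤ 2 * (C * C) * ‖v‖ := by gcongr
      _ = _ := by ring

/-- A linear term dominated by a quadratic one vanishes. -/
lemma eq_zero_of_forall_quadratic_nonneg {β q : ℝ} (h : ∀ t : ℝ, 0 ≤ 2 * t * β + t ^ 2 * q) :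
    β = 0 := by
  by_contra hb
  have h1 := h (-β / (|q| + 1))
  have hp : 0 < |q| + 1 := by positivity
  have h2 : 2 * (-β / (|q| + 1)) * β + (-β / (|q| + 1)) ^ 2 * q =
      β ^ 2 / (|q| + 1) ^ 2 * (q - 2 * (|q| + 1)) := by field_simp; ring
  rw [h2] at h1
  have h3 : 0 < β ^ 2 / (|q| + 1) ^ 2 := by positivity
  have h4 : q - 2 * (|q| + 1) < 0 := by linarith [le_abs_self q, abs_nonneg q]
  exact absurd h1 (not_le.2 (mul_neg_of_pos_of_neg h3 h4))

/-- The sum of the squares of the partial derivatives. -/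
noncomputable def gradSq (u : E n → ℝ) (y : E n) : ℝ :=
  ∑ j : Fin n, fderiv ℝ u y (EuclideanSpace.single j 1) * fderiv ℝ u y (EuclideanSpace.single j 1)

lemma gradSq_nonneg (u : E n → ℝ) (y : E n) : 0 ≤ gradSq u y :=
  Finset.sum_nonneg fun _ _ => mul_self_nonneg _

lemma gradSq_le {u : E n → ℝ} {y : E n} {C : ℝ} (h : ‖fderiv ℝ u y‖ ≤ C) :
    gradSq u y ≤ n * C ^ 2 := by
  have : ∀ j : Fin n, fderiv ℝ u y (EuclideanSpace.single j 1) *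
      fderiv ℝ u y (EuclideanSpace.single j 1) ≤ C ^ 2 := fun j => by
    have h1 := (fderiv ℝ u y).le_of_opNorm_le h (EuclideanSpace.single j 1)
    simp only [PiLp.norm_single, norm_one, mul_one, Real.norm_eq_abs] at h1
    nlinarith [abs_le.1 h1]
  calc _ ≤ ∑ j : Fin n, C ^ 2 := Finset.sum_le_sum fun j _ => this j
    _ = _ := by simp

lemma D2_sum {ι : Type*} (s : Finset ι) {f : ι → E n → ℝ} {x : E n}
    (hf : ∀ i ∈ s, ContDiffAt ℝ 2 (f i) x) (v : E n) :
    D2 (fun y => ∑ i ∈ s, f i y) x v v = ∑ i ∈ s, D2 (f i) x v v := by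
  classical
  induction s using Finset.induction_on with
  | empty => simp [D2]
  | insert a s ha ih =>
    simp only [Finset.sum_insert ha]
    rw [← ih fun i hi => hf i (Finset.mem_insert_of_mem hi),
      D2_add (hf a (Finset.mem_insert_self a s))
        (ContDiffAt.sum fun i hi => hf i (Finset.mem_insert_of_mem hi))]
    rfl

/-- Adding a|Du|² to the tested quantity yields the good term 2l_i². The third derivatives that come
with it are later summed by the linearised equation. -/
lemma gradSq_derivatives {u : E n → ℝ} {x : E n} (hu : ContDiffAt ℝ 3 u x) {v : Fin n → E n}
    {l : Fin n → ℝ} (hv : IsEigenframe (D2 u x) v l) (i : Fin n) :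
    ContDiffAt ℝ 2 (gradSq u) x ∧
    fderiv ℝ (gradSq u) x (v i) = 2 * (l i * fderiv ℝ u x (v i)) ∧
    D2 (gradSq u) x (v i) (v i) = 2 * l i ^ 2 + 2 * ∑ j : Fin n,
      fderiv ℝ u x (EuclideanSpace.single j 1) *
        D2 (fun y => fderiv ℝ u y (EuclideanSpace.single j 1)) x (v i) (v i) := by
  have hu2 : ContDiffAt ℝ 2 u x := hu.of_le (by norm_num)
  have hc : ∀ z : E n, ContDiffAt ℝ 2 (fun y => fderiv ℝ u y z) x := fun z =>
    (hu.fderiv_right (m := 2) (by norm_num)).clm_apply contDiffAt_const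
  have hcc : ∀ z : E n, ContDiffAt ℝ 2 (fun y => fderiv ℝ u y z * fderiv ℝ u y z) x := fun z =>
    (hc z).mul (hc z)
  have hexp : ∀ w : E n, w = ∑ j, w j • EuclideanSpace.single j (1:ℝ) := fun w => by
    have := (EuclideanSpace.basisFun (Fin n) ℝ).sum_repr w
    simpa using this.symm
  have hvj : ∀ j, D2 u x (v i) (EuclideanSpace.single j 1) = l i * (v i) j := fun j => by
    rw [hv.apply_eq, EuclideanSpace.inner_single_right]; simp
  refine ⟨ContDiffAt.sum fun j _ => hcc _, ?_, ?_⟩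
  · have h1 : HasFDerivAt (gradSq u) _ x := HasFDerivAt.fun_sum (u := Finset.univ)
      fun j _ => ((hc (EuclideanSpace.single j 1)).differentiableAt (by norm_num)).hasFDerivAt.fun_mul
        ((hc (EuclideanSpace.single j 1)).differentiableAt (by norm_num)).hasFDerivAt
    rw [h1.fderiv]
    conv_rhs => rw [hexp (v i)]
    simp only [FunLike.coe_sum, Finset.sum_apply, add_apply, smul_apply, smul_eq_mul,
      (hasFDerivAt_fderiv_apply hu2 _ _).2, hvj, map_sum, map_smul, Finset.mul_sum]
    exact Finset.sum_congr rfl fun j _ => by ring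
  · unfold gradSq
    rw [D2_sum _ fun j _ => hcc _]
    have h1 : ∀ j : Fin n, D2 (fun y => fderiv ℝ u y (EuclideanSpace.single j 1) *
        fderiv ℝ u y (EuclideanSpace.single j 1)) x (v i) (v i) =
        2 * (fderiv ℝ u x (EuclideanSpace.single j 1) *
        D2 (fun y => fderiv ℝ u y (EuclideanSpace.single j 1)) x (v i) (v i)) +
        2 * l i ^ 2 * ((v i) j) ^ 2 := fun j => by
      rw [D2_mul (hc _) (hc _), (hasFDerivAt_fderiv_apply hu2 _ _).2, hvj]; ring
    rw [Finset.sum_congr rfl fun j _ => h1 j, Finset.sum_add_distrib, ← Finset.mul_sum,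
      ← Finset.mul_sum]
    have : ∑ j, (v i) j ^ 2 = 1 := by
      have := EuclideanSpace.real_norm_sq_eq (v i)
      rw [hv.orthonormal.1 i] at this
      rw [← this]; norm_num
    rw [this]; ring

end KHessian

namespace KHessian

variable {n : ℕ}

/-- The comparison function for the second derivatives in the boundary strip. -/
noncomputable def stripTest (N a : ℝ) (F B : ℝ → ℝ) (ρ G : E n → ℝ) (ξ₀ x₀ : E n)
    (A : E n →L[ℝ] E n) (y : E n) : ℝ :=
  N * (F (ρ y) * (fderiv ℝ ρ y (ξ₀ + A (y - x₀)) * fderiv ℝ ρ y (ξ₀ + A (y - x₀))) +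
    B (ρ y) * ‖ξ₀ + A (y - x₀)‖ ^ 2) + -a * (G y * ‖ξ₀ + A (y - x₀)‖ ^ 2)

lemma D2_stripTest {N a : ℝ} {F F' B B' : ℝ → ℝ} {F'' B'' : ℝ} {ρ G : E n → ℝ} {ξ₀ x₀ : E n}
    (A : E n →L[ℝ] E n) (hρ : ContDiffAt ℝ 3 ρ x₀) (hG : ContDiffAt ℝ 2 G x₀)
    (hFc : ContDiffAt ℝ 2 F (ρ x₀)) (hF : ∀ᶠ t in 𝓝 (ρ x₀), HasDerivAt F (F' t) t)
    (hF' : HasDerivAt F' F'' (ρ x₀)) (hBc : ContDiffAt ℝ 2 B (ρ x₀))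
    (hB : ∀ᶠ t in 𝓝 (ρ x₀), HasDerivAt B (B' t) t) (hB' : HasDerivAt B' B'' (ρ x₀)) (v : E n) :
    ContDiffAt ℝ 2 (stripTest N a F B ρ G ξ₀ x₀ A) x₀ ∧
    D2 (stripTest N a F B ρ G ξ₀ x₀ A) x₀ v v =
      N * (F (ρ x₀) * (2 * fderiv ℝ ρ x₀ ξ₀ * (D2 (fun y => fderiv ℝ ρ y ξ₀) x₀ v v +
            2 * D2 ρ x₀ v (A v)) + 2 * (D2 ρ x₀ v ξ₀ + fderiv ℝ ρ x₀ (A v)) ^ 2) +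
          2 * (F' (ρ x₀) * fderiv ℝ ρ x₀ v) *
            (2 * fderiv ℝ ρ x₀ ξ₀ * (D2 ρ x₀ v ξ₀ + fderiv ℝ ρ x₀ (A v))) +
          fderiv ℝ ρ x₀ ξ₀ ^ 2 * (F'' * fderiv ℝ ρ x₀ v ^ 2 + F' (ρ x₀) * D2 ρ x₀ v v) +
        (B (ρ x₀) * (2 * ‖A v‖ ^ 2) + 2 * (B' (ρ x₀) * fderiv ℝ ρ x₀ v) * (2 * inner ℝ ξ₀ (A v)) +
          ‖ξ₀‖ ^ 2 * (B'' * fderiv ℝ ρ x₀ v ^ 2 + B' (ρ x₀) * D2 ρ x₀ v v))) -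
      a * (G x₀ * (2 * ‖A v‖ ^ 2) + 2 * fderiv ℝ G x₀ v * (2 * inner ℝ ξ₀ (A v)) +
          ‖ξ₀‖ ^ 2 * D2 G x₀ v v) := by
  have hρ2 : ContDiffAt ℝ 2 ρ x₀ := hρ.of_le (by norm_num)
  obtain ⟨cη, dη, ddη⟩ := fderiv_directional hρ ξ₀ A v
  obtain ⟨cq, dq, ddq⟩ := D2_norm_sq_affine ξ₀ x₀ A v
  have cF : ContDiffAt ℝ 2 (fun y => F (ρ y)) x₀ := hFc.comp x₀ hρ2
  have cB : ContDiffAt ℝ 2 (fun y => B (ρ y)) x₀ := hBc.comp x₀ hρ2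
  have dF : fderiv ℝ (fun y => F (ρ y)) x₀ v = F' (ρ x₀) * fderiv ℝ ρ x₀ v := by
    have := (hF.self_of_nhds.comp_hasFDerivAt x₀
      (hρ2.differentiableAt (by norm_num)).hasFDerivAt).fderiv
    change fderiv ℝ (F ∘ ρ) x₀ v = _
    rw [this]; simp
  have dB : fderiv ℝ (fun y => B (ρ y)) x₀ v = B' (ρ x₀) * fderiv ℝ ρ x₀ v := by
    have := (hB.self_of_nhds.comp_hasFDerivAt x₀
      (hρ2.differentiableAt (by norm_num)).hasFDerivAt).fderiv
    change fderiv ℝ (B ∘ ρ) x₀ v = _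
    rw [this]; simp
  set η : E n → ℝ := fun y => fderiv ℝ ρ y (ξ₀ + A (y - x₀)) with hη
  set q : E n → ℝ := fun y => ‖ξ₀ + A (y - x₀)‖ ^ 2 with hq
  have hη0 : η x₀ = fderiv ℝ ρ x₀ ξ₀ := by simp [hη]
  have hq0 : q x₀ = ‖ξ₀‖ ^ 2 := by simp [hq]
  have cηη := cη.mul cη
  have dηη : fderiv ℝ (fun y => η y * η y) x₀ v = 2 * η x₀ * fderiv ℝ η x₀ v := by
    rw [((cη.differentiableAt (by norm_num)).hasFDerivAt.fun_mul
      (cη.differentiableAt (by norm_num)).hasFDerivAt).fderiv]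
    simp; ring
  have c1 := cF.mul cηη
  have c2 := cB.mul cq
  have c3 := hG.mul cq
  have c12 := c1.add c2
  refine ⟨(contDiffAt_const.mul c12).add (contDiffAt_const.mul c3), ?_⟩
  have e0 : stripTest N a F B ρ G ξ₀ x₀ A = fun y => N * (F (ρ y) * (η y * η y) + B (ρ y) * q y) +
    -a * (G y * q y) := rfl
  rw [e0, D2_add (contDiffAt_const.mul c12) (contDiffAt_const.mul c3), D2_const_mul c12,
    D2_const_mul c3, D2_add c1 c2]
  change N * (D2 (fun y => F (ρ y) * (η y * η y)) x₀ v v + D2 (fun y => B (ρ y) * q y) x₀ v v) +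
    -a * D2 (fun y => G y * q y) x₀ v v = _
  rw [D2_mul cF cηη, D2_mul cB cq, D2_mul hG cq, D2_mul cη cη, D2_comp_real hρ2 hFc hF hF',
    D2_comp_real hρ2 hBc hB hB', dF, dB, dηη, ddq, ddη, dη, dq, hη0, hq0]
  ring

/-- The function `α` of the distance to the boundary. -/
noncomputable def stripAlpha (Λ θ ε t : ℝ) : ℝ := (1 / Λ + θ * Real.log ((ε + t) / ε))⁻¹

/-- The function `b` of the distance to the boundary. -/
noncomputable def stripB (K ε t : ℝ) : ℝ := ε + t - K * t ^ 2

lemma stripAlpha_pos {Λ θ ε t : ℝ} (hΛ : 0 < Λ) (hθ : 0 ≤ θ) (hε : 0 < ε) (ht : 0 ≤ t) :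
    0 < stripAlpha Λ θ ε t := by
  unfold stripAlpha
  have : 0 ≤ Real.log ((ε + t) / ε) := Real.log_nonneg (by rw [le_div_iff₀ hε]; linarith)
  positivity

/-- The logarithm is chosen so that α' = -θα²/(ε + t). With this law the quantity α(ρ)∂_ξρ can be
made stationary at the contact point by a field with ∂_v∂_ξρ = θ/(ε+ρ) · α∂_ξρ · ∂_vρ. -/
lemma stripAlpha_derivatives {Λ θ ε t : ℝ} (hΛ : 0 < Λ) (hθ : 0 ≤ θ) (hε : 0 < ε) (ht : 0 < t) :
    ContDiffAt ℝ 2 (stripAlpha Λ θ ε) t ∧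
    (∀ᶠ r in 𝓝 t, HasDerivAt (stripAlpha Λ θ ε) (-(θ / (ε + r)) * stripAlpha Λ θ ε r ^ 2) r) ∧
    HasDerivAt (fun r => -(θ / (ε + r)) * stripAlpha Λ θ ε r ^ 2)
      (2 * (θ / (ε + t)) ^ 2 * stripAlpha Λ θ ε t ^ 3 +
        θ / (ε + t) ^ 2 * stripAlpha Λ θ ε t ^ 2) t := by
  have hd : ∀ r > 0, HasDerivAt (stripAlpha Λ θ ε) (-(θ / (ε + r)) * stripAlpha Λ θ ε r ^ 2) r := by
    intro r hr
    have hp := stripAlpha_pos hΛ hθ hε hr.le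
    have hne : 1 / Λ + θ * Real.log ((ε + r) / ε) ≠ 0 := by
      have := hp.ne'; unfold stripAlpha at this; exact fun h => this (by rw [h, inv_zero])
    have h1 : HasDerivAt (fun r => (ε + r) / ε) (1 / ε) r :=
      ((hasDerivAt_id r).const_add ε).div_const ε
    have h2 := ((((h1.log (by positivity)).const_mul θ).const_add (1 / Λ)).inv hne)
    refine h2.congr_deriv ?_
    unfold stripAlpha
    have : 0 < ε + r := by linarith
    field_simp
  refine ⟨?_, (lt_mem_nhds ht).mono hd, ?_⟩
  · unfold stripAlpha
    refine ContDiffAt.inv ?_ ?_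
    · refine contDiffAt_const.add (contDiffAt_const.mul (ContDiffAt.log ?_ (by positivity)))
      exact (contDiffAt_const.add contDiffAt_id).div_const ε
    · have := (stripAlpha_pos hΛ hθ hε ht.le).ne'; unfold stripAlpha at this
      exact fun h => this (by rw [h, inv_zero])
  · have h0 : ε + t ≠ 0 := by positivity
    have h1 : HasDerivAt (fun r => θ / (ε + r)) (-(θ / (ε + t) ^ 2)) t := by
      have := (hasDerivAt_const t θ).div ((hasDerivAt_id t).const_add ε) h0
      refine this.congr_deriv ?_
      simp; ring
    refine (h1.neg.mul ((hd t ht).pow 2)).congr_deriv ?_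
    simp
    field_simp
    ring

lemma stripB_derivatives (K ε t : ℝ) :
    ContDiffAt ℝ 2 (stripB K ε) t ∧
    (∀ᶠ r in 𝓝 t, HasDerivAt (stripB K ε) (1 - 2 * K * r) r) ∧
    HasDerivAt (fun r => 1 - 2 * K * r) (-(2 * K)) t := by
  refine ⟨?_, Eventually.of_forall fun r => ?_, ?_⟩
  · unfold stripB; fun_prop
  · have := ((hasDerivAt_id r).const_add ε).sub (((hasDerivAt_pow 2 r)).const_mul K)
    refine this.congr_deriv ?_
    simp; ring
  · have := ((hasDerivAt_id t).const_mul (2 * K)).const_sub 1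
    simpa using this

/-- A function comparable to the distance to the boundary, strictly `k`-concave near it. -/
structure IsBarrier (k : ℕ) (Ω V : Set (E n)) (ρ : E n → ℝ) (ρ₁ c₀ C₀ : ℝ) : Prop where
  isOpen : IsOpen V
  continuousOn : ContinuousOn ρ (closure Ω)
  pos : ∀ x ∈ Ω, 0 < ρ x
  zero : ∀ x ∈ frontier Ω, ρ x = 0
  strip : ∀ x ∈ closure Ω, ρ x ≤ ρ₁ → x ∈ V
  contDiffOn : ContDiffOn ℝ 3 ρ V
  norm_le : ∀ x ∈ V, ‖fderiv ℝ ρ x‖ ≤ C₀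
  le_norm : ∀ x ∈ V, 1 ≤ C₀ * ‖fderiv ℝ ρ x‖
  second_le : ∀ x ∈ V, ∀ v w, |D2 ρ x v w| ≤ C₀ * ‖v‖ * ‖w‖
  third_le : ∀ x ∈ V, ∀ ξ v, |D2 (fun y => fderiv ℝ ρ y ξ) x v v| ≤ C₀ * ‖ξ‖ * ‖v‖ ^ 2
  concave : ∀ x ∈ V, ∀ B, IsConeForm k B → ∀ v l, IsEigenframe B v l →
    ∑ i, gw k l i * D2 ρ x (v i) (v i) ≤ -c₀ * ∑ i, gw k l i

/-- A solution of `σ_k(D²u)^{1/k} = h` with a controlled right hand side. -/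
structure IsControlled (k : ℕ) (Ω : Set (E n)) (u h : E n → ℝ) (p' : E n → E n →L[ℝ] ℝ)
    (C₁ : ℝ) : Prop where
  isOpen : IsOpen Ω
  contDiffOn : ContDiffOn ℝ 3 u Ω
  cone : ∀ x ∈ Ω, IsConeForm k (D2 u x)
  eq : ∀ x ∈ Ω, sigma k (formMatrix (D2 u x)) ^ (1 / (k : ℝ)) = h x
  h_le : ∀ x ∈ Ω, h x ≤ C₁
  p_le : ∀ x ∈ Ω, ‖p' x‖ ≤ C₁
  p_cont : ∀ x ∈ Ω, ContinuousAt p' x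
  semi : ∀ x ∈ Ω, ∃ κ : ℝ,
    (∀ᶠ p in 𝓝 (x, x), h p.1 + p' p.1 (p.2 - p.1) - κ / 2 * ‖p.2 - p.1‖ ^ 2 ≤ h p.2) ∧
    ∀ v l w, IsEigenframe (D2 u x) v l → ‖w‖ = 1 → 1 ≤ D2 u x w w → κ ≤ C₁ * ∑ i, gw k l i

end KHessian

namespace KHessian

variable {n : ℕ}

/-- The difference of the two sides is a nonnegative quadratic form vanishing at ξ, so ξ lies in its
kernel. This is the first order condition in the direction variable, and it relates each eigenvalue
to N. -/
lemma bilinear_eq_of_forall_le {H : Form n} (hH : IsSymmForm H) {L : E n →L[ℝ] ℝ} {ξ : E n}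
    {g N α b : ℝ} (hle : ∀ z, H z z + g * ‖z‖ ^ 2 ≤ N * (α * L z ^ 2 + b * ‖z‖ ^ 2))
    (heq : H ξ ξ + g * ‖ξ‖ ^ 2 = N * (α * L ξ ^ 2 + b * ‖ξ‖ ^ 2)) (v : E n) :
    H ξ v + g * inner ℝ ξ v = N * (α * L ξ * L v + b * inner ℝ ξ v) := by
  have := eq_zero_of_forall_quadratic_nonneg
    (β := N * (α * L ξ * L v + b * inner ℝ ξ v) - (H ξ v + g * inner ℝ ξ v))
    (q := N * (α * L v ^ 2 + b * ‖v‖ ^ 2) - (H v v + g * ‖v‖ ^ 2)) fun t => by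
    have h1 := hle (ξ + t • v)
    have e1 : H (ξ + t • v) (ξ + t • v) = H ξ ξ + 2 * t * H ξ v + t ^ 2 * H v v := by
      simp only [map_add, map_smul, add_apply, smul_apply, smul_eq_mul]
      rw [hH v ξ]; ring
    have e2 : ‖ξ + t • v‖ ^ 2 = ‖ξ‖ ^ 2 + 2 * t * inner ℝ ξ v + t ^ 2 * ‖v‖ ^ 2 := by
      rw [norm_add_sq_real, inner_smul_right, norm_smul, mul_pow, Real.norm_eq_abs, sq_abs]; ring
    rw [e1, e2, map_add, map_smul, smul_eq_mul] at h1
    linarith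
  linarith

lemma norm_single_le_of_norm_le {L : E n →L[ℝ] ℝ} {C : ℝ} (h : ‖L‖ ≤ C) {v : E n} (hv : ‖v‖ = 1) :
    |L v| ≤ C := by
  have := L.le_of_opNorm_le h v
  rwa [hv, mul_one, Real.norm_eq_abs] at this

/-- Regroups the second derivative of the test function in a frame direction. The multiples of r =
D²ρ(v,v) are collected for the concavity of the barrier, the third derivatives J for the linearised
equation, and the rest is what `strip_pointwise` estimates. -/
lemma strip_identity {N a α η w γ e c d₃ m r p τ b b' x y sv lam g G J K : ℝ} (hw : w = α * η)
    (hc : c = γ * w - e) :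
    N * (α * (2 * η * (d₃ + 2 * (c * r + m)) + 2 * (γ * w * p) ^ 2) +
          2 * (-γ * α ^ 2 * p) * (2 * η * (γ * w * p)) +
          η ^ 2 * ((2 * γ ^ 2 * α ^ 3 + τ * α ^ 2) * p ^ 2 + -γ * α ^ 2 * r) +
        (b * (2 * (c ^ 2 + sv)) + 2 * (b' * p) * (2 * (c * x + y)) +
          1 ^ 2 * (-(2 * K) * p ^ 2 + b' * r))) -
      a * (G * (2 * (c ^ 2 + sv)) + 2 * (2 * (lam * g)) * (2 * (c * x + y)) +
          1 ^ 2 * (2 * lam ^ 2 + 2 * J)) + 2 * lam * (c ^ 2 - sv) =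
    N * (3 * γ * w ^ 2 + b') * r +
      (N * (2 * w * (d₃ + 2 * m - 2 * e * r) + τ * w ^ 2 * p ^ 2 - 2 * K * p ^ 2 +
        4 * b' * p * (c * x + y) + 2 * b * (c ^ 2 + sv)) -
      a * (2 * lam ^ 2 + 8 * lam * g * (c * x + y) + 2 * G * (c ^ 2 + sv)) - 2 * lam * sv) -
      2 * a * J + 2 * c ^ 2 * lam := by
  subst hc; subst hw; ring

/-- After summation the barrier contributes -βc₀T, of which the pointwise error uses up N c₀(γw² +
1/2)T. A surplus of at least N c₀(2γw² + 1/4)T remains. The first part absorbs the c² terms and the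
second the constants, since T ≥ 1 and N is large. -/
lemma strip_contradiction {N M c₀ ε θ s C₁ C c e γ w κ T P SR SJ SL b' a m R β : ℝ}
    (hvisc : -κ * 1 ^ 2 + 4 * c * P ≤ R)
    (hR : R ≤ β * SR + N * c₀ * (γ * w ^ 2 + 1 / 2) * T - 2 * a * SJ + 2 * c ^ 2 * SL)
    (hβ : β = N * (3 * γ * w ^ 2 + b')) (hb' : 3 / 4 ≤ b') (hκ : κ ≤ C₁ * T) (hT : 1 ≤ T)
    (hSR : SR ≤ -c₀ * T) (hP : |P| ≤ C₁) (hSJ : |SJ| ≤ m * C₁ * C) (hSL : SL ≤ C₁)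
    (hc : c = γ * w - e) (he : |e| ≤ C) (hγs : γ * s = θ) (hγ : 0 < γ) (hs : 0 < s) (hεs : ε ≤ s)
    (ha0 : 0 ≤ a) (ha1 : a ≤ 1) (hm : 0 ≤ m) (hC₁ : 0 ≤ C₁) (hC : 0 ≤ C) (hc₀ : 0 < c₀)
    (hM : 0 < M) (hMN : M ≤ N) (hM4 : 4 * C₁ * θ ≤ M * c₀ * ε) (hε : 0 < ε)
    (hM5 : 3 * C₁ + 2 * m * C₁ * C + 8 * C₁ * C ^ 2 < M * c₀ / 4) : False := by
  have hN : 0 < N := hM.trans_le hMN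
  have hβ0 : 0 ≤ β := by
    have : 0 ≤ 3 * γ * w ^ 2 := by positivity
    rw [hβ]; refine mul_nonneg hN.le ?_; linarith only [this, hb']
  have hbr' := mul_le_mul_of_nonneg_left hSR hβ0
  have hcp : -(4 * c * P) ≤ 2 * C₁ + 2 * C₁ * c ^ 2 := by
    have h1 : |4 * c * P| ≤ 4 * |c| * C₁ := by
      rw [abs_mul, abs_mul, abs_of_pos (by norm_num : (0:ℝ) < 4)]; gcongr
    have h2 := neg_abs_le (4 * c * P)
    have h3 : 2 * |c| ≤ 1 + c ^ 2 := by rw [← sq_abs]; linarith only [sq_nonneg (|c| - 1)]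
    have h4 := mul_le_mul_of_nonneg_right h3 (by positivity : 0 ≤ 2 * C₁)
    linarith only [h1, h2, h4]
  have hJa : -(2 * a * SJ) ≤ 2 * (m * C₁ * C) := by
    have h1 := (abs_le.1 hSJ).1
    have h2 : 0 ≤ m * C₁ * C := by positivity
    have h3 := mul_le_mul_of_nonneg_left h1 ha0
    have h4 := mul_le_mul_of_nonneg_right ha1 h2
    linarith only [h3, h4]
  have hch : 2 * c ^ 2 * SL ≤ 2 * c ^ 2 * C₁ := by gcongr
  have hcsq : c ^ 2 ≤ 2 * γ ^ 2 * w ^ 2 + 2 * C ^ 2 := by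
    have e2 : e ^ 2 ≤ C ^ 2 := sq_le_sq' (abs_le.1 he).1 (abs_le.1 he).2
    rw [hc]; linarith only [e2, sq_nonneg (γ * w + e)]
  have hγM : 8 * C₁ * γ ^ 2 * w ^ 2 ≤ 2 * N * c₀ * γ * w ^ 2 := by
    have h1 : 4 * C₁ * γ ≤ N * c₀ := by
      have : 4 * C₁ * γ * s ≤ N * c₀ * s := by
        have h2 : M * c₀ * ε ≤ N * c₀ * s := by gcongr
        rw [mul_assoc, hγs]; linarith only [h2, hM4]
      exact le_of_mul_le_mul_right this hs
    have := mul_le_mul_of_nonneg_right h1 (by positivity : 0 ≤ 2 * γ * w ^ 2)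
    linarith only [this]
  have hfin : -(C₁ * T) - (2 * C₁ + 2 * C₁ * c ^ 2) ≤
      β * (-c₀ * T) + N * c₀ * (γ * w ^ 2 + 1 / 2) * T + 2 * (m * C₁ * C) + 2 * c ^ 2 * C₁ := by
    linarith only [hvisc, hR, hκ, hcp, hJa, hch, hbr']
  have hcC := mul_le_mul_of_nonneg_left hcsq (by positivity : 0 ≤ 4 * C₁)
  have hMN' : M * c₀ / 4 ≤ N * c₀ / 4 := by gcongr
  have hX : 3 * C₁ + 2 * m * C₁ * C + 8 * C₁ * C ^ 2 + 8 * C₁ * γ ^ 2 * w ^ 2 <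
      N * c₀ * (2 * γ * w ^ 2 + 1 / 4) := by linarith only [hM5, hMN', hγM]
  have hX0 : 0 ≤ 2 * C₁ + 2 * m * C₁ * C + 8 * C₁ * C ^ 2 + 8 * C₁ * γ ^ 2 * w ^ 2 := by positivity
  have hXT : (3 * C₁ + 2 * m * C₁ * C + 8 * C₁ * C ^ 2 + 8 * C₁ * γ ^ 2 * w ^ 2) * T <
      N * c₀ * (2 * γ * w ^ 2 + 1 / 4) * T := mul_lt_mul_of_pos_right hX (by linarith only [hT])
  have hX1 := mul_le_mul_of_nonneg_left hT hX0
  have hbT : N * c₀ * (2 * γ * w ^ 2 + 1 / 4) * T ≤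
      β * (c₀ * T) - N * c₀ * (γ * w ^ 2 + 1 / 2) * T := by
    have h1 : 2 * γ * w ^ 2 + 1 / 4 ≤ (3 * γ * w ^ 2 + b') - (γ * w ^ 2 + 1 / 2) := by
      linarith only [hb']
    have h2 := mul_le_mul_of_nonneg_left h1 (by positivity : 0 ≤ N * c₀ * T)
    rw [hβ]; linarith only [h2]
  linarith only [hfin, hcC, hXT, hX1, hbT]

set_option maxHeartbeats 2000000 in
-- At a contact point in the strip `viscosity_test` is applied with a field adapted to ρ. Concavity
-- of ρ against the weights then makes the right side too negative to dominate the semiconvexity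
-- error κ ≤ C₁T.
lemma not_isMax_strip {k : ℕ} (hk : 2 ≤ k) (hkn : k ≤ n) {Ω V : Set (E n)} {ρ u h : E n → ℝ}
    {p' : E n → E n →L[ℝ] ℝ} {ρ₁ c₀ C₀ C₁ C ε θ Λ M N a Q : ℝ}
    (hbar : IsBarrier k Ω V ρ ρ₁ c₀ C₀) (hsol : IsControlled k Ω u h p' C₁)
    (hu1 : ∀ x ∈ Ω, ‖fderiv ℝ u x‖ ≤ C) (hc₀ : 0 < c₀) (hC₀ : 1 ≤ C₀) (hCC : 7 * C₀ ^ 3 ≤ C)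
    (hC₁ : 0 ≤ C₁) (hε : 0 < ε) (hθ : 128 * θ = c₀) (hΛ : 0 < Λ)
    (hs1 : (ε + ρ₁) * (64 * C ^ 2) ≤ c₀ ^ 2 * θ) (hs2 : (ε + ρ₁) * (96 * C ^ 2) ≤ c₀)
    (hs3 : 8 * (128 * C ^ 2 / c₀) * ρ₁ ≤ 1)
    (hε1 : 512 * C ^ 4 * ε ^ 2 ≤ c₀ ^ 2) (hQ : Q * (16 * ε ^ 2) = c₀)
    (ha : a * M = Q) (hMN : M ≤ N) (hM0 : 1 ≤ M) (hMQ : Q ≤ M)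
    (hM1 : 256 * Q * C ^ 2 * θ ≤ c₀ * ε * M ^ 2) (hM2 : 4096 * Q * C ^ 4 ≤ c₀ * M ^ 2)
    (hM3 : 1 + n * C ^ 2 ≤ M * ε) (hM4 : 4 * C₁ * θ ≤ M * c₀ * ε)
    (hM5 : 3 * C₁ + 2 * n * C₁ * C + 8 * C₁ * C ^ 2 < M * c₀ / 4)
    {x₀ ξ₀ : E n} (hx₀ : x₀ ∈ Ω) (hρx : ρ x₀ ≤ ρ₁) (hξ : ‖ξ₀‖ = 1)
    (hle : ∀ᶠ y in 𝓝 x₀, ∀ ξ, D2 u y ξ ξ + a * gradSq u y * ‖ξ‖ ^ 2 ≤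
      N * (stripAlpha Λ θ ε (ρ y) * fderiv ℝ ρ y ξ ^ 2 +
        stripB (128 * C ^ 2 / c₀) ε (ρ y) * ‖ξ‖ ^ 2))
    (heq : D2 u x₀ ξ₀ ξ₀ + a * gradSq u x₀ * ‖ξ₀‖ ^ 2 =
      N * (stripAlpha Λ θ ε (ρ x₀) * fderiv ℝ ρ x₀ ξ₀ ^ 2 +
        stripB (128 * C ^ 2 / c₀) ε (ρ x₀) * ‖ξ₀‖ ^ 2)) : False := by
  have hk0 : 0 < k := by omega
  have hxV : x₀ ∈ V := hbar.strip x₀ (subset_closure hx₀) hρx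
  have hρpos := hbar.pos x₀ hx₀
  have hρ3 : ContDiffAt ℝ 3 ρ x₀ := hbar.contDiffOn.contDiffAt (hbar.isOpen.mem_nhds hxV)
  have hρ2 : ContDiffAt ℝ 2 ρ x₀ := hρ3.of_le (by norm_num)
  have hu3 : ContDiffAt ℝ 3 u x₀ := hsol.contDiffOn.contDiffAt (hsol.isOpen.mem_nhds hx₀)
  have hu2 : ContDiffAt ℝ 2 u x₀ := hu3.of_le (by norm_num)
  have hC₀3 : 1 ≤ C₀ ^ 3 := one_le_pow₀ hC₀
  have hC : 1 ≤ C := by linarith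
  have hC₀2 : C₀ ^ 2 ≤ C₀ ^ 3 := pow_le_pow_right₀ hC₀ (by norm_num)
  have hC₀1 : C₀ ≤ C₀ ^ 3 := le_self_pow₀ hC₀ (by norm_num)
  set K := 128 * C ^ 2 / c₀ with hK
  have hK0 : 0 < K := by positivity
  have hM : 0 < M := by linarith
  have hN : 0 < N := by linarith
  have hQ0 : 0 < Q := pos_of_mul_pos_left (hQ ▸ hc₀) (by positivity)
  have ha0 : 0 < a := pos_of_mul_pos_left (ha ▸ hQ0) hM.le
  have ha1 : a ≤ 1 := by
    have : a * M ≤ 1 * M := by rw [ha]; linarith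
    exact le_of_mul_le_mul_right this hM
  set L := fderiv ℝ ρ x₀ with hL
  set G := gradSq u x₀ with hG
  have hG0 : 0 ≤ G := gradSq_nonneg u x₀
  have hGle : G ≤ n * C ^ 2 := gradSq_le (hu1 x₀ hx₀)
  set r₀ := ρ x₀ with hr₀
  set s := ε + r₀ with hs
  have hs0 : 0 < s := by positivity
  set α := stripAlpha Λ θ ε r₀ with hα
  have hθ0 : 0 < θ := by linarith
  have hα0 : 0 < α := stripAlpha_pos hΛ hθ0.le hε hρpos.le
  set b := stripB K ε r₀ with hb
  have hKr : 8 * K * r₀ ≤ 1 := by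
    have : 8 * K * r₀ ≤ 8 * K * ρ₁ := by gcongr
    linarith
  have hbε : ε ≤ b := by
    rw [hb]; unfold stripB
    have := mul_le_mul_of_nonneg_right hKr hρpos.le
    linarith only [this, hρpos]
  have hbs : b ≤ s := by
    rw [hb, hs]; unfold stripB
    have : 0 ≤ K * r₀ ^ 2 := by positivity
    linarith
  -- Equality at the contact point, b ≥ ε and Nε ≥ 1 + nC² make ξ₀ a direction with D²u ≥ 1, which
  -- is the condition under which κ is controlled by T.
  have hD1 : 1 ≤ D2 u x₀ ξ₀ ξ₀ := by
    have h1 : 0 ≤ N * (α * L ξ₀ ^ 2) := by positivity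
    have h2 : M * ε ≤ N * b := by gcongr
    have h3 : a * G ≤ 1 * (n * C ^ 2) := by gcongr
    rw [hξ] at heq
    linarith
  obtain ⟨e, S, he, hSskew, hSL, hSn⟩ := exists_rotation (L := L) (H := D2 ρ x₀ ξ₀) (C := C₀)
    (by linarith) (hbar.le_norm x₀ hxV) (ContinuousLinearMap.opNorm_le_bound _ (by linarith)
      fun v => by simpa [hξ] using hbar.second_le x₀ hxV ξ₀ v)
  set w := α * L ξ₀ with hw
  set γ := θ / s with hγ
  have hγs : γ * s = θ := by rw [hγ]; field_simp
  have hγ0 : 0 < γ := by positivity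
  -- The rotation turns D²ρ(ξ₀, v) + Dρ(Sv) into eDρ(v). The dilation c corrects the factor e to γw,
  -- which is the value that makes α(ρ)∂_ξρ stationary at x₀.
  set c := γ * w - e with hc
  set A : E n →L[ℝ] E n := c • (1 : E n →L[ℝ] E n) + S with hA
  have hAv : ∀ v, A v = c • v + S v := fun v => by simp [hA]
  have hSv0 : ∀ v, inner ℝ v (S v) = 0 := fun v => by
    have := hSskew v v
    rw [real_inner_comm] at this; linarith
  have hconf : ∀ v w, inner ℝ (A v) w + inner ℝ v (A w) = 2 * c * inner ℝ v w := fun v w => by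
    rw [hAv, hAv, inner_add_left, inner_add_right, inner_smul_left, inner_smul_right, hSskew]
    simp only [conj_trivial]; ring
  obtain ⟨κ, hsemi, hκ⟩ := hsol.semi x₀ hx₀
  obtain ⟨cα, dα, ddα⟩ := stripAlpha_derivatives hΛ hθ0.le hε hρpos
  obtain ⟨cb, db, ddb⟩ := stripB_derivatives K ε r₀
  obtain ⟨v₁, l₁, hv₁⟩ := (hsol.cone x₀ hx₀).symm.exists_eigenframe
  have hGc : ContDiffAt ℝ 2 (gradSq u) x₀ :=
    ContDiffAt.sum fun j _ => ((hu3.fderiv_right (m := 2) (by norm_num)).clm_apply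
      contDiffAt_const).mul ((hu3.fderiv_right (m := 2) (by norm_num)).clm_apply contDiffAt_const)
  have hψ := D2_stripTest (N := N) (a := a) (ξ₀ := ξ₀) A hρ3 hGc cα dα ddα cb db ddb
  obtain ⟨v, l, hvl, hvisc⟩ := viscosity_test hk0 hsol.isOpen hsol.contDiffOn hsol.cone hsol.eq hx₀
    hconf (hψ 0).1 (by
      filter_upwards [hle] with y hy
      have := hy (ξ₀ + A (y - x₀))
      unfold stripTest
      linarith) (by
      unfold stripTest
      simp only [sub_self, map_zero, add_zero]
      linarith) (hsol.p_cont x₀ hx₀) hsemi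
  set T := ∑ i, gw k l i with hT
  have hT1 : 1 ≤ T := hvl.one_le_sum_gw hk0 hkn (hsol.cone x₀ hx₀)
  have hgp := fun i => hvl.gw_pos hk0 (hsol.cone x₀ hx₀) i
  have hκT := hκ v l ξ₀ hvl hξ hD1
  set β := N * (3 * γ * w ^ 2 + (1 - 2 * K * r₀)) with hβ
  set J : Fin n → ℝ := fun i => ∑ j : Fin n, fderiv ℝ u x₀ (EuclideanSpace.single j 1) *
        D2 (fun y => fderiv ℝ u y (EuclideanSpace.single j 1)) x₀ (v i) (v i) with hJ
  have hpt : ∀ i, D2 (stripTest N a (stripAlpha Λ θ ε) (stripB K ε) ρ (gradSq u) ξ₀ x₀ A) x₀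
      (v i) (v i) + 2 * l i * inner ℝ (v i) (A (A (v i))) ≤
      β * D2 ρ x₀ (v i) (v i) + N * c₀ * (γ * w ^ 2 + 1 / 2) - 2 * a * J i + 2 * c ^ 2 * l i := by
    intro i
    have hvi : ‖v i‖ = 1 := hvl.orthonormal.1 i
    obtain ⟨-, dG, ddG⟩ := gradSq_derivatives hu3 hvl i
    have e1 : D2 ρ x₀ (v i) ξ₀ + L (A (v i)) = γ * w * L (v i) := by
      rw [hAv, map_add, map_smul, smul_eq_mul, isSymmForm_D2 hρ2 (v i) ξ₀]
      have := hSL (v i)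
      rw [hc]; linarith
    have e2 : D2 ρ x₀ (v i) (A (v i)) = c * D2 ρ x₀ (v i) (v i) + D2 ρ x₀ (v i) (S (v i)) := by
      rw [hAv, map_add, map_smul, smul_eq_mul]
    have e3 : ‖A (v i)‖ ^ 2 = c ^ 2 + ‖S (v i)‖ ^ 2 := by
      rw [hAv, norm_add_sq_real, inner_smul_left, hSv0, norm_smul, hvi, mul_one, Real.norm_eq_abs,
        sq_abs]; simp
    have e4 : inner ℝ ξ₀ (A (v i)) = c * inner ℝ ξ₀ (v i) + inner ℝ ξ₀ (S (v i)) := by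
      rw [hAv, inner_add_right, inner_smul_right]
    have e5 : inner ℝ (v i) (A (A (v i))) = c ^ 2 - ‖S (v i)‖ ^ 2 := by
      have h1 : inner ℝ (v i) (A (A (v i))) = 2 * c * inner ℝ (v i) (A (v i)) -
        inner ℝ (A (v i)) (A (v i)) := by have := hconf (v i) (A (v i)); linarith
      rw [h1, real_inner_self_eq_norm_sq, e3, hAv, inner_add_right, inner_smul_right, hSv0,
        real_inner_self_eq_norm_sq, hvi]; ring
    have hcrit := bilinear_eq_of_forall_le (hsol.cone x₀ hx₀).symm hle.self_of_nhds heq (v i)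
    rw [(hsol.cone x₀ hx₀).symm ξ₀ (v i), hvl.apply_eq, real_inner_comm ξ₀ (v i)] at hcrit
    have hSb : ‖S (v i)‖ ≤ 2 * C₀ ^ 2 := by simpa [hvi] using hSn (v i)
    have hSC : ‖S (v i)‖ ≤ C := by linarith
    have hmain := strip_pointwise (N := N) (M := M) (w := w) (p := L (v i))
      (d := D2 (fun y => fderiv ℝ ρ y ξ₀) x₀ (v i) (v i) + 2 * D2 ρ x₀ (v i) (S (v i)) -
        2 * e * D2 ρ x₀ (v i) (v i)) (x := inner ℝ ξ₀ (v i)) (y := inner ℝ ξ₀ (S (v i)))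
      (sv := ‖S (v i)‖ ^ 2) (lam := l i) (g := fderiv ℝ u x₀ (v i)) (e := e) (b := b)
      (b' := 1 - 2 * K * r₀) (bt := b - a * G / N) (c := c) (a := a) (s := s) (θ := θ) (ε := ε)
      (C := C) (c₀ := c₀) (γ := γ) (Q := Q) (G := G) hε (by linarith) hγs hθ hc₀ hC hc
      (he.trans (by linarith)) ((abs_real_inner_le_norm _ _).trans (by rw [hξ, one_mul]; exact hSC))
      (sq_nonneg _) (pow_le_pow_left₀ (norm_nonneg _) hSC 2)
      ((abs_real_inner_le_norm _ _).trans (by rw [hξ, hvi, one_mul]))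
      (norm_single_le_of_norm_le (hu1 x₀ hx₀) hvi) (by linarith)
      (by have : 0 ≤ K * r₀ := by positivity
          linarith) (by linarith) hbs
      (by
        have h1 : a * G / N ≤ ε := by
          rw [div_le_iff₀ hN]
          have h3 : a * G ≤ 1 * (n * C ^ 2) := by gcongr
          have h4 : M * ε ≤ N * ε := by gcongr
          linarith
        have h2 : 0 ≤ a * G / N := by positivity
        rw [abs_le]; constructor <;> linarith) hG0
      (by
        have b1 := hbar.third_le x₀ hxV ξ₀ (v i)
        have b2 := hbar.second_le x₀ hxV (v i) (S (v i))
        have b3 := hbar.second_le x₀ hxV (v i) (v i)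
        rw [hξ, hvi] at b1
        rw [hvi] at b2 b3
        have b4 : C₀ * 1 * ‖S (v i)‖ ≤ C₀ * 1 * (2 * C₀ ^ 2) := by gcongr
        have b5 : |e * D2 ρ x₀ (v i) (v i)| ≤ C₀ ^ 2 * (C₀ * 1 * 1) := by
          rw [abs_mul]; gcongr
        have b6 := abs_le.1 b1
        have b7 := abs_le.1 (b2.trans b4)
        have b8 := abs_le.1 b5
        rw [abs_le]; constructor <;> linarith)
      (by rw [hw]; field_simp; linarith)
      hM hMN ha hQ
      (by have : s * (64 * C ^ 2) ≤ (ε + ρ₁) * (64 * C ^ 2) := by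
            rw [hs]; gcongr
          linarith)
      (by have : s * (96 * C ^ 2) ≤ (ε + ρ₁) * (96 * C ^ 2) := by
            rw [hs]; gcongr
          linarith) hε1 hM1 hM2
    rw [← hK] at hmain
    have hid := strip_identity (N := N) (a := a) (α := α) (η := L ξ₀) (w := w) (γ := γ) (e := e)
      (c := c) (d₃ := D2 (fun y => fderiv ℝ ρ y ξ₀) x₀ (v i) (v i)) (m := D2 ρ x₀ (v i) (S (v i)))
      (r := D2 ρ x₀ (v i) (v i)) (p := L (v i)) (τ := θ / s ^ 2) (b := b) (b' := 1 - 2 * K * r₀)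
      (x := inner ℝ ξ₀ (v i)) (y := inner ℝ ξ₀ (S (v i))) (sv := ‖S (v i)‖ ^ 2) (lam := l i)
      (g := fderiv ℝ u x₀ (v i)) (G := G) (J := J i) (K := K) hw hc
    rw [(hψ (v i)).2, e1, e2, e3, e4, e5, dG, ddG, hξ]
    refine (le_of_eq hid).trans ?_
    linarith only [hmain]
  have hsum : ∑ i, gw k l i * (D2 (stripTest N a (stripAlpha Λ θ ε) (stripB K ε) ρ (gradSq u) ξ₀ x₀
      A) x₀ (v i) (v i) + 2 * l i * inner ℝ (v i) (A (A (v i)))) ≤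
      β * ∑ i, gw k l i * D2 ρ x₀ (v i) (v i) + N * c₀ * (γ * w ^ 2 + 1 / 2) * T -
        2 * a * ∑ i, gw k l i * J i + 2 * c ^ 2 * ∑ i, gw k l i * l i := by
    rw [hT, Finset.mul_sum, Finset.mul_sum, Finset.mul_sum, Finset.mul_sum,
      ← Finset.sum_add_distrib, ← Finset.sum_sub_distrib, ← Finset.sum_add_distrib]
    refine Finset.sum_le_sum fun i _ => ?_
    have := mul_le_mul_of_nonneg_left (hpt i) (hgp i).le
    linarith
  have hh : ∑ i, gw k l i * l i ≤ C₁ := by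
    rw [hvl.sum_gw_mul hk0 (hsol.cone x₀ hx₀), hsol.eq x₀ hx₀]; exact hsol.h_le x₀ hx₀
  -- The linearised equation replaces the weighted third derivatives of u by p'(e_j), so the sum is
  -- of the size of |Du||p'|.
  have hJsum : |∑ i, gw k l i * J i| ≤ n * C₁ * C := by
    have h1 : ∑ i, gw k l i * J i = ∑ j : Fin n, fderiv ℝ u x₀ (EuclideanSpace.single j 1) *
        p' x₀ (EuclideanSpace.single j 1) := by
      simp only [hJ, Finset.mul_sum]
      rw [Finset.sum_comm]
      refine Finset.sum_congr rfl fun j _ => ?_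
      have hlin := sum_gw_D2_fderiv (p := p' x₀) (κ := κ) hk0 hu3
        (by filter_upwards [hsol.isOpen.mem_nhds hx₀] with y hy using hsol.cone y hy)
        (by filter_upwards [hsol.isOpen.mem_nhds hx₀] with y hy using hsol.eq y hy)
        (by
          have hc : Tendsto (fun z => (x₀, z)) (𝓝 x₀) (𝓝 (x₀, x₀)) :=
            tendsto_const_nhds.prodMk_nhds tendsto_id
          exact hc.eventually hsemi) hvl (EuclideanSpace.single j 1)
      rw [← hlin, Finset.mul_sum]
      exact Finset.sum_congr rfl fun i _ => by ring
    rw [h1]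
    refine (Finset.abs_sum_le_sum_abs _ _).trans ?_
    calc _ ≤ ∑ j : Fin n, C * C₁ := Finset.sum_le_sum fun j _ => by
          rw [abs_mul]
          exact mul_le_mul (norm_single_le_of_norm_le (hu1 x₀ hx₀) (by simp))
            (norm_single_le_of_norm_le (hsol.p_le x₀ hx₀) (by simp)) (abs_nonneg _) (by linarith)
      _ = _ := by simp; ring
  have hbr := hbar.concave x₀ hxV _ (hsol.cone x₀ hx₀) v l hvl
  have hpξ : |p' x₀ ξ₀| ≤ C₁ := norm_single_le_of_norm_le (hsol.p_le x₀ hx₀) hξ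
  rw [hξ] at hvisc
  exact strip_contradiction hvisc hsum hβ (by linarith only [hKr]) hκT hT1 hbr hpξ hJsum hh hc
    (he.trans (by linarith only [hCC, hC₀2, hC₀3])) hγs hγ0 hs0 (by linarith only [hs, hρpos]) ha0.le ha1
    (Nat.cast_nonneg n) hC₁ (by linarith only [hC]) hc₀ hM hMN hM4 hε hM5

end KHessian

/-! ### Functions vanishing on the boundary. -/

namespace KHessian

variable {n : ℕ}

lemma exists_taylor_bound {f : E n → ℝ} {y : E n} (hf : ContDiffAt ℝ 2 f y) :
    ∃ C δ : ℝ, 0 ≤ C ∧ 0 < δ ∧ ∀ x : E n, ‖x‖ < δ →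
      |f (y + x) - f y - fderiv ℝ f y x| ≤ C * ‖x‖ ^ 2 := by
  have h1 := (differentiableAt_fderiv hf).hasFDerivAt.isBigO_sub
  obtain ⟨C, hC0, hC⟩ := h1.exists_pos
  have h2 := hC.bound.and (hf.eventually (by simp))
  obtain ⟨δ, hδ, hb⟩ := Metric.eventually_nhds_iff_ball.1 h2
  refine ⟨C, δ, hC0.le, hδ, fun x hx => ?_⟩
  have hsub : Metric.closedBall y ‖x‖ ⊆ Metric.ball y δ :=
    Metric.closedBall_subset_ball hx
  have := (convex_closedBall y ‖x‖).norm_image_sub_le_of_norm_fderiv_le' (𝕜 := ℝ) (f := f)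
    (φ := fderiv ℝ f y) (C := C * ‖x‖) (x := y) (y := y + x)
    (fun z hz => (hb z (hsub hz)).2.differentiableAt (by norm_num))
    (fun z hz => by
      have h3 := (hb z (hsub hz)).1
      have h4 : ‖z - y‖ ≤ ‖x‖ := by simpa [dist_eq_norm] using hz
      exact h3.trans (mul_le_mul_of_nonneg_left h4 hC0.le))
    (Metric.mem_closedBall_self (norm_nonneg _)) (by simp [dist_eq_norm])
  rw [add_sub_cancel_left, Real.norm_eq_abs] at this
  exact this.trans_eq (by ring)

section BoundaryComparison

variable {Ω V : Set (E n)} {r : E n → ℝ} {m : ℕ}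

lemma IsDefiningFunction.eq_zero (hΩ : IsOpen Ω) (hr : IsDefiningFunction m Ω V r) {y : E n}
    (hy : y ∈ V) (hyf : y ∈ frontier Ω) : r y = 0 := by
  have hyΩ : y ∉ Ω := fun h => (hΩ.inter_frontier_eq ▸ (⟨h, hyf⟩ : y ∈ Ω ∩ frontier Ω) : y ∈ (∅ : Set _))
  refine le_antisymm (not_lt.1 fun h => hyΩ ((hr.mem_iff y hy).2 h)) ?_
  have hc : ContinuousAt r y := hr.contDiffOn.continuousOn.continuousAt (hr.isOpen.mem_nhds hy)
  have hcl : y ∈ closure (Ω ∩ V) := by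
    have := hr.isOpen.inter_closure (t := Ω) ⟨hy, frontier_subset_closure hyf⟩
    rwa [inter_comm] at this
  have hne : (𝓝[Ω ∩ V] y).NeBot := mem_closure_iff_nhdsWithin_neBot.1 hcl
  exact ge_of_tendsto (hc.mono_left (nhdsWithin_le_nhds (s := Ω ∩ V)))
    (eventually_nhdsWithin_of_forall fun z hz => ((hr.mem_iff z hz.2).1 hz.1).le)

/-- Estimate of a function vanishing on the boundary along a straight path to the boundary. -/
lemma abs_le_of_path {O : Set (E n)} (hΩ : IsOpen Ω) (hr : IsDefiningFunction m Ω V r)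
    (hOV : O ⊆ V) {w : E n → ℝ} {p ν : E n} {A η : ℝ} (hη : 0 ≤ η)
    (hA : 0 ≤ A) (hp : p ∈ Ω) (hseg : ∀ t ∈ Icc 0 A, p - t • ν ∈ O) (hend : r (p - A • ν) ≤ 0)
    (hw : ∀ x ∈ Ω ∩ O, DifferentiableAt ℝ w x) (hwη : ∀ x ∈ Ω ∩ O, ‖fderiv ℝ w x‖ ≤ η)
    (hw0 : ∀ z ∈ frontier Ω ∩ O, Tendsto w (𝓝[Ω] z) (𝓝 0)) : |w p| ≤ η * ‖ν‖ * A := by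
  have hrc : ContinuousOn r V := hr.contDiffOn.continuousOn
  have hpath : Continuous fun t : ℝ => p - t • ν := by fun_prop
  have hφ : ContinuousOn (fun t : ℝ => r (p - t • ν)) (Icc 0 A) :=
    hrc.comp hpath.continuousOn fun t ht => hOV (hseg t ht)
  have hS : IsCompact (Icc 0 A ∩ (fun t : ℝ => r (p - t • ν)) ⁻¹' Iic 0) :=
    isCompact_Icc.of_isClosed_subset (hφ.preimage_isClosed_of_isClosed isClosed_Icc isClosed_Iic)
      inter_subset_left
  -- The first parameter at which r ≤ 0. Before it the path runs inside Ω, where the gradient bound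
  -- holds, and at it the path meets the boundary, where w tends to 0.
  obtain ⟨t₁, ⟨ht₁, hrt₁⟩, hleast⟩ := hS.exists_isLeast ⟨A, ⟨hA, le_rfl⟩, hend⟩
  have hlt : ∀ t ∈ Ico 0 t₁, p - t • ν ∈ Ω ∩ O := fun t ht => by
    have htA : t ∈ Icc 0 A := ⟨ht.1, ht.2.le.trans ht₁.2⟩
    refine ⟨(hr.mem_iff _ (hOV (hseg t htA))).2 ?_, hseg t htA⟩
    by_contra! hc
    exact absurd (hleast ⟨htA, hc⟩) (not_le.2 ht.2)
  have ht₁pos : 0 < t₁ := by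
    refine lt_of_le_of_ne ht₁.1 fun h0 => ?_
    have hz : r p ≤ 0 := by
      have : r (p - t₁ • ν) ≤ 0 := hrt₁
      rwa [← h0, zero_smul, sub_zero] at this
    have hpV : p ∈ V := by
      have := hseg 0 ⟨le_rfl, hA⟩
      rw [zero_smul, sub_zero] at this; exact hOV this
    exact absurd ((hr.mem_iff p hpV).1 hp) (not_lt.2 hz)
  have hbd : ∀ t ∈ Ico 0 t₁, |w p - w (p - t • ν)| ≤ η * ‖ν‖ * A := fun t ht => by
    have hsegt : segment ℝ p (p - t • ν) ⊆ Ω ∩ O := by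
      intro x hx
      rw [segment_eq_image'] at hx
      obtain ⟨θ, hθ, rfl⟩ := hx
      have : p + θ • (p - t • ν - p) = p - (θ * t) • ν := by rw [mul_smul]; simp; abel
      simp only [this]
      exact hlt _ ⟨mul_nonneg hθ.1 ht.1, (mul_le_of_le_one_left ht.1 hθ.2).trans_lt ht.2⟩
    have := (convex_segment p (p - t • ν)).norm_image_sub_le_of_norm_fderiv_le (𝕜 := ℝ) (f := w)
      (C := η) (fun x hx => hw x (hsegt hx)) (fun x hx => hwη x (hsegt hx))
      (right_mem_segment ℝ _ _) (left_mem_segment ℝ _ _)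
    rw [Real.norm_eq_abs, sub_sub_cancel, norm_smul, Real.norm_eq_abs, abs_of_nonneg ht.1] at this
    refine this.trans ?_
    have h2 : t ≤ A := ht.2.le.trans ht₁.2
    calc η * (t * ‖ν‖) ≤ η * (A * ‖ν‖) := by gcongr
      _ = _ := by ring
  set z := p - t₁ • ν with hz
  have hne : (𝓝[<] t₁).NeBot := inferInstance
  have hten : Tendsto (fun t : ℝ => p - t • ν) (𝓝[<] t₁) (𝓝[Ω] z) := by
    refine tendsto_nhdsWithin_iff.2 ⟨(hpath.tendsto t₁).mono_left nhdsWithin_le_nhds, ?_⟩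
    filter_upwards [Ico_mem_nhdsLT ht₁pos] with t ht using (hlt t ht).1
  have hzO : z ∈ O := hseg t₁ ht₁
  have hzf : z ∈ frontier Ω := by
    rw [hΩ.frontier_eq]
    refine ⟨mem_closure_iff_nhdsWithin_neBot.2 (hten.neBot), fun hzΩ => ?_⟩
    exact absurd ((hr.mem_iff z (hOV hzO)).1 hzΩ) (not_lt.2 hrt₁)
  have hlim : Tendsto (fun t : ℝ => |w p - w (p - t • ν)|) (𝓝[<] t₁) (𝓝 |w p - 0|) :=
    (((hw0 z ⟨hzf, hzO⟩).comp hten).const_sub (w p)).abs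
  rw [sub_zero] at hlim
  refine le_of_tendsto hlim ?_
  filter_upwards [Ico_mem_nhdsLT ht₁pos] with t ht using hbd t ht

/-- Parabolic access to the boundary point `y` in the tangential direction `τ`. -/
lemma exists_parabola (hΩ : IsOpen Ω) (hr : IsDefiningFunction 2 Ω V r) {y : E n}
    (hy : y ∈ V) (hyf : y ∈ frontier Ω) {τ : E n} (hτ : fderiv ℝ r y τ = 0) :
    ∃ (b : E n) (C : ℝ), 0 ≤ C ∧ ∀ δ > 0, ∃ s₀ > 0, ∀ s, 0 < s → s ≤ s₀ →
      (∀ σ : ℝ, |σ| ≤ s → y + σ • τ + s ^ 2 • b ∈ Ω ∩ Metric.ball y δ ∧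
        s ^ 2 ≤ r (y + σ • τ + s ^ 2 • b)) ∧
      ∀ (w : E n → ℝ) (η : ℝ), 0 ≤ η → (∀ x ∈ Ω ∩ Metric.ball y δ, DifferentiableAt ℝ w x) →
        (∀ x ∈ Ω ∩ Metric.ball y δ, ‖fderiv ℝ w x‖ ≤ η) →
        (∀ z ∈ frontier Ω ∩ Metric.ball y δ, Tendsto w (𝓝[Ω] z) (𝓝 0)) →
        ∀ σ : ℝ, |σ| ≤ s → |w (y + σ • τ + s ^ 2 • b)| ≤ η * C * s ^ 2 := by
  obtain ⟨C, δ₀, hC0, hδ₀, hC⟩ := exists_taylor_bound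
    (hr.contDiffOn.contDiffAt (hr.isOpen.mem_nhds hy))
  obtain ⟨ν, hν, hνn⟩ := exists_inner_eq (fderiv ℝ r y)
  have hL0 : fderiv ℝ r y ≠ 0 := fun h => hr.gradient_ne y hy (by simp [gradient, h])
  have hν0 : 0 < ‖ν‖ := by rw [hνn]; exact norm_pos_iff.2 hL0
  have hLν : fderiv ℝ r y ν = ‖ν‖ ^ 2 := by rw [← hν, real_inner_self_eq_norm_sq]
  obtain ⟨δ₁, hδ₁, hδ₁V⟩ := Metric.isOpen_iff.1 hr.isOpen y hy
  -- The normal lift κs²‖ν‖² exceeds the quadratic Taylor error over |σ| ≤ s by exactly s², so the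
  -- whole arc stays inside Ω at height r ≥ s². Going down by 2κs² along ν leaves Ω.
  set κ := (2 * C * (‖τ‖ ^ 2 + ‖ν‖ ^ 2) + 1) / ‖ν‖ ^ 2 with hκ
  have hκ0 : 0 < κ := by positivity
  have hr0 := hr.eq_zero hΩ hy hyf
  refine ⟨κ • ν, ‖ν‖ * (2 * κ), by positivity, fun δ hδ => ?_⟩
  set D := min δ (min δ₀ δ₁) with hD
  have hDpos : 0 < D := by positivity
  set s₀ := min 1 (min (1 / κ) (D / (‖τ‖ + κ * ‖ν‖ + 1))) with hs₀
  have hden : 0 < ‖τ‖ + κ * ‖ν‖ + 1 := by positivity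
  refine ⟨s₀, by positivity, fun s hs hss => ?_⟩
  have hs1 : s ≤ 1 := hss.trans (min_le_left _ _)
  have hsκ : κ * s ≤ 1 := by
    have := hss.trans ((min_le_right _ _).trans (min_le_left _ _))
    rw [le_div_iff₀ hκ0] at this; linarith
  have hsD : s * (‖τ‖ + κ * ‖ν‖ + 1) ≤ D := by
    rw [← le_div_iff₀ hden]; exact hss.trans ((min_le_right _ _).trans (min_le_right _ _))
  -- displacement bounds
  have hdisp : ∀ σ c : ℝ, |σ| ≤ s → |c| ≤ κ * s ^ 2 → ‖σ • τ + c • ν‖ < D ∧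
      |r (y + (σ • τ + c • ν)) - c * ‖ν‖ ^ 2| ≤ 2 * C * (‖τ‖ ^ 2 + ‖ν‖ ^ 2) * s ^ 2 := by
    intro σ c hσ hc
    have h1 : ‖σ • τ + c • ν‖ ≤ |σ| * ‖τ‖ + |c| * ‖ν‖ := by
      have := norm_add_le (σ • τ) (c • ν)
      rwa [norm_smul, norm_smul, Real.norm_eq_abs, Real.norm_eq_abs] at this
    have hc' : |c| ≤ s := by
      have : κ * s ^ 2 = (κ * s) * s := by ring
      rw [this] at hc
      exact hc.trans (mul_le_of_le_one_left hs.le hsκ)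
    have hlt : ‖σ • τ + c • ν‖ < D := by
      have h2 : |σ| * ‖τ‖ ≤ s * ‖τ‖ := by gcongr
      have h3 : |c| * ‖ν‖ ≤ s * (κ * ‖ν‖) := by
        have : κ * s ^ 2 ≤ κ * s := by
          have : s ^ 2 ≤ s := by nlinarith
          gcongr
        have := mul_le_mul_of_nonneg_right (hc.trans this) hν0.le
        linarith
      linarith
    refine ⟨hlt, ?_⟩
    have h4 := hC (σ • τ + c • ν) (hlt.trans_le ((min_le_right _ _).trans (min_le_left _ _)))
    rw [map_add, map_smul, map_smul, hτ, hLν, hr0, smul_zero, zero_add, sub_zero, smul_eq_mul] at h4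
    refine h4.trans ?_
    have h5 : ‖σ • τ + c • ν‖ ^ 2 ≤ 2 * (‖τ‖ ^ 2 + ‖ν‖ ^ 2) * s ^ 2 := by
      have a1 : ‖σ • τ + c • ν‖ ≤ s * (‖τ‖ + ‖ν‖) := by
        have h2 : |σ| * ‖τ‖ ≤ s * ‖τ‖ := by gcongr
        have h3 : |c| * ‖ν‖ ≤ s * ‖ν‖ := by gcongr
        linarith
      calc _ ≤ (s * (‖τ‖ + ‖ν‖)) ^ 2 := pow_le_pow_left₀ (norm_nonneg _) a1 2
        _ ≤ _ := by nlinarith [mul_nonneg (sq_nonneg s) (sq_nonneg (‖τ‖ - ‖ν‖))]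
    calc _ ≤ C * (2 * (‖τ‖ ^ 2 + ‖ν‖ ^ 2) * s ^ 2) := by gcongr
      _ = _ := by ring
  have hκν : κ * s ^ 2 * ‖ν‖ ^ 2 = 2 * C * (‖τ‖ ^ 2 + ‖ν‖ ^ 2) * s ^ 2 + s ^ 2 := by
    rw [hκ]; field_simp
  have hκs0 : 0 ≤ κ * s ^ 2 := by positivity
  have hpt : ∀ σ : ℝ, y + σ • τ + s ^ 2 • κ • ν = y + (σ • τ + (κ * s ^ 2) • ν) := fun σ => by
    rw [smul_smul, mul_comm, add_assoc]
  have hballV : ∀ z : E n, ‖z‖ < D → y + z ∈ Metric.ball y δ ∩ V := fun z hz => by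
    refine ⟨?_, hδ₁V ?_⟩
    · rw [Metric.mem_ball, dist_eq_norm, add_sub_cancel_left]; exact hz.trans_le (min_le_left _ _)
    · rw [Metric.mem_ball, dist_eq_norm, add_sub_cancel_left]
      exact hz.trans_le ((min_le_right _ _).trans (min_le_right _ _))
  have hin : ∀ σ : ℝ, |σ| ≤ s → y + σ • τ + s ^ 2 • κ • ν ∈ Ω ∩ Metric.ball y δ ∧
        s ^ 2 ≤ r (y + σ • τ + s ^ 2 • κ • ν) := fun σ hσ => by
    rw [hpt]
    obtain ⟨h1, h2⟩ := hdisp σ (κ * s ^ 2) hσ (by rw [abs_of_nonneg hκs0])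
    have h3 := (abs_le.1 h2).1
    obtain ⟨h4, h5⟩ := hballV _ h1
    have h6 : s ^ 2 ≤ r (y + (σ • τ + (κ * s ^ 2) • ν)) := by linarith
    exact ⟨⟨(hr.mem_iff _ h5).2 (lt_of_lt_of_le (by positivity) h6), h4⟩, h6⟩
  refine ⟨hin, fun w η hη hw hwη hw0 σ hσ => ?_⟩
  have := abs_le_of_path (O := Metric.ball y δ ∩ V) (w := w) (p := y + σ • τ + s ^ 2 • κ • ν)
    (ν := ν) (A := 2 * κ * s ^ 2) hΩ hr inter_subset_right hη (by positivity) (hin σ hσ).1.1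
    (fun t ht => by
      have e : y + σ • τ + s ^ 2 • κ • ν - t • ν = y + (σ • τ + (κ * s ^ 2 - t) • ν) := by
        rw [hpt, sub_smul]; abel
      rw [e]
      exact hballV _ (hdisp σ _ hσ (abs_le.2 ⟨by linarith [ht.2], by linarith [ht.1]⟩)).1)
    (by
      have e : y + σ • τ + s ^ 2 • κ • ν - (2 * κ * s ^ 2) • ν =
          y + (σ • τ + (-(κ * s ^ 2)) • ν) := by
        rw [hpt, show -(κ * s ^ 2) = κ * s ^ 2 - 2 * κ * s ^ 2 by ring, sub_smul]; abel
      rw [e]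
      have h1 := (abs_le.1 (hdisp σ (-(κ * s ^ 2)) hσ (by rw [abs_neg, abs_of_nonneg hκs0])).2).2
      have : 0 < s ^ 2 := by positivity
      linarith)
    (fun x hx => hw x ⟨hx.1, hx.2.1⟩) (fun x hx => hwη x ⟨hx.1, hx.2.1⟩)
    (fun z hz => hw0 z ⟨hz.1, hz.2.1⟩)
  exact this.trans_eq (by ring)

end BoundaryComparison
end KHessian

namespace KHessian

variable {n : ℕ}

/-- First and second order behaviour at a boundary point of a function vanishing on the boundary. -/
theorem boundary_comparison {Ω V W : Set (E n)} {r v : E n → ℝ} (hΩ : IsOpen Ω)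
    (hr : IsDefiningFunction 2 Ω V r) {y : E n} (hy : y ∈ V) (hyf : y ∈ frontier Ω)
    (hW : W ∈ 𝓝 y) (hv : ∀ x ∈ Ω ∩ W, ContDiffAt ℝ 2 v x)
    (hv0 : ∀ z ∈ frontier Ω ∩ W, Tendsto v (𝓝[Ω] z) (𝓝 0)) {g₁ : E n →L[ℝ] ℝ}
    (hg₁ : Tendsto (fderiv ℝ v) (𝓝[Ω] y) (𝓝 g₁)) {g₂ : E n → ℝ}
    (hg₂ : ∀ τ, Tendsto (fun x => D2 v x τ τ) (𝓝[Ω] y) (𝓝 (g₂ τ))) :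
    ∃ q : ℝ, g₁ = q • fderiv ℝ r y ∧ (∀ τ, fderiv ℝ r y τ = 0 → g₂ τ = q * D2 r y τ τ) ∧
      ((∀ x ∈ Ω ∩ W, 0 ≤ v x) → 0 ≤ q) := by
  obtain ⟨δW, hδW, hballW⟩ := Metric.mem_nhds_iff.1 hW
  have hrV : ∀ x ∈ V, ContDiffAt ℝ 2 r x := fun x hx =>
    hr.contDiffOn.contDiffAt (hr.isOpen.mem_nhds hx)
  obtain ⟨δV, hδV, hballV⟩ := Metric.isOpen_iff.1 hr.isOpen y hy
  obtain ⟨ν, hν, hνn⟩ := exists_inner_eq (fderiv ℝ r y)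
  have hL0 : fderiv ℝ r y ≠ 0 := fun h => hr.gradient_ne y hy (by simp [gradient, h])
  have hν0 : 0 < ‖ν‖ := by rw [hνn]; exact norm_pos_iff.2 hL0
  have hLν : fderiv ℝ r y ν = ‖ν‖ ^ 2 := by rw [← hν, real_inner_self_eq_norm_sq]
  -- tangential derivatives vanish
  have htan : ∀ τ, fderiv ℝ r y τ = 0 → g₁ τ = 0 := by
    intro τ hτ
    obtain ⟨b, C, hC0, hpar⟩ := exists_parabola hΩ hr hy hyf hτ
    refine abs_eq_zero.1 (le_antisymm (le_of_forall_pos_le_add fun ε hε => ?_) (abs_nonneg _))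
    have hev : ∀ᶠ x in 𝓝[Ω] y, ‖fderiv ℝ v x - g₁‖ < min 1 (ε / (2 * (‖τ‖ + 1))) := by
      have := Metric.tendsto_nhds.1 hg₁ (min 1 (ε / (2 * (‖τ‖ + 1)))) (by positivity)
      simpa only [dist_eq_norm] using this
    rw [eventually_nhdsWithin_iff] at hev
    obtain ⟨δ₀, hδ₀, hb⟩ := Metric.eventually_nhds_iff_ball.1 hev
    obtain ⟨s₀, hs₀, hs⟩ := hpar (min δ₀ δW) (by positivity)
    have hball : ∀ x ∈ Ω ∩ Metric.ball y (min δ₀ δW), x ∈ Ω ∩ W ∧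
        ‖fderiv ℝ v x - g₁‖ < min 1 (ε / (2 * (‖τ‖ + 1))) := fun x hx =>
      ⟨⟨hx.1, hballW (Metric.ball_subset_ball (min_le_right _ _) hx.2)⟩,
        hb x (Metric.ball_subset_ball (min_le_left _ _) hx.2) hx.1⟩
    set s := min s₀ (ε / (2 * ((‖g₁‖ + 1) * C + 1))) with hsdef
    have hC1 : 0 < (‖g₁‖ + 1) * C + 1 := by positivity
    have hspos : 0 < s := by positivity
    obtain ⟨hin, hest⟩ := hs s hspos (min_le_left _ _)
    have hvb := hest v (‖g₁‖ + 1) (by positivity)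
      (fun x hx => (hv x (hball x hx).1).differentiableAt (by norm_num))
      (fun x hx => by
        have h1 := ((hball x hx).2.le).trans (min_le_left _ _)
        have h2 := norm_le_norm_sub_add (fderiv ℝ v x) g₁
        linarith)
      (fun z hz => hv0 z ⟨hz.1, hballW (Metric.ball_subset_ball (min_le_right _ _) hz.2)⟩)
    have hder : ∀ σ ∈ Icc (-s) s, HasDerivAt (fun σ : ℝ => v (y + σ • τ + s ^ 2 • b))
        (fderiv ℝ v (y + σ • τ + s ^ 2 • b) τ) σ := fun σ hσ => by
      have h1 : HasDerivAt (fun σ : ℝ => y + σ • τ + s ^ 2 • b) τ σ := by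
        simpa using (((hasDerivAt_id σ).smul_const τ).const_add y).add_const (s ^ 2 • b)
      have h2 := (hv _ (hball _ (hin σ (abs_le.2 hσ)).1).1).differentiableAt (by norm_num)
      exact h2.hasFDerivAt.comp_hasDerivAt σ h1
    -- The end values are of order s² and the arc has parameter length 2s, so some tangential
    -- derivative on it is of order s.
    obtain ⟨σ, hσ, hmv⟩ := exists_hasDerivAt_eq_slope (fun σ : ℝ => v (y + σ • τ + s ^ 2 • b))
      (fun σ => fderiv ℝ v (y + σ • τ + s ^ 2 • b) τ) (by linarith : -s < s)
      (fun σ hσ => (hder σ hσ).continuousAt.continuousWithinAt)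
      (fun σ hσ => hder σ (Ioo_subset_Icc_self hσ))
    have hσ' : |σ| ≤ s := abs_le.2 ⟨hσ.1.le, hσ.2.le⟩
    have h1 := hvb s (abs_of_pos hspos).le
    have h2 := hvb (-s) (by rw [abs_neg, abs_of_pos hspos])
    have h3 : |fderiv ℝ v (y + σ • τ + s ^ 2 • b) τ| ≤ (‖g₁‖ + 1) * C * s := by
      rw [hmv, abs_div, show s - -s = 2 * s by ring, abs_of_pos (by linarith : 0 < 2 * s),
        div_le_iff₀ (by linarith)]
      have h4 := abs_sub (v (y + s • τ + s ^ 2 • b)) (v (y + (-s) • τ + s ^ 2 • b))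
      nlinarith
    have h5 : ((‖g₁‖ + 1) * C + 1) * s ≤ ε / 2 := by
      have h6 : s ≤ ε / (2 * ((‖g₁‖ + 1) * C + 1)) := min_le_right _ _
      rw [le_div_iff₀ (by positivity)] at h6
      linarith
    have h6 : |(fderiv ℝ v (y + σ • τ + s ^ 2 • b) - g₁) τ| ≤ ε / 2 := by
      have h7 := ((hball _ (hin σ hσ').1).2.le).trans (min_le_right _ _)
      rw [le_div_iff₀ (by positivity)] at h7
      have h8 := (fderiv ℝ v (y + σ • τ + s ^ 2 • b) - g₁).le_opNorm τ
      rw [Real.norm_eq_abs] at h8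
      have := norm_nonneg (fderiv ℝ v (y + σ • τ + s ^ 2 • b) - g₁)
      nlinarith
    have h9 : g₁ τ = fderiv ℝ v (y + σ • τ + s ^ 2 • b) τ -
      (fderiv ℝ v (y + σ • τ + s ^ 2 • b) - g₁) τ := by simp
    rw [h9]
    have := abs_sub (fderiv ℝ v (y + σ • τ + s ^ 2 • b) τ)
      ((fderiv ℝ v (y + σ • τ + s ^ 2 • b) - g₁) τ)
    linarith
  set q := g₁ ν / ‖ν‖ ^ 2 with hq
  have hg₁q : g₁ = q • fderiv ℝ r y := by
    ext x
    have h1 := htan (x - (fderiv ℝ r y x / ‖ν‖ ^ 2) • ν) (by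
      rw [map_sub, map_smul, hLν, smul_eq_mul]; field_simp; ring)
    rw [map_sub, map_smul, smul_eq_mul] at h1
    rw [smul_apply, smul_eq_mul, hq]
    field_simp at h1 ⊢
    linarith
  -- Subtracting qr removes the whole boundary gradient, so Dw → 0 and the path estimate holds with
  -- an arbitrarily small η. No extension of v across the boundary is needed.
  set w : E n → ℝ := fun x => v x - q * r x with hw
  have hrc2 : ContDiffAt ℝ 2 r y := hrV y hy
  have hwc : ∀ x ∈ Ω ∩ (W ∩ V), ContDiffAt ℝ 2 w x := fun x hx =>
    (hv x ⟨hx.1, hx.2.1⟩).sub (contDiffAt_const.mul (hrV x hx.2.2))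
  have hw0 : ∀ z ∈ frontier Ω ∩ (W ∩ V), Tendsto w (𝓝[Ω] z) (𝓝 0) := fun z hz => by
    have h1 := hv0 z ⟨hz.1, hz.2.1⟩
    have h2 : Tendsto r (𝓝[Ω] z) (𝓝 (r z)) :=
      (hrV z hz.2.2).continuousAt.tendsto.mono_left nhdsWithin_le_nhds
    rw [hr.eq_zero hΩ hz.2.2 hz.1] at h2
    simpa using h1.sub (h2.const_mul q)
  have hmem : ∀ᶠ x in 𝓝[Ω] y, x ∈ Ω ∩ (W ∩ V) := by
    filter_upwards [self_mem_nhdsWithin, nhdsWithin_le_nhds hW,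
      nhdsWithin_le_nhds (hr.isOpen.mem_nhds hy)] with x h1 h2 h3 using ⟨h1, h2, h3⟩
  have hdw : Tendsto (fderiv ℝ w) (𝓝[Ω] y) (𝓝 0) := by
    have h1 : Tendsto (fderiv ℝ r) (𝓝[Ω] y) (𝓝 (fderiv ℝ r y)) :=
      ((hrc2.fderiv_right (m := 1) (by norm_num)).continuousAt.tendsto).mono_left nhdsWithin_le_nhds
    have h2 := hg₁.sub (h1.const_smul q)
    rw [← hg₁q, sub_self] at h2
    refine h2.congr' ?_
    filter_upwards [hmem] with x hx
    have d1 := (hv x ⟨hx.1, hx.2.1⟩).differentiableAt (n := 2) (by norm_num)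
    have d2 := (hrV x hx.2.2).differentiableAt (n := 2) (by norm_num)
    exact (d1.hasFDerivAt.sub (d2.hasFDerivAt.const_mul q)).fderiv.symm
  have hsmall : ∀ η > 0, ∃ δ > 0, ∀ x ∈ Ω ∩ Metric.ball y δ, x ∈ Ω ∩ (W ∩ V) ∧
      ‖fderiv ℝ w x‖ ≤ η := fun η hη => by
    have h1 : ∀ᶠ x in 𝓝[Ω] y, ‖fderiv ℝ w x‖ < η := by
      have := Metric.tendsto_nhds.1 hdw η hη
      simpa only [dist_zero_right] using this
    obtain ⟨δ, hδ, hb⟩ := Metric.eventually_nhds_iff_ball.1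
      (eventually_nhdsWithin_iff.1 (hmem.and h1))
    exact ⟨δ, hδ, fun x hx => ⟨(hb x hx.2 hx.1).1, (hb x hx.2 hx.1).2.le⟩⟩
  refine ⟨q, hg₁q, fun τ hτ => ?_, fun hpos => ?_⟩
  · obtain ⟨b, C, hC0, hpar⟩ := exists_parabola hΩ hr hy hyf hτ
    have hD2w : Tendsto (fun x => D2 w x τ τ) (𝓝[Ω] y) (𝓝 (g₂ τ - q * D2 r y τ τ)) := by
      have h1 : Tendsto (fun x => D2 r x τ τ) (𝓝[Ω] y) (𝓝 (D2 r y τ τ)) := by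
        have hc3 : Continuous fun A : Form n => A τ τ := by fun_prop
        have hcD : ContinuousAt (D2 r) y := ((hrc2.fderiv_right (m := 1)
          (by norm_num)).fderiv_right (m := 0) (by norm_num)).continuousAt
        exact ((hc3.tendsto _).comp hcD.tendsto).mono_left nhdsWithin_le_nhds
      refine ((hg₂ τ).sub (h1.const_mul q)).congr' ?_
      filter_upwards [hmem] with x hx
      rw [hw, D2_sub (hv x ⟨hx.1, hx.2.1⟩) (contDiffAt_const.mul (hrV x hx.2.2)),
        D2_const_mul (hrV x hx.2.2)]
      rfl
    have : g₂ τ - q * D2 r y τ τ = 0 := by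
      refine abs_eq_zero.1 (le_antisymm (le_of_forall_pos_le_add fun ε hε => ?_) (abs_nonneg _))
      set η := ε / (2 * (4 * C + 1)) with hη
      have hηpos : 0 < η := by positivity
      obtain ⟨δ₁, hδ₁, hb₁⟩ := hsmall η hηpos
      have h2 : ∀ᶠ x in 𝓝[Ω] y, |D2 w x τ τ - (g₂ τ - q * D2 r y τ τ)| < ε / 2 := by
        have := Metric.tendsto_nhds.1 hD2w (ε / 2) (by positivity)
        simpa only [Real.dist_eq] using this
      obtain ⟨δ₂, hδ₂, hb₂⟩ := Metric.eventually_nhds_iff_ball.1 (eventually_nhdsWithin_iff.1 h2)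
      set δ := min (min δ₁ δ₂) (min δW δV) with hδdef
      have hδpos : 0 < δ := by positivity
      have hδ1 : δ ≤ δ₁ := (min_le_left _ _).trans (min_le_left _ _)
      have hδ2 : δ ≤ δ₂ := (min_le_left _ _).trans (min_le_right _ _)
      obtain ⟨s, hs, hs'⟩ := hpar δ hδpos
      obtain ⟨hin, hest⟩ := hs' s hs le_rfl
      have hin1 : ∀ σ : ℝ, |σ| ≤ s → ContDiffAt ℝ 2 w (y + σ • τ + s ^ 2 • b) := fun σ hσ =>
        hwc _ (hb₁ _ ⟨(hin σ hσ).1.1, Metric.ball_subset_ball hδ1 (hin σ hσ).1.2⟩).1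
      have hwb := hest w η hηpos.le
        (fun x hx => (hwc _ (hb₁ x ⟨hx.1, Metric.ball_subset_ball hδ1 hx.2⟩).1).differentiableAt
          (by norm_num))
        (fun x hx => (hb₁ x ⟨hx.1, Metric.ball_subset_ball hδ1 hx.2⟩).2)
        (fun z hz => hw0 z ⟨hz.1, hballW (Metric.ball_subset_ball
          ((min_le_right _ _).trans (min_le_left _ _)) hz.2), hballV (Metric.ball_subset_ball
          ((min_le_right _ _).trans (min_le_right _ _)) hz.2)⟩)
      have hline : ∀ σ : ℝ, y + σ • τ + s ^ 2 • b = (y + s ^ 2 • b) + σ • τ := fun σ => by abel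
      simp only [hline] at hin1 hwb hin
      -- The second difference of w over the lifted segment is of order ηs², so dividing by s² shows
      -- that the limit of D²w(τ,τ) is as small as wished.
      have hsd := abs_second_difference_sub_le (g := fun σ => w ((y + s ^ 2 • b) + σ • τ))
        (g' := fun σ => fderiv ℝ w ((y + s ^ 2 • b) + σ • τ) τ)
        (g'' := fun σ => D2 w ((y + s ^ 2 • b) + σ • τ) τ τ) (t := s) (ε := ε / 2)
        (m := g₂ τ - q * D2 r y τ τ) hs
        (fun σ hσ => hasDerivAt_line ((hin1 σ hσ).differentiableAt (by norm_num)))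
        (fun σ hσ => hasDerivAt_fderiv_line (differentiableAt_fderiv (hin1 σ hσ)))
        (fun σ hσ => (hb₂ _ (Metric.ball_subset_ball hδ2 (hin σ hσ).1.2) (hin σ hσ).1.1).le)
      have b1 := hwb s (abs_of_pos hs).le
      have b2 := hwb (-s) (by rw [abs_neg, abs_of_pos hs])
      have b3 := hwb 0 (by rw [abs_zero]; exact hs.le)
      set X := (w ((y + s ^ 2 • b) + s • τ) + w ((y + s ^ 2 • b) + (-s) • τ) -
        2 * w ((y + s ^ 2 • b) + (0:ℝ) • τ)) / s ^ 2 with hX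
      have b4 : |X| ≤ 4 * (η * C) := by
        rw [hX, abs_div, abs_of_pos (by positivity : 0 < s ^ 2), div_le_iff₀ (by positivity)]
        have b1' := abs_le.1 b1
        have b2' := abs_le.1 b2
        have b3' := abs_le.1 b3
        rw [abs_le]; constructor <;> linarith [b1'.1, b1'.2, b2'.1, b2'.2, b3'.1, b3'.2]
      have b5 : 4 * (η * C) ≤ ε / 2 := by
        have : η * (2 * (4 * C + 1)) = ε := by rw [hη]; field_simp
        nlinarith
      have b6 := abs_le.1 hsd
      have b7 := abs_le.1 (b4.trans b5)
      rw [abs_le]; constructor <;> linarith [b6.1, b6.2, b7.1, b7.2]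
    linarith
  · by_contra! hq0
    -- With τ = 0 the arc is a single point where r ≥ s² and |w| ≤ ηCs². If q < 0, then v = w + qr
    -- would be negative there.
    obtain ⟨b, C, hC0, hpar⟩ := exists_parabola hΩ hr hy hyf (τ := 0) (map_zero _)
    set η := -q / (2 * (C + 1)) with hη
    have hηpos : 0 < η := div_pos (by linarith) (by positivity)
    obtain ⟨δ₁, hδ₁, hb₁⟩ := hsmall η hηpos
    obtain ⟨s, hs, hs'⟩ := hpar (min δ₁ (min δW δV)) (by positivity)
    obtain ⟨hin, hest⟩ := hs' s hs le_rfl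
    have hb' : ∀ x ∈ Ω ∩ Metric.ball y (min δ₁ (min δW δV)), x ∈ Ω ∩ (W ∩ V) ∧
      ‖fderiv ℝ w x‖ ≤ η := fun x hx => hb₁ x ⟨hx.1, Metric.ball_subset_ball (min_le_left _ _) hx.2⟩
    have hwb := hest w η hηpos.le
        (fun x hx => (hwc _ (hb' x hx).1).differentiableAt (by norm_num))
        (fun x hx => (hb' x hx).2)
        (fun z hz => hw0 z ⟨hz.1, hballW (Metric.ball_subset_ball
          ((min_le_right _ _).trans (min_le_left _ _)) hz.2), hballV (Metric.ball_subset_ball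
          ((min_le_right _ _).trans (min_le_right _ _)) hz.2)⟩) 0 (by simpa using hs.le)
    obtain ⟨h1, h2⟩ := hin 0 (by simpa using hs.le)
    set P := y + (0:ℝ) • (0 : E n) + s ^ 2 • b with hP
    have h3 := hpos P ⟨h1.1, (hb' P h1).1.2.1⟩
    have h4 := (abs_le.1 hwb).2
    have h5 : w P = v P - q * r P := rfl
    have h6 : η * (2 * (C + 1)) = -q := by rw [hη]; field_simp
    have h7 : -q * s ^ 2 ≤ -q * r P := mul_le_mul_of_nonneg_left h2 (by linarith)
    have h8 : 0 < s ^ 2 := by positivity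
    have h9 : η * C * s ^ 2 < -q * s ^ 2 := by
      refine mul_lt_mul_of_pos_right ?_ h8
      nlinarith
    linarith

end KHessian

/-! ### Symmetric functions of rank one perturbations. -/

namespace KHessian

variable {n : ℕ}

lemma charpoly_formMatrix_eq {A : Form n} {ι : Type*} [Fintype ι] [DecidableEq ι]
    (b : OrthonormalBasis ι ℝ (E n)) :
    (Matrix.of fun i j => A (b i) (b j)).charpoly = (formMatrix A).charpoly := by
  let T : E n →ₗ[ℝ] E n := Matrix.toEuclideanLin (formMatrix A)
  have hT : ∀ v w, inner ℝ v (T w) = A v w := fun v w => by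
    have h1 : ∀ j, (T w) j = A (EuclideanSpace.single j 1) w := fun j => by
      rw [formMatrix_apply_single]; simp [T, Matrix.toLpLin_apply]
    have hv : v = ∑ j, v j • EuclideanSpace.single j (1:ℝ) := by
      have := (EuclideanSpace.basisFun (Fin n) ℝ).sum_repr v
      simpa using this.symm
    conv_rhs => rw [hv]
    simp only [map_sum, map_smul, FunLike.coe_sum, Finset.sum_apply, smul_apply, smul_eq_mul]
    rw [PiLp.inner_apply]
    refine Finset.sum_congr rfl fun j _ => ?_
    rw [h1]; simp [mul_comm]
  have h1 : LinearMap.toMatrix b.toBasis b.toBasis T = Matrix.of fun i j => A (b i) (b j) := by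
    ext i j
    rw [LinearMap.toMatrix_apply]
    simp [OrthonormalBasis.repr_apply_apply, hT]
  have h2 : LinearMap.toMatrix (EuclideanSpace.basisFun (Fin n) ℝ).toBasis
      (EuclideanSpace.basisFun (Fin n) ℝ).toBasis T = formMatrix A := by
    ext i j
    rw [LinearMap.toMatrix_apply]
    simp [T, Matrix.toLpLin_apply]
  rw [← h1, LinearMap.charpoly_toMatrix, ← h2, LinearMap.charpoly_toMatrix]

/-- The determinant is linear in the last row, and the perturbation adds a multiple of a unit row,
whose determinant is that of the remaining block. -/
lemma charpoly_add_single {ι : Type*} [Fintype ι] [DecidableEq ι]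
    {M M' : Matrix (ι ⊕ Unit) (ι ⊕ Unit) ℝ} {κ : ℝ}
    (h : M' = M + Matrix.single (Sum.inr ()) (Sum.inr ()) κ) :
    M'.charpoly = M.charpoly - Polynomial.C κ * M.toBlocks₁₁.charpoly := by
  have e1 : M'.charmatrix = M.charmatrix.updateRow (Sum.inr ())
      (M.charmatrix (Sum.inr ()) + (-Polynomial.C κ) • Pi.single (Sum.inr ()) 1) := by
    ext1 i j
    rcases i with i | i <;> rcases j with j | j <;>
      simp [Matrix.charmatrix_apply, Matrix.updateRow_apply, h, Matrix.diagonal_apply,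
        sub_eq_add_neg, add_comm]
    ring
  have e2 : M.charmatrix.updateRow (Sum.inr ()) (Pi.single (Sum.inr ()) 1) =
      Matrix.fromBlocks M.toBlocks₁₁.charmatrix M.charmatrix.toBlocks₁₂ 0 1 := by
    ext1 i j
    rcases i with i | i <;> rcases j with j | j <;>
      simp [Matrix.charmatrix_apply, Matrix.updateRow_apply, Matrix.diagonal_apply,
        Matrix.toBlocks₁₁, Matrix.toBlocks₁₂]
  unfold Matrix.charpoly
  rw [e1, Matrix.det_updateRow_add, Matrix.updateRow_eq_self, Matrix.det_updateRow_smul, e2,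
    Matrix.det_fromBlocks_zero₂₁]
  simp [sub_eq_add_neg]

lemma sigma_eq_coeff {A : Form n} (hA : IsSymmForm A) {j : ℕ} (hj : j ≤ n) :
    sigma j (formMatrix A) = (-1) ^ j * (formMatrix A).charpoly.coeff (n - j) := by
  obtain ⟨v, l, hv⟩ := hA.exists_eigenframe
  have hc : (formMatrix A).charpoly =
      ((Finset.univ.val.map l).map fun a => Polynomial.X - Polynomial.C a).prod := by
    rw [hv.charpoly hA, Multiset.map_map]; rfl
  have hcard : Multiset.card (Finset.univ.val.map l) = n := by simp
  rw [hc, Multiset.prod_X_sub_C_coeff _ (by rw [hcard]; omega), hcard, sigma, hv.eigenvalues_eq hA,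
    show n - (n - j) = j by omega, ← mul_assoc, ← mul_pow]
  simp

lemma coeff_prod_X_sub_C {m j : ℕ} (hj : j ≤ m) (μ : Fin m → ℝ) :
    (∏ i, (Polynomial.X - Polynomial.C (μ i))).coeff (m - j) =
      (-1) ^ j * es Finset.univ μ j := by
  have hc : (∏ i, (Polynomial.X - Polynomial.C (μ i))) =
      ((Finset.univ.val.map μ).map fun a => Polynomial.X - Polynomial.C a).prod := by
    rw [Multiset.map_map]; rfl
  have hcard : Multiset.card (Finset.univ.val.map μ) = m := by simp
  rw [hc, Multiset.prod_X_sub_C_coeff _ (by rw [hcard]; omega), hcard,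
    show m - (m - j) = j by omega, esymm_map_val_eq_es]

lemma continuous_coeff_charpoly {X : Type*} [TopologicalSpace X]
    {M : X → Matrix (Fin n) (Fin n) ℝ} (hM : Continuous M) (j : ℕ) :
    Continuous fun x => (M x).charpoly.coeff j := by
  have e : ∀ x, (M x).charpoly.coeff j = MvPolynomial.eval (fun p : Fin n × Fin n => M x p.1 p.2)
      ((Matrix.charpoly.univ ℝ (Fin n)).coeff j) := fun x => by
    have := Matrix.charpoly.univ_coeff_eval₂Hom (Fin n) (RingHom.id ℝ)
      (fun p : Fin n × Fin n => M x p.1 p.2) j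
    have e2 : Matrix.of (Function.curry fun p : Fin n × Fin n => M x p.1 p.2) = M x := by ext; rfl
    rw [e2] at this
    rw [← this]; rfl
  simp only [e]
  refine (MvPolynomial.continuous_eval _).comp ?_
  exact continuous_pi fun p => hM.matrix_elem p.1 p.2

lemma continuous_formMatrix : Continuous (formMatrix : Form n → _) := by
  refine continuous_matrix fun i j => ?_
  change Continuous fun A : Form n => A (EuclideanSpace.single i 1) (EuclideanSpace.single j 1)
  fun_prop

/-- For symmetric forms σ_j is, up to sign, a coefficient of the characteristic polynomial, hence a
polynomial in the entries. Continuity of the individual eigenvalues is not required. -/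
lemma continuous_sigma {X : Type*} [TopologicalSpace X] {A : X → Form n} (hA : Continuous A)
    (hs : ∀ x, IsSymmForm (A x)) {j : ℕ} (hj : j ≤ n) :
    Continuous fun x => sigma j (formMatrix (A x)) := by
  simp only [sigma_eq_coeff (hs _) hj]
  exact continuous_const.mul (continuous_coeff_charpoly (continuous_formMatrix.comp hA) _)

/-- `σ_{j+1}` of a rank one perturbation in the normal direction. -/
lemma sigma_add_rankOne {B B' : Form n} (hB : IsSymmForm B) (hB' : IsSymmForm B')
    {L : E n →L[ℝ] ℝ} {K c : ℝ} (hBB' : ∀ x z, B' x z = B x z + K * (L x * L z))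
    {F : Submodule ℝ (E n)} (hdim : Module.finrank ℝ F = n - 1) {e : E n} (he : ‖e‖ = 1)
    (heF : ∀ x ∈ F, inner ℝ x e = 0) (hLF : ∀ x ∈ F, L x = 0) (hLe : L e ^ 2 = ‖L‖ ^ 2)
    {S : F →ₗ[ℝ] F} (hS : S.IsSymmetric)
    (hSB : ∀ x z : F, B x z = c * inner ℝ (S x) z) {j : ℕ} (hj : j + 1 ≤ n) :
    sigma (j + 1) (formMatrix B') = sigma (j + 1) (formMatrix B) +
      K * ‖L‖ ^ 2 * (c ^ j * S.charpoly.roots.esymm j) := by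
  set b := hS.eigenvectorBasis hdim with hb
  set μ := hS.eigenvalues hdim with hμ
  have hSb : ∀ i, S (b i) = μ i • b i := fun i => hS.apply_eigenvectorBasis hdim i
  have hon : Orthonormal ℝ (Sum.elim (fun i => (b i : E n)) fun _ : Unit => e) := by
    rw [orthonormal_iff_ite]
    have h1 := orthonormal_iff_ite.1 b.orthonormal
    rintro (i | i) (j | j)
    · have := h1 i j
      simp only [Submodule.coe_inner] at this
      simpa using this
    · simpa using heF _ (b i).2
    · simpa [real_inner_comm] using heF _ (b j).2
    · simp [he]
  obtain ⟨a, ha⟩ : ∃ a : OrthonormalBasis (Fin (n - 1) ⊕ Unit) ℝ (E n),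
      ⇑a = Sum.elim (fun i => (b i : E n)) fun _ : Unit => e := by
    have hc : Module.finrank ℝ (E n) = Fintype.card (Fin (n - 1) ⊕ Unit) := by simp; omega
    obtain ⟨a, ha⟩ := Orthonormal.exists_orthonormalBasis_extension_of_card_eq hc
      (s := Set.univ) (v := Sum.elim (fun i => (b i : E n)) fun _ : Unit => e)
      (hon.comp _ Subtype.val_injective)
    exact ⟨a, funext fun i => ha i (Set.mem_univ i)⟩
  -- In the basis made of the eigenvectors of S on F followed by e, the forms differ only in the
  -- last diagonal entry, and the remaining block of B is diagonal with entries cμ_i.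
  have hM := charpoly_add_single (M := Matrix.of fun i j => B (a i) (a j))
    (M' := Matrix.of fun i j => B' (a i) (a j)) (κ := K * ‖L‖ ^ 2) (by
      ext i j
      rcases i with i | i <;> rcases j with j | j <;>
        simp [hBB', ha, hLF _ (b _).2, ← hLe, sq])
  have h11 : (Matrix.of fun i j => B (a i) (a j)).toBlocks₁₁ = Matrix.diagonal fun i => c * μ i := by
    ext i j
    have h1 := hSB (b i) (b j)
    have h2 : inner ℝ (μ i • b i) (b j) = μ i * inner ℝ (b i) (b j) :=
      real_inner_smul_left (b i : E n) (b j : E n) (μ i)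
    rw [hSb, h2, (orthonormal_iff_ite.1 b.orthonormal) i j] at h1
    simp only [Matrix.toBlocks₁₁, Matrix.of_apply, ha, Sum.elim_inl, h1, Matrix.diagonal_apply]
    split_ifs <;> simp
  rw [h11, Matrix.charpoly_diagonal, charpoly_formMatrix_eq, charpoly_formMatrix_eq] at hM
  rw [sigma_eq_coeff hB' hj, sigma_eq_coeff hB hj, hM, Polynomial.coeff_sub, Polynomial.coeff_C_mul,
    show n - (j + 1) = (n - 1) - j by omega, coeff_prod_X_sub_C (by omega), es_smul,
    hS.roots_charpoly_eq_eigenvalues hdim]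
  have h2 : Multiset.map (RCLike.ofReal ∘ hS.eigenvalues hdim) Finset.univ.val =
      Finset.univ.val.map μ := rfl
  rw [h2, esymm_map_val_eq_es]
  have h3 : ((-1 : ℝ) ^ (j + 1)) * (-1) ^ j = -1 := by
    rw [← pow_add, show j + 1 + j = 2 * j + 1 by ring, pow_add, pow_mul]; simp
  linear_combination (-(K * ‖L‖ ^ 2 * (c ^ j * es Finset.univ μ j))) * h3

end KHessian

/-! ### Strictly k-concave defining functions. -/

namespace KHessian

variable {n : ℕ}

/-- R is a finite sum of local defining functions times bumps supported where those are smooth. Near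
each boundary point one bump equals 1 and the other terms are nonnegative in Ω. The resulting R ≥ r
later shows that the gradient of R does not vanish on the boundary. -/
lemma exists_global_defining {Ω : Set (E n)} (hΩo : IsOpen Ω) (hΩb : Bornology.IsBounded Ω)
    (hC : HasCLipBoundary 3 Ω) : ∃ R : E n → ℝ, ContDiff ℝ 3 R ∧ (∀ x ∈ Ω, 0 ≤ R x) ∧
      (∀ y ∈ frontier Ω, R y = 0) ∧ ∀ y ∈ frontier Ω, ∃ (V : Set (E n)) (r : E n → ℝ),
        y ∈ V ∧ IsDefiningFunction 2 Ω V r ∧ ∀ᶠ x in 𝓝 y, x ∈ Ω → r x ≤ R x := by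
  have hcomp : IsCompact (frontier Ω) :=
    Metric.isCompact_of_isClosed_isBounded isClosed_frontier (hΩb.closure.subset frontier_subset_closure)
  choose! V r hyV hr _ using hC
  have hball : ∀ y ∈ frontier Ω, ∃ δ : ℝ, 0 < δ ∧ Metric.closedBall y (2 * δ) ⊆ V y := fun y hy => by
    obtain ⟨δ, hδ, h⟩ := Metric.nhds_basis_closedBall.mem_iff.1 ((hr y hy).isOpen.mem_nhds (hyV y hy))
    exact ⟨δ / 2, by positivity, by rwa [mul_div_cancel₀ _ two_ne_zero]⟩
  choose! δ hδ hδV using hball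
  obtain ⟨t, ht, hcov⟩ := hcomp.elim_nhds_subcover (fun y => Metric.ball y (δ y))
    fun y hy => Metric.ball_mem_nhds y (hδ y hy)
  have hbump : ∀ y, ∃ χ : E n → ℝ, y ∈ frontier Ω → (ContDiff ℝ 3 χ ∧ (∀ x, 0 ≤ χ x) ∧
      (∀ x ∈ Metric.ball y (δ y), χ x = 1) ∧ tsupport χ ⊆ V y) := fun y => by
    by_cases hy : y ∈ frontier Ω
    · let f : ContDiffBump y := ⟨δ y, 2 * δ y, hδ y hy, by linarith [hδ y hy]⟩
      refine ⟨f, fun _ => ⟨f.contDiff, fun x => f.nonneg, fun x hx => ?_, ?_⟩⟩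
      · exact f.one_of_mem_closedBall (Metric.ball_subset_closedBall hx)
      · rw [f.tsupport_eq]; exact hδV y hy
    · exact ⟨0, fun h => absurd h hy⟩
  choose χ hχ using hbump
  have h0 : ∀ y ∈ frontier Ω, ∀ x, x ∉ V y → χ y x = 0 := fun y hy x hx => by
    by_contra h
    exact hx ((hχ y hy).2.2.2 (subset_tsupport _ h))
  have hnn : ∀ y ∈ frontier Ω, ∀ x ∈ Ω, 0 ≤ χ y x * r y x := fun y hy x hx => by
    by_cases hxV : x ∈ V y
    · exact mul_nonneg ((hχ y hy).2.1 x) (((hr y hy).mem_iff x hxV).1 hx).le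
    · rw [h0 y hy x hxV, zero_mul]
  refine ⟨fun x => ∑ y ∈ t, χ y x * r y x, ?_, ?_, ?_, ?_⟩
  · refine ContDiff.sum fun y hy => contDiff_iff_contDiffAt.2 fun x => ?_
    have hy' := ht y hy
    by_cases hx : x ∈ tsupport (χ y)
    swap
    · refine (contDiffAt_const (c := (0:ℝ))).congr_of_eventuallyEq ?_
      filter_upwards [notMem_tsupport_iff_eventuallyEq.1 hx] with z hz
      rw [hz]; simp
    have hxV : x ∈ V y := (hχ y hy').2.2.2 hx
    exact (hχ y hy').1.contDiffAt.mul
      ((hr y hy').contDiffOn.contDiffAt ((hr y hy').isOpen.mem_nhds hxV))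
  · exact fun x hx => Finset.sum_nonneg fun y hy => hnn y (ht y hy) x hx
  · refine fun z hz => Finset.sum_eq_zero fun y hy => ?_
    by_cases hzV : z ∈ V y
    · rw [(hr y (ht y hy)).eq_zero hΩo hzV hz, mul_zero]
    · rw [h0 y (ht y hy) z hzV, zero_mul]
  · intro z hz
    obtain ⟨y, hy, hzy⟩ := mem_iUnion₂.1 (hcov hz)
    have hy' := ht y hy
    have hzV : z ∈ V y := hδV y hy' (Metric.ball_subset_closedBall.trans
      (Metric.closedBall_subset_closedBall (by linarith [hδ y hy'])) hzy)
    have hd := hr y hy'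
    refine ⟨V y, r y, hzV, ⟨hd.isOpen, hd.contDiffOn.of_le (by norm_num), hd.gradient_ne,
      hd.mem_iff⟩, ?_⟩
    filter_upwards [Metric.isOpen_ball.mem_nhds hzy] with x hx hxΩ
    calc r y x = χ y x * r y x := by rw [(hχ y hy').2.2.1 x hx, one_mul]
      _ ≤ _ := Finset.single_le_sum (f := fun y => χ y x * r y x)
          (fun y hy => hnn y (ht y hy) x hxΩ) hy

lemma inner_gradient (r : E n → ℝ) (y z : E n) : inner ℝ (gradient r y) z = fderiv ℝ r y z :=
  InnerProductSpace.toDual_symm_apply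

lemma norm_gradient (r : E n → ℝ) (y : E n) : ‖gradient r y‖ = ‖fderiv ℝ r y‖ :=
  LinearIsometryEquiv.norm_map _ _

lemma inner_fderiv_gradient {r : E n → ℝ} {y : E n} (hr : ContDiffAt ℝ 2 r y) (x z : E n) :
    inner ℝ (fderiv ℝ (gradient r) y x) z = D2 r y x z := by
  have e1 : gradient r = fun y' => ∑ j : Fin n, fderiv ℝ r y' (EuclideanSpace.single j 1) •
      EuclideanSpace.single j (1:ℝ) := by
    ext1 y'
    have := (EuclideanSpace.basisFun (Fin n) ℝ).sum_repr' (gradient r y')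
    simp only [EuclideanSpace.basisFun_apply] at this
    rw [← this]
    exact Finset.sum_congr rfl fun j _ => by rw [real_inner_comm, inner_gradient]
  have hd : DifferentiableAt ℝ (gradient r) y := by
    rw [e1]
    refine DifferentiableAt.fun_sum fun j _ => ?_
    exact (hasFDerivAt_fderiv_apply hr (EuclideanSpace.single j 1) 0).1.smul_const _
  have h1 := fderiv_inner_apply ℝ hd (differentiableAt_const z) x
  have h2 : (fun t => inner ℝ (gradient r t) z) = fun t => fderiv ℝ r t z :=
    funext fun t => inner_gradient r t z
  rw [h2, (hasFDerivAt_fderiv_apply hr z x).2] at h1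
  rw [h1]; simp

lemma inner_shapeOperator {r : E n → ℝ} {y : E n} (hr : ContDiffAt ℝ 2 r y)
    (x z : tangentSpace r y) :
    inner ℝ (shapeOperator r y x) z = -‖gradient r y‖⁻¹ * D2 r y x z := by
  have h1 : shapeOperator r y x = (-‖gradient r y‖⁻¹) •
      (tangentSpace r y).orthogonalProjectionOnto (fderiv ℝ (gradient r) y x) := rfl
  have h2 : inner ℝ (shapeOperator r y x) z = -‖gradient r y‖⁻¹ * inner ℝ
      ((tangentSpace r y).orthogonalProjectionOnto (fderiv ℝ (gradient r) y x)) z := by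
    rw [h1]
    exact real_inner_smul_left (_ : E n) (z : E n) _
  have h3 : inner ℝ ((tangentSpace r y).orthogonalProjectionOnto (fderiv ℝ (gradient r) y x)) z =
      inner ℝ (fderiv ℝ (gradient r) y x) (z : E n) :=
    Submodule.inner_orthogonalProjectionOnto_eq_of_mem_right z _
  rw [h2, h3, inner_fderiv_gradient hr]

lemma isSymmetric_shapeOperator {r : E n → ℝ} {y : E n} (hr : ContDiffAt ℝ 2 r y) :
    (shapeOperator r y : tangentSpace r y →ₗ[ℝ] tangentSpace r y).IsSymmetric := by
  intro x z
  have e1 := inner_shapeOperator hr x z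
  have e2 := inner_shapeOperator hr z x
  have e3 : inner ℝ x (shapeOperator r y z) = inner ℝ (shapeOperator r y z) x :=
    real_inner_comm (shapeOperator r y z : E n) (x : E n)
  rw [isSymmForm_D2 hr (z : E n) x] at e2
  exact e1.trans (e3.trans e2).symm

/-- The curvatures are read off from a local function r. Proportionality of the gradients and of the
tangential Hessians transfers them to R: on the tangent space -D²R is |DR| times the shape operator
of r. -/
lemma sigma_add_rankOne_of_defining {R r : E n → ℝ} {y : E n} (hR : ContDiffAt ℝ 2 R y)
    (hr : ContDiffAt ℝ 2 r y) (hg : gradient r y ≠ 0) {q : ℝ} (hq : 0 ≤ q)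
    (h1 : fderiv ℝ R y = q • fderiv ℝ r y)
    (h2 : ∀ τ, fderiv ℝ r y τ = 0 → D2 R y τ τ = q * D2 r y τ τ) (K : ℝ) {B' : Form n}
    (hB' : ∀ x z, B' x z = -D2 R y x z + K * (fderiv ℝ R y x * fderiv ℝ R y z)) {j : ℕ}
    (hj : j + 1 ≤ n) :
    sigma (j + 1) (formMatrix B') = sigma (j + 1) (formMatrix (-D2 R y)) +
      K * ‖fderiv ℝ R y‖ ^ 2 * (‖fderiv ℝ R y‖ ^ j * (principalCurvatures r y).esymm j) := by
  have sR := isSymmForm_D2 hR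
  have sr := isSymmForm_D2 hr
  have hg0 : 0 < ‖gradient r y‖ := norm_pos_iff.2 hg
  have hF : ∀ x ∈ tangentSpace r y, fderiv ℝ r y x = 0 := fun x hx => by
    rw [← inner_gradient]
    exact Submodule.mem_orthogonal_singleton_iff_inner_right.1 hx
  have hL : ‖fderiv ℝ R y‖ = q * ‖gradient r y‖ := by
    rw [h1, norm_smul, norm_gradient, Real.norm_of_nonneg hq]
  set e := ‖gradient r y‖⁻¹ • gradient r y with he
  have hn : 0 < n := by omega
  have hsym := isSymmetric_shapeOperator hr
  have a1 : IsSymmForm (-D2 R y) := fun v w => congrArg Neg.neg (sR v w)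
  have a2 : IsSymmForm B' := fun v w => by rw [hB', hB', sR v w]; ring
  have a3 : Module.finrank ℝ (tangentSpace r y) = n - 1 := by
    have : Fact (Module.finrank ℝ (E n) = (n - 1) + 1) := ⟨by simp; omega⟩
    exact Submodule.finrank_orthogonal_span_singleton hg
  have a4 : ‖e‖ = 1 := by rw [he, norm_smul, norm_inv, norm_norm, inv_mul_cancel₀ hg0.ne']
  have a5 : ∀ x ∈ tangentSpace r y, inner ℝ x e = 0 := fun x hx => by
    rw [he, real_inner_smul_right, real_inner_comm, inner_gradient, hF x hx, mul_zero]
  have a6 : ∀ x ∈ tangentSpace r y, fderiv ℝ R y x = 0 := fun x hx => by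
    rw [h1]; simp [hF x hx]
  have a7 : fderiv ℝ R y e ^ 2 = ‖fderiv ℝ R y‖ ^ 2 := by
    rw [hL, h1, he]
    have : fderiv ℝ r y (gradient r y) = ‖gradient r y‖ ^ 2 := by
      rw [← inner_gradient, real_inner_self_eq_norm_sq]
    simp only [smul_apply, map_smul, smul_eq_mul, this]
    field_simp
  have a8 : ∀ x z : tangentSpace r y, (-D2 R y) x z =
      ‖fderiv ℝ R y‖ * inner ℝ ((shapeOperator r y : tangentSpace r y →ₗ[ℝ] tangentSpace r y) x) z := by
    intro x z
    have e1 := inner_shapeOperator hr x z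
    change -D2 R y x z = _ * inner ℝ (shapeOperator r y x) z
    rw [e1, hL]
    have hx := hF x x.2
    have hz := hF z z.2
    have a1 := h2 x hx
    have a2 := h2 z hz
    have a3 := h2 (x + z) (by rw [map_add, hx, hz, add_zero])
    simp only [map_add, add_apply, a1, a2] at a3
    rw [sR (z : E n) x, sr (z : E n) x] at a3
    field_simp
    linarith
  have key := sigma_add_rankOne a1 a2 hB' a3 a4 a5 a6 a7 hsym a8 hj
  rw [key, principalCurvatures]

end KHessian

namespace KHessian

variable {n : ℕ}

lemma IsSymmForm.ext {A B : Form n} (hA : IsSymmForm A) (hB : IsSymmForm B)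
    (h : ∀ v, A v v = B v v) (x z : E n) : A x z = B x z := by
  have h1 := h x
  have h2 := h z
  have h3 := h (x + z)
  simp only [map_add, add_apply] at h3
  rw [hA z x, hB z x] at h3
  linarith

lemma continuous_D2 {R : E n → ℝ} (hR : ContDiff ℝ 3 R) : Continuous (D2 R) := by
  have h1 : ContDiff ℝ 2 (fderiv ℝ R) := hR.fderiv_right (by norm_num)
  exact h1.continuous_fderiv (by norm_num)

lemma continuous_neg_of_normed {F : Type*} [NormedAddCommGroup F] : Continuous fun a : F => -a :=
  continuous_neg

lemma continuous_neg_form : Continuous fun A : Form n => -A := by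
  have h := continuous_neg_of_normed (F := Form n)
  exact h

/-- For S = (1 - e^{-KR})/K, on the boundary DS = DR and -D²S = -D²R + K DR⊗DR. The rank one term
adds K|DR|^{j+2}σ_j(κ) to σ_{j+1}, and convexity of the boundary makes this dominate when K is
large. -/
lemma exists_strictly_concave_defining {Ω : Set (E n)} {k : ℕ} (hkn : k ≤ n)
    (hΩo : IsOpen Ω) (hΩb : Bornology.IsBounded Ω) (hC : HasCLipBoundary 3 Ω)
    (hΩk : IsStrictlyConvexBoundary (k - 1) Ω) :
    ∃ R : E n → ℝ, ContDiff ℝ 3 R ∧ (∀ x ∈ Ω, 0 ≤ R x) ∧ ∀ y ∈ frontier Ω,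
      R y = 0 ∧ fderiv ℝ R y ≠ 0 ∧ IsConeForm k (-D2 R y) ∧ ∀ᶠ x in 𝓝 y, x ∈ Ω → 0 < R x := by
  obtain ⟨R, hR, hR0, hRf, hRr⟩ := exists_global_defining hΩo hΩb hC
  obtain ⟨δ, hδ, hδr⟩ := hΩk
  have hcomp : IsCompact (frontier Ω) :=
    Metric.isCompact_of_isClosed_isBounded isClosed_frontier
      (hΩb.closure.subset frontier_subset_closure)
  have hR2 : ∀ x, ContDiffAt ℝ 2 R x := fun x => hR.contDiffAt.of_le (by norm_num)
  have hR1 : Continuous (fderiv ℝ R) := hR.continuous_fderiv (by norm_num)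
  have hbc : ∀ v : E n → ℝ, ∀ W : Set (E n), ∀ y ∈ frontier Ω, W ∈ 𝓝 y →
      (∀ x ∈ W, ContDiffAt ℝ 2 v x) → (∀ z ∈ frontier Ω ∩ W, v z = 0) →
      ∀ V r, y ∈ V → IsDefiningFunction 2 Ω V r → ∃ q : ℝ, fderiv ℝ v y = q • fderiv ℝ r y ∧
      (∀ τ, fderiv ℝ r y τ = 0 → D2 v y τ τ = q * D2 r y τ τ) ∧
      ((∀ x ∈ Ω ∩ W, 0 ≤ v x) → 0 ≤ q) := by
    intro v W y hy hW hv hv0 V r hyV hr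
    have hvy := hv y (mem_of_mem_nhds hW)
    have c1 : ContDiffAt ℝ 1 (fderiv ℝ v) y := hvy.fderiv_right (by norm_num)
    have c2 : ContinuousAt (D2 v) y :=
      (c1.fderiv_right (m := 0) (by norm_num)).continuousAt
    refine boundary_comparison hΩo hr hyV hy hW (fun x hx => hv x hx.2) (fun z hz => ?_)
      (c1.continuousAt.tendsto.mono_left nhdsWithin_le_nhds) fun τ => ?_
    · have := (hv z hz.2).continuousAt.tendsto
      rw [hv0 z hz] at this
      exact this.mono_left nhdsWithin_le_nhds
    · have h3 : Continuous fun A : Form n => A τ τ := by fun_prop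
      exact (h3.continuousAt.comp c2).tendsto.mono_left nhdsWithin_le_nhds
  have hq : ∀ y ∈ frontier Ω, (fderiv ℝ R y ≠ 0 ∧ ∀ᶠ x in 𝓝 y, x ∈ Ω → 0 < R x) ∧
      ∃ (r : E n → ℝ) (q : ℝ), 0 ≤ q ∧ ContDiffAt ℝ 2 r y ∧ gradient r y ≠ 0 ∧
      fderiv ℝ R y = q • fderiv ℝ r y ∧
      (∀ τ, fderiv ℝ r y τ = 0 → D2 R y τ τ = q * D2 r y τ τ) ∧
      ∀ j : ℕ, 1 ≤ j → j ≤ k - 1 → δ ≤ (principalCurvatures r y).esymm j := by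
    intro y hy
    obtain ⟨V, r, hyV, hr, hcurv⟩ := hδr y hy
    obtain ⟨V', r', hyV', hr', hrR⟩ := hRr y hy
    obtain ⟨q, hq1, hq2, hq3⟩ := hbc R univ y hy univ_mem (fun x _ => hR2 x)
      (fun z hz => hRf z hz.1) V r hyV hr
    have hq0 := hq3 fun x hx => hR0 x hx.1
    have hV' : V' ∈ 𝓝 y := hr'.isOpen.mem_nhds hyV'
    refine ⟨⟨fun h0 => ?_, ?_⟩, r, q, hq0, hr.contDiffOn.contDiffAt (hr.isOpen.mem_nhds hyV),
      hr.gradient_ne y hyV, hq1, hq2, hcurv⟩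
    -- If DR vanished, R - r' ≥ 0 would have gradient -Dr' = q'Dr' with q' ≥ 0, contradicting Dr' ≠
    -- 0.
    · obtain ⟨q', hq'1, -, hq'3⟩ := hbc (fun x => R x - r' x)
        ({x | x ∈ Ω → r' x ≤ R x} ∩ V') y hy (inter_mem hrR hV')
        (fun x hx => (hR2 x).sub (hr'.contDiffOn.contDiffAt (hr'.isOpen.mem_nhds hx.2)))
        (fun z hz => by rw [hRf z hz.1, hr'.eq_zero hΩo hz.2.2 hz.1, sub_zero]) V' r' hyV' hr'
      have hq'0 := hq'3 fun x hx => sub_nonneg.2 (hx.2.1 hx.1)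
      have hd' : DifferentiableAt ℝ r' y :=
        (hr'.contDiffOn.contDiffAt hV').differentiableAt (by norm_num)
      rw [fderiv_fun_sub ((hR2 y).differentiableAt (by norm_num)) hd', h0] at hq'1
      have h1 : (q' + 1) • fderiv ℝ r' y = 0 := by
        rw [add_smul, one_smul, ← hq'1]; simp
      have h2 : fderiv ℝ r' y = 0 := (smul_eq_zero.1 h1).resolve_left (by positivity)
      exact hr'.gradient_ne y hyV' (by simp [gradient, h2])
    · filter_upwards [hrR, hV'] with x hx hxV hxΩ
      exact ((hr'.mem_iff x hxV).1 hxΩ).trans_le (hx hxΩ)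
  -- σ_{j+1}(-D²R) is bounded below on the compact boundary in units of |DR|^{j+2}, the factor
  -- carried by the rank one term.
  have hlow : ∀ j : ℕ, ∃ m : ℝ, 0 ≤ m ∧ (j + 1 ≤ n → ∀ y ∈ frontier Ω,
      -m * ‖fderiv ℝ R y‖ ^ (j + 2) ≤ sigma (j + 1) (formMatrix (-D2 R y))) := by
    intro j
    by_cases hj : j + 1 ≤ n
    · have c : ContinuousOn (fun y => sigma (j + 1) (formMatrix (-D2 R y)) /
          ‖fderiv ℝ R y‖ ^ (j + 2)) (frontier Ω) := by
        refine ContinuousOn.div ?_ (hR1.norm.pow _).continuousOn fun y hy => ?_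
        · exact (continuous_sigma (continuous_neg_form.comp (continuous_D2 hR))
            (fun x v w => congrArg Neg.neg (isSymmForm_D2 (hR2 x) v w)) hj).continuousOn
        · exact pow_ne_zero _ (norm_ne_zero_iff.2 (hq y hy).1.1)
      obtain ⟨m, hm⟩ := hcomp.exists_bound_of_continuousOn c
      refine ⟨|m|, abs_nonneg _, fun _ y hy => ?_⟩
      have h1 := (abs_le.1 ((hm y hy).trans (le_abs_self m))).1
      rwa [le_div_iff₀ (pow_pos (norm_pos_iff.2 (hq y hy).1.1) _)] at h1
    · exact ⟨0, le_rfl, fun h => absurd h hj⟩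
  choose m hm0 hm using hlow
  -- The minimum with 1 covers j = 0, where σ₀ of the curvatures equals 1 and the convexity
  -- hypothesis says nothing.
  set δ' := min δ 1 with hδ'
  have hδ'0 : 0 < δ' := lt_min hδ one_pos
  set K := ((∑ j ∈ Finset.range k, m j) + 1) / δ' with hK
  have hsum0 : 0 ≤ ∑ j ∈ Finset.range k, m j := Finset.sum_nonneg fun j _ => hm0 j
  have hK0 : 0 < K := by positivity
  have hF : ∀ t : ℝ, HasDerivAt (fun t => (1 - Real.exp (-K * t)) / K) (Real.exp (-K * t)) t := by
    intro t
    have := ((((hasDerivAt_id t).const_mul (-K)).exp).const_sub 1).div_const K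
    refine this.congr_deriv ?_
    simp; field_simp
  have hF' : ∀ t : ℝ, HasDerivAt (fun t => Real.exp (-K * t)) (-K * Real.exp (-K * t)) t := by
    intro t
    refine ((hasDerivAt_id t).const_mul (-K)).exp.congr_deriv ?_
    simp; ring
  have hFc : ContDiff ℝ 3 (fun t => (1 - Real.exp (-K * t)) / K) := by fun_prop
  have hSc : ContDiff ℝ 3 fun x => (1 - Real.exp (-K * R x)) / K := hFc.comp hR
  refine ⟨fun x => (1 - Real.exp (-K * R x)) / K, hSc, fun x hx => ?_, fun y hy => ⟨?_, ?_, ?_, ?_⟩⟩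
  · have : Real.exp (-K * R x) ≤ 1 := Real.exp_le_one_iff.2 (by nlinarith [hR0 x hx])
    exact div_nonneg (by linarith) hK0.le
  · change (1 - Real.exp (-K * R y)) / K = 0
    rw [hRf y hy]; simp
  · have h1 := (hF (R y)).comp_hasFDerivAt y ((hR2 y).differentiableAt (by norm_num)).hasFDerivAt
    have h2 : fderiv ℝ (fun x => (1 - Real.exp (-K * R x)) / K) y = fderiv ℝ R y := by
      refine HasFDerivAt.fderiv (h1.congr_fderiv ?_)
      rw [hRf y hy]; simp
    rw [h2]; exact (hq y hy).1.1
  · have hS2 : ContDiffAt ℝ 2 (fun x => (1 - Real.exp (-K * R x)) / K) y :=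
      hSc.contDiffAt.of_le (by norm_num)
    have sS := isSymmForm_D2 hS2
    have sR := isSymmForm_D2 (hR2 y)
    have hform : ∀ x z, (-D2 (fun x => (1 - Real.exp (-K * R x)) / K) y) x z =
        -D2 R y x z + K * (fderiv ℝ R y x * fderiv ℝ R y z) := by
      intro x z
      have hB : IsSymmForm (-D2 R y + K • (fderiv ℝ R y).smulRight (fderiv ℝ R y)) := by
        intro v w
        change -D2 R y v w + K * (fderiv ℝ R y v * fderiv ℝ R y w) =
          -D2 R y w v + K * (fderiv ℝ R y w * fderiv ℝ R y v)
        rw [sR v w]; ring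
      have := IsSymmForm.ext (A := -D2 (fun x => (1 - Real.exp (-K * R x)) / K) y)
        (fun v w => congrArg Neg.neg (sS v w)) hB (fun v => ?_) x z
      · exact this
      · change -D2 (fun x => (1 - Real.exp (-K * R x)) / K) y v v =
          -D2 R y v v + K * (fderiv ℝ R y v * fderiv ℝ R y v)
        rw [D2_comp_real (hR2 y) (hFc.contDiffAt.of_le (by norm_num))
          (Eventually.of_forall hF) (hF' _), hRf y hy]
        rw [mul_zero, Real.exp_zero]; ring
    refine ⟨fun v w => congrArg Neg.neg (sS v w), fun j hj => ?_⟩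
    rcases j with _ | j
    · simp [sigma, Multiset.esymm]
    obtain ⟨⟨hne, -⟩, r, q, hq0, hrc, hg, hq1, hq2, hcurv⟩ := hq y hy
    rw [sigma_add_rankOne_of_defining (hR2 y) hrc hg hq0 hq1 hq2 K hform (by omega)]
    have h1 := hm j (by omega) y hy
    have hp : 0 < ‖fderiv ℝ R y‖ ^ (j + 2) := pow_pos (norm_pos_iff.2 hne) _
    have h2 : δ' ≤ (principalCurvatures r y).esymm j := by
      rcases Nat.eq_zero_or_pos j with rfl | hj0
      · have : (principalCurvatures r y).esymm 0 = 1 := by simp [Multiset.esymm]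
        rw [this]; exact min_le_right δ 1
      · exact (min_le_left _ _).trans (hcurv j hj0 (by omega))
    have h3 : m j ≤ ∑ j ∈ Finset.range k, m j :=
      Finset.single_le_sum (fun j _ => hm0 j) (Finset.mem_range.2 (by omega))
    have h4 : m j + 1 ≤ K * (principalCurvatures r y).esymm j := by
      calc m j + 1 ≤ K * δ' := by rw [hK, div_mul_cancel₀ _ hδ'0.ne']; linarith
        _ ≤ _ := mul_le_mul_of_nonneg_left h2 hK0.le
    have h5 := mul_le_mul_of_nonneg_left h4 hp.le
    have h6 : K * ‖fderiv ℝ R y‖ ^ 2 * (‖fderiv ℝ R y‖ ^ j * (principalCurvatures r y).esymm j) =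
      ‖fderiv ℝ R y‖ ^ (j + 2) * (K * (principalCurvatures r y).esymm j) := by ring
    rw [h6]
    linarith
  · filter_upwards [(hq y hy).1.2] with x hx hxΩ
    have h1 : Real.exp (-K * R x) < 1 := Real.exp_lt_one_iff.2 (by nlinarith [hx hxΩ])
    exact div_pos (by linarith) hK0

end KHessian

/-! ### Construction of the barrier. -/

namespace KHessian

variable {n : ℕ}

/-- The Euclidean metric as a bilinear form. -/
noncomputable def metricForm (n : ℕ) : Form n := innerSL ℝ

lemma continuous_neg_sub_smul {F : Type*} [NormedAddCommGroup F] [NormedSpace ℝ F] (g : F) :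
    Continuous fun p : F × ℝ => -p.1 - p.2 • g := by fun_prop

lemma isOpen_cone_sub {k : ℕ} (hkn : k ≤ n) {R : E n → ℝ} (hR : ContDiff ℝ 3 R) :
    IsOpen {p : E n × ℝ | IsConeForm k (-D2 R p.1 - p.2 • metricForm n)} := by
  have hs : ∀ p : E n × ℝ, IsSymmForm (-D2 R p.1 - p.2 • metricForm n) := by
    intro p v w
    have := isSymmForm_D2 (hR.contDiffAt.of_le (by norm_num) : ContDiffAt ℝ 2 R p.1) v w
    change -D2 R p.1 v w - p.2 * inner ℝ v w = -D2 R p.1 w v - p.2 * inner ℝ w v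
    rw [this, real_inner_comm]
  have hc : Continuous fun p : E n × ℝ => (-D2 R p.1 - p.2 • metricForm n) := by
    have h1 : Continuous fun p : E n × ℝ => (D2 R p.1, p.2) :=
      ((continuous_D2 hR).comp continuous_fst).prodMk continuous_snd
    have h2 := (continuous_neg_sub_smul (metricForm n)).comp h1
    exact h2
  have e : {p : E n × ℝ | IsConeForm k (-D2 R p.1 - p.2 • metricForm n)} =
      ⋂ j ∈ Iic k, {p | 0 < sigma j (formMatrix (-D2 R p.1 - p.2 • metricForm n))} := by
    ext p
    simp only [mem_ofPred_eq, mem_iInter, mem_Iic]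
    exact ⟨fun h => h.pos, fun h => ⟨hs p, h⟩⟩
  rw [e]
  exact (finite_Iic k).isOpen_biInter fun j hj =>
    isOpen_lt continuous_const (continuous_sigma hc hs (le_trans hj hkn))

lemma exists_norm_le_of_continuous {F : Type*} [NormedAddCommGroup F] {S : Set (E n)}
    (hS : IsCompact S) {f : E n → F} (hf : Continuous f) : ∃ M : ℝ, ∀ x ∈ S, ‖f x‖ ≤ M :=
  hS.exists_bound_of_continuousOn hf.continuousOn

lemma exists_norm_form_le {S : Set (E n)} (hS : IsCompact S) {F : E n → Form n}
    (hF : Continuous F) : ∃ M : ℝ, ∀ x ∈ S, ∀ v w, |F x v w| ≤ M * ‖v‖ * ‖w‖ := by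
  have h := exists_norm_le_of_continuous hS (F := Form n) (f := F)
  obtain ⟨M, hM⟩ := h hF
  exact ⟨M, fun x hx v w => (F x).le_of_opNorm₂_le_of_le (hM x hx) le_rfl le_rfl⟩

/-- Gårding's inequality for -A - c·metric, with its nonnegative left side discarded. -/
lemma sum_gw_le_of_isConeForm {k : ℕ} (hk : 0 < k) {A B : Form n} {c : ℝ}
    (hA : IsConeForm k (-A - c • metricForm n)) (hB : IsConeForm k B) {v : Fin n → E n}
    {l : Fin n → ℝ} (hv : IsEigenframe B v l) :
    ∑ i, gw k l i * A (v i) (v i) ≤ -c * ∑ i, gw k l i := by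
  have h1 := garding_form hk hB hA hv hv.orthonormal
  have h2 : 0 ≤ sigma k (formMatrix (-A - c • metricForm n)) ^ (1 / (k:ℝ)) :=
    Real.rpow_nonneg (hA.pos k le_rfl).le _
  have h3 : ∀ i, (-A - c • metricForm n) (v i) (v i) = -A (v i) (v i) - c := fun i => by
    change -A (v i) (v i) - c * inner ℝ (v i) (v i) = _
    rw [real_inner_self_eq_norm_sq, hv.orthonormal.1 i]; ring
  simp only [h3, mul_sub, Finset.sum_sub_distrib, mul_neg, Finset.sum_neg_distrib,
    ← Finset.sum_mul] at h1
  linarith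

lemma exists_third_derivative_bound {R : E n → ℝ} (hR : ContDiff ℝ 3 R) {S : Set (E n)}
    (hS : IsCompact S) : ∃ M : ℝ, ∀ x ∈ S, ∀ ξ v,
      |D2 (fun y => fderiv ℝ R y ξ) x v v| ≤ M * ‖ξ‖ * ‖v‖ ^ 2 := by
  have hc : ∀ ξ, ContDiff ℝ 2 fun y => fderiv ℝ R y ξ := fun ξ =>
    (hR.fderiv_right (m := 2) (by norm_num)).clm_apply contDiff_const
  have hD : ∀ ξ, Continuous (D2 fun y => fderiv ℝ R y ξ) := fun ξ =>
    ((hc ξ).fderiv_right (m := 1) (by norm_num)).continuous_fderiv (by norm_num)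
  have hM : ∀ j : Fin n, ∃ M : ℝ, ∀ x ∈ S, ∀ v w,
      |D2 (fun y => fderiv ℝ R y (EuclideanSpace.single j 1)) x v w| ≤ M * ‖v‖ * ‖w‖ := fun j =>
    exists_norm_form_le hS (hD _)
  choose M hM using hM
  refine ⟨∑ j, |M j|, fun x hx ξ v => ?_⟩
  have e1 : (fun y => fderiv ℝ R y ξ) =
      fun y => ∑ j : Fin n, ξ j * fderiv ℝ R y (EuclideanSpace.single j 1) := by
    ext1 y
    have := (EuclideanSpace.basisFun (Fin n) ℝ).sum_repr ξ
    simp only [EuclideanSpace.basisFun_apply, EuclideanSpace.basisFun_repr] at this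
    conv_lhs => rw [← this]
    simp
  rw [e1, D2_sum _ fun j _ => contDiffAt_const.mul (hc _).contDiffAt]
  calc _ ≤ ∑ j : Fin n, |M j| * ‖ξ‖ * ‖v‖ ^ 2 := by
        refine (Finset.abs_sum_le_sum_abs _ _).trans (Finset.sum_le_sum fun j _ => ?_)
        rw [D2_const_mul (hc _).contDiffAt]
        change |ξ j * D2 (fun y => fderiv ℝ R y (EuclideanSpace.single j 1)) x v v| ≤ _
        have h1 : |D2 (fun y => fderiv ℝ R y (EuclideanSpace.single j 1)) x v v| ≤
            |M j| * ‖v‖ * ‖v‖ := by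
          refine (hM j x hx v v).trans ?_
          gcongr
          exact le_abs_self _
        have h2 : |ξ j| ≤ ‖ξ‖ := PiLp.norm_apply_le ξ j
        rw [abs_mul]
        calc _ ≤ ‖ξ‖ * (|M j| * ‖v‖ * ‖v‖) := by gcongr
          _ = _ := by ring
    _ = _ := by rw [Finset.sum_mul, Finset.sum_mul]

/-- Membership of -D²R in the cone is an open condition, so by compactness it persists near the
boundary even after a small multiple of the metric is subtracted. That multiple is c₀. -/
theorem exists_isBarrier {Ω : Set (E n)} {k : ℕ} (hk : 0 < k) (hkn : k ≤ n)
    (hΩo : IsOpen Ω) (hΩb : Bornology.IsBounded Ω) (hne : (frontier Ω).Nonempty)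
    (hC : HasCLipBoundary 3 Ω) (hΩk : IsStrictlyConvexBoundary (k - 1) Ω) :
    ∃ (V : Set (E n)) (ρ : E n → ℝ) (ρ₁ c₀ C₀ : ℝ), 0 < ρ₁ ∧ 0 < c₀ ∧ 1 ≤ C₀ ∧
      IsBarrier k Ω V ρ ρ₁ c₀ C₀ := by
  obtain ⟨R, hR, hR0, hRf⟩ := exists_strictly_concave_defining hkn hΩo hΩb hC hΩk
  have hcomp : IsCompact (frontier Ω) :=
    Metric.isCompact_of_isClosed_isBounded isClosed_frontier
      (hΩb.closure.subset frontier_subset_closure)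
  have hcompΩ : IsCompact (closure Ω) :=
    Metric.isCompact_of_isClosed_isBounded isClosed_closure hΩb.closure
  have hR2 : ∀ x, ContDiffAt ℝ 2 R x := fun x => hR.contDiffAt.of_le (by norm_num)
  have hR1c : ContDiff ℝ 2 (fderiv ℝ R) := hR.fderiv_right (by norm_num)
  have hR1 : Continuous (fderiv ℝ R) := hR1c.continuous
  -- a uniform neighbourhood on which `-D²R` minus a multiple of the metric is in the cone
  obtain ⟨U₁, U₂, hU₁, hU₂, hfU, h0U, hUU⟩ := generalized_tube_lemma hcomp
    (isCompact_singleton (x := (0:ℝ))) (isOpen_cone_sub (k := k) hkn hR) (by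
      rintro ⟨y, c⟩ ⟨hy, hc⟩
      have hc0 : c = 0 := hc
      rw [hc0]
      have := (hRf y hy).2.2.1
      change IsConeForm k (-D2 R y - (0:ℝ) • metricForm n)
      have e : -D2 R y - (0:ℝ) • metricForm n = -D2 R y := by
        ext v w
        change -D2 R y v w - 0 * inner ℝ v w = -D2 R y v w
        ring
      rwa [e])
  obtain ⟨c, hc, hcU⟩ := Metric.isOpen_iff.1 hU₂ 0 (h0U rfl)
  have hcU' : c / 2 ∈ U₂ := hcU (by
    rw [Metric.mem_ball, Real.dist_eq, sub_zero, abs_of_pos (by positivity)]; linarith)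
  have hcone : ∀ x ∈ U₁, IsConeForm k (-D2 R x - (c / 2) • metricForm n) := fun x hx => by
    have h : (x, c / 2) ∈ U₁ ×ˢ U₂ := mk_mem_prod hx hcU'
    exact hUU h
  obtain ⟨l₀, hl₀, hl⟩ : ∃ l₀ > 0, ∀ y ∈ frontier Ω, l₀ < ‖fderiv ℝ R y‖ := by
    obtain ⟨z, hz, hmin⟩ := hcomp.exists_isMinOn hne hR1.norm.continuousOn
    have hz0 := norm_pos_iff.2 (hRf z hz).2.1
    exact ⟨‖fderiv ℝ R z‖ / 2, by positivity, fun y hy => by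
      have := isMinOn_iff.1 hmin y hy; linarith⟩
  have hU₃ : IsOpen {x | l₀ < ‖fderiv ℝ R x‖} := isOpen_lt continuous_const hR1.norm
  choose! W hWy hWo using fun y (hy : y ∈ frontier Ω) => eventually_nhds_iff.1 (hRf y hy).2.2.2 |>.imp
    fun W hW => (⟨hW.2.2, hW.2.1, hW.1⟩ : y ∈ W ∧ IsOpen W ∧ ∀ x ∈ W, x ∈ Ω → 0 < R x)
  have hU₄ : IsOpen (⋃ y ∈ frontier Ω, W y) := isOpen_biUnion fun y hy => (hWo y hy).1
  obtain ⟨r, hr, hthick⟩ := hcomp.exists_thickening_subset_open ((hU₁.inter hU₃).inter hU₄)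
    fun y hy => ⟨⟨hfU hy, hl y hy⟩, mem_biUnion hy (hWy y hy)⟩
  set d : E n → ℝ := fun x => Metric.infDist x (frontier Ω) with hd
  have hdc : Continuous d := Metric.continuous_infDist_pt _
  have hthick' : ∀ x, d x < r → x ∈ U₁ ∧ l₀ < ‖fderiv ℝ R x‖ ∧ (x ∈ Ω → 0 < R x) := fun x hx => by
    have h1 : x ∈ Metric.thickening r (frontier Ω) := by
      rwa [Metric.mem_thickening_iff_infDist_lt hne]
    obtain ⟨⟨h2, h3⟩, h4⟩ := hthick h1
    obtain ⟨y, hy, hxy⟩ := mem_iUnion₂.1 h4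
    exact ⟨h2, h3, (hWo y hy).2 x hxy⟩
  -- R is known to be positive only near the boundary. The added term vanishes at distance at most
  -- r/2 from the boundary, so ρ has the derivatives of R in the strip and is positive in all of Ω.
  set ρ : E n → ℝ := fun x => R x + max 0 (d x - r / 2) with hρ
  set V : Set (E n) := {x | d x < r / 2} with hV
  have hVo : IsOpen V := isOpen_lt hdc continuous_const
  have hρR : ∀ x ∈ V, ρ =ᶠ[𝓝 x] R := fun x hx => by
    filter_upwards [hVo.mem_nhds hx] with z hz
    rw [hρ]
    simp only
    rw [max_eq_left (by linarith [show d z < r / 2 from hz]), add_zero]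
  have hVr : ∀ x ∈ V, d x < r := fun x hx => by
    have : d x < r / 2 := hx
    linarith
  have hVb : Bornology.IsBounded V := by
    refine (hcomp.isBounded.cthickening (δ := r / 2)).subset fun x hx => ?_
    exact Metric.thickening_subset_cthickening _ _
      ((Metric.mem_thickening_iff_infDist_lt hne).2 hx)
  have hVc : IsCompact (closure V) :=
    Metric.isCompact_of_isClosed_isBounded isClosed_closure hVb.closure
  have hρc : Continuous ρ := hR.continuous.add (continuous_const.max (hdc.sub continuous_const))
  have hpos : ∀ x ∈ Ω, 0 < ρ x := fun x hx => by
    by_cases hxr : d x < r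
    · have := (hthick' x hxr).2.2 hx
      exact add_pos_of_pos_of_nonneg this (le_max_left _ _)
    · have h1 : 0 < max 0 (d x - r / 2) := lt_max_of_lt_right (by linarith [not_lt.1 hxr])
      exact add_pos_of_nonneg_of_pos (hR0 x hx) h1
  have hfV : frontier Ω ⊆ V := fun y hy => by
    change Metric.infDist y (frontier Ω) < r / 2
    rw [Metric.infDist_zero_of_mem hy]; positivity
  obtain ⟨ρ₁, hρ₁, hρ₁'⟩ : ∃ ρ₁ > 0, ∀ x ∈ closure Ω, ρ x ≤ ρ₁ → x ∈ V := by
    have hK : IsCompact (closure Ω \ V) := hcompΩ.diff hVo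
    have hKΩ : ∀ x ∈ closure Ω \ V, x ∈ Ω := fun x hx => by
      by_contra h
      exact hx.2 (hfV ⟨hx.1, by rwa [hΩo.interior_eq]⟩)
    rcases (closure Ω \ V).eq_empty_or_nonempty with h | h
    · exact ⟨1, one_pos, fun x hx _ => by
        by_contra hxV
        exact (h ▸ (⟨hx, hxV⟩ : x ∈ closure Ω \ V) : x ∈ (∅ : Set _))⟩
    · obtain ⟨z, hz, hmin⟩ := hK.exists_isMinOn h hρc.continuousOn
      refine ⟨ρ z / 2, half_pos (hpos z (hKΩ z hz)), fun x hx hxρ => ?_⟩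
      by_contra hxV
      have h1 := isMinOn_iff.1 hmin x ⟨hx, hxV⟩
      linarith [hpos z (hKΩ z hz)]
  obtain ⟨M₁, hM₁⟩ := hVc.exists_bound_of_continuousOn (f := fderiv ℝ R) hR1.continuousOn
  obtain ⟨M₂, hM₂⟩ := exists_norm_form_le hVc (continuous_D2 hR)
  obtain ⟨M₃, hM₃⟩ := exists_third_derivative_bound hR hVc
  set C₀ := 1 + |M₁| + |M₂| + |M₃| + 1 / l₀ with hC₀
  have hl₀' : 0 < 1 / l₀ := by positivity
  have hC1 : M₁ ≤ C₀ := by linarith [le_abs_self M₁, abs_nonneg M₂, abs_nonneg M₃]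
  have hC2 : M₂ ≤ C₀ := by linarith [le_abs_self M₂, abs_nonneg M₁, abs_nonneg M₃]
  have hC3 : M₃ ≤ C₀ := by linarith [le_abs_self M₃, abs_nonneg M₂, abs_nonneg M₁]
  have hC4 : 1 / l₀ ≤ C₀ := by linarith [abs_nonneg M₁, abs_nonneg M₂, abs_nonneg M₃]
  refine ⟨V, ρ, ρ₁, c / 2, C₀, hρ₁, by positivity,
    by linarith [abs_nonneg M₁, abs_nonneg M₂, abs_nonneg M₃], hVo, hρc.continuousOn, hpos, ?_,
    hρ₁', ?_, ?_, ?_, ?_, ?_, ?_⟩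
  · intro y hy
    rw [(hρR y (hfV hy)).self_of_nhds, (hRf y hy).1]
  · exact fun x hx => (hR.contDiffAt.congr_of_eventuallyEq (hρR x hx)).contDiffWithinAt
  · intro x hx
    rw [(hρR x hx).fderiv_eq]
    exact (hM₁ x (subset_closure hx)).trans hC1
  · intro x hx
    rw [(hρR x hx).fderiv_eq]
    have h1 := (hthick' x (hVr x hx)).2.1
    calc (1:ℝ) = 1 / l₀ * l₀ := by field_simp
      _ ≤ C₀ * ‖fderiv ℝ R x‖ := mul_le_mul hC4 h1.le hl₀.le (hl₀'.le.trans hC4)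
  · intro x hx v w
    rw [D2_congr (hρR x hx)]
    refine (hM₂ x (subset_closure hx) v w).trans ?_
    gcongr
  · intro x hx ξ v
    have e1 : (fun y => fderiv ℝ ρ y ξ) =ᶠ[𝓝 x] fun y => fderiv ℝ R y ξ := by
      have e0 : fderiv ℝ ρ =ᶠ[𝓝 x] fderiv ℝ R := (hρR x hx).fderiv
      filter_upwards [e0] with z hz
      rw [hz]
    rw [D2_congr e1]
    refine (hM₃ x (subset_closure hx) ξ v).trans ?_
    gcongr
  · intro x hx B hB v l hv
    rw [D2_congr (hρR x hx)]
    exact sum_gw_le_of_isConeForm hk (hcone x (hthick' x (hVr x hx)).1) hB hv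

end KHessian

/-! ### Semiconvexity of powers of nonnegative functions. -/

namespace KHessian

variable {n : ℕ}

lemma add_mul_deriv_le {φ ψ χ : ℝ → ℝ} {T : ℝ} (hT : 0 ≤ T)
    (hφ : ∀ t ∈ Icc 0 T, HasDerivAt φ (ψ t) t) (hψ : ∀ t ∈ Icc 0 T, HasDerivAt ψ (χ t) t)
    (hχ : ∀ t ∈ Icc 0 T, 0 ≤ χ t) : φ 0 + T * ψ 0 ≤ φ T := by
  have h0 : (0:ℝ) ∈ Icc 0 T := ⟨le_rfl, hT⟩
  have hmψ : MonotoneOn ψ (Icc 0 T) := by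
    refine monotoneOn_of_hasDerivWithinAt_nonneg (f' := χ) (convex_Icc 0 T)
      (fun t ht => (hψ t ht).continuousAt.continuousWithinAt)
      (fun t ht => (hψ t (interior_subset ht)).hasDerivWithinAt)
      fun t ht => hχ t (interior_subset ht)
  have hm : MonotoneOn (fun t => φ t - t * ψ 0) (Icc 0 T) := by
    have hd : ∀ t ∈ Icc 0 T, HasDerivAt (fun t => φ t - t * ψ 0) (ψ t - ψ 0) t := fun t ht => by
      refine ((hφ t ht).sub ((hasDerivAt_id t).mul_const (ψ 0))).congr_deriv ?_
      simp
    refine monotoneOn_of_hasDerivWithinAt_nonneg (f' := fun t => ψ t - ψ 0) (convex_Icc 0 T)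
      (fun t ht => (hd t ht).continuousAt.continuousWithinAt)
      (fun t ht => (hd t (interior_subset ht)).hasDerivWithinAt) fun t ht => ?_
    exact sub_nonneg.2 (hmψ h0 (interior_subset ht) (interior_subset ht).1)
  have := hm h0 ⟨hT, le_rfl⟩ hT
  simp only [zero_mul, sub_zero] at this
  linarith

/-- Bernoulli's inequality bounds the complementary power r^{1-β} from above. Multiplying by it and
using r^β r^{1-β} = r leaves an error of the right sign, (r-1)²(β² + (1-β)r). -/
lemma one_add_sub_sq_le_rpow {r β : ℝ} (hr : 0 < r) (hβ : 0 ≤ β) (hβ1 : β ≤ 1) :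
    1 + β * (r - 1) - (r - 1) ^ 2 ≤ r ^ β := by
  have h1 : r ^ (1 - β) ≤ 1 + (1 - β) * (r - 1) := by
    have := rpow_one_add_le_one_add_mul_self (s := r - 1) (p := 1 - β) (by linarith)
      (by linarith) (by linarith)
    rwa [add_sub_cancel] at this
  have hp : 0 < r ^ (1 - β) := Real.rpow_pos_of_pos hr _
  have h2 : r ^ β * r ^ (1 - β) = r := by rw [← Real.rpow_add hr]; simp
  have hq : 0 < r ^ β := Real.rpow_pos_of_pos hr _
  by_contra! hc
  have h3 : r < (1 + β * (r - 1) - (r - 1) ^ 2) * (1 + (1 - β) * (r - 1)) := by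
    calc r = r ^ β * r ^ (1 - β) := h2.symm
      _ < (1 + β * (r - 1) - (r - 1) ^ 2) * r ^ (1 - β) := by gcongr
      _ ≤ _ := by
        have : 0 ≤ 1 + β * (r - 1) - (r - 1) ^ 2 := hq.le.trans hc.le
        gcongr
  have h4 : (1 + β * (r - 1) - (r - 1) ^ 2) * (1 + (1 - β) * (r - 1)) =
      r - (r - 1) ^ 2 * (β ^ 2 + (1 - β) * r) := by ring
  have h5 : 0 ≤ (r - 1) ^ 2 * (β ^ 2 + (1 - β) * r) := by
    have : 0 ≤ 1 - β := by linarith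
    positivity
  linarith

/-- A lower bound for the second derivative of a power of a nonnegative function, from
nonnegativity of the third order Taylor polynomial. -/
lemma exists_mul_sub_sq_ge (L d M : ℝ) (hL : 0 ≤ L) (hd : 0 < d) (hM : 0 < M) :
    ∃ C : ℝ, 0 ≤ C ∧ ∀ γ p q : ℝ, 0 < γ → γ ≤ M →
      (∀ t, |t| < d → 0 ≤ γ ^ 3 + t * p + t ^ 2 / 2 * q + L * |t| ^ 3) →
      -C * γ ^ 4 ≤ γ ^ 3 * q - p ^ 2 / 2 := by
  set c := 4 * M / d with hc
  have hc0 : 0 < c := by positivity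
  set s := d / (2 * M) with hs
  have hs0 : 0 < s := by positivity
  refine ⟨4 * L / c + (2 / s ^ 2 + 2 * L * s + c ^ 2), by positivity, fun γ p q hγ hγM h => ?_⟩
  have hA : 0 ≤ 4 * L / c := by positivity
  have hB : 0 ≤ 2 / s ^ 2 + 2 * L * s + c ^ 2 := by positivity
  rcases le_or_gt (c * γ ^ 2) |p| with hp | hp
  · have hp0 : 0 < |p| := lt_of_lt_of_le (by positivity) hp
    -- When |p| is large, the polynomial is tested against the sign of p at the t with t|p| = 2γ³.
    -- Multiplication by p²/(2γ³) then gives γ³q - p²/2 up to 4Lγ⁶/|p|. The condition |p| ≥ cγ²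
    -- keeps t below d and makes this error of order γ⁴.
    set t := 2 * γ ^ 3 / |p| with ht
    have ht0 : 0 < t := by positivity
    have htd : t < d := by
      rw [ht, div_lt_iff₀ hp0]
      have : 2 * γ ^ 3 < d * (c * γ ^ 2) := by
        have e : d * (c * γ ^ 2) = 4 * M * γ ^ 2 := by rw [hc]; field_simp
        rw [e]
        nlinarith [mul_le_mul_of_nonneg_right hγM (sq_nonneg γ), pow_pos hγ 3]
      exact this.trans_le (mul_le_mul_of_nonneg_left hp hd.le)
    have key : 0 ≤ γ ^ 3 - t * |p| + t ^ 2 / 2 * q + L * t ^ 3 := by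
      rcases abs_cases p with ⟨e, -⟩ | ⟨e, -⟩
      · have := h (-t) (by rwa [abs_neg, abs_of_pos ht0])
        rw [abs_neg, abs_of_pos ht0, neg_sq] at this
        rw [e]; linarith
      · have := h t (by rwa [abs_of_pos ht0])
        rw [abs_of_pos ht0] at this
        rw [e]; linarith
    have e1 : t * |p| = 2 * γ ^ 3 := div_mul_cancel₀ _ hp0.ne'
    have h1 : 0 ≤ γ ^ 3 * q - p ^ 2 / 2 + 4 * L * γ ^ 6 / |p| := by
      have e2 : γ ^ 3 - t * |p| + t ^ 2 / 2 * q + L * t ^ 3 =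
          2 * γ ^ 3 / |p| ^ 2 * (γ ^ 3 * q - |p| ^ 2 / 2 + 4 * L * γ ^ 6 / |p|) := by
        rw [e1, ht]; field_simp; ring
      rw [e2] at key
      rw [← sq_abs p]
      exact nonneg_of_mul_nonneg_right key (by positivity)
    have h2 : 4 * L * γ ^ 6 / |p| ≤ 4 * L / c * γ ^ 4 := by
      rw [div_le_iff₀ hp0]
      calc 4 * L * γ ^ 6 = 4 * L / c * γ ^ 4 * (c * γ ^ 2) := by field_simp
        _ ≤ _ := by gcongr
    have h3 := mul_nonneg hB (pow_nonneg hγ.le 4)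
    linarith
  -- When |p| is small, averaging over ±t removes p. This leaves q ≥ -Cγ, and p² is itself of order
  -- γ⁴.
  · set t := s * γ with ht
    have ht0 : 0 < t := by positivity
    have htd : t < d := by
      calc s * γ ≤ s * M := by gcongr
        _ = d / 2 := by rw [hs]; field_simp
        _ < d := by linarith
    have h1 := h t (by rwa [abs_of_pos ht0])
    have h2 := h (-t) (by rwa [abs_neg, abs_of_pos ht0])
    rw [abs_neg, neg_sq] at h2
    rw [abs_of_pos ht0] at h1 h2
    have h3 : 0 ≤ γ ^ 3 + t ^ 2 / 2 * q + L * t ^ 3 := by linarith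
    have e2 : γ ^ 3 + t ^ 2 / 2 * q + L * t ^ 3 =
        s ^ 2 * γ ^ 2 / 2 * (q + (2 / s ^ 2 + 2 * L * s) * γ) := by
      rw [ht]; field_simp; ring
    rw [e2] at h3
    have h4 := nonneg_of_mul_nonneg_right h3 (by positivity)
    have h5 := mul_nonneg (pow_nonneg hγ.le 3) h4
    have h6 : p ^ 2 ≤ c ^ 2 * γ ^ 4 := by
      rw [← sq_abs p]
      calc |p| ^ 2 ≤ (c * γ ^ 2) ^ 2 := by gcongr
        _ = _ := by ring
    have h7 := mul_nonneg hA (pow_nonneg hγ.le 4)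
    have h8 := mul_nonneg (sq_nonneg c) (pow_nonneg hγ.le 4)
    linarith

/-- The bounds on a positive function with Lipschitz gradient used below. -/
structure HasGradBounds (S U : Set (E n)) (g : E n → ℝ) (d M : ℝ) : Prop where
  isOpen : IsOpen S
  isOpen' : IsOpen U
  ball_subset : ∀ x ∈ S, Metric.ball x d ⊆ U
  contDiffOn : ContDiffOn ℝ 1 g U
  pos : ∀ x ∈ U, 0 < g x
  le : ∀ x ∈ U, g x ≤ M
  norm_le : ∀ x ∈ U, ‖fderiv ℝ g x‖ ≤ M
  lipschitz : ∀ x ∈ S, ∀ y ∈ Metric.ball x d, ‖fderiv ℝ g y - fderiv ℝ g x‖ ≤ M * ‖y - x‖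

lemma HasGradBounds.differentiableAt {S U : Set (E n)} {g : E n → ℝ} {d M : ℝ}
    (h : HasGradBounds S U g d M) {x : E n} (hx : x ∈ U) : DifferentiableAt ℝ g x :=
  (h.contDiffOn.contDiffAt (h.isOpen'.mem_nhds hx)).differentiableAt (by norm_num)

lemma HasGradBounds.taylor {S U : Set (E n)} {g : E n → ℝ} {d M : ℝ}
    (h : HasGradBounds S U g d M) (hM : 0 ≤ M) {x y : E n} (hx : x ∈ S)
    (hy : y ∈ Metric.ball x d) : |g y - g x - fderiv ℝ g x (y - x)| ≤ M * ‖y - x‖ ^ 2 := by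
  have hyd : ‖y - x‖ < d := by rwa [mem_ball_iff_norm] at hy
  have hsub : Metric.closedBall x ‖y - x‖ ⊆ Metric.ball x d := Metric.closedBall_subset_ball hyd
  have := (convex_closedBall x ‖y - x‖).norm_image_sub_le_of_norm_fderiv_le' (𝕜 := ℝ) (f := g)
    (φ := fderiv ℝ g x) (C := M * ‖y - x‖) (x := x) (y := y)
    (fun z hz => h.differentiableAt (h.ball_subset x hx (hsub hz)))
    (fun z hz => (h.lipschitz x hx z (hsub hz)).trans
      (mul_le_mul_of_nonneg_left (by rwa [mem_closedBall_iff_norm] at hz) hM))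
    (Metric.mem_closedBall_self (norm_nonneg _)) (by rw [mem_closedBall_iff_norm])
  rw [Real.norm_eq_abs] at this
  linarith [this]

/-- Stepping against the gradient lowers g by about s|Dg|², with a second order error at most half
of that for the chosen s. Since g stays positive, |Dg|² is at most a multiple of g. The term M/d in
the constant keeps the step shorter than d. -/
lemma HasGradBounds.norm_sq_le {S U : Set (E n)} {g : E n → ℝ} {d M : ℝ}
    (h : HasGradBounds S U g d M) (hM : 0 ≤ M) (hd : 0 < d) {x : E n} (hx : x ∈ S) :
    ‖fderiv ℝ g x‖ ^ 2 ≤ 4 * (M + M / d + 1) * g x := by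
  set M' := M + M / d + 1 with hM'
  have hMd : 0 ≤ M / d := by positivity
  have hM'0 : 0 < M' := by positivity
  have hxU : x ∈ U := h.ball_subset x hx (Metric.mem_ball_self hd)
  obtain ⟨ν, hν, hνn⟩ := exists_inner_eq (fderiv ℝ g x)
  set s := 1 / (2 * M') with hs
  have hs0 : 0 < s := by positivity
  have hn : ‖(x - s • ν) - x‖ = s * ‖fderiv ℝ g x‖ := by
    rw [sub_sub_cancel_left, norm_neg, norm_smul, hνn, Real.norm_of_nonneg hs0.le]
  have hy : x - s • ν ∈ Metric.ball x d := by
    rw [mem_ball_iff_norm, hn]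
    have h1 : s * ‖fderiv ℝ g x‖ ≤ s * M := mul_le_mul_of_nonneg_left (h.norm_le x hxU) hs0.le
    have h2 : s * M < d := by
      rw [hs, div_mul_eq_mul_div, one_mul, div_lt_iff₀ (by positivity)]
      have : d * (2 * M') = 2 * d * M + 2 * M + 2 * d := by rw [hM']; field_simp
      rw [this]
      nlinarith [mul_nonneg hd.le hM]
    linarith
  have h1 := (abs_le.1 (h.taylor hM hx hy)).2
  have h2 := h.pos _ (h.ball_subset x hx hy)
  have h3 : fderiv ℝ g x (x - s • ν - x) = -(s * ‖fderiv ℝ g x‖ ^ 2) := by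
    rw [sub_sub_cancel_left, map_neg, map_smul, ← hν, real_inner_self_eq_norm_sq, hνn, smul_eq_mul]
  rw [h3, hn] at h1
  have h4 : M * (s * ‖fderiv ℝ g x‖) ^ 2 ≤ s * ‖fderiv ℝ g x‖ ^ 2 / 2 := by
    have : M * s ≤ 1 / 2 := by
      rw [hs, mul_one_div, div_le_div_iff₀ (by positivity) (by positivity)]
      linarith
    calc M * (s * ‖fderiv ℝ g x‖) ^ 2 = M * s * (s * ‖fderiv ℝ g x‖ ^ 2) := by ring
      _ ≤ 1 / 2 * (s * ‖fderiv ℝ g x‖ ^ 2) := by gcongr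
      _ = _ := by ring
  have h5 : s * ‖fderiv ℝ g x‖ ^ 2 ≤ 2 * g x := by linarith
  calc ‖fderiv ℝ g x‖ ^ 2 = 2 * M' * (s * ‖fderiv ℝ g x‖ ^ 2) := by rw [hs]; field_simp
    _ ≤ 2 * M' * (2 * g x) := by gcongr
    _ = _ := by ring

lemma HasGradBounds.fderiv_rpow {S U : Set (E n)} {g : E n → ℝ} {d M : ℝ}
    (h : HasGradBounds S U g d M) {x : E n} (hx : x ∈ U) (β : ℝ) :
    fderiv ℝ (fun y => g y ^ β) x = (β * g x ^ (β - 1)) • fderiv ℝ g x :=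
  ((h.differentiableAt hx).hasFDerivAt.rpow_const (Or.inl (h.pos x hx).ne')).fderiv

/-- The derivative is βg^{β-1}Dg with |Dg| ≤ C g^{1/2}, so β ≥ 1/2 is what prevents a negative power
of g. -/
lemma HasGradBounds.norm_fderiv_rpow_le {S U : Set (E n)} {g : E n → ℝ} {d M : ℝ}
    (h : HasGradBounds S U g d M) (hM : 1 ≤ M) (hd : 0 < d) {x : E n} (hx : x ∈ S) {β : ℝ}
    (hβ : 1 / 2 ≤ β) (hβ1 : β ≤ 1) :
    ‖fderiv ℝ (fun y => g y ^ β) x‖ ≤ 2 * (M + M / d + 1) * M := by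
  have hxU : x ∈ U := h.ball_subset x hx (Metric.mem_ball_self hd)
  have hg := h.pos x hxU
  set M' := M + M / d + 1 with hM'
  have hMd : 0 ≤ M / d := by positivity
  have hM'1 : 1 ≤ M' := by linarith
  have h1 := h.norm_sq_le (by linarith) hd hx
  rw [h.fderiv_rpow hxU, norm_smul, Real.norm_of_nonneg (by positivity)]
  have h2 : ‖fderiv ℝ g x‖ ≤ 2 * M' * g x ^ (1 / 2 : ℝ) := by
    rw [← Real.sqrt_eq_rpow]
    refine abs_le_of_sq_le_sq' (?_) (by positivity) |>.2
    rw [mul_pow, Real.sq_sqrt hg.le]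
    refine h1.trans ?_
    have : M' ≤ M' ^ 2 := by nlinarith
    rw [mul_pow]
    have := mul_le_mul_of_nonneg_right this hg.le
    linarith
  have h3 : g x ^ (β - 1) * g x ^ (1 / 2 : ℝ) ≤ M := by
    rw [← Real.rpow_add hg]
    calc g x ^ (β - 1 + 1 / 2) ≤ M ^ (β - 1 + 1 / 2) :=
          Real.rpow_le_rpow hg.le (h.le x hxU) (by linarith)
      _ ≤ M ^ (1:ℝ) := Real.rpow_le_rpow_of_exponent_le hM (by linarith)
      _ = M := Real.rpow_one M
  calc β * g x ^ (β - 1) * ‖fderiv ℝ g x‖ ≤ 1 * g x ^ (β - 1) * (2 * M' * g x ^ (1 / 2 : ℝ)) := by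
        gcongr
    _ = 2 * M' * (g x ^ (β - 1) * g x ^ (1 / 2 : ℝ)) := by ring
    _ ≤ _ := by gcongr

end KHessian

namespace KHessian

variable {n : ℕ}

lemma HasGradBounds.rpow_eventually_le {S U : Set (E n)} {g : E n → ℝ} {d M : ℝ}
    (h : HasGradBounds S U g d M) {x : E n} (hx : x ∈ U) (e : ℝ) :
    ∀ᶠ y in 𝓝 x, g y ^ e ≤ 2 * g x ^ e := by
  have hg := h.pos x hx
  have hp : 0 < g x ^ e := Real.rpow_pos_of_pos hg e
  have hc : ContinuousAt (fun y => g y ^ e) x :=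
    (h.differentiableAt hx).continuousAt.rpow_const (Or.inl hg.ne')
  exact (hc.eventually_lt continuousAt_const (by linarith : g x ^ e < 2 * g x ^ e)).mono
    fun y hy => hy.le

/-- Semiconvexity of a power of a positive function with Lipschitz gradient. -/
lemma HasGradBounds.semiconvex {S U : Set (E n)} {g : E n → ℝ} {d M : ℝ}
    (h : HasGradBounds S U g d M) (hM : 1 ≤ M) (hd : 0 < d) {x : E n} (hx : x ∈ S) {β : ℝ}
    (hβ : 0 ≤ β) (hβ1 : β ≤ 1) :
    ∀ᶠ p in 𝓝 (x, x), g p.1 ^ β + fderiv ℝ (fun y => g y ^ β) p.1 (p.2 - p.1) -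
      (4 * (M + 8 * (M + M / d + 1) + 2 * M ^ 2)) * g x ^ (β - 1) / 2 * ‖p.2 - p.1‖ ^ 2 ≤
        g p.2 ^ β := by
  have hM0 : 0 ≤ M := by linarith
  have hMd : 0 ≤ M / d := by positivity
  have hxU : x ∈ U := h.ball_subset x hx (Metric.mem_ball_self hd)
  have hg := h.pos x hxU
  have hgc := (h.differentiableAt hxU).continuousAt
  have e1 : ∀ᶠ p : E n × E n in 𝓝 (x, x), p.1 ∈ S :=
    continuousAt_fst.eventually (h.isOpen.mem_nhds hx)
  have e2 : ∀ᶠ p : E n × E n in 𝓝 (x, x), ‖p.2 - p.1‖ < d := by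
    have hc : Continuous fun p : E n × E n => ‖p.2 - p.1‖ := by fun_prop
    exact hc.continuousAt.eventually_lt continuousAt_const (by simpa using hd)
  -- Restricting to |z - y|² < g(y) allows (g(z) - g(y))²/g(y) to be bounded by a multiple of |z -
  -- y|²: the linear part uses |Dg|² ≤ Cg, and the quadratic part this restriction.
  have e3 : ∀ᶠ p : E n × E n in 𝓝 (x, x), ‖p.2 - p.1‖ ^ 2 < g p.1 := by
    have hc : Continuous fun p : E n × E n => ‖p.2 - p.1‖ ^ 2 := by fun_prop
    have hgc' : ContinuousAt (fun p : E n × E n => g p.1) (x, x) :=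
      ContinuousAt.comp (f := Prod.fst) (x := (x, x)) hgc continuousAt_fst
    exact hc.continuousAt.eventually_lt hgc' (by simpa using hg)
  have e4 : ∀ᶠ p : E n × E n in 𝓝 (x, x), g p.1 ^ (β - 1) ≤ 2 * g x ^ (β - 1) :=
    (continuousAt_fst (p := (x, x))).eventually (h.rpow_eventually_le hxU (β - 1))
  filter_upwards [e1, e2, e3, e4] with p h1 h2 h3 h4
  obtain ⟨y, z⟩ := p
  simp only at h1 h2 h3 h4 ⊢
  set v := z - y with hv
  have hzball : z ∈ Metric.ball y d := by rwa [mem_ball_iff_norm]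
  have hyU := h.ball_subset y h1 (Metric.mem_ball_self hd)
  have hzU := h.ball_subset y h1 hzball
  have hs := h.pos y hyU
  have ht := h.pos z hzU
  have hT := h.taylor hM0 h1 hzball
  have hL := h.norm_sq_le hM0 hd h1
  rw [h.fderiv_rpow hyU]
  change g y ^ β + β * g y ^ (β - 1) * fderiv ℝ g y v - _ ≤ _
  set L := fderiv ℝ g y v with hLdef
  set s := g y with hsdef
  set t := g z with htdef
  set M' := M + M / d + 1 with hM'
  have hLv : L ^ 2 ≤ 4 * M' * s * ‖v‖ ^ 2 := by
    have : |L| ≤ ‖fderiv ℝ g y‖ * ‖v‖ := (fderiv ℝ g y).le_opNorm v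
    calc L ^ 2 = |L| ^ 2 := (sq_abs L).symm
      _ ≤ (‖fderiv ℝ g y‖ * ‖v‖) ^ 2 := by gcongr
      _ = ‖fderiv ℝ g y‖ ^ 2 * ‖v‖ ^ 2 := by ring
      _ ≤ _ := by gcongr
  have hr : s ^ β * (1 + β * (t / s - 1) - (t / s - 1) ^ 2) ≤ t ^ β := by
    have := one_add_sub_sq_le_rpow (r := t / s) (by positivity) hβ hβ1
    rw [Real.div_rpow ht.le hs.le, le_div_iff₀ (Real.rpow_pos_of_pos hs β)] at this
    linarith
  have hsβ : s ^ β = s ^ (β - 1) * s := by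
    rw [← Real.rpow_add_one hs.ne', sub_add_cancel]
  have hp : 0 < s ^ (β - 1) := Real.rpow_pos_of_pos hs _
  have hr' : s ^ β * (1 + β * (t / s - 1) - (t / s - 1) ^ 2) =
      s ^ β + s ^ (β - 1) * (β * (t - s)) - s ^ (β - 1) * ((t - s) ^ 2 / s) := by
    rw [hsβ]; field_simp
  rw [hr'] at hr
  obtain ⟨hT1, hT2⟩ := abs_le.1 hT
  have hq : (t - s) ^ 2 / s ≤ (8 * M' + 2 * M ^ 2) * ‖v‖ ^ 2 := by
    rw [div_le_iff₀ hs]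
    have hw : (t - s) ^ 2 ≤ 2 * L ^ 2 + 2 * (M * ‖v‖ ^ 2) ^ 2 := by
      have h5 : (t - s - L) ^ 2 ≤ (M * ‖v‖ ^ 2) ^ 2 := sq_le_sq' hT1 hT2
      nlinarith [sq_nonneg (t - s - 2 * L)]
    have hw2 : (M * ‖v‖ ^ 2) ^ 2 ≤ M ^ 2 * ‖v‖ ^ 2 * s := by
      calc (M * ‖v‖ ^ 2) ^ 2 = M ^ 2 * ‖v‖ ^ 2 * ‖v‖ ^ 2 := by ring
        _ ≤ _ := by gcongr
    linarith
  have hβt : β * L - M * ‖v‖ ^ 2 ≤ β * (t - s) := by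
    have h5 := mul_le_mul_of_nonneg_left hT1 hβ
    have h6 : β * (M * ‖v‖ ^ 2) ≤ 1 * (M * ‖v‖ ^ 2) :=
      mul_le_mul_of_nonneg_right hβ1 (by positivity)
    linarith
  have h7 := mul_le_mul_of_nonneg_left hβt hp.le
  have h8 := mul_le_mul_of_nonneg_left hq hp.le
  have h9 : s ^ (β - 1) * ((M + 8 * M' + 2 * M ^ 2) * ‖v‖ ^ 2) ≤
      2 * g x ^ (β - 1) * ((M + 8 * M' + 2 * M ^ 2) * ‖v‖ ^ 2) := by
    have : 0 ≤ M' := by positivity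
    gcongr
  linarith

/-- The cubic is an upper Taylor bound for the positive function g along a line, by the Lipschitz
bound on its second derivative. -/
lemma HasGradBounds.cubic_nonneg {S U : Set (E n)} {g : E n → ℝ} {d M : ℝ}
    (h : HasGradBounds S U g d M) (h2 : ContDiffOn ℝ 2 g U)
    (hD2 : ∀ x ∈ S, ∀ y ∈ Metric.ball x d, ∀ v, |D2 g y v v - D2 g x v v| ≤ M * ‖y - x‖ * ‖v‖ ^ 2)
    {x : E n} (hx : x ∈ S) (hM : 0 ≤ M) {e : E n} (he : ‖e‖ = 1) {T : ℝ} (hT : 0 ≤ T)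
    (hTd : T < d) : 0 ≤ g x + T * fderiv ℝ g x e + T ^ 2 / 2 * D2 g x e e + M * T ^ 3 := by
  have hball : ∀ r ∈ Icc 0 T, x + r • e ∈ Metric.ball x d := fun r hr => by
    rw [mem_ball_iff_norm, add_sub_cancel_left, norm_smul, he, mul_one, Real.norm_of_nonneg hr.1]
    exact hr.2.trans_lt hTd
  have hcd : ∀ r ∈ Icc 0 T, ContDiffAt ℝ 2 g (x + r • e) := fun r hr =>
    h2.contDiffAt (h.isOpen'.mem_nhds (h.ball_subset x hx (hball r hr)))
  set p := fderiv ℝ g x e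
  set q := D2 g x e e
  have key := add_mul_deriv_le (T := T)
    (φ := fun r => g x + r * p + r ^ 2 / 2 * q + M * r ^ 3 - g (x + r • e))
    (ψ := fun r => p + r * q + 3 * M * r ^ 2 - fderiv ℝ g (x + r • e) e)
    (χ := fun r => q + 6 * M * r - D2 g (x + r • e) e e) hT (fun r hr => ?_) (fun r hr => ?_)
    fun r hr => ?_
  · simp only [zero_smul, add_zero] at key
    have := h.pos _ (h.ball_subset x hx (hball T ⟨hT, le_rfl⟩))
    have e0 : p - fderiv ℝ g x e = 0 := sub_self _
    have e1 : p + 0 * q + 3 * M * 0 ^ 2 - fderiv ℝ g x e = 0 := by linarith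
    rw [e1] at key
    linarith
  · have h1 := hasDerivAt_line (v := e) ((hcd r hr).differentiableAt (by norm_num))
    refine ((((((hasDerivAt_id r).mul_const p).const_add (g x)).add
      (((hasDerivAt_pow 2 r).div_const 2).mul_const q)).add
      ((hasDerivAt_pow 3 r).const_mul M)).sub h1).congr_deriv ?_
    simp; ring
  · have h1 := hasDerivAt_fderiv_line (v := e) (z := e) (differentiableAt_fderiv (hcd r hr))
    refine (((((hasDerivAt_id r).mul_const q).const_add p).add
      ((hasDerivAt_pow 2 r).const_mul (3 * M))).sub h1).congr_deriv ?_
    simp; ring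
  · have := (abs_le.1 (hD2 x hx _ (hball r hr) e)).2
    rw [add_sub_cancel_left, norm_smul, he, Real.norm_of_nonneg hr.1] at this
    have h3 := mul_nonneg hM hr.1
    simp only [mul_one, one_pow] at this
    linarith

lemma D2_rpow {g : E n → ℝ} {x : E n} (hg : ContDiffAt ℝ 2 g x) (hx : 0 < g x) (a : ℝ) (v : E n) :
    ContDiffAt ℝ 2 (fun y => g y ^ a) x ∧ D2 (fun y => g y ^ a) x v v =
      a * g x ^ (a - 2) * (g x * D2 g x v v - (1 - a) * fderiv ℝ g x v ^ 2) := by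
  refine ⟨hg.rpow_const_of_ne hx.ne', ?_⟩
  have h1 : ∀ᶠ t in 𝓝 (g x), HasDerivAt (fun t : ℝ => t ^ a) (a * t ^ (a - 1)) t := by
    filter_upwards [lt_mem_nhds hx] with t ht
    exact Real.hasDerivAt_rpow_const (Or.inl ht.ne')
  have h2 : HasDerivAt (fun t : ℝ => a * t ^ (a - 1)) (a * ((a - 1) * g x ^ (a - 1 - 1))) (g x) :=
    (Real.hasDerivAt_rpow_const (Or.inl hx.ne')).const_mul a
  rw [D2_comp_real (F := fun t => t ^ a) hg (contDiffAt_id.rpow_const_of_ne hx.ne') h1 h2]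
  have e1 : g x ^ (a - 1) = g x ^ (a - 2) * g x := by
    rw [← Real.rpow_add_one hx.ne']; congr 1; ring
  rw [e1, show a - 1 - 1 = a - 2 by ring]
  ring

/-- Semiconvexity of a power of a positive function with Lipschitz second derivatives. -/
lemma HasGradBounds.exists_semiconvex (d M : ℝ) (hd : 0 < d) (hM : 1 ≤ M) :
    ∃ C : ℝ, 0 ≤ C ∧ ∀ (S U : Set (E n)) (g : E n → ℝ), HasGradBounds S U g d M →
      ContDiffOn ℝ 2 g U →
      (∀ x ∈ S, ∀ y ∈ Metric.ball x d, ∀ v,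
        |D2 g y v v - D2 g x v v| ≤ M * ‖y - x‖ * ‖v‖ ^ 2) →
      ∀ a : ℝ, 1 / 2 ≤ a → a ≤ 1 → ∀ x ∈ S,
        ∀ᶠ p in 𝓝 (x, x), g p.1 ^ a + fderiv ℝ (fun y => g y ^ a) p.1 (p.2 - p.1) -
          C * g x ^ (a - 2 / 3) / 2 * ‖p.2 - p.1‖ ^ 2 ≤ g p.2 ^ a := by
  have hM0 : 0 < M := by linarith
  obtain ⟨C, hC, key⟩ := exists_mul_sub_sq_ge M d M hM0.le hd hM0
  refine ⟨2 * C, by positivity, fun S U g h h2 hD2 a ha ha1 x hx => ?_⟩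
  have hSU : ∀ z ∈ S, z ∈ U := fun z hz => h.ball_subset z hz (Metric.mem_ball_self hd)
  have hcd : ∀ z ∈ S, ContDiffAt ℝ 2 g z := fun z hz =>
    h2.contDiffAt (h.isOpen'.mem_nhds (hSU z hz))
  have hlow1 : ∀ z ∈ S, ∀ e : E n, ‖e‖ = 1 →
      -C * g z ^ (a - 2 / 3) ≤ D2 (fun y => g y ^ a) z e e := by
    intro z hz e he
    have hgz := h.pos z (hSU z hz)
    set γ := g z ^ (1 / 3 : ℝ) with hγ
    have hγ0 : 0 < γ := Real.rpow_pos_of_pos hgz _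
    have hγ3 : γ ^ 3 = g z := by
      rw [hγ, ← Real.rpow_natCast, ← Real.rpow_mul hgz.le]; norm_num
    have hγ4 : γ ^ 4 = g z ^ (4 / 3 : ℝ) := by
      rw [hγ, ← Real.rpow_natCast, ← Real.rpow_mul hgz.le]; norm_num
    have hγM : γ ≤ M := by
      calc γ ≤ M ^ (1 / 3 : ℝ) := Real.rpow_le_rpow hgz.le (h.le z (hSU z hz)) (by norm_num)
        _ ≤ M ^ (1 : ℝ) := Real.rpow_le_rpow_of_exponent_le hM (by norm_num)
        _ = M := Real.rpow_one M
    have h3 := key γ (fderiv ℝ g z e) (D2 g z e e) hγ0 hγM (fun t ht => by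
      rw [hγ3]
      rcases le_total 0 t with h0 | h0
      · rw [abs_of_nonneg h0] at ht ⊢
        exact h.cubic_nonneg h2 hD2 hz hM0.le he h0 ht
      · rw [abs_of_nonpos h0] at ht ⊢
        have := h.cubic_nonneg h2 hD2 hz hM0.le (e := -e) (by rwa [norm_neg])
          (neg_nonneg.2 h0) ht
        have e3 : D2 g z (-e) (-e) = D2 g z e e := by
          rw [map_neg, map_neg]
          change -(-(D2 g z e e)) = _
          rw [neg_neg]
        rw [e3, map_neg, neg_sq] at this
        linarith)
    rw [hγ3, hγ4] at h3
    rw [(D2_rpow (hcd z hz) hgz a e).2]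
    -- As a ≥ 1/2, the coefficient 1 - a is at most the 1/2 in `exists_mul_sub_sq_ge`, used with γ³
    -- = g. The factor g^{a-2} then turns g^{4/3} into g^{a-2/3}.
    have h4 : -C * g z ^ (4 / 3 : ℝ) ≤ g z * D2 g z e e - (1 - a) * fderiv ℝ g z e ^ 2 := by
      have : (1 - a) * fderiv ℝ g z e ^ 2 ≤ 1 / 2 * fderiv ℝ g z e ^ 2 :=
        mul_le_mul_of_nonneg_right (by linarith) (sq_nonneg _)
      linarith
    have h5 : 0 ≤ a * g z ^ (a - 2) := by positivity
    have h6 := mul_le_mul_of_nonneg_left h4 h5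
    have h7 : g z ^ (a - 2) * g z ^ (4 / 3 : ℝ) = g z ^ (a - 2 / 3) := by
      rw [← Real.rpow_add hgz]; congr 1; ring
    have h8 : a * (C * g z ^ (a - 2 / 3)) ≤ 1 * (C * g z ^ (a - 2 / 3)) :=
      mul_le_mul_of_nonneg_right ha1 (by positivity)
    have h9 : a * g z ^ (a - 2) * (-C * g z ^ (4 / 3 : ℝ)) = -(a * (C * g z ^ (a - 2 / 3))) := by
      rw [← h7]; ring
    linarith
  have hlow : ∀ z ∈ S, ∀ v : E n,
      -C * g z ^ (a - 2 / 3) * ‖v‖ ^ 2 ≤ D2 (fun y => g y ^ a) z v v := by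
    intro z hz v
    rcases eq_or_ne v 0 with rfl | hv
    · simp
    · have hv0 : 0 < ‖v‖ := norm_pos_iff.2 hv
      have h1 := hlow1 z hz (‖v‖⁻¹ • v) (by
        rw [norm_smul, norm_inv, norm_norm, inv_mul_cancel₀ hv0.ne'])
      rw [map_smul, map_smul] at h1
      change _ ≤ ‖v‖⁻¹ * (‖v‖⁻¹ * D2 (fun y => g y ^ a) z v v) at h1
      have h2 := mul_le_mul_of_nonneg_right h1 (sq_nonneg ‖v‖)
      refine h2.trans_eq ?_
      field_simp
  have e1 : ∀ᶠ z in 𝓝 x, z ∈ S ∧ g z ^ (a - 2 / 3) ≤ 2 * g x ^ (a - 2 / 3) :=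
    (h.isOpen.eventually_mem hx).and (h.rpow_eventually_le (hSU x hx) _)
  obtain ⟨δ, hδ, hball⟩ := Metric.eventually_nhds_iff_ball.1 e1
  have e2 : ∀ᶠ p : E n × E n in 𝓝 (x, x), p.1 ∈ Metric.ball x δ ∧ p.2 ∈ Metric.ball x δ :=
    (continuousAt_fst.eventually_mem (Metric.ball_mem_nhds x hδ)).and
      (continuousAt_snd.eventually_mem (Metric.ball_mem_nhds x hδ))
  filter_upwards [e2] with p hp
  obtain ⟨y, z⟩ := p
  simp only at hp ⊢
  obtain ⟨hy, hz⟩ := hp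
  set v := z - y with hv
  have hseg : ∀ r ∈ Icc (0:ℝ) 1, y + r • v ∈ Metric.ball x δ := fun r hr => by
    exact (convex_ball x δ).add_smul_sub_mem hy hz hr
  have hc : ∀ r ∈ Icc (0:ℝ) 1, ContDiffAt ℝ 2 (fun y => g y ^ a) (y + r • v) := fun r hr =>
    (D2_rpow (hcd _ (hball _ (hseg r hr)).1) (h.pos _ (hSU _ (hball _ (hseg r hr)).1)) a 0).1
  set κ := 2 * C * g x ^ (a - 2 / 3) with hκ
  have h3 := add_mul_deriv_le (T := 1)
    (φ := fun r => g (y + r • v) ^ a + κ / 2 * ‖v‖ ^ 2 * r ^ 2)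
    (ψ := fun r => fderiv ℝ (fun y => g y ^ a) (y + r • v) v + κ * ‖v‖ ^ 2 * r)
    (χ := fun r => D2 (fun y => g y ^ a) (y + r • v) v v + κ * ‖v‖ ^ 2) zero_le_one
    (fun r hr => ?_) (fun r hr => ?_) fun r hr => ?_
  · simp only [zero_smul, add_zero, one_smul] at h3
    have e3 : y + v = z := by rw [hv]; abel
    rw [e3] at h3
    linarith
  · have h1 := hasDerivAt_line (w := fun y => g y ^ a) (v := v)
      ((hc r hr).differentiableAt (by norm_num))
    refine (h1.add ((hasDerivAt_pow 2 r).const_mul (κ / 2 * ‖v‖ ^ 2))).congr_deriv ?_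
    simp; ring
  · have h1 := hasDerivAt_fderiv_line (w := fun y => g y ^ a) (v := v) (z := v)
      (differentiableAt_fderiv (hc r hr))
    refine (h1.add ((hasDerivAt_id r).const_mul (κ * ‖v‖ ^ 2))).congr_deriv ?_
    simp
  · obtain ⟨hS, hle⟩ := hball _ (hseg r hr)
    have h1 := hlow _ hS v
    have h2 := mul_le_mul_of_nonneg_left hle (mul_nonneg hC (sq_nonneg ‖v‖))
    rw [hκ]
    linarith

end KHessian

/-! ### From the assumptions on f to bounds free of inf f. -/

namespace KHessian

variable {n : ℕ}

lemma norm_iteratedFDeriv_le_of_cNorm {m j : ℕ} (hj : j ≤ m) {U : Set (E n)} {g : E n → ℝ} {M : ℝ≥0}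
    (h : cNorm m U g ≤ M) {x : E n} (hx : x ∈ U) : ‖iteratedFDeriv ℝ j g x‖ ≤ M := by
  have h1 : ‖iteratedFDeriv ℝ j g x‖ₑ ≤ M := by
    refine le_trans ?_ h
    refine le_trans ?_ (Finset.single_le_sum (f := fun j => ⨆ x ∈ U, ‖iteratedFDeriv ℝ j g x‖ₑ)
      (fun _ _ => zero_le) (Finset.mem_range.2 (Nat.lt_succ_of_le hj)))
    exact le_iSup₂ (f := fun x (_ : x ∈ U) => ‖iteratedFDeriv ℝ j g x‖ₑ) x hx
  rw [enorm_eq_nnnorm] at h1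
  exact_mod_cast h1

lemma norm_iteratedFDeriv_sub_le_of_cLipNorm {m : ℕ} {U : Set (E n)} {g : E n → ℝ} {M : ℝ≥0}
    (h : cLipNorm m U g ≤ M) {x y : E n} (hx : x ∈ U) (hy : y ∈ U) :
    ‖iteratedFDeriv ℝ m g x - iteratedFDeriv ℝ m g y‖ ≤ M * ‖x - y‖ := by
  rcases eq_or_ne x y with rfl | hxy
  · simp
  have h1 : edist (iteratedFDeriv ℝ m g x) (iteratedFDeriv ℝ m g y) / edist x y ≤ M := by
    refine le_trans ?_ (le_add_self.trans h)
    refine le_trans ?_ (le_iSup₂ (f := fun x (_ : x ∈ U) => ⨆ y ∈ U,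
      edist (iteratedFDeriv ℝ m g x) (iteratedFDeriv ℝ m g y) / edist x y) x hx)
    exact le_iSup₂ (f := fun y (_ : y ∈ U) =>
      edist (iteratedFDeriv ℝ m g x) (iteratedFDeriv ℝ m g y) / edist x y) y hy
  rw [ENNReal.div_le_iff (edist_pos.2 hxy).ne' (edist_ne_top _ _), edist_nndist, edist_nndist] at h1
  have h2 : nndist (iteratedFDeriv ℝ m g x) (iteratedFDeriv ℝ m g y) ≤ M * nndist x y := by
    exact_mod_cast h1
  rw [← dist_eq_norm, ← dist_eq_norm]
  exact_mod_cast h2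

lemma fderiv_apply_eq_iteratedFDeriv (g : E n → ℝ) (x v : E n) :
    fderiv ℝ g x v = iteratedFDeriv ℝ 1 g x fun _ => v := by
  rw [iteratedFDeriv_one_apply]

lemma D2_apply_eq_iteratedFDeriv (g : E n → ℝ) (x v w : E n) :
    D2 g x v w = iteratedFDeriv ℝ 2 g x ![v, w] := by
  rw [iteratedFDeriv_two_apply]; rfl

lemma norm_fderiv_le_of_iteratedFDeriv {g : E n → ℝ} {x : E n} {M : ℝ} (hM : 0 ≤ M)
    (h : ‖iteratedFDeriv ℝ 1 g x‖ ≤ M) : ‖fderiv ℝ g x‖ ≤ M := by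
  refine ContinuousLinearMap.opNorm_le_bound _ hM fun v => ?_
  rw [fderiv_apply_eq_iteratedFDeriv]
  refine ((iteratedFDeriv ℝ 1 g x).le_opNorm _).trans ?_
  simpa using mul_le_mul_of_nonneg_right h (norm_nonneg v)

lemma abs_D2_le_of_iteratedFDeriv {g : E n → ℝ} {x : E n} {M : ℝ}
    (h : ‖iteratedFDeriv ℝ 2 g x‖ ≤ M) (v w : E n) : |D2 g x v w| ≤ M * ‖v‖ * ‖w‖ := by
  rw [D2_apply_eq_iteratedFDeriv, ← Real.norm_eq_abs]
  refine ((iteratedFDeriv ℝ 2 g x).le_opNorm _).trans ?_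
  rw [Fin.prod_univ_two, mul_assoc]
  exact mul_le_mul_of_nonneg_right h (by positivity)

/-- The ball is connected, meets Ω₀ and avoids its frontier. -/
lemma ball_subset_of_forall_dist {Ω₀ : Set (E n)} {d : ℝ} (hd : 0 < d) {x : E n} (hx : x ∈ Ω₀)
    (h : ∀ y ∈ frontier Ω₀, d ≤ dist x y) : Metric.ball x d ⊆ Ω₀ := by
  have hxb := Metric.mem_ball_self (x := x) hd
  have hdis : Metric.ball x d ∩ frontier Ω₀ = ∅ := by
    rw [eq_empty_iff_forall_notMem]
    rintro y ⟨hy, hyf⟩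
    rw [Metric.mem_ball, dist_comm] at hy
    exact absurd (h y hyf) (not_le.2 hy)
  refine (convex_ball x d).isPreconnected.subset_left_of_subset_union isOpen_interior
    isClosed_closure.isOpen_compl (v := (closure Ω₀)ᶜ) ?_ ?_ ?_ |>.trans interior_subset
  · exact disjoint_left.2 fun y hy hy' => hy' (subset_closure (interior_subset hy))
  · intro y hy
    by_contra hc
    rw [mem_union, not_or, notMem_compl_iff] at hc
    exact (hdis ▸ (⟨hy, hc.2, hc.1⟩ : y ∈ Metric.ball x d ∩ frontier Ω₀) : y ∈ (∅ : Set _))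
  · refine ⟨x, hxb, ?_⟩
    by_contra hc
    exact (hdis ▸ (⟨hxb, subset_closure hx, hc⟩ : x ∈ Metric.ball x d ∩ frontier Ω₀) :
      x ∈ (∅ : Set _))

lemma norm_fderiv_sub_le_of_D2 {g : E n → ℝ} {x y : E n} {d M : ℝ} (hM : 0 ≤ M)
    (hg : ∀ z ∈ Metric.ball x d, ContDiffAt ℝ 2 g z)
    (h : ∀ z ∈ Metric.ball x d, ∀ v w, |D2 g z v w| ≤ M * ‖v‖ * ‖w‖)
    (hy : y ∈ Metric.ball x d) : ‖fderiv ℝ g y - fderiv ℝ g x‖ ≤ M * ‖y - x‖ := by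
  have hx : x ∈ Metric.ball x d :=
    Metric.mem_ball_self (dist_nonneg.trans_lt (Metric.mem_ball.1 hy))
  refine ContinuousLinearMap.opNorm_le_bound _ (by positivity) fun v => ?_
  have h1 := (convex_ball x d).norm_image_sub_le_of_norm_fderiv_le (𝕜 := ℝ)
    (f := fun z => fderiv ℝ g z v) (C := M * ‖v‖)
    (fun z hz => (hasFDerivAt_fderiv_apply (hg z hz) v 0).1) (fun z hz => by
      refine ContinuousLinearMap.opNorm_le_bound _ (by positivity) fun w => ?_
      rw [(hasFDerivAt_fderiv_apply (hg z hz) v w).2]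
      refine (h z hz w v).trans_eq ?_
      ring) hx hy
  refine h1.trans_eq ?_
  ring

/-- The properties of the right hand side `f` used in the estimates. -/
def RhsBounds (k : ℕ) (Ω : Set (E n)) (f : E n → ℝ) (C : ℝ) : Prop :=
  ∀ x ∈ Ω, 0 < f x ∧ f x ^ (1 / (k : ℝ)) ≤ C ∧ ‖fderiv ℝ (fun y => f y ^ (1 / (k : ℝ))) x‖ ≤ C ∧
    ContinuousAt (fderiv ℝ fun y => f y ^ (1 / (k : ℝ))) x ∧
    ∀ᶠ p in 𝓝 (x, x), f p.1 ^ (1 / (k : ℝ)) +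
      fderiv ℝ (fun y => f y ^ (1 / (k : ℝ))) p.1 (p.2 - p.1) -
      C * f x ^ (-(1 / ((k : ℝ) * (k - 1)))) / 2 * ‖p.2 - p.1‖ ^ 2 ≤ f p.2 ^ (1 / (k : ℝ))

/-- With g = f^γ, the relation γβ = 1/k identifies g^β with f^{1/k}, and γe = -1/(k(k-1)) gives the
semiconvexity constant the order of the lower bound for the trace of the linearised operator. -/
lemma rhsBounds_of_rpow {k : ℕ} {Ω U : Set (E n)} {f : E n → ℝ} {d M C C' γ β e : ℝ} (hd : 0 < d)
    (hM : 1 ≤ M)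
    (hf : ∀ x ∈ U, 0 < f x) (h : HasGradBounds Ω U (fun y => f y ^ γ) d M)
    (hβ : 1 / 2 ≤ β) (hβ1 : β ≤ 1) (hγβ : γ * β = 1 / (k : ℝ))
    (hγe : γ * e = -(1 / ((k : ℝ) * (k - 1))))
    (hsemi : ∀ x ∈ Ω, ∀ᶠ p in 𝓝 (x, x), (f p.1 ^ γ) ^ β +
      fderiv ℝ (fun y => (f y ^ γ) ^ β) p.1 (p.2 - p.1) -
          C' * (f x ^ γ) ^ e / 2 * ‖p.2 - p.1‖ ^ 2 ≤ (f p.2 ^ γ) ^ β)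
    (hC1 : M ≤ C) (hC2 : 2 * (M + M / d + 1) * M ≤ C) (hC3 : C' ≤ C) :
    RhsBounds k Ω f C := by
  intro x hx
  have hxU : x ∈ U := h.ball_subset x hx (Metric.mem_ball_self hd)
  have hfx := hf x hxU
  have hpow : ∀ y ∈ U, (f y ^ γ) ^ β = f y ^ (1 / (k : ℝ)) := fun y hy => by
    rw [← Real.rpow_mul (hf y hy).le, hγβ]
  have heq : ∀ y ∈ U, (fun y => (f y ^ γ) ^ β) =ᶠ[𝓝 y] fun y => f y ^ (1 / (k : ℝ)) := fun y hy => by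
    filter_upwards [h.isOpen'.mem_nhds hy] with z hz using hpow z hz
  have hfd : ∀ y ∈ U, fderiv ℝ (fun y => f y ^ (1 / (k : ℝ))) y =
      fderiv ℝ (fun y => (f y ^ γ) ^ β) y := fun y hy => (heq y hy).fderiv_eq.symm
  have hg := h.pos x hxU
  refine ⟨hfx, ?_, ?_, ?_, ?_⟩
  · rw [← hpow x hxU]
    calc (f x ^ γ) ^ β ≤ M ^ β := Real.rpow_le_rpow hg.le (h.le x hxU) (by linarith)
      _ ≤ M ^ (1 : ℝ) := Real.rpow_le_rpow_of_exponent_le hM hβ1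
      _ = M := Real.rpow_one M
      _ ≤ C := hC1
  · rw [hfd x hxU]
    exact (h.norm_fderiv_rpow_le hM hd hx hβ hβ1).trans hC2
  · have c1 : ContDiffAt ℝ 1 (fun y => f y ^ (1 / (k : ℝ))) x :=
      ((h.contDiffOn.contDiffAt (h.isOpen'.mem_nhds hxU)).rpow_const_of_ne hg.ne' (p := β)).congr_of_eventuallyEq
        (heq x hxU).symm
    exact (c1.fderiv_right (m := 0) (by norm_num)).continuousAt
  · have e1 : ∀ᶠ p : E n × E n in 𝓝 (x, x), p.1 ∈ U :=
      continuousAt_fst.eventually_mem (h.isOpen'.mem_nhds hxU)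
    have e2 : ∀ᶠ p : E n × E n in 𝓝 (x, x), p.2 ∈ U :=
      continuousAt_snd.eventually_mem (h.isOpen'.mem_nhds hxU)
    filter_upwards [hsemi x hx, e1, e2] with p hp h1 h2
    rw [hpow _ h1, hpow _ h2, ← hfd _ h1, ← Real.rpow_mul hfx.le, hγe] at hp
    have h3 : C' * f x ^ (-(1 / ((k : ℝ) * (k - 1)))) / 2 * ‖p.2 - p.1‖ ^ 2 ≤
        C * f x ^ (-(1 / ((k : ℝ) * (k - 1)))) / 2 * ‖p.2 - p.1‖ ^ 2 := by
      have := Real.rpow_nonneg hfx.le (-(1 / ((k : ℝ) * (k - 1))))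
      gcongr
    linarith

/-- Either of the two regularity assumptions on `f` gives control on `f^{1/k}` that does not depend
on a lower bound for `f`. -/
theorem exists_rhsBounds {k : ℕ} (hk : 2 ≤ k) {d₀ : ℝ} (hd₀ : 0 < d₀) (Mf : ℝ≥0) :
    ∃ C : ℝ, 1 ≤ C ∧ ∀ (Ω Ω₀ : Set (E n)) (f : E n → ℝ), IsOpen Ω → IsOpen Ω₀ → closure Ω ⊆ Ω₀ →
      (∀ x ∈ Ω, ∀ y ∈ frontier Ω₀, d₀ ≤ dist x y) → (∀ x ∈ Ω₀, 0 < f x) →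
      ((IsCLipBar 1 Ω₀ (fun x => f x ^ (1 / ((k : ℝ) - 1))) ∧
          cLipNorm 1 Ω₀ (fun x => f x ^ (1 / ((k : ℝ) - 1))) ≤ Mf) ∨
        (5 ≤ k ∧ IsCLipBar 2 Ω₀ (fun x => f x ^ (3 / (2 * (k : ℝ) - 2))) ∧
          cLipNorm 2 Ω₀ (fun x => f x ^ (3 / (2 * (k : ℝ) - 2))) ≤ Mf)) → RhsBounds k Ω f C := by
  have hk2 : (2:ℝ) ≤ k := by exact_mod_cast hk
  set M : ℝ := Mf + 1 with hMdef
  have hMf : (Mf : ℝ) ≤ M := by linarith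
  have hM : 1 ≤ M := by linarith [Mf.coe_nonneg]
  obtain ⟨C, hC, hCsemi⟩ := HasGradBounds.exists_semiconvex (n := n) d₀ M hd₀ hM
  have hMd : 0 ≤ M / d₀ := by positivity
  set C' := 4 * (M + 8 * (M + M / d₀ + 1) + 2 * M ^ 2) with hC'
  have hC'0 : 0 ≤ C' := by positivity
  set C₂ := 2 * (M + M / d₀ + 1) * M with hC₂
  have hC₂0 : 0 ≤ C₂ := by positivity
  refine ⟨M + C₂ + C' + C, by linarith, fun Ω Ω₀ f hΩ hΩ₀ hcl hdist hf hreg => ?_⟩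
  have hball : ∀ x ∈ Ω, Metric.ball x d₀ ⊆ Ω₀ := fun x hx =>
    ball_subset_of_forall_dist hd₀ (hcl (subset_closure hx)) (hdist x hx)
  have hle : ∀ {g : E n → ℝ} {m : ℕ}, cLipNorm m Ω₀ g ≤ Mf → ∀ x ∈ Ω₀, g x ≤ M := by
    intro g m hg x hx
    have := norm_iteratedFDeriv_le_of_cNorm (Nat.zero_le m) (le_self_add.trans hg) hx
    rw [norm_iteratedFDeriv_zero] at this
    exact (le_abs_self _).trans (this.trans hMf)
  have hfd : ∀ {g : E n → ℝ} {m : ℕ}, 1 ≤ m → cLipNorm m Ω₀ g ≤ Mf →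
      ∀ x ∈ Ω₀, ‖fderiv ℝ g x‖ ≤ M := by
    intro g m hm hg x hx
    exact norm_fderiv_le_of_iteratedFDeriv (by linarith)
      ((norm_iteratedFDeriv_le_of_cNorm hm (le_self_add.trans hg) hx).trans hMf)
  rcases hreg with ⟨hg, hn⟩ | ⟨hk5, hg, hn⟩
  · have hG : HasGradBounds Ω Ω₀ (fun x => f x ^ (1 / ((k : ℝ) - 1))) d₀ M := by
      refine ⟨hΩ, hΩ₀, hball, hg.contDiffOn, fun x hx => Real.rpow_pos_of_pos (hf x hx) _,
        hle hn, hfd le_rfl hn, fun x hx y hy => ?_⟩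
      have h1 := norm_iteratedFDeriv_sub_le_of_cLipNorm hn (hball x hx hy)
        (hcl (subset_closure hx))
      refine ContinuousLinearMap.opNorm_le_bound _ (by positivity) fun v => ?_
      change ‖fderiv ℝ (fun x => f x ^ (1 / ((k : ℝ) - 1))) y v -
        fderiv ℝ (fun x => f x ^ (1 / ((k : ℝ) - 1))) x v‖ ≤ _
      rw [fderiv_apply_eq_iteratedFDeriv, fderiv_apply_eq_iteratedFDeriv]
      have h2 := (iteratedFDeriv ℝ 1 (fun x => f x ^ (1 / ((k : ℝ) - 1))) y -
        iteratedFDeriv ℝ 1 (fun x => f x ^ (1 / ((k : ℝ) - 1))) x).le_opNorm fun _ => v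
      refine h2.trans ?_
      simp only [Finset.univ_unique, Finset.prod_const, Finset.card_singleton, pow_one]
      refine mul_le_mul_of_nonneg_right (h1.trans ?_) (norm_nonneg v)
      gcongr
    have hk1 : (0:ℝ) < k - 1 := by linarith
    -- Here γ = 1/(k-1), and semiconvexity from a Lipschitz gradient has exponent e = β - 1 = -1/k.
    -- The requirement β ≥ 1/2 is k ≥ 2.
    refine rhsBounds_of_rpow (β := ((k:ℝ) - 1) / k) (e := ((k:ℝ) - 1) / k - 1) (C' := C') hd₀ hM hf
      hG ?_ ?_ ?_ ?_ (fun x hx => ?_) (by linarith) (by linarith) (by linarith)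
    · rw [div_le_div_iff₀ (by norm_num) (by linarith)]; linarith
    · rw [div_le_one (by linarith)]; linarith
    · field_simp
    · field_simp; ring
    · refine hG.semiconvex hM hd₀ hx (by positivity) ?_
      rw [div_le_one (by linarith)]; linarith
  · have hk5' : (5:ℝ) ≤ k := by exact_mod_cast hk5
    have hk1 : (0:ℝ) < 2 * k - 2 := by linarith
    set g : E n → ℝ := fun x => f x ^ (3 / (2 * (k : ℝ) - 2)) with hgdef
    have hcd : ∀ x ∈ Ω₀, ContDiffAt ℝ 2 g x := fun x hx =>
      hg.contDiffOn.contDiffAt (hΩ₀.mem_nhds hx)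
    have hG : HasGradBounds Ω Ω₀ g d₀ M := by
      refine ⟨hΩ, hΩ₀, hball, hg.contDiffOn.of_le (by norm_num),
        fun x hx => Real.rpow_pos_of_pos (hf x hx) _,
        hle hn, hfd (by norm_num) hn, fun x hx y hy => ?_⟩
      refine norm_fderiv_sub_le_of_D2 (by linarith) (fun z hz => hcd z (hball x hx hz))
        (fun z hz v w => abs_D2_le_of_iteratedFDeriv ?_ v w) hy
      exact (norm_iteratedFDeriv_le_of_cNorm le_rfl (le_self_add.trans hn) (hball x hx hz)).trans hMf
    have hD2 : ∀ x ∈ Ω, ∀ y ∈ Metric.ball x d₀, ∀ v,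
        |D2 g y v v - D2 g x v v| ≤ M * ‖y - x‖ * ‖v‖ ^ 2 := by
      intro x hx y hy v
      have h1 := norm_iteratedFDeriv_sub_le_of_cLipNorm hn (hball x hx hy)
        (hcl (subset_closure hx))
      rw [D2_apply_eq_iteratedFDeriv, D2_apply_eq_iteratedFDeriv, ← Real.norm_eq_abs]
      have h2 := (iteratedFDeriv ℝ 2 g y - iteratedFDeriv ℝ 2 g x).le_opNorm ![v, v]
      refine h2.trans ?_
      rw [Fin.prod_univ_two]
      simp only [Matrix.cons_val_zero, Matrix.cons_val_one]
      rw [← sq]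
      refine mul_le_mul_of_nonneg_right (h1.trans ?_) (sq_nonneg _)
      gcongr
    -- Here γ = 3/(2k-2), and a Lipschitz second derivative improves the exponent to e = β - 2/3 =
    -- -2/(3k), so γe is again -1/(k(k-1)).
    refine rhsBounds_of_rpow (β := (2 * (k:ℝ) - 2) / (3 * k))
      (e := (2 * (k:ℝ) - 2) / (3 * k) - 2 / 3) (C' := C) hd₀ hM hf
      hG ?_ ?_ ?_ ?_ (fun x hx => ?_) (by linarith) (by linarith) (by linarith)
    · rw [div_le_div_iff₀ (by norm_num) (by linarith)]; linarith
    · rw [div_le_one (by linarith)]; linarith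
    · have : (k:ℝ) - 1 ≠ 0 := by linarith
      field_simp
    · have : (k:ℝ) - 1 ≠ 0 := by linarith
      have h2 : 2 * (k:ℝ) - 2 = 2 * (k - 1) := by ring
      rw [h2]; field_simp; ring
    · refine hCsemi Ω Ω₀ g hG hg.contDiffOn hD2 _ ?_ ?_ x hx
      · rw [div_le_div_iff₀ (by norm_num) (by linarith)]; linarith
      · rw [div_le_one (by linarith)]; linarith

/-- This is where the dependence on inf f disappears: in the presence of a direction with D²u ≥ 1,
the constant C f^{-1/(k(k-1))} is at most Ck times the trace of the linearised operator. -/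
lemma RhsBounds.isControlled {k : ℕ} (hk : 2 ≤ k) (hkn : k ≤ n) {Ω : Set (E n)} {f u : E n → ℝ}
    {C : ℝ} (hC : 0 ≤ C) (hf : RhsBounds k Ω f C) (hΩ : IsOpen Ω) (hu : ContDiffOn ℝ 3 u Ω)
    (hcone : ∀ x ∈ Ω, IsConeForm k (D2 u x)) (heq : ∀ x ∈ Ω, sigma k (formMatrix (D2 u x)) = f x) :
    IsControlled k Ω u (fun x => f x ^ (1 / (k : ℝ))) (fderiv ℝ fun y => f y ^ (1 / (k : ℝ)))
      (C * k) := by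
  have hk1 : (1:ℝ) ≤ k := by exact_mod_cast (by omega : 1 ≤ k)
  have hCk : C ≤ C * k := le_mul_of_one_le_right hC hk1
  refine ⟨hΩ, hu, hcone, fun x hx => by rw [heq x hx], fun x hx => (hf x hx).2.1.trans hCk,
    fun x hx => (hf x hx).2.2.1.trans hCk, fun x hx => (hf x hx).2.2.2.1, fun x hx =>
    ⟨C * f x ^ (-(1 / ((k : ℝ) * (k - 1)))), (hf x hx).2.2.2.2, fun v l w hv hw h1 => ?_⟩⟩
  have := hv.sigma_rpow_le hk hkn (hcone x hx) hw h1
  rw [heq x hx] at this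
  rw [mul_assoc]
  exact mul_le_mul_of_nonneg_left this hC

end KHessian

/-! ### Bounds for u, for Du and on the boundary. -/

namespace KHessian

variable {n : ℕ}

/-- `u` is `C³` in `Ω`, and `u`, `Du`, `D²u` extend continuously to the closure. -/
structure HasBoundaryValues (Ω : Set (E n)) (u : E n → ℝ) (u₁ : E n → E n →L[ℝ] ℝ)
    (u₂ : E n → E n → E n → ℝ) : Prop where
  contDiffOn : ContDiffOn ℝ 3 u Ω
  continuousOn : ContinuousOn u (closure Ω)
  cont₁ : ContinuousOn u₁ (closure Ω)
  eq₁ : ∀ x ∈ Ω, u₁ x = fderiv ℝ u x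
  cont₂ : ContinuousOn (fun p : E n × E n => u₂ p.1 p.2 p.2) (closure Ω ×ˢ univ)
  eq₂ : ∀ x ∈ Ω, ∀ v w, u₂ x v w = D2 u x v w
  tendsto₂ : ∀ y ∈ closure Ω, ∀ v w, Tendsto (fun x => D2 u x v w) (𝓝[Ω] y) (𝓝 (u₂ y v w))

lemma HasBoundaryValues.tendsto₁ {Ω : Set (E n)} {u : E n → ℝ} {u₁ : E n → E n →L[ℝ] ℝ}
    {u₂ : E n → E n → E n → ℝ} (h : HasBoundaryValues Ω u u₁ u₂) {y : E n} (hy : y ∈ closure Ω) :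
    Tendsto (fderiv ℝ u) (𝓝[Ω] y) (𝓝 (u₁ y)) := by
  refine ((h.cont₁ y hy).mono subset_closure).tendsto.congr' ?_
  filter_upwards [self_mem_nhdsWithin] with x hx using h.eq₁ x hx

lemma IsCBar.exists_boundaryValues {Ω : Set (E n)} {u : E n → ℝ} (hΩb : Bornology.IsBounded Ω)
    (h : IsCBar 3 Ω u) : ∃ u₁ u₂, HasBoundaryValues Ω u u₁ u₂ ∧
      ∀ y ∈ frontier Ω, ∀ v w, |u₂ y v w| ≤ supBoundaryHessian Ω u * ‖v‖ * ‖w‖ := by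
  obtain ⟨G₁, hG₁, hG₁e⟩ := h.extends_deriv 1 (by norm_num)
  obtain ⟨G₂, hG₂, hG₂e⟩ := h.extends_deriv 2 (by norm_num)
  have htend : ∀ y ∈ closure Ω, Tendsto (iteratedFDeriv ℝ 2 u) (𝓝[Ω] y) (𝓝 (G₂ y)) := by
    intro y hy
    refine ((hG₂ y hy).mono subset_closure).tendsto.congr' ?_
    filter_upwards [self_mem_nhdsWithin] with x hx using hG₂e hx
  refine ⟨fun x => continuousMultilinearCurryFin1 ℝ (E n) ℝ (G₁ x), fun x v w => G₂ x ![v, w],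
    ⟨h.contDiffOn, h.continuousOn, ?_, ?_, ?_, ?_, ?_⟩, ?_⟩
  · exact (continuousMultilinearCurryFin1 ℝ (E n) ℝ).continuous.comp_continuousOn hG₁
  · intro x hx
    ext v
    rw [hG₁e hx, fderiv_apply_eq_iteratedFDeriv]
    simp only [continuousMultilinearCurryFin1_apply]
    congr 1
  · have h1 : ContinuousOn (fun p : E n × E n => G₂ p.1) (closure Ω ×ˢ univ) :=
      hG₂.comp continuousOn_fst fun p hp => hp.1
    have h2 : Continuous fun p : E n × E n => ![p.2, p.2] := by
      refine continuous_pi fun i => ?_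
      fin_cases i <;> exact continuous_snd
    exact h1.eval h2.continuousOn
  · intro x hx v w
    rw [D2_apply_eq_iteratedFDeriv, hG₂e hx]
  · intro y hy v w
    have h3 : Continuous fun A : ContinuousMultilinearMap ℝ (fun _ : Fin 2 => E n) ℝ => A ![v, w] :=
      continuous_eval_const _
    refine ((h3.tendsto (G₂ y)).comp (htend y hy)).congr fun x => ?_
    rw [D2_apply_eq_iteratedFDeriv]; rfl
  · intro y hy v w
    have hcomp : IsCompact (frontier Ω) :=
      Metric.isCompact_of_isClosed_isBounded isClosed_frontier
        (hΩb.closure.subset frontier_subset_closure)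
    have hext : ∀ z ∈ frontier Ω, extendFrom Ω (iteratedFDeriv ℝ 2 u) z = G₂ z := fun z hz =>
      extendFrom_eq (frontier_subset_closure hz) (htend z (frontier_subset_closure hz))
    have hle : ‖G₂ y‖ ≤ supBoundaryHessian Ω u := by
      refine le_csSup ?_ ⟨y, hy, by simp only [hext y hy]⟩
      obtain ⟨C, hC⟩ := hcomp.exists_bound_of_continuousOn (hG₂.mono frontier_subset_closure)
      refine ⟨C, ?_⟩
      rintro _ ⟨z, hz, rfl⟩
      simp only [hext z hz]
      exact hC z hz
    rw [← Real.norm_eq_abs]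
    refine ((G₂ y).le_opNorm _).trans ?_
    rw [Fin.prod_univ_two, mul_assoc]
    exact mul_le_mul_of_nonneg_right hle (by positivity)

lemma supBoundaryHessian_nonneg (Ω : Set (E n)) (u : E n → ℝ) : 0 ≤ supBoundaryHessian Ω u :=
  Real.sSup_nonneg (by rintro _ ⟨y, -, rfl⟩; exact norm_nonneg _)

/-- Maximum principle in terms of second derivatives. -/
lemma le_of_forall_exists_D2_pos {S : Set (E n)} (hS : IsCompact S) {w : E n → ℝ}
    (hw : ContinuousOn w S) {B : ℝ}
    (h : ∀ x ∈ S, w x ≤ B ∨ (S ∈ 𝓝 x ∧ ContDiffAt ℝ 2 w x ∧ ∃ v, 0 < D2 w x v v)) :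
    ∀ x ∈ S, w x ≤ B := by
  intro x hx
  obtain ⟨z, hz, hmax⟩ := hS.exists_isMaxOn ⟨x, hx⟩ hw
  rcases h z hz with h1 | ⟨hS', hc, v, hv⟩
  · exact (isMaxOn_iff.1 hmax x hx).trans h1
  · exact absurd (D2_nonpos_of_isLocalMax hc (hmax.isLocalMax hS') v) (not_le.2 hv)

lemma IsEigenframe.exists_D2_pos {k : ℕ} (hk : 0 < k) {A B : Form n} (hA : IsConeForm k A)
    {v : Fin n → E n} {l : Fin n → ℝ} (h : IsEigenframe A v l)
    (hpos : 0 < ∑ i, gw k l i * B (v i) (v i)) : ∃ v, 0 < B v v := by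
  by_contra! hc
  exact absurd (Finset.sum_nonpos fun i _ =>
    mul_nonpos_of_nonneg_of_nonpos (h.gw_pos hk hA i).le (hc (v i))) (not_le.2 hpos)

lemma D2_mul_norm_sq (K : ℝ) (x : E n) : ContDiffAt ℝ 2 (fun y : E n => K * ‖y‖ ^ 2) x ∧
    ∀ v, D2 (fun y => K * ‖y‖ ^ 2) x v v = 2 * K * ‖v‖ ^ 2 := by
  have hc : ContDiffAt ℝ 2 (fun y : E n => ‖y‖ ^ 2) x := (contDiff_norm_sq ℝ).contDiffAt
  refine ⟨contDiffAt_const.mul hc, fun v => ?_⟩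
  rw [D2_const_mul hc]
  have h1 := (D2_norm_sq_affine x x (ContinuousLinearMap.id ℝ (E n)) v).2.2
  have e : (fun y : E n => ‖x + (ContinuousLinearMap.id ℝ (E n)) (y - x)‖ ^ 2) = fun y => ‖y‖ ^ 2 := by
    ext y; simp
  rw [e] at h1
  change K * D2 (fun y : E n => ‖y‖ ^ 2) x v v = _
  rw [h1]; simp; ring

/-- Above, u has positive Laplacian. Below, the linearised operator applied to (C₁+1)|x|² - u is
2(C₁+1)T - h > 0, because h ≤ C₁ and T ≥ 1. -/
lemma IsControlled.sup_bound {k : ℕ} (hk : 0 < k) (hkn : k ≤ n) {Ω : Set (E n)} {u h : E n → ℝ}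
    {p' : E n → E n →L[ℝ] ℝ} {C₁ M D : ℝ} (hsol : IsControlled k Ω u h p' C₁) (hC₁ : 0 ≤ C₁)
    (hΩb : Bornology.IsBounded Ω)
    (hu : ContinuousOn u (closure Ω)) (hM : ∀ y ∈ frontier Ω, |u y| ≤ M)
    (hD : ∀ x ∈ closure Ω, ‖x‖ ≤ D) : ∀ x ∈ closure Ω, |u x| ≤ M + (C₁ + 1) * D ^ 2 := by
  have hcomp : IsCompact (closure Ω) :=
    Metric.isCompact_of_isClosed_isBounded isClosed_closure hΩb.closure
  have hcd : ∀ x ∈ Ω, ContDiffAt ℝ 2 u x := fun x hx =>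
    (hsol.contDiffOn.contDiffAt (hsol.isOpen.mem_nhds hx)).of_le (by norm_num)
  have hnh : ∀ x ∈ Ω, closure Ω ∈ 𝓝 x := fun x hx =>
    mem_of_superset (hsol.isOpen.mem_nhds hx) subset_closure
  have hdich : ∀ x ∈ closure Ω, x ∈ Ω ∨ x ∈ frontier Ω := fun x hx => by
    by_cases hxΩ : x ∈ Ω
    · exact Or.inl hxΩ
    · exact Or.inr ⟨hx, by rwa [hsol.isOpen.interior_eq]⟩
  intro x hx
  rw [abs_le]
  constructor
  · have := le_of_forall_exists_D2_pos hcomp (w := fun y => (C₁ + 1) * ‖y‖ ^ 2 - u y)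
      (B := M + (C₁ + 1) * D ^ 2) (((continuous_const.mul (continuous_norm.pow 2)).continuousOn).sub hu)
      (fun z hz => ?_) x hx
    · have h2 : 0 ≤ (C₁ + 1) * ‖x‖ ^ 2 := by positivity
      linarith
    · rcases hdich z hz with hzΩ | hzf
      · obtain ⟨hc, hq⟩ := D2_mul_norm_sq (C₁ + 1) z
        obtain ⟨v, l, hv⟩ := (hsol.cone z hzΩ).symm.exists_eigenframe
        refine Or.inr ⟨hnh z hzΩ, hc.sub (hcd z hzΩ), hv.exists_D2_pos hk (hsol.cone z hzΩ) ?_⟩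
        rw [D2_sub hc (hcd z hzΩ)]
        have e : ∀ i, (D2 (fun y => (C₁ + 1) * ‖y‖ ^ 2) z - D2 u z) (v i) (v i) =
            2 * (C₁ + 1) - l i := fun i => by
          change D2 (fun y => (C₁ + 1) * ‖y‖ ^ 2) z (v i) (v i) - D2 u z (v i) (v i) = _
          rw [hq, hv.apply_eq, real_inner_self_eq_norm_sq, hv.orthonormal.1 i]; ring
        simp only [e, mul_sub, Finset.sum_sub_distrib, ← Finset.sum_mul]
        have h1 := hv.sum_gw_mul hk (hsol.cone z hzΩ)
        rw [hsol.eq z hzΩ] at h1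
        have h2 := hsol.h_le z hzΩ
        have h3 := hv.one_le_sum_gw hk hkn (hsol.cone z hzΩ)
        rw [h1]
        nlinarith
      · left
        have h1 := (abs_le.1 (hM z hzf)).1
        have h2 : (C₁ + 1) * ‖z‖ ^ 2 ≤ (C₁ + 1) * D ^ 2 := by
          have := hD z hz
          gcongr
        linarith
  · have := le_of_forall_exists_D2_pos hcomp (w := u) (B := M) hu (fun z hz => ?_) x hx
    · have h2 : 0 ≤ (C₁ + 1) * D ^ 2 := by positivity
      linarith
    · rcases hdich z hz with hzΩ | hzf
      · obtain ⟨v, l, hv⟩ := (hsol.cone z hzΩ).symm.exists_eigenframe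
        refine Or.inr ⟨hnh z hzΩ, hcd z hzΩ, ?_⟩
        have h1 := hv.inCone (hsol.cone z hzΩ) 1 hk
        rw [es_one] at h1
        obtain ⟨i, -, hi⟩ := Finset.exists_lt_of_sum_lt (f := fun _ => (0:ℝ)) (by simpa using h1)
        refine ⟨v i, ?_⟩
        rw [hv.apply_eq, real_inner_self_eq_norm_sq, hv.orthonormal.1 i]
        simpa using hi
      · exact Or.inl (abs_le.1 (hM z hzf)).2

/-- Near the boundary `u` is close to any function with the same boundary values. -/
lemma IsBarrier.abs_sub_le {k : ℕ} (hk : 0 < k) (hkn : k ≤ n) {Ω V : Set (E n)} {ρ u h Φ : E n → ℝ}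
    {p' : E n → E n →L[ℝ] ℝ} {ρ₁ c₀ C₀ C₁ M C K : ℝ} (hbar : IsBarrier k Ω V ρ ρ₁ c₀ C₀)
    (hsol : IsControlled k Ω u h p' C₁) (hΩb : Bornology.IsBounded Ω)
    (hu : ContinuousOn u (closure Ω)) (hΦ : ContinuousOn Φ (closure Ω))
    (hΦd : ContDiffOn ℝ 2 Φ Ω) (hΦ2 : ∀ x ∈ Ω, ∀ v, |D2 Φ x v v| ≤ M * ‖v‖ ^ 2)
    (huΦ : ∀ y ∈ frontier Ω, u y = Φ y) (hC : ∀ x ∈ closure Ω, |u x - Φ x| ≤ C) (hC₁ : 0 ≤ C₁)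
    (hK0 : 0 ≤ K) (hK1 : C ≤ K * ρ₁) (hK2 : C₁ + M < K * c₀) :
    ∀ x ∈ closure Ω, ρ x ≤ ρ₁ → |u x - Φ x| ≤ K * ρ x := by
  have hΩ := hsol.isOpen
  have hcomp : IsCompact (closure Ω ∩ ρ ⁻¹' Iic ρ₁) :=
    (Metric.isCompact_of_isClosed_isBounded isClosed_closure hΩb.closure).of_isClosed_subset
      (hbar.continuousOn.preimage_isClosed_of_isClosed isClosed_closure isClosed_Iic)
      inter_subset_left
  have hcd : ∀ x ∈ Ω, ContDiffAt ℝ 2 u x := fun x hx =>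
    (hsol.contDiffOn.contDiffAt (hΩ.mem_nhds hx)).of_le (by norm_num)
  have hcΦ : ∀ x ∈ Ω, ContDiffAt ℝ 2 Φ x := fun x hx => hΦd.contDiffAt (hΩ.mem_nhds hx)
  -- Kρ dominates on {ρ = ρ₁} because Kρ₁ ≥ C, and on the boundary everything vanishes. In between,
  -- the barrier adds Kc₀T, which exceeds the contribution (C₁ + M)T of u and Φ and excludes a
  -- maximum.
  have key : ∀ s : ℝ, |s| = 1 → ∀ x ∈ closure Ω ∩ ρ ⁻¹' Iic ρ₁,
      s * (u x - Φ x) - K * ρ x ≤ 0 := by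
    intro s hs
    refine le_of_forall_exists_D2_pos hcomp ?_ fun z hz => ?_
    · exact ((continuousOn_const.mul (hu.sub hΦ)).sub (continuousOn_const.mul hbar.continuousOn)).mono
        inter_subset_left
    · by_cases hzΩ : z ∈ Ω
      · rcases (show ρ z ≤ ρ₁ from hz.2).lt_or_eq with hlt | heq
        · right
          have hzV := hbar.strip z hz.1 hz.2
          have hcρ : ContDiffAt ℝ 2 ρ z :=
            (hbar.contDiffOn.contDiffAt (hbar.isOpen.mem_nhds hzV)).of_le (by norm_num)
          obtain ⟨v, l, hv⟩ := (hsol.cone z hzΩ).symm.exists_eigenframe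
          refine ⟨?_, (contDiffAt_const.mul ((hcd z hzΩ).sub (hcΦ z hzΩ))).sub
            (contDiffAt_const.mul hcρ), hv.exists_D2_pos hk (hsol.cone z hzΩ) ?_⟩
          · have h1 : ∀ᶠ y in 𝓝 z, ρ y < ρ₁ :=
              hcρ.continuousAt.eventually_lt continuousAt_const hlt
            filter_upwards [h1, hΩ.mem_nhds hzΩ] with y hy hyΩ
            exact ⟨subset_closure hyΩ, hy.le⟩
          · have h1 := (hcd z hzΩ).sub (hcΦ z hzΩ)
            have e1 : ContDiffAt ℝ 2 (fun y => s * (u y - Φ y)) z := contDiffAt_const.mul h1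
            have e2 : ContDiffAt ℝ 2 (fun y => K * ρ y) z := contDiffAt_const.mul hcρ
            rw [D2_sub e1 e2, D2_const_mul (f := fun y => u y - Φ y) h1,
              D2_sub (hcd z hzΩ) (hcΦ z hzΩ), D2_const_mul hcρ]
            have e : ∀ i, (s • (D2 u z - D2 Φ z) - K • D2 ρ z) (v i) (v i) =
                s * l i - s * D2 Φ z (v i) (v i) - K * D2 ρ z (v i) (v i) := fun i => by
              change s * (D2 u z (v i) (v i) - D2 Φ z (v i) (v i)) - K * D2 ρ z (v i) (v i) = _
              rw [hv.apply_eq, real_inner_self_eq_norm_sq, hv.orthonormal.1 i]; ring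
            simp only [e]
            have h2 : ∑ i, gw k l i * (s * l i - s * D2 Φ z (v i) (v i) -
                K * D2 ρ z (v i) (v i)) = s * ∑ i, gw k l i * l i -
                s * ∑ i, gw k l i * D2 Φ z (v i) (v i) -
                K * ∑ i, gw k l i * D2 ρ z (v i) (v i) := by
              simp only [Finset.mul_sum, ← Finset.sum_sub_distrib]
              exact Finset.sum_congr rfl fun i _ => by ring
            rw [h2, hv.sum_gw_mul hk (hsol.cone z hzΩ), hsol.eq z hzΩ]
            have hT := hv.one_le_sum_gw hk hkn (hsol.cone z hzΩ)
            set T := ∑ i, gw k l i with hTdef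
            have h3 := hbar.concave z hzV _ (hsol.cone z hzΩ) v l hv
            have h4 : |∑ i, gw k l i * D2 Φ z (v i) (v i)| ≤ M * T := by
              refine (Finset.abs_sum_le_sum_abs _ _).trans ?_
              rw [hTdef, Finset.mul_sum]
              refine Finset.sum_le_sum fun i _ => ?_
              rw [abs_mul, abs_of_pos (hv.gw_pos hk (hsol.cone z hzΩ) i), mul_comm]
              refine mul_le_mul_of_nonneg_right ?_ (hv.gw_pos hk (hsol.cone z hzΩ) i).le
              have := hΦ2 z hzΩ (v i)
              rwa [hv.orthonormal.1 i, one_pow, mul_one] at this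
            have h5 : 0 ≤ h z := by
              rw [← hsol.eq z hzΩ]
              exact Real.rpow_nonneg ((hsol.cone z hzΩ).pos k le_rfl).le _
            have h6 : |s * h z| ≤ C₁ * T := by
              rw [abs_mul, hs, one_mul, abs_of_nonneg h5]
              exact (hsol.h_le z hzΩ).trans (le_mul_of_one_le_right hC₁ hT)
            have h7 : |s * ∑ i, gw k l i * D2 Φ z (v i) (v i)| ≤ M * T := by
              rw [abs_mul, hs, one_mul]; exact h4
            have h8 := mul_le_mul_of_nonneg_left h3 hK0
            have h9 : (C₁ + M) * T < K * c₀ * T := mul_lt_mul_of_pos_right hK2 (by linarith)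
            have h10 := (abs_le.1 h6).1
            have h11 := (abs_le.1 h7).2
            linarith
        · left
          have h1 : s * (u z - Φ z) ≤ C := by
            refine (le_abs_self _).trans ?_
            rw [abs_mul, hs, one_mul]; exact hC z hz.1
          rw [heq]; linarith
      · left
        have hzf : z ∈ frontier Ω := ⟨hz.1, by rwa [hΩ.interior_eq]⟩
        rw [huΦ z hzf, hbar.zero z hzf]; simp
  intro x hx hxρ
  have h1 := key 1 (by simp) x ⟨hx, hxρ⟩
  have h2 := key (-1) (by simp) x ⟨hx, hxρ⟩
  rw [abs_le]
  constructor <;> linarith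

end KHessian

namespace KHessian

variable {n : ℕ}

lemma HasBoundaryValues.contDiffAt {Ω : Set (E n)} {u : E n → ℝ} {u₁ : E n → E n →L[ℝ] ℝ}
    {u₂ : E n → E n → E n → ℝ} (h : HasBoundaryValues Ω u u₁ u₂) (hΩ : IsOpen Ω) {x : E n}
    (hx : x ∈ Ω) : ContDiffAt ℝ 3 u x := h.contDiffOn.contDiffAt (hΩ.mem_nhds hx)

/-- Bounds for the gradient and the tangential second derivatives on the boundary, from a barrier. -/
lemma IsBarrier.boundary_bounds {k : ℕ} {Ω V : Set (E n)} {ρ u Φ : E n → ℝ}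
    {u₁ Φ₁ : E n → E n →L[ℝ] ℝ} {u₂ Φ₂ : E n → E n → E n → ℝ} {ρ₁ c₀ C₀ K : ℝ}
    (hbar : IsBarrier k Ω V ρ ρ₁ c₀ C₀) (hΩ : IsOpen Ω) (hC : HasCLipBoundary 3 Ω)
    (hu : HasBoundaryValues Ω u u₁ u₂) (hΦ : HasBoundaryValues Ω Φ Φ₁ Φ₂)
    (huΦ : ∀ y ∈ frontier Ω, u y = Φ y) (hρ₁ : 0 < ρ₁) (hK0 : 0 < K)
    (hK : ∀ x ∈ closure Ω, ρ x ≤ ρ₁ → |u x - Φ x| ≤ K * ρ x) {y : E n} (hy : y ∈ frontier Ω) :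
    ‖u₁ y - Φ₁ y‖ ≤ K * C₀ ∧
      ∀ τ, fderiv ℝ ρ y τ = 0 → |u₂ y τ τ - Φ₂ y τ τ| ≤ K * C₀ * ‖τ‖ ^ 2 := by
  have hyc := frontier_subset_closure hy
  have hyV : y ∈ V := hbar.strip y hyc (by rw [hbar.zero y hy]; exact hρ₁.le)
  have hcρ : ∀ x ∈ V, ContDiffAt ℝ 3 ρ x := fun x hx =>
    hbar.contDiffOn.contDiffAt (hbar.isOpen.mem_nhds hx)
  have hcρ2 : ∀ x ∈ V, ContDiffAt ℝ 2 ρ x := fun x hx => (hcρ x hx).of_le (by norm_num)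
  have hcu : ∀ x ∈ Ω, ContDiffAt ℝ 2 u x := fun x hx => (hu.contDiffAt hΩ hx).of_le (by norm_num)
  have hcΦ : ∀ x ∈ Ω, ContDiffAt ℝ 2 Φ x := fun x hx => (hΦ.contDiffAt hΩ hx).of_le (by norm_num)
  obtain ⟨V', r, hyV', hr, -⟩ := hC y hy
  have hr2 : IsDefiningFunction 2 Ω V' r :=
    ⟨hr.isOpen, hr.contDiffOn.of_le (by norm_num), hr.gradient_ne, hr.mem_iff⟩
  have hW : {x | x ∈ V ∧ ρ x < ρ₁} ∈ 𝓝 y := by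
    have h1 : ∀ᶠ x in 𝓝 y, ρ x < ρ₁ := (hcρ y hyV).continuousAt.eventually_lt continuousAt_const
      (by rw [hbar.zero y hy]; exact hρ₁)
    exact (hbar.isOpen.eventually_mem hyV).and h1
  have key : ∀ s : ℝ, |s| = 1 → ∃ q : ℝ, 0 ≤ q ∧
      K • fderiv ℝ ρ y - s • (u₁ y - Φ₁ y) = q • fderiv ℝ r y ∧
      ∀ τ, fderiv ℝ r y τ = 0 → K * D2 ρ y τ τ - s * (u₂ y τ τ - Φ₂ y τ τ) = q * D2 r y τ τ := by
    intro s hs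
    have hd : ∀ x ∈ Ω ∩ V,
        fderiv ℝ (fun x => K * ρ x - s * (u x - Φ x)) x =
          K • fderiv ℝ ρ x - s • (fderiv ℝ u x - fderiv ℝ Φ x) ∧
        D2 (fun x => K * ρ x - s * (u x - Φ x)) x = K • D2 ρ x - s • (D2 u x - D2 Φ x) := by
      intro x hx
      have a1 := hcρ2 x hx.2
      have a2 := hcu x hx.1
      have a3 := hcΦ x hx.1
      have a4 : ContDiffAt ℝ 2 (fun x => u x - Φ x) x := a2.sub a3
      have a5 : ContDiffAt ℝ 2 (fun x => K * ρ x) x := contDiffAt_const.mul a1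
      have a6 : ContDiffAt ℝ 2 (fun x => s * (u x - Φ x)) x := contDiffAt_const.mul a4
      constructor
      · rw [fderiv_fun_sub (a5.differentiableAt (by norm_num)) (a6.differentiableAt (by norm_num)),
          fderiv_const_mul (a1.differentiableAt (by norm_num)),
          fderiv_const_mul (a4.differentiableAt (by norm_num)),
          fderiv_fun_sub (a2.differentiableAt (by norm_num)) (a3.differentiableAt (by norm_num))]
      · rw [D2_sub a5 a6, D2_const_mul a1, D2_const_mul a4, D2_sub a2 a3]
    have hmem : ∀ᶠ x in 𝓝[Ω] y, x ∈ Ω ∩ V := by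
      filter_upwards [self_mem_nhdsWithin, nhdsWithin_le_nhds (hbar.isOpen.mem_nhds hyV)] with x h1 h2
      exact ⟨h1, h2⟩
    have f1 : ∀ z ∈ frontier Ω ∩ {x | x ∈ V ∧ ρ x < ρ₁},
        Tendsto (fun x => K * ρ x - s * (u x - Φ x)) (𝓝[Ω] z) (𝓝 0) := by
      intro z hz
      have hzc := frontier_subset_closure hz.1
      have t1 : Tendsto ρ (𝓝[Ω] z) (𝓝 (ρ z)) := (hbar.continuousOn z hzc).mono subset_closure
      have t2 : Tendsto u (𝓝[Ω] z) (𝓝 (u z)) := (hu.continuousOn z hzc).mono subset_closure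
      have t3 : Tendsto Φ (𝓝[Ω] z) (𝓝 (Φ z)) := (hΦ.continuousOn z hzc).mono subset_closure
      have := (t1.const_mul K).sub ((t2.sub t3).const_mul s)
      rwa [hbar.zero z hz.1, huΦ z hz.1, sub_self, mul_zero, mul_zero, sub_self] at this
    have f2 : Tendsto (fderiv ℝ fun x => K * ρ x - s * (u x - Φ x)) (𝓝[Ω] y)
        (𝓝 (K • fderiv ℝ ρ y - s • (u₁ y - Φ₁ y))) := by
      have c1 : ContinuousAt (fderiv ℝ ρ) y :=
        ((hcρ y hyV).fderiv_right (m := 2) (by norm_num)).continuousAt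
      have t1 := c1.tendsto.mono_left (nhdsWithin_le_nhds (s := Ω))
      have := (t1.const_smul K).sub (((hu.tendsto₁ hyc).sub (hΦ.tendsto₁ hyc)).const_smul s)
      refine this.congr' ?_
      filter_upwards [hmem] with x hx
      exact (hd x hx).1.symm
    have f3 : ∀ τ, Tendsto (fun x => D2 (fun x => K * ρ x - s * (u x - Φ x)) x τ τ) (𝓝[Ω] y)
        (𝓝 (K * D2 ρ y τ τ - s * (u₂ y τ τ - Φ₂ y τ τ))) := by
      intro τ
      have c1 : ContinuousAt (D2 ρ) y :=
        (((hcρ y hyV).fderiv_right (m := 2) (by norm_num)).fderiv_right (m := 1)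
          (by norm_num)).continuousAt
      have h3 : Continuous fun A : Form n => A τ τ := by fun_prop
      have t1 : Tendsto (fun x => D2 ρ x τ τ) (𝓝[Ω] y) (𝓝 (D2 ρ y τ τ)) :=
        (h3.continuousAt.comp c1).tendsto.mono_left nhdsWithin_le_nhds
      have := (t1.const_mul K).sub
        (((hu.tendsto₂ y hyc τ τ).sub (hΦ.tendsto₂ y hyc τ τ)).const_mul s)
      refine this.congr' ?_
      filter_upwards [hmem] with x hx
      rw [(hd x hx).2]
      rfl
    obtain ⟨q, hq1, hq2, hq3⟩ := boundary_comparison (v := fun x => K * ρ x - s * (u x - Φ x))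
      (g₁ := K • fderiv ℝ ρ y - s • (u₁ y - Φ₁ y))
      (g₂ := fun τ => K * D2 ρ y τ τ - s * (u₂ y τ τ - Φ₂ y τ τ)) hΩ hr2 hyV' hy hW
      (fun x hx => (contDiffAt_const.mul (hcρ2 x hx.2.1)).sub
        (contDiffAt_const.mul ((hcu x hx.1).sub (hcΦ x hx.1)))) f1 f2 f3
    refine ⟨q, hq3 fun x hx => ?_, hq1, hq2⟩
    have h1 := hK x (subset_closure hx.1) hx.2.2.le
    have h2 : s * (u x - Φ x) ≤ |u x - Φ x| := by
      refine (le_abs_self _).trans ?_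
      rw [abs_mul, hs, one_mul]
    linarith
  obtain ⟨q, hq0, hq1, hq2⟩ := key 1 (by simp)
  obtain ⟨q', hq'0, hq'1, hq'2⟩ := key (-1) (by simp)
  -- Sum and difference of the comparisons for s = ±1. Since q, q' ≥ 0, |q' - q| ≤ q + q', so the
  -- derivatives of u - Φ are bounded by those of Kρ, whose size is known.
  have e1 : (2 * K) • fderiv ℝ ρ y = (q + q') • fderiv ℝ r y := by
    rw [add_smul, ← hq1, ← hq'1]; module
  have e2 : (2:ℝ) • (u₁ y - Φ₁ y) = (q' - q) • fderiv ℝ r y := by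
    rw [sub_smul, ← hq1, ← hq'1]; module
  have hqq : |q' - q| ≤ q + q' := by rw [abs_le]; constructor <;> linarith
  constructor
  · have h1 : 2 * ‖u₁ y - Φ₁ y‖ ≤ 2 * K * ‖fderiv ℝ ρ y‖ := by
      have n1 := congrArg norm e1
      have n2 := congrArg norm e2
      rw [norm_smul, norm_smul, Real.norm_of_nonneg (by positivity),
        Real.norm_of_nonneg (by positivity)] at n1
      rw [norm_smul, norm_smul, Real.norm_of_nonneg (by positivity), Real.norm_eq_abs] at n2
      rw [n1, n2]
      exact mul_le_mul_of_nonneg_right hqq (norm_nonneg _)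
    have h2 := mul_le_mul_of_nonneg_left (hbar.norm_le y hyV) hK0.le
    linarith
  · intro τ hτ
    have hrτ : fderiv ℝ r y τ = 0 := by
      have hne : (2 * K) * fderiv ℝ ρ y τ = (q + q') * fderiv ℝ r y τ := by
        have := congrArg (fun L : E n →L[ℝ] ℝ => L τ) e1
        exact this
      rw [hτ, mul_zero] at hne
      rcases mul_eq_zero.1 hne.symm with h | h
      · rw [h, zero_smul] at e1
        have h0 := (smul_eq_zero.1 e1).resolve_left (by positivity)
        have := hbar.le_norm y hyV
        rw [h0, norm_zero, mul_zero] at this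
        linarith
      · exact h
    have a1 := hq2 τ hrτ
    have a2 := hq'2 τ hrτ
    have h2 : |(q' - q) * D2 r y τ τ| ≤ |(q + q') * D2 r y τ τ| := by
      rw [abs_mul, abs_mul]
      exact mul_le_mul_of_nonneg_right (hqq.trans (le_abs_self _)) (abs_nonneg _)
    have e3 : (q' - q) * D2 r y τ τ = 2 * (u₂ y τ τ - Φ₂ y τ τ) := by linarith
    have e4 : (q + q') * D2 r y τ τ = 2 * (K * D2 ρ y τ τ) := by linarith
    rw [e3, e4, abs_mul, abs_mul, abs_mul, abs_of_pos hK0] at h2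
    have h3 := mul_le_mul_of_nonneg_left (hbar.second_le y hyV τ τ) hK0.le
    rw [abs_of_pos (by norm_num : (0:ℝ) < 2)] at h2
    have : K * (C₀ * ‖τ‖ * ‖τ‖) = K * C₀ * ‖τ‖ ^ 2 := by ring
    linarith

/-- Global gradient bound from the boundary gradient bound. -/
lemma IsControlled.gradient_bound {k : ℕ} (hk : 0 < k) (hkn : k ≤ n) {Ω : Set (E n)}
    {u h : E n → ℝ} {p' : E n → E n →L[ℝ] ℝ} {u₁ : E n → E n →L[ℝ] ℝ}
    {u₂ : E n → E n → E n → ℝ} {C₁ M D : ℝ} (hsol : IsControlled k Ω u h p' C₁) (hC₁ : 0 ≤ C₁)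
    (hΩb : Bornology.IsBounded Ω) (hu : HasBoundaryValues Ω u u₁ u₂)
    (hM : ∀ y ∈ frontier Ω, ‖u₁ y‖ ≤ M) (hM0 : 0 ≤ M) (hD : ∀ x ∈ closure Ω, ‖x‖ ≤ D) :
    ∀ x ∈ closure Ω, ‖u₁ x‖ ≤ M + (C₁ + 1) * D ^ 2 := by
  have hΩ := hsol.isOpen
  have hcomp : IsCompact (closure Ω) :=
    Metric.isCompact_of_isClosed_isBounded isClosed_closure hΩb.closure
  -- By the linearised equation the operator applied to ∂_e u is p'(e) ≥ -C₁, and the quadratic adds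
  -- 2(C₁+1)T, so a maximum occurs only on the boundary.
  have key : ∀ e : E n, ‖e‖ = 1 → ∀ x ∈ closure Ω,
      u₁ x e + (C₁ + 1) * ‖x‖ ^ 2 ≤ M + (C₁ + 1) * D ^ 2 := by
    intro e he
    refine le_of_forall_exists_D2_pos hcomp ?_ fun z hz => ?_
    · exact (hu.cont₁.clm_apply continuousOn_const).add
        (continuous_const.mul (continuous_norm.pow 2)).continuousOn
    · by_cases hzΩ : z ∈ Ω
      · right
        have hnh : closure Ω ∈ 𝓝 z := mem_of_superset (hΩ.mem_nhds hzΩ) subset_closure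
        have hc3 := hu.contDiffAt hΩ hzΩ
        have hce : ContDiffAt ℝ 2 (fun y => fderiv ℝ u y e) z :=
          (hc3.fderiv_right (m := 2) (by norm_num)).clm_apply contDiffAt_const
        have heq : (fun y => u₁ y e) =ᶠ[𝓝 z] fun y => fderiv ℝ u y e := by
          filter_upwards [hΩ.mem_nhds hzΩ] with y hy
          rw [hu.eq₁ y hy]
        have hce' : ContDiffAt ℝ 2 (fun y => u₁ y e) z := hce.congr_of_eventuallyEq heq
        obtain ⟨hcq, hq⟩ := D2_mul_norm_sq (C₁ + 1) z
        obtain ⟨v, l, hv⟩ := (hsol.cone z hzΩ).symm.exists_eigenframe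
        refine ⟨hnh, hce'.add hcq, hv.exists_D2_pos hk (hsol.cone z hzΩ) ?_⟩
        rw [D2_add hce' hcq, D2_congr heq]
        have e1 : ∀ i, (D2 (fun y => fderiv ℝ u y e) z + D2 (fun y => (C₁ + 1) * ‖y‖ ^ 2) z)
            (v i) (v i) = D2 (fun y => fderiv ℝ u y e) z (v i) (v i) + 2 * (C₁ + 1) := fun i => by
          change D2 (fun y => fderiv ℝ u y e) z (v i) (v i) +
            D2 (fun y => (C₁ + 1) * ‖y‖ ^ 2) z (v i) (v i) = _
          rw [hq, hv.orthonormal.1 i]; ring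
        simp only [e1, mul_add, Finset.sum_add_distrib, ← Finset.sum_mul]
        obtain ⟨κ, hsemi, -⟩ := hsol.semi z hzΩ
        have hsemi' : ∀ᶠ y in 𝓝 z, h z + p' z (y - z) - κ / 2 * ‖y - z‖ ^ 2 ≤ h y := by
          have ht : Tendsto (fun y : E n => (z, y)) (𝓝 z) (𝓝 (z, z)) :=
            (Continuous.prodMk_right z).tendsto z
          exact ht.eventually hsemi
        have h1 := sum_gw_D2_fderiv hk hc3
          (by filter_upwards [hΩ.mem_nhds hzΩ] with y hy using hsol.cone y hy)
          (by filter_upwards [hΩ.mem_nhds hzΩ] with y hy using hsol.eq y hy) hsemi' hv e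
        rw [h1]
        have h2 : |p' z e| ≤ C₁ := by
          have := (p' z).le_of_opNorm_le (hsol.p_le z hzΩ) e
          rwa [he, mul_one, Real.norm_eq_abs] at this
        have h3 := hv.one_le_sum_gw hk hkn (hsol.cone z hzΩ)
        have h4 := (abs_le.1 h2).1
        nlinarith
      · left
        have hzf : z ∈ frontier Ω := ⟨hz, by rwa [hΩ.interior_eq]⟩
        have h1 : u₁ z e ≤ M := by
          have := (u₁ z).le_of_opNorm_le (hM z hzf) e
          rw [he, mul_one, Real.norm_eq_abs] at this
          exact (le_abs_self _).trans this
        have h2 : (C₁ + 1) * ‖z‖ ^ 2 ≤ (C₁ + 1) * D ^ 2 := by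
          have := hD z hz
          gcongr
        linarith
  intro x hx
  set B := M + (C₁ + 1) * D ^ 2 with hB
  have hB0 : 0 ≤ B := by positivity
  have hup : ∀ e : E n, ‖e‖ = 1 → u₁ x e ≤ B := fun e he => by
    have := key e he x hx
    have h2 : 0 ≤ (C₁ + 1) * ‖x‖ ^ 2 := by positivity
    linarith
  obtain ⟨ν, hν, hνn⟩ := exists_inner_eq (u₁ x)
  rw [← hνn]
  rcases eq_or_ne ν 0 with h0 | h0
  · rw [h0, norm_zero]; exact hB0
  · have hp : 0 < ‖ν‖ := norm_pos_iff.2 h0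
    have := hup (‖ν‖⁻¹ • ν) (by rw [norm_smul, norm_inv, norm_norm, inv_mul_cancel₀ hp.ne'])
    rw [← hν, real_inner_smul_right, real_inner_self_eq_norm_sq] at this
    field_simp at this
    exact this

end KHessian

/-! ### Interior maximum principle; barrier versus distance. -/

namespace KHessian

variable {n : ℕ}

/-- Interior maximum principle for pure second derivatives. -/
lemma IsControlled.D2_bound {k : ℕ} (hk : 0 < k) (hkn : k ≤ n) {Ω : Set (E n)}
    {u h : E n → ℝ} {p' : E n → E n →L[ℝ] ℝ} {C₁ D B : ℝ} (hsol : IsControlled k Ω u h p' C₁)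
    (hC₁ : 0 ≤ C₁) {S : Set (E n)} (hS : IsCompact S) (hSΩ : S ⊆ Ω) (hD : ∀ x ∈ S, ‖x‖ ≤ D)
    (hB : 1 ≤ B) {ξ : E n} (hξ : ‖ξ‖ = 1) (hbd : ∀ x ∈ S, S ∈ 𝓝 x ∨ D2 u x ξ ξ ≤ B) :
    ∀ x ∈ S, D2 u x ξ ξ ≤ B + (C₁ + 1) * D ^ 2 := by
  intro x hx
  have hcd : ∀ x ∈ Ω, ContDiffAt ℝ 3 u x := fun x hx =>
    hsol.contDiffOn.contDiffAt (hsol.isOpen.mem_nhds hx)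
  have hcont : ContinuousOn (fun y => D2 u y ξ ξ + (C₁ + 1) * ‖y‖ ^ 2) S := by
    refine ContinuousOn.add (fun y hy => ContinuousAt.continuousWithinAt ?_)
      (continuous_const.mul (continuous_norm.pow 2)).continuousOn
    have c1 : ContinuousAt (D2 u) y :=
      (((hcd y (hSΩ hy)).fderiv_right (m := 2) (by norm_num)).fderiv_right (m := 1)
        (by norm_num)).continuousAt
    have h3 : Continuous fun A : Form n => A ξ ξ := by fun_prop
    exact h3.continuousAt.comp c1
  obtain ⟨z, hz, hmax⟩ := hS.exists_isMaxOn ⟨x, hx⟩ hcont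
  have h1 := isMaxOn_iff.1 hmax x hx
  have h2 : (C₁ + 1) * ‖z‖ ^ 2 ≤ (C₁ + 1) * D ^ 2 := by
    have := hD z hz
    gcongr
  have h3 : 0 ≤ (C₁ + 1) * ‖x‖ ^ 2 := by positivity
  suffices hs : D2 u z ξ ξ ≤ B by linarith
  by_contra! hlt
  have hSz := (hbd z hz).resolve_right (not_le.2 hlt)
  have hzΩ := hSΩ hz
  obtain ⟨κ, hsemi, hκ⟩ := hsol.semi z hzΩ
  obtain ⟨hcq, hq⟩ := D2_mul_norm_sq (-(C₁ + 1)) z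
  have hcc : ContDiffAt ℝ 2 (fun _ : E n => D2 u z ξ ξ + (C₁ + 1) * ‖z‖ ^ 2) z := contDiffAt_const
  -- Pure translations suffice here. The test function contributes -2(C₁+1)T, against a
  -- semiconvexity error of at most C₁T.
  obtain ⟨v, l, hv, hineq⟩ := viscosity_test (ξ₀ := ξ) (A := 0) (c := 0)
    (ψ := fun y => (D2 u z ξ ξ + (C₁ + 1) * ‖z‖ ^ 2) + -(C₁ + 1) * ‖y‖ ^ 2)
    hk hsol.isOpen hsol.contDiffOn hsol.cone hsol.eq hzΩ (by simp) (hcc.add hcq)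
    (by
      filter_upwards [hSz] with y hy
      have := isMaxOn_iff.1 hmax y hy
      simp only [zero_apply, add_zero]
      linarith) (by ring) (hsol.p_cont z hzΩ) hsemi
  have h4 := hκ v l ξ hv hξ (hB.trans hlt.le)
  have h5 := hv.one_le_sum_gw hk hkn (hsol.cone z hzΩ)
  have h6 : ∀ i, D2 (fun y => (D2 u z ξ ξ + (C₁ + 1) * ‖z‖ ^ 2) + -(C₁ + 1) * ‖y‖ ^ 2) z (v i) (v i)
      + 2 * l i * inner ℝ (v i) ((0 : E n →L[ℝ] E n) ((0 : E n →L[ℝ] E n) (v i))) =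
        -2 * (C₁ + 1) := fun i => by
    rw [D2_add hcc hcq]
    have e1 : D2 (fun _ : E n => D2 u z ξ ξ + (C₁ + 1) * ‖z‖ ^ 2) z = 0 := by
      unfold D2; simp
    rw [e1]
    change (0:ℝ) + D2 (fun y => -(C₁ + 1) * ‖y‖ ^ 2) z (v i) (v i) +
      2 * l i * inner ℝ (v i) 0 = _
    rw [hq, hv.orthonormal.1 i, inner_zero_right]; ring
  simp only [h6, ← Finset.sum_mul] at hineq
  rw [hξ] at hineq
  nlinarith

/-- A barrier is bounded below by a multiple of the distance to the boundary. -/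
lemma IsBarrier.exists_infDist_le {k : ℕ} {Ω V : Set (E n)} {ρ : E n → ℝ} {ρ₁ c₀ C₀ : ℝ}
    (hbar : IsBarrier k Ω V ρ ρ₁ c₀ C₀) (hΩ : IsOpen Ω) (hΩb : Bornology.IsBounded Ω)
    (hne : (frontier Ω).Nonempty) (hρ₁ : 0 < ρ₁) (hC₀ : 1 ≤ C₀) :
    ∃ c : ℝ, 0 < c ∧ ∀ x ∈ Ω, c * Metric.infDist x (frontier Ω) ≤ ρ x := by
  have hcomp : IsCompact (frontier Ω) :=
    Metric.isCompact_of_isClosed_isBounded isClosed_frontier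
      (hΩb.closure.subset frontier_subset_closure)
  have hcompΩ : IsCompact (closure Ω) :=
    Metric.isCompact_of_isClosed_isBounded isClosed_closure hΩb.closure
  have hfV : frontier Ω ⊆ V := fun y hy => hbar.strip y (frontier_subset_closure hy)
    (by rw [hbar.zero y hy]; exact hρ₁.le)
  obtain ⟨r, hr, hthick⟩ := hcomp.exists_thickening_subset_open hbar.isOpen hfV
  set d : E n → ℝ := fun x => Metric.infDist x (frontier Ω) with hd
  have hdc : Continuous d := Metric.continuous_infDist_pt _
  set s := min (r / 2) (1 / C₀ ^ 2) with hs
  have hs0 : 0 < s := lt_min (by positivity) (by positivity)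
  have hball : ∀ x ∈ Ω, Metric.ball x (d x) ⊆ Ω := fun x hx => by
    rcases (Metric.infDist_nonneg (x := x) (s := frontier Ω)).eq_or_lt with h0 | h0
    · have : d x = 0 := h0.symm
      rw [this, Metric.ball_zero]; exact empty_subset _
    · exact ball_subset_of_forall_dist h0 hx fun y hy => Metric.infDist_le_dist_of_mem hy
  have near : ∀ x ∈ Ω, d x < s → d x / (4 * C₀) ≤ ρ x := by
    intro x hx hxs
    have hd0 : 0 < d x := by
      refine lt_of_le_of_ne Metric.infDist_nonneg fun h => ?_
      have := (isClosed_frontier.mem_iff_infDist_zero hne).2 h.symm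
      exact (hΩ.inter_frontier_eq ▸ (⟨hx, this⟩ : x ∈ Ω ∩ frontier Ω) : x ∈ (∅ : Set _))
    have hdV : Metric.ball x (d x) ⊆ V := fun z hz => by
      refine hthick ((Metric.mem_thickening_iff_infDist_lt hne).2 ?_)
      have h1 : Metric.infDist z (frontier Ω) ≤ Metric.infDist x (frontier Ω) + dist z x :=
        Metric.infDist_le_infDist_add_dist
      have h2 : dist z x < d x := hz
      have h3 : s ≤ r / 2 := min_le_left _ _
      have h4 : Metric.infDist x (frontier Ω) = d x := rfl
      linarith
    have hxV : x ∈ V := hdV (Metric.mem_ball_self hd0)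
    obtain ⟨ν, hν, hνn⟩ := exists_inner_eq (fderiv ℝ ρ x)
    have hL := hbar.le_norm x hxV
    have hLpos : 0 < ‖fderiv ℝ ρ x‖ := by
      by_contra! h
      have := mul_nonneg (by linarith : (0:ℝ) ≤ C₀) (norm_nonneg (fderiv ℝ ρ x))
      nlinarith [norm_nonneg (fderiv ℝ ρ x)]
    set e := ‖ν‖⁻¹ • ν with he
    have hν0 : 0 < ‖ν‖ := by rw [hνn]; exact hLpos
    have hen : ‖e‖ = 1 := by rw [he, norm_smul, norm_inv, norm_norm, inv_mul_cancel₀ hν0.ne']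
    have hLe : fderiv ℝ ρ x e = ‖fderiv ℝ ρ x‖ := by
      rw [he, map_smul, ← hν, real_inner_self_eq_norm_sq, smul_eq_mul, ← hνn]
      field_simp
    -- Half the distance against the gradient stays in Ω, where ρ > 0, so ρ(x) ≥ t|Dρ| - C₀t². The
    -- bound d ≤ 1/C₀² makes the quadratic term at most half of t/C₀.
    set t := d x / 2 with ht
    have ht0 : 0 < t := by positivity
    set y := x - t • e with hy
    have hyx : ‖y - x‖ = t := by
      rw [hy, sub_sub_cancel_left, norm_neg, norm_smul, hen, mul_one, Real.norm_of_nonneg ht0.le]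
    have hyball : y ∈ Metric.ball x (d x) := by
      rw [mem_ball_iff_norm, hyx, ht]; linarith
    have hsub : Metric.closedBall x t ⊆ Metric.ball x (d x) :=
      Metric.closedBall_subset_ball (by rw [ht]; linarith)
    have hcd : ∀ z ∈ Metric.ball x (d x), ContDiffAt ℝ 2 ρ z := fun z hz =>
      (hbar.contDiffOn.contDiffAt (hbar.isOpen.mem_nhds (hdV hz))).of_le (by norm_num)
    have hT := (convex_closedBall x t).norm_image_sub_le_of_norm_fderiv_le' (𝕜 := ℝ) (f := ρ)
      (φ := fderiv ℝ ρ x) (C := C₀ * t) (x := x) (y := y)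
      (fun z hz => (hcd z (hsub hz)).differentiableAt (by norm_num))
      (fun z hz => (norm_fderiv_sub_le_of_D2 (by linarith) hcd
        (fun z hz v w => hbar.second_le z (hdV hz) v w) (hsub hz)).trans
        (mul_le_mul_of_nonneg_left (by rwa [mem_closedBall_iff_norm] at hz) (by linarith)))
      (Metric.mem_closedBall_self ht0.le) (by rw [mem_closedBall_iff_norm, hyx])
    rw [hyx, Real.norm_eq_abs] at hT
    have e1 : fderiv ℝ ρ x (y - x) = -(t * ‖fderiv ℝ ρ x‖) := by
      rw [hy, sub_sub_cancel_left, map_neg, map_smul, hLe, smul_eq_mul]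
    rw [e1] at hT
    have h1 := (abs_le.1 hT).2
    have h2 := hbar.pos y (hball x hx hyball)
    have h3 : 1 / C₀ ≤ ‖fderiv ℝ ρ x‖ := by rw [div_le_iff₀ (by linarith)]; linarith
    have h4 : C₀ * t ≤ 1 / (2 * C₀) := by
      have : d x ≤ 1 / C₀ ^ 2 := hxs.le.trans (min_le_right _ _)
      calc C₀ * t ≤ C₀ * (1 / C₀ ^ 2 / 2) := by rw [ht]; gcongr
        _ = _ := by field_simp
    have h5 : t * (1 / C₀) ≤ t * ‖fderiv ℝ ρ x‖ := mul_le_mul_of_nonneg_left h3 ht0.le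
    have h6 : C₀ * t * t ≤ 1 / (2 * C₀) * t := mul_le_mul_of_nonneg_right h4 ht0.le
    have h7 : d x / (4 * C₀) = t * (1 / C₀) - 1 / (2 * C₀) * t := by rw [ht]; field_simp; ring
    rw [h7]
    linarith
  have hcompS : IsCompact (closure Ω ∩ {x | s ≤ d x}) :=
    hcompΩ.inter_right (isClosed_le continuous_const hdc)
  obtain ⟨D, hD⟩ := hcompΩ.exists_bound_of_continuousOn hdc.continuousOn
  have hposS : ∀ x ∈ closure Ω ∩ {x | s ≤ d x}, 0 < ρ x := fun x hx => by
    refine hbar.pos x ?_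
    by_contra hxΩ
    have hxf : x ∈ frontier Ω := ⟨hx.1, by rwa [hΩ.interior_eq]⟩
    have h1 : s ≤ Metric.infDist x (frontier Ω) := hx.2
    rw [Metric.infDist_zero_of_mem hxf] at h1
    linarith
  obtain ⟨m, hm, hmS⟩ : ∃ m > 0, ∀ x ∈ closure Ω ∩ {x | s ≤ d x}, m ≤ ρ x := by
    rcases (closure Ω ∩ {x | s ≤ d x}).eq_empty_or_nonempty with h | h
    · exact ⟨1, one_pos, fun x hx => by rw [h] at hx; exact absurd hx (notMem_empty x)⟩
    · obtain ⟨z, hz, hmin⟩ := hcompS.exists_isMinOn h (hbar.continuousOn.mono inter_subset_left)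
      exact ⟨ρ z, hposS z hz, fun x hx => isMinOn_iff.1 hmin x hx⟩
  refine ⟨min (1 / (4 * C₀)) (m / (|D| + 1)), lt_min (by positivity) (by positivity),
    fun x hx => ?_⟩
  have hdx : 0 ≤ d x := Metric.infDist_nonneg
  rcases lt_or_ge (d x) s with h | h
  · calc _ ≤ 1 / (4 * C₀) * d x := mul_le_mul_of_nonneg_right (min_le_left _ _) hdx
      _ = d x / (4 * C₀) := by ring
      _ ≤ ρ x := near x hx h
  · have h1 := hD x (subset_closure hx)
    rw [Real.norm_of_nonneg hdx] at h1
    calc _ ≤ m / (|D| + 1) * d x := mul_le_mul_of_nonneg_right (min_le_right _ _) hdx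
      _ ≤ m / (|D| + 1) * (|D| + 1) := by
        have := le_abs_self D
        gcongr
        linarith
      _ = m := by field_simp
      _ ≤ ρ x := hmS x ⟨subset_closure hx, h⟩

end KHessian

/-! ### Parameters and the estimate in the boundary strip. -/

namespace KHessian

variable {n : ℕ}

/-- Smallness and largeness conditions on the parameters of the boundary strip. -/
structure StripConstants (n : ℕ) (c₀ C₀ C₁ C C₂ ρ₀ ε θ Q N₀ : ℝ) : Prop where
  c₀_pos : 0 < c₀
  one_le : 1 ≤ C₀
  le_C : 7 * C₀ ^ 3 ≤ C
  C₁_nonneg : 0 ≤ C₁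
  C₂_nonneg : 0 ≤ C₂
  ρ₀_pos : 0 < ρ₀
  ε_pos : 0 < ε
  hθ : 128 * θ = c₀
  small₁ : (ε + ρ₀) * (64 * C ^ 2) ≤ c₀ ^ 2 * θ
  small₂ : (ε + ρ₀) * (96 * C ^ 2) ≤ c₀
  small₃ : 8 * (128 * C ^ 2 / c₀) * ρ₀ ≤ 1
  small₄ : 512 * C ^ 4 * ε ^ 2 ≤ c₀ ^ 2
  hQ : Q * (16 * ε ^ 2) = c₀
  one_le_N₀ : 1 ≤ N₀
  Q_le : Q ≤ N₀
  large₁ : 256 * Q * C ^ 2 * θ ≤ c₀ * ε * N₀ ^ 2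
  large₂ : 4096 * Q * C ^ 4 ≤ c₀ * N₀ ^ 2
  large₃ : 1 + n * C ^ 2 ≤ N₀ * ε
  large₄ : 4 * C₁ * θ ≤ N₀ * c₀ * ε
  large₅ : 3 * C₁ + 2 * n * C₁ * C + 8 * C₁ * C ^ 2 < N₀ * c₀ / 4
  large₆ : 2 * (C₂ + n * C ^ 2) ≤ N₀ * ε
  ε_le : 16 * ε ≤ ρ₀
  log_le : 16 * C₀ ^ 2 ≤ ρ₀ * (θ * Real.log ((ε + ρ₀ / 4) / ε))

/-- The choices are made in the order θ, ρ₀, ε, Q, N₀, each depending only on the earlier ones and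
on the given constants. Neither ε₁ nor the boundary supremum of the Hessian occurs, so the strip is
fixed before the final ε₁ is used. -/
lemma exists_stripConstants (n : ℕ) {c₀ C₀ C₁ C C₂ ρ₁ : ℝ} (hc₀ : 0 < c₀) (hC₀ : 1 ≤ C₀)
    (hC : 7 * C₀ ^ 3 ≤ C) (hC₁ : 0 ≤ C₁) (hC₂ : 0 ≤ C₂) (hρ₁ : 0 < ρ₁) :
    ∃ ρ₀ ε θ Q N₀ : ℝ, ρ₀ ≤ ρ₁ ∧ StripConstants n c₀ C₀ C₁ C C₂ ρ₀ ε θ Q N₀ := by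
  have hC1 : 1 ≤ C := by linarith only [one_le_pow₀ hC₀ (n := 3), hC]
  obtain ⟨θ, hθ⟩ : ∃ θ, 128 * θ = c₀ := ⟨c₀ / 128, by ring⟩
  have hθ0 : 0 < θ := by linarith only [hθ, hc₀]
  obtain ⟨ρ₀, hρ₀0, h0, h1, h2, h3⟩ : ∃ ρ₀, 0 < ρ₀ ∧ ρ₀ ≤ ρ₁ ∧
      ρ₀ * (2 * (64 * C ^ 2)) ≤ c₀ ^ 2 * θ ∧ ρ₀ * (2 * (96 * C ^ 2)) ≤ c₀ ∧
      8 * (128 * C ^ 2 / c₀) * ρ₀ ≤ 1 := by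
    refine ⟨min ρ₁ (min (c₀ ^ 2 * θ / (2 * (64 * C ^ 2)))
      (min (c₀ / (2 * (96 * C ^ 2))) (1 / (8 * (128 * C ^ 2 / c₀))))),
      lt_min hρ₁ (lt_min (by positivity) (lt_min (by positivity) (by positivity))),
      min_le_left _ _, ?_, ?_, ?_⟩
    · rw [← le_div_iff₀ (by positivity)]
      exact (min_le_right _ _).trans (min_le_left _ _)
    · rw [← le_div_iff₀ (by positivity)]
      exact (min_le_right _ _).trans ((min_le_right _ _).trans (min_le_left _ _))
    · rw [mul_comm, ← le_div_iff₀ (by positivity)]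
      exact (min_le_right _ _).trans ((min_le_right _ _).trans (min_le_right _ _))
  -- The exponentially small bound makes log((ε + ρ₀/4)/ε) large, so that αC₀² is at most ρ₀/16 at
  -- depth ρ₀/4.
  obtain ⟨ε, hε0, e1, e2, e3⟩ : ∃ ε, 0 < ε ∧ 16 * ε ≤ ρ₀ ∧ ε * (32 * C ^ 2) ≤ c₀ ∧
      ε ≤ ρ₀ / 4 * Real.exp (-(16 * C₀ ^ 2 / (ρ₀ * θ))) := by
    refine ⟨min (ρ₀ / 16) (min (c₀ / (32 * C ^ 2))
      (ρ₀ / 4 * Real.exp (-(16 * C₀ ^ 2 / (ρ₀ * θ))))),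
      lt_min (by positivity) (lt_min (by positivity) (by positivity)), ?_, ?_,
      (min_le_right _ _).trans (min_le_right _ _)⟩
    · rw [mul_comm, ← le_div_iff₀ (by norm_num)]
      exact min_le_left _ _
    · rw [← le_div_iff₀ (by positivity)]
      exact (min_le_right _ _).trans (min_le_left _ _)
  obtain ⟨Q, hQ⟩ : ∃ Q, Q * (16 * ε ^ 2) = c₀ :=
    ⟨c₀ / (16 * ε ^ 2), div_mul_cancel₀ _ (by positivity)⟩
  have hQ0 : 0 < Q := pos_of_mul_pos_left (hQ ▸ hc₀) (by positivity)
  have choose_div : ∀ a b : ℝ, 0 ≤ a → 0 < b → ∃ t, 0 ≤ t ∧ t * b = a := fun a b ha hb =>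
    ⟨a / b, by positivity, div_mul_cancel₀ _ hb.ne'⟩
  obtain ⟨A₁, p1, q1⟩ := choose_div (256 * Q * C ^ 2 * θ) (c₀ * ε) (by positivity) (by positivity)
  obtain ⟨A₂, p2, q2⟩ := choose_div (4096 * Q * C ^ 4) c₀ (by positivity) hc₀
  obtain ⟨A₃, p3, q3⟩ := choose_div (1 + n * C ^ 2) ε (by positivity) hε0
  obtain ⟨A₄, p4, q4⟩ := choose_div (4 * C₁ * θ) (c₀ * ε) (by positivity) (by positivity)
  obtain ⟨A₅, p5, q5⟩ := choose_div (4 * (3 * C₁ + 2 * n * C₁ * C + 8 * C₁ * C ^ 2)) c₀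
    (by positivity) hc₀
  obtain ⟨A₆, p6, q6⟩ := choose_div (2 * (C₂ + n * C ^ 2)) ε (by positivity) hε0
  obtain ⟨N₀, hN₀⟩ : ∃ N₀, N₀ = 1 + Q + A₁ + A₂ + A₃ + A₄ + A₅ + A₆ := ⟨_, rfl⟩
  have hN1 : 1 ≤ N₀ := by linarith only [hN₀, hQ0, p1, p2, p3, p4, p5, p6]
  have hN2 : N₀ ≤ N₀ ^ 2 := le_self_pow₀ hN1 two_ne_zero
  have hsum : ε + ρ₀ ≤ 2 * ρ₀ := by linarith only [e1, hε0]
  have hc₀ε : 0 < c₀ * ε := mul_pos hc₀ hε0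
  have i1 : A₁ ≤ N₀ ^ 2 := by linarith only [hN2, hN₀, hQ0, p1, p2, p3, p4, p5, p6]
  have i2 : A₂ ≤ N₀ ^ 2 := by linarith only [hN2, hN₀, hQ0, p1, p2, p3, p4, p5, p6]
  have i3 : A₃ ≤ N₀ := by linarith only [hN₀, hQ0, p1, p2, p3, p4, p5, p6]
  have i4 : A₄ ≤ N₀ := by linarith only [hN₀, hQ0, p1, p2, p3, p4, p5, p6]
  have i5 : A₅ < N₀ := by linarith only [hN₀, hQ0, p1, p2, p3, p4, p5, p6]
  have i6 : A₆ ≤ N₀ := by linarith only [hN₀, hQ0, p1, p2, p3, p4, p5, p6]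
  refine ⟨ρ₀, ε, θ, Q, N₀, h0, hc₀, hC₀, hC, hC₁, hC₂, hρ₀0, hε0, hθ, ?_, ?_, h3, ?_,
    hQ, hN1, by linarith only [hN₀, hQ0, p1, p2, p3, p4, p5, p6], ?_, ?_, ?_, ?_, ?_, ?_, e1, ?_⟩
  · have := mul_le_mul_of_nonneg_right hsum (by positivity : 0 ≤ 64 * C ^ 2)
    linarith only [this, h1]
  · have := mul_le_mul_of_nonneg_right hsum (by positivity : 0 ≤ 96 * C ^ 2)
    linarith only [this, h2]
  · have h5 : (ε * (32 * C ^ 2)) ^ 2 ≤ c₀ ^ 2 := pow_le_pow_left₀ (by positivity) e2 2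
    have h6 : (ε * (32 * C ^ 2)) ^ 2 = 1024 * C ^ 4 * ε ^ 2 := by ring
    have h7 : 0 ≤ C ^ 4 * ε ^ 2 := by positivity
    linarith only [h5, h6, h7]
  · have := mul_le_mul_of_nonneg_right i1 hc₀ε.le
    linarith only [this, q1]
  · have := mul_le_mul_of_nonneg_right i2 hc₀.le
    linarith only [this, q2]
  · exact q3 ▸ mul_le_mul_of_nonneg_right i3 hε0.le
  · have := mul_le_mul_of_nonneg_right i4 hc₀ε.le
    linarith only [this, q4]
  · have := mul_lt_mul_of_pos_right i5 hc₀
    linarith only [this, q5]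
  · exact q6 ▸ mul_le_mul_of_nonneg_right i6 hε0.le
  · have h5 : 16 * C₀ ^ 2 / (ρ₀ * θ) ≤ Real.log ((ε + ρ₀ / 4) / ε) := by
      rw [Real.le_log_iff_exp_le (by positivity), le_div_iff₀ hε0]
      have h6 := mul_le_mul_of_nonneg_left e3 (Real.exp_pos (16 * C₀ ^ 2 / (ρ₀ * θ))).le
      have h7 : Real.exp (16 * C₀ ^ 2 / (ρ₀ * θ)) *
          (ρ₀ / 4 * Real.exp (-(16 * C₀ ^ 2 / (ρ₀ * θ)))) = ρ₀ / 4 := by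
        rw [mul_left_comm, ← Real.exp_add]; simp
      linarith only [h6, h7, hε0]
    rw [div_le_iff₀ (by positivity)] at h5
    linarith only [h5]

lemma continuousOn_stripAlpha {Λ θ ε : ℝ} (hΛ : 0 < Λ) (hθ : 0 ≤ θ) (hε : 0 < ε) :
    ContinuousOn (stripAlpha Λ θ ε) (Ici 0) := by
  intro t ht
  have ht0 : 0 ≤ t := ht
  have h0 := (stripAlpha_pos hΛ hθ hε ht0).ne'
  unfold stripAlpha at h0 ⊢
  refine ContinuousAt.continuousWithinAt (ContinuousAt.inv₀ ?_ fun h => h0 (by rw [h, inv_zero]))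
  refine continuousAt_const.add (continuousAt_const.mul (ContinuousAt.log ?_ (by positivity)))
  exact (continuousAt_const.add continuousAt_id).div_const ε

lemma le_stripB {K ε t ρ₀ : ℝ} (hK : 0 ≤ K) (h : 8 * K * ρ₀ ≤ 1) (ht : 0 ≤ t) (htρ : t ≤ ρ₀) :
    ε + 7 / 8 * t ≤ stripB K ε t := by
  unfold stripB
  have : 8 * K * t ≤ 1 := (mul_le_mul_of_nonneg_left htρ (by positivity)).trans h
  nlinarith

/-- If the comparison fails for N, the maximum of F/B provides a larger constant N' for which it
holds with contact at a point. The largeness conditions are inherited by N'. -/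
lemma exists_ratio_max {X : Type*} [TopologicalSpace X] {P : Set X} (hP : IsCompact P)
    {F B : X → ℝ} (hF : ContinuousOn F P) (hB : ContinuousOn B P) (hBP : ∀ p ∈ P, 0 < B p) {N : ℝ}
    {p : X} (hp : p ∈ P) (hlt : N * B p < F p) :
    ∃ q ∈ P, ∃ N', N < N' ∧ (∀ r ∈ P, F r ≤ N' * B r) ∧ F q = N' * B q := by
  obtain ⟨q, hq, hmax⟩ := hP.exists_isMaxOn ⟨p, hp⟩ (hF.div hB fun p hp => (hBP p hp).ne')
  have hle : ∀ r ∈ P, F r ≤ F q / B q * B r := fun r hr => by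
    have := isMaxOn_iff.1 hmax r hr
    rwa [Pi.div_apply, Pi.div_apply, div_le_iff₀ (hBP r hr)] at this
  exact ⟨q, hq, F q / B q, lt_of_mul_lt_mul_right (hlt.trans_le (hle p hp)) (hBP p hp).le, hle,
    (div_mul_cancel₀ _ (hBP q hq).ne').symm⟩

lemma le_of_le_on_sphere {F : Type*} [NormedAddCommGroup F] [NormedSpace ℝ F] {f g : F → ℝ}
    (hf : ∀ (c : ℝ) w, f (c • w) = c ^ 2 * f w) (hg : ∀ (c : ℝ) w, g (c • w) = c ^ 2 * g w)
    (h : ∀ w, ‖w‖ = 1 → f w ≤ g w) (w : F) : f w ≤ g w := by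
  rcases eq_or_ne w 0 with rfl | hw
  · have h1 := hf 0 0
    have h2 := hg 0 0
    rw [smul_zero] at h1 h2
    linarith
  · have hw0 : 0 < ‖w‖ := norm_pos_iff.2 hw
    have h1 := h (‖w‖⁻¹ • w) (by rw [norm_smul, norm_inv, norm_norm, inv_mul_cancel₀ hw0.ne'])
    rw [hf, hg] at h1
    exact le_of_mul_le_mul_left h1 (by positivity)

lemma HasBoundaryValues.add_apply_add {Ω : Set (E n)} {u : E n → ℝ} {u₁ : E n → E n →L[ℝ] ℝ}
    {u₂ : E n → E n → E n → ℝ} (hu : HasBoundaryValues Ω u u₁ u₂) {z : E n} (hz : z ∈ closure Ω)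
    (v w : E n) : u₂ z (v + w) (v + w) = u₂ z v v + u₂ z v w + u₂ z w v + u₂ z w w := by
  have : (𝓝[Ω] z).NeBot := mem_closure_iff_nhdsWithin_neBot.1 hz
  refine tendsto_nhds_unique (hu.tendsto₂ z hz (v + w) (v + w)) ?_
  refine ((((hu.tendsto₂ z hz v v).add (hu.tendsto₂ z hz v w)).add
    (hu.tendsto₂ z hz w v)).add (hu.tendsto₂ z hz w w)).congr fun x => ?_
  simp only [map_add, add_apply]
  ring

/-- Splitting of a unit vector into a component on which a nonzero functional vanishes and a
multiple of its gradient. -/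
lemma exists_tangent_normal {L : E n →L[ℝ] ℝ} {C₀ : ℝ} (hC₀ : 0 < C₀) (hL : 1 ≤ C₀ * ‖L‖)
    {ξ : E n} (hξ : ‖ξ‖ = 1) :
    ∃ τ w, ξ = τ + w ∧ L τ = 0 ∧ ‖τ‖ ≤ 1 ∧ ‖w‖ ≤ C₀ * |L ξ| := by
  obtain ⟨ν, hν, hνn⟩ := exists_inner_eq L
  rw [← hνn] at hL
  have hν0 : 0 < ‖ν‖ := pos_of_mul_pos_right (by linarith) hC₀.le
  obtain ⟨s, hs⟩ : ∃ s, s = L ξ / ‖ν‖ ^ 2 := ⟨_, rfl⟩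
  have hLν : L ν = ‖ν‖ ^ 2 := by rw [← hν, real_inner_self_eq_norm_sq]
  have hLτ : L (ξ - s • ν) = 0 := by
    rw [map_sub, map_smul, hLν, smul_eq_mul, hs, div_mul_cancel₀ _ (by positivity), sub_self]
  have hinner : inner ℝ ν (ξ - s • ν) = 0 := by rw [hν, hLτ]
  refine ⟨ξ - s • ν, s • ν, (sub_add_cancel _ _).symm, hLτ, ?_, ?_⟩
  · have h1 : ‖ξ‖ ^ 2 = ‖ξ - s • ν‖ ^ 2 + ‖s • ν‖ ^ 2 := by
      rw [← sub_add_cancel ξ (s • ν), norm_add_sq_real, real_inner_smul_right, real_inner_comm,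
        sub_add_cancel, hinner]
      ring
    rw [hξ, one_pow] at h1
    rw [← sq_le_one_iff₀ (norm_nonneg _)]
    linarith [sq_nonneg ‖s • ν‖]
  · rw [norm_smul, hs, norm_div, norm_pow, norm_norm, Real.norm_eq_abs]
    calc |L ξ| / ‖ν‖ ^ 2 * ‖ν‖ = |L ξ| * (1 / ‖ν‖) := by field_simp
      _ ≤ |L ξ| * C₀ := by
        refine mul_le_mul_of_nonneg_left ?_ (abs_nonneg _)
        rw [div_le_iff₀ hν0]; exact hL
      _ = _ := mul_comm _ _

/-- Mixed and normal derivatives are at most N/ε₁ and carry a factor |η| or η². Young's inequality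
moves them into the coefficient of η² at the cost of Nε/2. The tangential part and A use the other
half of Nε. -/
lemma strip_boundary_bound {C₀ M η t s N ε ε₁ C₂ A : ℝ} {a b c d : ℝ} (hC₀ : 1 ≤ C₀)
    (ht0 : 0 ≤ t) (ht : t ≤ 1) (hs0 : 0 ≤ s) (hs : s ≤ C₀ * |η|) (hC₂ : 0 ≤ C₂) (hM0 : 0 ≤ M)
    (hε : 0 < ε) (hε₁ : 0 < ε₁) (hN : 0 < N) (hNM : ε₁ * M ≤ N) (ha : a ≤ C₂ * t ^ 2)
    (hb : b ≤ M * t * s) (hc : c ≤ M * s * t) (hd : d ≤ M * s * s)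
    (hA : 2 * (C₂ + A) ≤ N * ε) :
    a + b + c + d + A ≤ N * ((2 * C₀ ^ 2 / (ε₁ ^ 2 * ε) + C₀ ^ 2 / ε₁) * η ^ 2 + ε) := by
  have b6 : C₂ * t ^ 2 ≤ C₂ := mul_le_of_le_one_right hC₂ (pow_le_one₀ ht0 ht)
  have b7 : M * t * s ≤ M * (C₀ * |η|) := by
    calc M * t * s ≤ M * 1 * (C₀ * |η|) := by gcongr
      _ = _ := by ring
  have b8 : M * s * t = M * t * s := by ring
  have b9 : M * s * s ≤ M * (C₀ ^ 2 * η ^ 2) := by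
    calc M * s * s ≤ M * (C₀ * |η|) * (C₀ * |η|) := by gcongr
      _ = M * (C₀ ^ 2 * |η| ^ 2) := by ring
      _ = _ := by rw [sq_abs]
  have hMN : M ≤ N / ε₁ := by rw [le_div_iff₀ hε₁]; linarith
  have c1 : M * (C₀ ^ 2 * η ^ 2) ≤ N * (C₀ ^ 2 / ε₁ * η ^ 2) := by
    calc M * (C₀ ^ 2 * η ^ 2) ≤ N / ε₁ * (C₀ ^ 2 * η ^ 2) := by gcongr
      _ = _ := by ring
  have c2 : 2 * (M * (C₀ * |η|)) ≤ N * (ε / 2 + 2 * C₀ ^ 2 / (ε₁ ^ 2 * ε) * η ^ 2) := by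
    have h1 : 2 * (C₀ * |η| / ε₁) ≤ ε / 2 + 2 * C₀ ^ 2 / (ε₁ ^ 2 * ε) * η ^ 2 := by
      have h2 : ε / 2 + 2 * C₀ ^ 2 / (ε₁ ^ 2 * ε) * η ^ 2 - 2 * (C₀ * |η| / ε₁) =
          (ε / 2) * (1 - 2 * (C₀ * |η|) / (ε₁ * ε)) ^ 2 := by
        rw [← sq_abs η]; field_simp; ring
      have h3 : 0 ≤ (ε / 2) * (1 - 2 * (C₀ * |η|) / (ε₁ * ε)) ^ 2 := by positivity
      linarith
    calc 2 * (M * (C₀ * |η|)) ≤ 2 * (N / ε₁ * (C₀ * |η|)) := by gcongr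
      _ = N * (2 * (C₀ * |η| / ε₁)) := by ring
      _ ≤ _ := mul_le_mul_of_nonneg_left h1 hN.le
  have c4 : N * ((2 * C₀ ^ 2 / (ε₁ ^ 2 * ε) + C₀ ^ 2 / ε₁) * η ^ 2 + ε) =
      N * (ε / 2 + 2 * C₀ ^ 2 / (ε₁ ^ 2 * ε) * η ^ 2) + N * (C₀ ^ 2 / ε₁ * η ^ 2) + N * ε / 2 := by
    ring
  rw [c4]
  linarith

/-- The estimate in the boundary strip for the pure second derivatives, given bounds on the two
components of the boundary of the strip. -/
theorem strip_bound {k : ℕ} (hk : 2 ≤ k) (hkn : k ≤ n) {Ω V : Set (E n)} {ρ u h : E n → ℝ}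
    {p' : E n → E n →L[ℝ] ℝ} {u₁ : E n → E n →L[ℝ] ℝ} {u₂ : E n → E n → E n → ℝ}
    {c₀ C₀ C₁ C C₂ ρ₀ ε θ Q N₀ M N m ε₁ : ℝ} (hbar : IsBarrier k Ω V ρ ρ₀ c₀ C₀)
    (hsol : IsControlled k Ω u h p' C₁) (hu : HasBoundaryValues Ω u u₁ u₂)
    (hΩb : Bornology.IsBounded Ω) (hS : StripConstants n c₀ C₀ C₁ C C₂ ρ₀ ε θ Q N₀)
    (hu1 : ∀ x ∈ closure Ω, ‖u₁ x‖ ≤ C)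
    (hτ : ∀ y ∈ frontier Ω, ∀ τ, fderiv ℝ ρ y τ = 0 → u₂ y τ τ ≤ C₂ * ‖τ‖ ^ 2)
    (hM : ∀ y ∈ frontier Ω, ∀ v w, |u₂ y v w| ≤ M * ‖v‖ * ‖w‖) (hM0 : 0 ≤ M) (hε₁ : 0 < ε₁)
    (hN₀ : N₀ ≤ N) (hNM : ε₁ * M ≤ N)
    (hm : ∀ x ∈ Ω, ρ x = ρ₀ → ∀ ξ, ‖ξ‖ = 1 → D2 u x ξ ξ ≤ m) (hmN : 2 * m ≤ N * ρ₀) :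
    ∀ x ∈ Ω, ρ x ≤ ρ₀ → ∀ ξ, ‖ξ‖ = 1 → D2 u x ξ ξ ≤
      N * (stripAlpha (2 * C₀ ^ 2 / (ε₁ ^ 2 * ε) + C₀ ^ 2 / ε₁) θ ε (ρ x) * C₀ ^ 2 + ε + ρ x) := by
  obtain ⟨hc₀, hC₀, hCC, hC₁, hC₂, hρ₀, hε, hθ, hs1, hs2, hs3, hε1, hQ, hM0', hMQ, hM1, hM2, hM3, hM4,
    hM5, hM6, -, -⟩ := hS
  have hΩ := hsol.isOpen
  have hθ0 : 0 < θ := by linarith only [hθ, hc₀]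
  have hN0 : 0 < N := by linarith only [hM0', hN₀]
  have hC0 : 0 < C := by linarith only [one_le_pow₀ hC₀ (n := 3), hCC]
  obtain ⟨Λ, hΛ⟩ : ∃ Λ, Λ = 2 * C₀ ^ 2 / (ε₁ ^ 2 * ε) + C₀ ^ 2 / ε₁ := ⟨_, rfl⟩
  have hΛ0 : 0 < Λ := by rw [hΛ]; positivity
  have hK0 : 0 ≤ 128 * C ^ 2 / c₀ := by positivity
  have hQ0 : 0 < Q := pos_of_mul_pos_left (hQ ▸ hc₀) (by positivity)
  obtain ⟨a, ha', ha0, ha1⟩ : ∃ a, a * N₀ = Q ∧ 0 < a ∧ a ≤ 1 :=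
    ⟨Q / N₀, div_mul_cancel₀ _ (by linarith only [hM0']), div_pos hQ0 (by linarith only [hM0']),
      (div_le_one (by linarith only [hM0'])).2 hMQ⟩
  obtain ⟨G, hG⟩ : ∃ G : E n → ℝ, ∀ x, G x = ∑ j : Fin n,
    u₁ x (EuclideanSpace.single j 1) * u₁ x (EuclideanSpace.single j 1) := ⟨_, fun _ => rfl⟩
  have hGΩ : ∀ x ∈ Ω, G x = gradSq u x := fun x hx => by
    rw [hG]; simp only [gradSq, hu.eq₁ x hx]
  have hG0 : ∀ x, 0 ≤ G x := fun x => hG x ▸ Finset.sum_nonneg fun _ _ => mul_self_nonneg _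
  have haG : ∀ x ∈ closure Ω, a * G x ≤ n * C ^ 2 := fun x hx => by
    have h1 : ∀ j : Fin n, u₁ x (EuclideanSpace.single j 1) * u₁ x (EuclideanSpace.single j 1) ≤
        C ^ 2 := fun j => by
      have h1 := (u₁ x).le_of_opNorm_le (hu1 x hx) (EuclideanSpace.single j 1)
      simp only [PiLp.norm_single, norm_one, mul_one, Real.norm_eq_abs] at h1
      rw [← sq, ← sq_abs]
      exact pow_le_pow_left₀ (abs_nonneg _) h1 2
    refine (mul_le_of_le_one_left (hG0 x) ha1).trans ?_
    calc G x ≤ ∑ _j : Fin n, C ^ 2 := by rw [hG]; exact Finset.sum_le_sum fun j _ => h1 j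
      _ = n * C ^ 2 := by simp
  have hGc : ContinuousOn G (closure Ω) := by
    rw [funext hG]
    exact continuousOn_finsetSum _ fun j _ =>
      (hu.cont₁.clm_apply continuousOn_const).mul (hu.cont₁.clm_apply continuousOn_const)
  have hρ0 : ∀ x ∈ closure Ω, 0 ≤ ρ x := fun x hx => by
    by_cases hxΩ : x ∈ Ω
    · exact (hbar.pos x hxΩ).le
    · rw [hbar.zero x ⟨hx, by rwa [hΩ.interior_eq]⟩]
  obtain ⟨S, hSdef⟩ : ∃ S, S = closure Ω ∩ ρ ⁻¹' Iic ρ₀ := ⟨_, rfl⟩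
  have hSc : IsCompact S :=
    (Metric.isCompact_of_isClosed_isBounded isClosed_closure hΩb.closure).of_isClosed_subset
      (hSdef ▸ hbar.continuousOn.preimage_isClosed_of_isClosed isClosed_closure isClosed_Iic)
      (hSdef ▸ inter_subset_left)
  have hS1 : ∀ x ∈ S, x ∈ closure Ω := fun x hx => by rw [hSdef] at hx; exact hx.1
  have hS2 : ∀ x ∈ S, ρ x ≤ ρ₀ := fun x hx => by rw [hSdef] at hx; exact hx.2
  have hS3 : ∀ x ∈ closure Ω, ρ x ≤ ρ₀ → x ∈ S := fun x h1 h2 => by rw [hSdef]; exact ⟨h1, h2⟩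
  have hSV : ∀ x ∈ S, x ∈ V := fun x hx => hbar.strip x (hS1 x hx) (hS2 x hx)
  obtain ⟨F, hF⟩ : ∃ F : E n × E n → ℝ, ∀ x w, F (x, w) = u₂ x w w + a * G x * ‖w‖ ^ 2 :=
    ⟨fun p => u₂ p.1 p.2 p.2 + a * G p.1 * ‖p.2‖ ^ 2, fun _ _ => rfl⟩
  obtain ⟨B, hB⟩ : ∃ B : E n × E n → ℝ, ∀ x w, B (x, w) =
      stripAlpha Λ θ ε (ρ x) * fderiv ℝ ρ x w ^ 2 + stripB (128 * C ^ 2 / c₀) ε (ρ x) * ‖w‖ ^ 2 :=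
    ⟨fun p => stripAlpha Λ θ ε (ρ p.1) * fderiv ℝ ρ p.1 p.2 ^ 2 +
      stripB (128 * C ^ 2 / c₀) ε (ρ p.1) * ‖p.2‖ ^ 2, fun _ _ => rfl⟩
  have hαpos : ∀ x ∈ closure Ω, 0 < stripAlpha Λ θ ε (ρ x) := fun x hx =>
    stripAlpha_pos hΛ0 hθ0.le hε (hρ0 x hx)
  have hbge : ∀ x ∈ S, ε + 7 / 8 * ρ x ≤ stripB (128 * C ^ 2 / c₀) ε (ρ x) := fun x hx =>
    le_stripB hK0 hs3 (hρ0 x (hS1 x hx)) (hS2 x hx)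
  obtain ⟨P, hPdef⟩ : ∃ P, P = S ×ˢ Metric.sphere (0 : E n) 1 := ⟨_, rfl⟩
  have hPc : IsCompact P := hPdef ▸ hSc.prod (isCompact_sphere 0 1)
  have hPS : ∀ p ∈ P, p.1 ∈ S := fun p hp => by rw [hPdef] at hp; exact hp.1
  have hPn : ∀ p ∈ P, ‖p.2‖ = 1 := fun p hp => by
    rw [hPdef] at hp; exact mem_sphere_zero_iff_norm.1 hp.2
  have hPm : ∀ x ∈ S, ∀ w, ‖w‖ = 1 → (x, w) ∈ P := fun x hx w hw => by
    rw [hPdef]; exact ⟨hx, mem_sphere_zero_iff_norm.2 hw⟩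
  have hBP : ∀ p ∈ P, 0 < B p := by
    rintro ⟨x, w⟩ hp
    have hxS : x ∈ S := hPS (x, w) hp
    have hw : ‖w‖ = 1 := hPn (x, w) hp
    have h1 := hαpos x (hS1 x hxS)
    have h2 := hbge x hxS
    have h3 := hρ0 x (hS1 x hxS)
    rw [hB, hw, one_pow, mul_one]
    have : 0 ≤ stripAlpha Λ θ ε (ρ x) * fderiv ℝ ρ x w ^ 2 := mul_nonneg h1.le (sq_nonneg _)
    linarith only [this, h2, h3, hε]
  have hFc : ContinuousOn F P := by
    rw [show F = fun p => u₂ p.1 p.2 p.2 + a * G p.1 * ‖p.2‖ ^ 2 from funext fun p => hF p.1 p.2]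
    refine (hu.cont₂.mono ?_).add ((ContinuousOn.mul continuousOn_const ?_).mul ?_)
    · exact fun p hp => ⟨hS1 p.1 (hPS p hp), mem_univ _⟩
    · exact hGc.comp continuousOn_fst fun p hp => hS1 p.1 (hPS p hp)
    · exact (continuous_snd.norm.pow 2).continuousOn
  have hρP : ContinuousOn (fun p : E n × E n => ρ p.1) P :=
    hbar.continuousOn.comp continuousOn_fst fun p hp => hS1 p.1 (hPS p hp)
  have hBc : ContinuousOn B P := by
    rw [show B = fun p => stripAlpha Λ θ ε (ρ p.1) * fderiv ℝ ρ p.1 p.2 ^ 2 +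
      stripB (128 * C ^ 2 / c₀) ε (ρ p.1) * ‖p.2‖ ^ 2 from funext fun p => hB p.1 p.2]
    refine (ContinuousOn.mul ?_ (ContinuousOn.pow ?_ 2)).add (ContinuousOn.mul ?_ ?_)
    · exact (continuousOn_stripAlpha hΛ0 hθ0.le hε).comp hρP fun p hp => hρ0 p.1 (hS1 p.1 (hPS p hp))
    · have h1 : ContinuousOn (fderiv ℝ ρ) V :=
        (hbar.contDiffOn.continuousOn_fderiv_of_isOpen hbar.isOpen (by norm_num))
      exact (h1.comp continuousOn_fst fun p hp => hSV p.1 (hPS p hp)).clm_apply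
        continuous_snd.continuousOn
    · have h1 : Continuous (stripB (128 * C ^ 2 / c₀) ε) := by unfold stripB; fun_prop
      exact h1.comp_continuousOn hρP
    · exact (continuous_snd.norm.pow 2).continuousOn
  have main : ∀ p ∈ P, F p ≤ N * B p := by
    intro p hp
    by_contra! hlt
    -- The contact point lies inside the strip, on {ρ = ρ₀} or on the boundary. These cases are
    -- excluded by `not_isMax_strip`, by the bound m, and by `strip_boundary_bound` respectively.
    obtain ⟨⟨z, ξ⟩, hq, N', hNN', hle, hq0⟩ := exists_ratio_max hPc hFc hBc hBP hp hlt
    have hzS : z ∈ S := hPS (z, ξ) hq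
    have hzc : z ∈ closure Ω := hS1 z hzS
    have hξ : ‖ξ‖ = 1 := hPn (z, ξ) hq
    have hqN : N * B (z, ξ) < F (z, ξ) := by
      rw [hq0]; exact mul_lt_mul_of_pos_right hNN' (hBP (z, ξ) hq)
    have hzV := hSV z hzS
    have hNε : N₀ * ε ≤ N * ε := mul_le_mul_of_nonneg_right hN₀ hε.le
    have haGz := haG z hzc
    by_cases hzΩ : z ∈ Ω
    · rcases (hS2 z hzS).lt_or_eq with hlt' | heq
      · have hscale : ∀ y ∈ Ω, ρ y ≤ ρ₀ → ∀ w : E n, F (y, w) ≤ N' * B (y, w) := by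
          intro y hy hyρ
          refine le_of_le_on_sphere (f := fun w => F (y, w)) (g := fun w => N' * B (y, w)) ?_ ?_
            fun w hw => hle (y, w) (hPm y (hS3 y (subset_closure hy) hyρ) w hw)
          · intro c w
            have : D2 u y (c • w) (c • w) = c * (c * D2 u y w w) := by
              rw [map_smul, map_smul]; rfl
            change F (y, c • w) = c ^ 2 * F (y, w)
            rw [hF, hF, hu.eq₂ y hy, hu.eq₂ y hy, this, norm_smul, Real.norm_eq_abs, mul_pow,
              sq_abs]
            ring
          · intro c w
            change N' * B (y, c • w) = c ^ 2 * (N' * B (y, w))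
            rw [hB, hB, map_smul, norm_smul, Real.norm_eq_abs, smul_eq_mul, mul_pow, mul_pow,
              sq_abs]
            ring
        have hcρ : ContinuousAt ρ z :=
          (hbar.contDiffOn.contDiffAt (hbar.isOpen.mem_nhds hzV)).continuousAt
        have hu1' : ∀ x ∈ Ω, ‖fderiv ℝ u x‖ ≤ C := fun x hx => by
          rw [← hu.eq₁ x hx]; exact hu1 x (subset_closure hx)
        refine not_isMax_strip hk hkn (N := N') hbar hsol hu1' hc₀ hC₀ hCC hC₁ hε hθ hΛ0
          hs1 hs2 hs3 hε1 hQ ha' (hN₀.trans hNN'.le) hM0' hMQ hM1 hM2 hM3 hM4 hM5 hzΩ hlt'.le hξ ?_ ?_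
        · filter_upwards [hΩ.mem_nhds hzΩ,
            hcρ.eventually_lt continuousAt_const hlt'] with y hy hyρ w
          have h1 := hscale y hy hyρ.le w
          rw [hF, hB, hu.eq₂ y hy, hGΩ y hy] at h1
          exact h1
        · rw [hF, hB, hu.eq₂ z hzΩ, hGΩ z hzΩ] at hq0
          exact hq0
      · have h1 := hm z hzΩ heq ξ hξ
        have h3 := hbge z hzS
        have h4 : 0 ≤ stripAlpha Λ θ ε (ρ z) * fderiv ℝ ρ z ξ ^ 2 :=
          mul_nonneg (hαpos z hzc).le (sq_nonneg _)
        rw [hF, hB, hu.eq₂ z hzΩ, hξ, one_pow, mul_one, mul_one] at hqN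
        rw [heq] at h3 h4 hqN
        have h5 : N * (ε + 7 / 8 * ρ₀) ≤ N * (stripAlpha Λ θ ε ρ₀ * fderiv ℝ ρ z ξ ^ 2 +
          stripB (128 * C ^ 2 / c₀) ε ρ₀) :=
            mul_le_mul_of_nonneg_left (by linarith only [h3, h4]) hN0.le
        have h7 := mul_pos hN0 hρ₀
        linarith only [h1, haGz, h5, hNε, h7, hqN, hmN, hM3]
    · have hzf : z ∈ frontier Ω := ⟨hzc, by rwa [hΩ.interior_eq]⟩
      have hz0 := hbar.zero z hzf
      have hL := hbar.le_norm z hzV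
      obtain ⟨τ, w, hξτ, hLτ, hτ1, hw⟩ := exists_tangent_normal (by linarith only [hC₀]) hL hξ
      -- At ρ = 0 the logarithm vanishes, so the two coefficients are exactly Λ and ε.
      have hα0 : stripAlpha Λ θ ε 0 = Λ := by
        unfold stripAlpha; rw [add_zero, div_self hε.ne', Real.log_one]; simp
      have hb0 : stripB (128 * C ^ 2 / c₀) ε 0 = ε := by unfold stripB; simp
      rw [hF, hB, hξ, hz0, hα0, hb0, one_pow, mul_one, mul_one, hΛ] at hqN
      have hexp : u₂ z ξ ξ = u₂ z τ τ + u₂ z τ w + u₂ z w τ + u₂ z w w := by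
        rw [hξτ]; exact hu.add_apply_add hzc τ w
      have := strip_boundary_bound hC₀ (norm_nonneg τ) hτ1 (norm_nonneg w) hw hC₂ hM0 hε hε₁ hN0
        hNM (hτ z hzf τ hLτ) ((le_abs_self _).trans (hM z hzf τ w))
        ((le_abs_self _).trans (hM z hzf w τ)) ((le_abs_self _).trans (hM z hzf w w))
        (A := a * G z) (by linarith only [haGz, hM6, hNε])
      rw [← hexp] at this
      exact hqN.not_ge this
  intro x hx hxρ ξ hξ
  have hxS : x ∈ S := hS3 x (subset_closure hx) hxρ
  have h1 := main (x, ξ) (hPm x hxS ξ hξ)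
  rw [hF, hB, hξ, one_pow, mul_one, mul_one, hu.eq₂ x hx] at h1
  have h2 := mul_nonneg ha0.le (hG0 x)
  have h3 : fderiv ℝ ρ x ξ ^ 2 ≤ C₀ ^ 2 := by
    have := (fderiv ℝ ρ x).le_of_opNorm_le (hbar.norm_le x (hSV x hxS)) ξ
    rw [hξ, mul_one, Real.norm_eq_abs] at this
    rw [← sq_abs]
    exact pow_le_pow_left₀ (abs_nonneg _) this 2
  have h4 : stripB (128 * C ^ 2 / c₀) ε (ρ x) ≤ ε + ρ x := by
    unfold stripB
    have := mul_nonneg hK0 (sq_nonneg (ρ x))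
    linarith only [this]
  have h5 := mul_le_mul_of_nonneg_left h3 (hαpos x (subset_closure hx)).le
  have h6 : N * (stripAlpha Λ θ ε (ρ x) * fderiv ℝ ρ x ξ ^ 2 +
      stripB (128 * C ^ 2 / c₀) ε (ρ x)) ≤ N * (stripAlpha Λ θ ε (ρ x) * C₀ ^ 2 + ε + ρ x) :=
    mul_le_mul_of_nonneg_left (by linarith only [h4, h5]) hN0.le
  rw [← hΛ]
  linarith only [h1, h2, h6]

end KHessian

/-! ### Conclusion: choice of N, weighted estimate, full Hessian. -/

namespace KHessian

variable {n : ℕ}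

lemma IsBarrier.mono {k : ℕ} {Ω V : Set (E n)} {ρ : E n → ℝ} {ρ₀ ρ₁ c₀ C₀ : ℝ}
    (hbar : IsBarrier k Ω V ρ ρ₁ c₀ C₀) (h : ρ₀ ≤ ρ₁) : IsBarrier k Ω V ρ ρ₀ c₀ C₀ :=
  { hbar with strip := fun x hx hρ => hbar.strip x hx (hρ.trans h) }

lemma stripAlpha_le {Λ θ ε t : ℝ} (hΛ : 0 < Λ) (hθ : 0 < θ) (hε : 0 < ε) (ht : 0 < t) :
    stripAlpha Λ θ ε t ≤ (θ * Real.log ((ε + t) / ε))⁻¹ := by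
  have h1 : 1 < (ε + t) / ε := by rw [lt_div_iff₀ hε]; linarith
  have h2 := mul_pos hθ (Real.log_pos h1)
  unfold stripAlpha
  exact inv_anti₀ h2 (by linarith [one_div_pos.2 hΛ])

/-- From log x ≥ 1 - 1/x. The bound is free of Λ, so tα(t) stays bounded however large Λ is taken to
control the boundary. -/
lemma stripAlpha_le_div {Λ θ ε t : ℝ} (hΛ : 0 < Λ) (hθ : 0 < θ) (hε : 0 < ε) (ht : 0 < t) :
    stripAlpha Λ θ ε t ≤ (ε + t) / (θ * t) := by
  refine (stripAlpha_le hΛ hθ hε ht).trans ?_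
  have h1 : 0 < (ε + t) / ε := by positivity
  have h2 := Real.one_sub_inv_le_log_of_pos h1
  have h3 : 1 - ((ε + t) / ε)⁻¹ = t / (ε + t) := by field_simp; ring
  rw [h3] at h2
  have h4 : (ε + t) / (θ * t) = (θ * (t / (ε + t)))⁻¹ := by field_simp
  rw [h4]
  exact inv_anti₀ (by positivity) (mul_le_mul_of_nonneg_left h2 hθ.le)

lemma frontier_nonempty_of_isBounded (hn : 0 < n) {Ω : Set (E n)}
    (hne : Ω.Nonempty) (hΩb : Bornology.IsBounded Ω) : (frontier Ω).Nonempty := by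
  have : Nonempty (Fin n) := ⟨⟨0, hn⟩⟩
  rw [nonempty_frontier_iff]
  refine ⟨hne, fun h => ?_⟩
  rw [h] at hΩb
  exact NormedSpace.unbounded_univ ℝ (E n) hΩb

/-- The bounds on the boundary values of a function with bounded `C³` norm. -/
lemma HasBoundaryValues.le_of_cNorm {Ω : Set (E n)} {Φ : E n → ℝ} {Φ₁ : E n → E n →L[ℝ] ℝ}
    {Φ₂ : E n → E n → E n → ℝ} (hΦ : HasBoundaryValues Ω Φ Φ₁ Φ₂) {M : ℝ≥0}
    (hM : cNorm 3 Ω Φ ≤ M) {y : E n} (hy : y ∈ closure Ω) :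
    |Φ y| ≤ M ∧ ‖Φ₁ y‖ ≤ M ∧ ∀ v w, |Φ₂ y v w| ≤ M * ‖v‖ * ‖w‖ := by
  have : (𝓝[Ω] y).NeBot := mem_closure_iff_nhdsWithin_neBot.1 hy
  refine ⟨le_of_tendsto ((hΦ.continuousOn y hy).mono subset_closure).tendsto.abs ?_,
    le_of_tendsto (hΦ.tendsto₁ hy).norm ?_, fun v w => le_of_tendsto (hΦ.tendsto₂ y hy v w).abs ?_⟩
  · filter_upwards [self_mem_nhdsWithin] with x hx
    have h := norm_iteratedFDeriv_le_of_cNorm (j := 0) (by norm_num) hM hx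
    rwa [norm_iteratedFDeriv_zero, Real.norm_eq_abs] at h
  · filter_upwards [self_mem_nhdsWithin] with x hx
    exact norm_fderiv_le_of_iteratedFDeriv M.coe_nonneg
      (norm_iteratedFDeriv_le_of_cNorm (by norm_num) hM hx)
  · filter_upwards [self_mem_nhdsWithin] with x hx
    exact abs_D2_le_of_iteratedFDeriv (norm_iteratedFDeriv_le_of_cNorm (by norm_num) hM hx) v w

/-- Bounds for the gradient and for the tangential second derivatives on the boundary. -/
lemma IsBarrier.exists_boundary_constants {k : ℕ} (hk : 0 < k) (hkn : k ≤ n) {Ω V : Set (E n)}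
    {ρ : E n → ℝ} {ρ₁ c₀ C₀ C₁ D : ℝ} (hbar : IsBarrier k Ω V ρ ρ₁ c₀ C₀)
    (hC : HasCLipBoundary 3 Ω) (hΩb : Bornology.IsBounded Ω) (hρ₁ : 0 < ρ₁) (hc₀ : 0 < c₀)
    (hC₀ : 1 ≤ C₀) (hC₁ : 0 ≤ C₁) (hD : ∀ x ∈ closure Ω, ‖x‖ ≤ D) (MΦ : ℝ≥0) :
    ∃ C C₂ : ℝ, 7 * C₀ ^ 3 ≤ C ∧ 0 ≤ C₂ ∧
      ∀ (u h Φ : E n → ℝ) (p' u₁ : E n → E n →L[ℝ] ℝ) (u₂ : E n → E n → E n → ℝ),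
        IsControlled k Ω u h p' C₁ → HasBoundaryValues Ω u u₁ u₂ → IsCBar 3 Ω Φ →
        cNorm 3 Ω Φ ≤ MΦ → (∀ y ∈ frontier Ω, u y = Φ y) →
        (∀ x ∈ closure Ω, ‖u₁ x‖ ≤ C) ∧
          ∀ y ∈ frontier Ω, ∀ τ, fderiv ℝ ρ y τ = 0 → u₂ y τ τ ≤ C₂ * ‖τ‖ ^ 2 := by
  have hM0 : (0 : ℝ) ≤ MΦ := MΦ.coe_nonneg
  obtain ⟨Cs, hCs⟩ : ∃ Cs : ℝ, Cs = MΦ + (C₁ + 1) * D ^ 2 + MΦ := ⟨_, rfl⟩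
  have hCs0 : 0 ≤ Cs := by rw [hCs]; positivity
  obtain ⟨K, hK⟩ : ∃ K, K = Cs / ρ₁ + (C₁ + MΦ + 1) / c₀ := ⟨_, rfl⟩
  have hK0 : 0 < K := by rw [hK]; positivity
  have hK1 : Cs ≤ K * ρ₁ := by
    rw [hK, add_mul, div_mul_cancel₀ _ hρ₁.ne']
    exact le_add_of_nonneg_right (by positivity)
  have hK2 : C₁ + MΦ < K * c₀ := by
    rw [hK, add_mul, div_mul_cancel₀ _ hc₀.ne']
    have : 0 ≤ Cs / ρ₁ * c₀ := by positivity
    linarith only [this]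
  refine ⟨MΦ + K * C₀ + (C₁ + 1) * D ^ 2 + 7 * C₀ ^ 3, MΦ + K * C₀,
    le_add_of_nonneg_left (by positivity), by positivity, ?_⟩
  intro u h Φ p' u₁ u₂ hsol hu hΦC hΦM huΦ
  obtain ⟨Φ₁, Φ₂, hΦ, -⟩ := hΦC.exists_boundaryValues hΩb
  have hΦle := fun y (hy : y ∈ closure Ω) => hΦ.le_of_cNorm hΦM hy
  have hsup := hsol.sup_bound hk hkn hC₁ hΩb hu.continuousOn
    (fun y hy => by rw [huΦ y hy]; exact (hΦle y (frontier_subset_closure hy)).1) hD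
  have hdiff : ∀ x ∈ closure Ω, |u x - Φ x| ≤ Cs := fun x hx => by
    rw [hCs]
    exact (abs_sub _ _).trans (add_le_add (hsup x hx) (hΦle x hx).1)
  have hΦ2 : ∀ x ∈ Ω, ∀ v, |D2 Φ x v v| ≤ MΦ * ‖v‖ ^ 2 := fun x hx v => by
    have := (hΦle x (subset_closure hx)).2.2 v v
    rwa [hΦ.eq₂ x hx, mul_assoc, ← sq] at this
  have hKρ := hbar.abs_sub_le hk hkn hsol hΩb hu.continuousOn hΦ.continuousOn
    (hΦ.contDiffOn.of_le (by norm_num)) hΦ2 huΦ hdiff hC₁ hK0.le hK1 hK2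
  have hb := fun y (hy : y ∈ frontier Ω) =>
    hbar.boundary_bounds hsol.isOpen hC hu hΦ huΦ hρ₁ hK0 hKρ hy
  have hgrad : ∀ y ∈ frontier Ω, ‖u₁ y‖ ≤ MΦ + K * C₀ := fun y hy => by
    have h1 := norm_le_norm_add_norm_sub' (u₁ y) (Φ₁ y)
    exact h1.trans (add_le_add (hΦle y (frontier_subset_closure hy)).2.1 (hb y hy).1)
  refine ⟨fun x hx => (hsol.gradient_bound hk hkn hC₁ hΩb hu hgrad (by positivity) hD x hx).trans
    (le_add_of_nonneg_right (by positivity)), fun y hy τ hτ => ?_⟩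
  have h1 := (abs_le.1 ((hb y hy).2 τ hτ)).2
  have h2 := (abs_le.1 ((hΦle y (frontier_subset_closure hy)).2.2 τ τ)).2
  rw [mul_assoc, ← sq] at h2
  linarith only [h1, h2]

lemma IsBarrier.isCompact_superlevel {k : ℕ} {Ω V : Set (E n)} {ρ : E n → ℝ} {ρ₁ c₀ C₀ : ℝ}
    (hbar : IsBarrier k Ω V ρ ρ₁ c₀ C₀) (hΩ : IsOpen Ω) (hΩb : Bornology.IsBounded Ω) {t : ℝ}
    (ht : 0 < t) : IsCompact {x ∈ Ω | t ≤ ρ x} := by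
  have h1 : {x ∈ Ω | t ≤ ρ x} = closure Ω ∩ ρ ⁻¹' Ici t := by
    ext x
    refine ⟨fun h => ⟨subset_closure h.1, h.2⟩, fun h => ⟨?_, h.2⟩⟩
    by_contra hx
    have h2 : t ≤ ρ x := h.2
    rw [hbar.zero x ⟨h.1, by rwa [hΩ.interior_eq]⟩] at h2
    exact ht.not_ge h2
  rw [h1]
  exact (Metric.isCompact_of_isClosed_isBounded isClosed_closure hΩb.closure).of_isClosed_subset
    (hbar.continuousOn.preimage_isClosed_of_isClosed isClosed_closure isClosed_Ici)
    inter_subset_left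

lemma exists_max_D2 {Ω S : Set (E n)} {u : E n → ℝ} {u₁ : E n → E n →L[ℝ] ℝ}
    {u₂ : E n → E n → E n → ℝ} (hu : HasBoundaryValues Ω u u₁ u₂) (hS : IsCompact S) (hSΩ : S ⊆ Ω) :
    ∃ m : ℝ, 0 ≤ m ∧ (∀ x ∈ S, ∀ ξ, ‖ξ‖ = 1 → D2 u x ξ ξ ≤ m) ∧
      (0 < m → ∃ x ∈ S, ∃ ξ, ‖ξ‖ = 1 ∧ D2 u x ξ ξ = m) := by
  rcases (S ×ˢ Metric.sphere (0 : E n) 1).eq_empty_or_nonempty with he | hne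
  · refine ⟨0, le_rfl, fun x hx ξ hξ => ?_, fun h => absurd h (lt_irrefl _)⟩
    have : (x, ξ) ∈ S ×ˢ Metric.sphere (0 : E n) 1 := ⟨hx, mem_sphere_zero_iff_norm.2 hξ⟩
    rw [he] at this
    exact absurd this (notMem_empty _)
  · have hc : ContinuousOn (fun p : E n × E n => u₂ p.1 p.2 p.2) (S ×ˢ Metric.sphere (0 : E n) 1) :=
      hu.cont₂.mono fun p hp => ⟨subset_closure (hSΩ hp.1), mem_univ _⟩
    obtain ⟨⟨y, η⟩, hy, hmax⟩ := (hS.prod (isCompact_sphere (0 : E n) 1)).exists_isMaxOn hne hc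
    have hyS : y ∈ S := hy.1
    have hη : ‖η‖ = 1 := mem_sphere_zero_iff_norm.1 hy.2
    have hle : ∀ x ∈ S, ∀ ξ, ‖ξ‖ = 1 → D2 u x ξ ξ ≤ D2 u y η η := fun x hx ξ hξ => by
      have h1 : u₂ x ξ ξ ≤ u₂ y η η :=
        isMaxOn_iff.1 hmax (x, ξ) ⟨hx, mem_sphere_zero_iff_norm.2 hξ⟩
      rwa [hu.eq₂ x (hSΩ hx), hu.eq₂ y (hSΩ hyS)] at h1
    refine ⟨max 0 (D2 u y η η), le_max_left _ _,
      fun x hx ξ hξ => (hle x hx ξ hξ).trans (le_max_right _ _), fun h => ⟨y, hyS, η, hη, ?_⟩⟩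
    rcases lt_max_iff.1 h with h | h
    · exact absurd h (lt_irrefl _)
    · exact (max_eq_right h.le).symm

/-- The interior maximum of the second derivatives is controlled, and hence the constant of the
estimate in the boundary strip may be chosen explicitly. -/
lemma exists_strip_constant {k : ℕ} (hk : 2 ≤ k) (hkn : k ≤ n) {Ω V : Set (E n)} {ρ u h : E n → ℝ}
    {p' : E n → E n →L[ℝ] ℝ} {u₁ : E n → E n →L[ℝ] ℝ} {u₂ : E n → E n → E n → ℝ}
    {c₀ C₀ C₁ C C₂ ρ₀ ε θ Q N₀ M D ε₁ : ℝ} (hbar : IsBarrier k Ω V ρ ρ₀ c₀ C₀)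
    (hsol : IsControlled k Ω u h p' C₁) (hu : HasBoundaryValues Ω u u₁ u₂)
    (hΩb : Bornology.IsBounded Ω) (hS : StripConstants n c₀ C₀ C₁ C C₂ ρ₀ ε θ Q N₀)
    (hu1 : ∀ x ∈ closure Ω, ‖u₁ x‖ ≤ C)
    (hτ : ∀ y ∈ frontier Ω, ∀ τ, fderiv ℝ ρ y τ = 0 → u₂ y τ τ ≤ C₂ * ‖τ‖ ^ 2)
    (hM : ∀ y ∈ frontier Ω, ∀ v w, |u₂ y v w| ≤ M * ‖v‖ * ‖w‖) (hM0 : 0 ≤ M) (hε₁ : 0 < ε₁)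
    (hD : ∀ x ∈ closure Ω, ‖x‖ ≤ D) :
    ∃ N, 0 ≤ N ∧ N ≤ ε₁ * M + (N₀ + 8 * (1 + (C₁ + 1) * D ^ 2) / ρ₀) ∧
      (∀ x ∈ Ω, ρ₀ ≤ ρ x → ∀ ξ, ‖ξ‖ = 1 → D2 u x ξ ξ ≤ N * ρ₀ / 2) ∧
      ∀ x ∈ Ω, ρ x ≤ ρ₀ → ∀ ξ, ‖ξ‖ = 1 → D2 u x ξ ξ ≤
        N * (stripAlpha (2 * C₀ ^ 2 / (ε₁ ^ 2 * ε) + C₀ ^ 2 / ε₁) θ ε (ρ x) * C₀ ^ 2 +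
          ε + ρ x) := by
  have hΩ := hsol.isOpen
  have hρ₀ := hS.ρ₀_pos
  have hε := hS.ε_pos
  have hC₁ := hS.C₁_nonneg
  have hC₀ := hS.one_le
  have hN₀ := hS.one_le_N₀
  have hθ0 : 0 < θ := by linarith only [hS.hθ, hS.c₀_pos]
  obtain ⟨m, hm0, hm, hmx⟩ := exists_max_D2 hu (hbar.isCompact_superlevel hΩ hΩb hρ₀)
    fun x hx => hx.1
  have hε₁M : 0 ≤ ε₁ * M := by positivity
  have hD0 : 0 ≤ (C₁ + 1) * D ^ 2 := by positivity
  have hT : 0 ≤ 8 * (1 + (C₁ + 1) * D ^ 2) / ρ₀ := by positivity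
  -- The two entries are what the comparison needs on {ρ = ρ₀} and on the boundary of Ω.
  obtain ⟨N, hN⟩ : ∃ N, N = max (2 * m / ρ₀) (ε₁ * M + N₀) := ⟨_, rfl⟩
  have hN1 : ε₁ * M + N₀ ≤ N := hN ▸ le_max_right _ _
  have hN2 : 2 * m ≤ N * ρ₀ := by
    rw [← div_le_iff₀ hρ₀, hN]; exact le_max_left _ _
  have hstrip := strip_bound hk hkn hbar hsol hu hΩb hS hu1 hτ hM hM0 hε₁
    (N := N) (m := m) (by linarith only [hN1, hε₁M]) (by linarith only [hN1, hN₀])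
    (fun x hx hρ ξ hξ => hm x ⟨hx, hρ.ge⟩ ξ hξ) hN2
  refine ⟨N, by linarith only [hN1, hε₁M, hN₀], ?_, fun x hx hρ ξ hξ =>
    (hm x ⟨hx, hρ⟩ ξ hξ).trans (by linarith only [hN2]), hstrip⟩
  rcases max_choice (2 * m / ρ₀) (ε₁ * M + N₀) with hmax | hmax
  · rw [hmax] at hN
    have hNρ : N * ρ₀ = 2 * m := by rw [hN, div_mul_cancel₀ _ hρ₀.ne']
    have hm0' : 0 < m := by
      have := mul_pos (by linarith only [hN1, hε₁M, hN₀] : 0 < N) hρ₀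
      linarith only [this, hNρ]
    obtain ⟨y, hy, ξ, hξ, hmy⟩ := hmx hm0'
    -- Here Nρ₀ = 2m. At depth ρ₀/4 the three terms are at most ρ₀/16, ρ₀/16 and ρ₀/4, in total
    -- 3ρ₀/8, which gives the factor 3/4 < 1.
    have hquarter : ∀ x ∈ Ω, ρ x = ρ₀ / 4 → D2 u x ξ ξ ≤ 3 * m / 4 := fun x hx hxρ => by
      have h1 := hstrip x hx (by linarith only [hxρ, hρ₀]) ξ hξ
      rw [hxρ] at h1
      have h2 := stripAlpha_le (Λ := 2 * C₀ ^ 2 / (ε₁ ^ 2 * ε) + C₀ ^ 2 / ε₁) (by positivity)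
        hθ0 hε (by linarith only [hρ₀] : 0 < ρ₀ / 4)
      have h3 : (θ * Real.log ((ε + ρ₀ / 4) / ε))⁻¹ * C₀ ^ 2 ≤ ρ₀ / 16 := by
        have hlog : 0 < θ * Real.log ((ε + ρ₀ / 4) / ε) := by
          refine mul_pos hθ0 (Real.log_pos ?_)
          rw [lt_div_iff₀ hε]; linarith only [hρ₀]
        rw [inv_mul_le_iff₀ hlog]
        linarith only [hS.log_le]
      have h4 := mul_le_mul_of_nonneg_right h2 (sq_nonneg C₀)
      have h5 : N * (stripAlpha (2 * C₀ ^ 2 / (ε₁ ^ 2 * ε) + C₀ ^ 2 / ε₁) θ ε (ρ₀ / 4) * C₀ ^ 2 +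
          ε + ρ₀ / 4) ≤ N * (3 * ρ₀ / 8) :=
        mul_le_mul_of_nonneg_left (by linarith only [h3, h4, hS.ε_le])
          (by linarith only [hN1, hε₁M, hN₀])
      linarith only [h1, h5, hNρ]
    have hDb := hsol.D2_bound (by omega) hkn hC₁ (D := D) (B := max 1 (3 * m / 4))
      (hbar.isCompact_superlevel hΩ hΩb (by linarith only [hρ₀] : 0 < ρ₀ / 4)) (fun x hx => hx.1)
      (fun x hx => hD x (subset_closure hx.1)) (le_max_left _ _) hξ (fun x hx => ?_) y
      ⟨hy.1, by linarith only [show ρ₀ ≤ ρ y from hy.2, hρ₀]⟩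
    -- The interior maximum principle on {ρ ≥ ρ₀/4} returns m ≤ max(1, 3m/4) plus a constant, so m
    -- is bounded and N does not depend on u through it.
    · have hmle : m ≤ 4 * (1 + (C₁ + 1) * D ^ 2) := by
        rcases max_choice 1 (3 * m / 4) with h | h <;> rw [h, hmy] at hDb <;>
          linarith only [hDb, hD0, hm0]
      have h6 : N ≤ 8 * (1 + (C₁ + 1) * D ^ 2) / ρ₀ := by
        rw [le_div_iff₀ hρ₀]; linarith only [hNρ, hmle]
      linarith only [h6, hε₁M, hN₀]
    · rcases (show ρ₀ / 4 ≤ ρ x from hx.2).eq_or_lt with heq | hlt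
      · exact Or.inr ((hquarter x hx.1 heq.symm).trans (le_max_right _ _))
      · have hc : ContinuousAt ρ x :=
          hbar.continuousOn.continuousAt (mem_of_superset (hΩ.mem_nhds hx.1) subset_closure)
        refine Or.inl ?_
        filter_upwards [hΩ.mem_nhds hx.1, continuousAt_const.eventually_lt hc hlt] with z h1 h2
          using ⟨h1, h2.le⟩
  · rw [hmax] at hN
    linarith only [hN, hT]

/-- The weighted estimate for the pure second derivatives in the whole domain. -/
lemma exists_weighted_bound {k : ℕ} (hk : 2 ≤ k) (hkn : k ≤ n) {Ω V : Set (E n)} {ρ u h : E n → ℝ}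
    {p' : E n → E n →L[ℝ] ℝ} {u₁ : E n → E n →L[ℝ] ℝ} {u₂ : E n → E n → E n → ℝ}
    {c₀ C₀ C₁ C C₂ ρ₀ ε θ Q N₀ M D ε₁ c : ℝ} (hbar : IsBarrier k Ω V ρ ρ₀ c₀ C₀)
    (hsol : IsControlled k Ω u h p' C₁) (hu : HasBoundaryValues Ω u u₁ u₂)
    (hΩb : Bornology.IsBounded Ω) (hS : StripConstants n c₀ C₀ C₁ C C₂ ρ₀ ε θ Q N₀)
    (hu1 : ∀ x ∈ closure Ω, ‖u₁ x‖ ≤ C)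
    (hτ : ∀ y ∈ frontier Ω, ∀ τ, fderiv ℝ ρ y τ = 0 → u₂ y τ τ ≤ C₂ * ‖τ‖ ^ 2)
    (hM : ∀ y ∈ frontier Ω, ∀ v w, |u₂ y v w| ≤ M * ‖v‖ * ‖w‖) (hM0 : 0 ≤ M) (hε₁ : 0 < ε₁)
    (hD : ∀ x ∈ closure Ω, ‖x‖ ≤ D) (hne : (frontier Ω).Nonempty) (hc : 0 < c)
    (hcρ : ∀ x ∈ Ω, c * Metric.infDist x (frontier Ω) ≤ ρ x) {x : E n} (hx : x ∈ Ω) {ξ : E n}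
    (hξ : ‖ξ‖ = 1) :
    D2 u x ξ ξ * Metric.infDist x (frontier Ω) ≤
      (ε₁ * M + (N₀ + 8 * (1 + (C₁ + 1) * D ^ 2) / ρ₀)) *
        ((2 * ρ₀ * C₀ ^ 2 / θ + 2 * ρ₀ ^ 2) / c + ρ₀ * D) := by
  obtain ⟨N, hN0, hN, hint, hstrip⟩ :=
    exists_strip_constant hk hkn hbar hsol hu hΩb hS hu1 hτ hM hM0 hε₁ hD
  have hρ₀ := hS.ρ₀_pos
  have hε := hS.ε_pos
  have hC₀ := hS.one_le
  have hθ0 : 0 < θ := by linarith only [hS.hθ, hS.c₀_pos]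
  obtain ⟨d, hd⟩ : ∃ d, d = Metric.infDist x (frontier Ω) := ⟨_, rfl⟩
  have hd0 : 0 ≤ d := hd ▸ Metric.infDist_nonneg
  have hD0 : 0 ≤ D := (norm_nonneg x).trans (hD x (subset_closure hx))
  have hdD : d ≤ 2 * D := by
    obtain ⟨y, hy⟩ := hne
    have h1 := hD x (subset_closure hx)
    have h2 := hD y (frontier_subset_closure hy)
    have h3 := (Metric.infDist_le_dist_of_mem hy).trans (dist_le_norm_add_norm x y)
    rw [← hd] at h3
    linarith only [h1, h2, h3]
  have hcd := hcρ x hx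
  rw [← hd] at hcd ⊢
  have hA0 : 0 ≤ (2 * ρ₀ * C₀ ^ 2 / θ + 2 * ρ₀ ^ 2) / c := by positivity
  refine le_trans ?_ (mul_le_mul_of_nonneg_right hN (by positivity))
  rcases le_total (ρ x) ρ₀ with hρ | hρ
  · have hρx := hbar.pos x hx
    have h1 := hstrip x hx hρ ξ hξ
    have h2 := stripAlpha_le_div (Λ := 2 * C₀ ^ 2 / (ε₁ ^ 2 * ε) + C₀ ^ 2 / ε₁) (by positivity)
      hθ0 hε hρx
    have h3 : ε + ρ x ≤ 2 * ρ₀ := by linarith only [hS.ε_le, hε, hρ]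
    -- The product with ρ removes the singularity of the bound (ε+ρ)/(θρ) for α, and Λ, hence ε₁,
    -- has dropped out.
    have h4 : (stripAlpha (2 * C₀ ^ 2 / (ε₁ ^ 2 * ε) + C₀ ^ 2 / ε₁) θ ε (ρ x) * C₀ ^ 2 + ε + ρ x) *
        ρ x ≤ 2 * ρ₀ * C₀ ^ 2 / θ + 2 * ρ₀ ^ 2 := by
      have h5 : (ε + ρ x) / (θ * ρ x) * C₀ ^ 2 * ρ x = (ε + ρ x) * C₀ ^ 2 / θ := by field_simp
      have h6 : (ε + ρ x) * C₀ ^ 2 / θ ≤ 2 * ρ₀ * C₀ ^ 2 / θ := by gcongr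
      have h7 : (ε + ρ x) * ρ x ≤ 2 * ρ₀ * ρ₀ := by gcongr
      have h8 := mul_le_mul_of_nonneg_right (mul_le_mul_of_nonneg_right h2 (sq_nonneg C₀)) hρx.le
      linarith only [h5, h6, h7, h8]
    have hα := stripAlpha_pos (Λ := 2 * C₀ ^ 2 / (ε₁ ^ 2 * ε) + C₀ ^ 2 / ε₁) (by positivity)
      hθ0.le hε hρx.le
    have hY : 0 ≤ N * (stripAlpha (2 * C₀ ^ 2 / (ε₁ ^ 2 * ε) + C₀ ^ 2 / ε₁) θ ε (ρ x) * C₀ ^ 2 +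
        ε + ρ x) := mul_nonneg hN0 (by positivity)
    have h9 : d ≤ ρ x / c := by rw [le_div_iff₀ hc]; linarith only [hcd]
    calc D2 u x ξ ξ * d ≤ _ * d := mul_le_mul_of_nonneg_right h1 hd0
      _ ≤ _ * (ρ x / c) := mul_le_mul_of_nonneg_left h9 hY
      _ = N * ((stripAlpha (2 * C₀ ^ 2 / (ε₁ ^ 2 * ε) + C₀ ^ 2 / ε₁) θ ε (ρ x) * C₀ ^ 2 +
        ε + ρ x) * ρ x / c) := by ring
      _ ≤ N * ((2 * ρ₀ * C₀ ^ 2 / θ + 2 * ρ₀ ^ 2) / c) := by gcongr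
      _ ≤ _ := mul_le_mul_of_nonneg_left (le_add_of_nonneg_right (by positivity)) hN0
  · calc D2 u x ξ ξ * d ≤ N * ρ₀ / 2 * d := mul_le_mul_of_nonneg_right (hint x hx hρ ξ hξ) hd0
      _ ≤ N * ρ₀ / 2 * (2 * D) := mul_le_mul_of_nonneg_left hdD (by positivity)
      _ = N * (ρ₀ * D) := by ring
      _ ≤ _ := mul_le_mul_of_nonneg_left (le_add_of_nonneg_left hA0) hN0

lemma norm_iteratedFDeriv_two_le {u : E n → ℝ} {x : E n} {B : ℝ} (hB : 0 ≤ B)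
    (h : ∀ v w, |D2 u x v w| ≤ B * ‖v‖ * ‖w‖) : ‖iteratedFDeriv ℝ 2 u x‖ ≤ B := by
  refine ContinuousMultilinearMap.opNorm_le_bound hB fun m => ?_
  have h1 := h (m 0) (m 1)
  rw [D2_apply_eq_iteratedFDeriv] at h1
  have h2 : ![m 0, m 1] = m := by ext i; fin_cases i <;> rfl
  rw [h2] at h1
  rw [Fin.prod_univ_two, ← mul_assoc]
  exact h1

end KHessian

theorem mainTheorem7 (n k : ℕ) (hk : 2 ≤ k) (hkn : k ≤ n)
    (Ω : Set (KHessian.E n)) (hΩo : IsOpen Ω) (hΩc : IsConnected Ω)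
    (hΩb : Bornology.IsBounded Ω)
    (hΩ : KHessian.HasCLipBoundary 3 Ω)
    (hΩk : KHessian.IsStrictlyConvexBoundary (k - 1) Ω)
    (ε : ℝ) (hε : 0 < ε) (d₀ : ℝ) (hd₀ : 0 < d₀) (Mφ Mf : ℝ≥0) :
    ∃ C : ℝ, 0 < C ∧
      ∀ (Ω₀ : Set (KHessian.E n)) (f φ u : KHessian.E n → ℝ),
        IsOpen Ω₀ →
        closure Ω ⊆ Ω₀ →
        (∀ x ∈ Ω, ∀ y ∈ frontier Ω₀, d₀ ≤ dist x y) →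
        (∃ c : ℝ, 0 < c ∧ ∀ x ∈ Ω₀, c ≤ f x) →
        ((KHessian.IsCLipBar 1 Ω₀ (fun x => f x ^ (1 / ((k : ℝ) - 1))) ∧
            KHessian.cLipNorm 1 Ω₀ (fun x => f x ^ (1 / ((k : ℝ) - 1))) ≤ Mf) ∨
          (5 ≤ k ∧
            KHessian.IsCLipBar 2 Ω₀ (fun x => f x ^ (3 / (2 * (k : ℝ) - 2))) ∧
            KHessian.cLipNorm 2 Ω₀ (fun x => f x ^ (3 / (2 * (k : ℝ) - 2))) ≤ Mf)) →
        KHessian.IsCLipBoundary 3 Ω φ →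
        KHessian.boundaryCNorm 3 Ω φ ≤ Mφ →
        KHessian.IsCLipBar 3 Ω u →
        KHessian.IsAdmissible k Ω u →
        KHessian.SolvesDirichlet k Ω f φ u →
        ∀ x ∈ Ω,
          ‖iteratedFDeriv ℝ 2 u x‖ ≤
            1 / Metric.infDist x (frontier Ω) *
              (ε * KHessian.supBoundaryHessian Ω u + C) := by
  obtain ⟨D, hD⟩ : ∃ D, ∀ x ∈ closure Ω, ‖x‖ ≤ D := hΩb.closure.exists_norm_le
  have hk0 : 0 < k := by omega
  have hne : (frontier Ω).Nonempty :=
    KHessian.frontier_nonempty_of_isBounded (by omega) hΩc.nonempty hΩb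
  obtain ⟨V, ρ, ρ₁, c₀, C₀, hρ₁, hc₀, hC₀, hbar⟩ :=
    KHessian.exists_isBarrier hk0 hkn hΩo hΩb hne hΩ hΩk
  obtain ⟨c, hc, hcρ⟩ := hbar.exists_infDist_le hΩo hΩb hne hρ₁ hC₀
  obtain ⟨Cf, hCf, hrhs⟩ := KHessian.exists_rhsBounds (n := n) hk hd₀ Mf
  have hCf0 : 0 ≤ Cf := by linarith only [hCf]
  have hC₁ : 0 ≤ Cf * k := by positivity
  -- The boundary norm is an infimum that need not be attained. An extension of norm at most Mφ + 1
  -- is used instead.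
  obtain ⟨C, C₂, hC, hC₂, hbdry⟩ :=
    hbar.exists_boundary_constants hk0 hkn hΩ hΩb hρ₁ hc₀ hC₀ hC₁ hD (Mφ + 1)
  obtain ⟨ρ₀, e, θ, Q, N₀, hρ, hS⟩ :=
    KHessian.exists_stripConstants n hc₀ hC₀ hC hC₁ hC₂ hρ₁
  have hbar₀ := hbar.mono hρ
  have hD0 : 0 ≤ D := by
    obtain ⟨x, hx⟩ := hΩc.nonempty
    exact (norm_nonneg x).trans (hD x (subset_closure hx))
  have hρ₀ := hS.ρ₀_pos
  have hθ : 0 < θ := by linarith only [hS.hθ, hc₀]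
  have hN₀ := hS.one_le_N₀
  obtain ⟨A, hA⟩ : ∃ A, A = (2 * ρ₀ * C₀ ^ 2 / θ + 2 * ρ₀ ^ 2) / c + ρ₀ * D := ⟨_, rfl⟩
  obtain ⟨T, hT⟩ : ∃ T, T = N₀ + 8 * (1 + (Cf * k + 1) * D ^ 2) / ρ₀ := ⟨_, rfl⟩
  have hA0 : 0 ≤ A := by rw [hA]; positivity
  have hT0 : 0 ≤ T := by rw [hT]; positivity
  refine ⟨n * A * T + 1, by positivity, ?_⟩
  intro Ω₀ f φ u hΩ₀ hΩΩ₀ hdist hfpos hf _ hφ hu hadm hsolve x hx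
  have hf0 : ∀ x ∈ Ω₀, 0 < f x := fun x hx => by
    obtain ⟨a, ha, hfa⟩ := hfpos
    exact ha.trans_le (hfa x hx)
  have hu2 : ∀ x ∈ Ω, ContDiffAt ℝ 2 u x := fun x hx =>
    hadm.contDiffOn.contDiffAt (hΩo.mem_nhds hx)
  have hcone : ∀ x ∈ Ω, KHessian.IsConeForm k (KHessian.D2 u x) := fun x hx =>
    KHessian.isConeForm_of_mem (KHessian.isSymmForm_D2 (hu2 x hx)) (by
      have h := hadm.mem_cone x hx
      rw [KHessian.hessian_eq_formMatrix] at h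
      exact h)
  have heq : ∀ x ∈ Ω, KHessian.sigma k (KHessian.formMatrix (KHessian.D2 u x)) = f x :=
    fun x hx => by
      have h := hsolve.equation x hx
      rw [KHessian.hessian_eq_formMatrix] at h
      exact h
  have hsol := (hrhs Ω Ω₀ f hΩo hΩ₀ hΩΩ₀ hdist hf0 hf).isControlled hk hkn hCf0 hΩo
    hu.contDiffOn hcone heq
  obtain ⟨u₁, u₂, hu12, hM⟩ := hu.toIsCBar.exists_boundaryValues hΩb
  have hM0 := KHessian.supBoundaryHessian_nonneg Ω u
  obtain ⟨Φ, hΦ, hΦφ, hΦM⟩ : ∃ Φ, KHessian.IsCBar 3 Ω Φ ∧ EqOn Φ φ (frontier Ω) ∧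
      KHessian.cNorm 3 Ω Φ ≤ ((Mφ + 1 : ℝ≥0) : ℝ≥0∞) := by
    have h1 : KHessian.boundaryCNorm 3 Ω φ < ((Mφ + 1 : ℝ≥0) : ℝ≥0∞) :=
      hφ.trans_lt (ENNReal.coe_lt_coe.2 (lt_add_one Mφ))
    obtain ⟨Φ, h2⟩ := iInf_lt_iff.1 h1
    obtain ⟨h3, h4⟩ := iInf_lt_iff.1 h2
    exact ⟨Φ, h3.1, h3.2, h4.le⟩
  obtain ⟨hu1, hτ⟩ := hbdry u _ Φ _ u₁ u₂ hsol hu12 hΦ hΦM fun y hy =>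
    (hsolve.boundary y hy).trans (hΦφ hy).symm
  -- Passing from pure second derivatives to the whole Hessian costs a factor n, and the weight
  -- costs A. Both were fixed independently of ε₁, so this choice makes the coefficient of the
  -- boundary supremum at most ε.
  have hε₁ : 0 < ε / (n * A + 1) := by positivity
  have hd : 0 < Metric.infDist x (frontier Ω) :=
    (isClosed_frontier.notMem_iff_infDist_pos hne).1 fun h => h.2 (by rwa [hΩo.interior_eq])
  have hpure : ∀ ξ : KHessian.E n, ‖ξ‖ = 1 → KHessian.D2 u x ξ ξ ≤
      (ε / (n * A + 1) * KHessian.supBoundaryHessian Ω u + T) * A /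
        Metric.infDist x (frontier Ω) := fun ξ hξ => by
    rw [le_div_iff₀ hd, hA, hT]
    have h := KHessian.exists_weighted_bound hk hkn hbar₀ hsol hu12 hΩb hS hu1 hτ hM hM0 hε₁ hD hne
      hc hcρ hx hξ
    rwa [hA] at h
  have hB := (hcone x hx).abs_apply_le hk (by positivity) hpure
  refine (KHessian.norm_iteratedFDeriv_two_le (by positivity) hB).trans ?_
  have h1 : n * A * (ε / (n * A + 1)) ≤ ε := by
    rw [mul_div_assoc', div_le_iff₀ (by positivity), mul_comm]
    exact mul_le_mul_of_nonneg_left (le_add_of_nonneg_right zero_le_one) hε.le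
  have h2 := mul_le_mul_of_nonneg_right h1 hM0
  calc n * ((ε / (n * A + 1) * KHessian.supBoundaryHessian Ω u + T) * A /
        Metric.infDist x (frontier Ω)) = 1 / Metric.infDist x (frontier Ω) *
        (n * A * (ε / (n * A + 1)) * KHessian.supBoundaryHessian Ω u + n * A * T) := by ring
    _ ≤ _ := mul_le_mul_of_nonneg_left (by linarith only [h2]) (by positivity)
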